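/- \textbf{Setting.} Let $\Theta\in\mathbb R^{n\times n}$ be symmetric positive definite. The Gaussian graphical model (GGM) with precision matrix $\Theta$ is the law $N(0,\Theta^{-1})$ of $X=(X_1,\dots,X_n)$; its graph has an edge between $i\ne j$ iff $\Theta_{ij}\neq0$. It is \emph{attractive} if $\Theta_{ij}\le 0$ for all $i\ne j$, and \emph{$\kappa$-nondegenerate} ($\kappa>0$) if $|\Theta_{ij}|\ge\kappa\sqrt{\Theta_{ii}\Theta_{jj}}$ for all $i\neq j$ with $\Theta_{ij}\ne0$. \textbf{Algorithm} SearchAndValidate$(i,d,\nu)$. Split $m=2k$ samples into two sample sets of size $k$, with empirical expectations $\hat{\mathbb E}_1,\hat{\mathbb E}_2$, and let $\widehat{\mathrm{Var}}_2(X_i\mid X_S)=\min_{\mathrm{supp}(w)\subseteq S}\hat{\mathbb E}_2[(X_i-w\cdot X)^2]$. For $d'=0,\dots,d$ let $w_{d'}$ be any minimizer of $\hat{\mathbb E}_1[(X_i-w\cdot X)^2]$ over all $w$ with $w_i=0$ and $|\mathrm{supp}(w)|\le d'$. Return $\mathrm{supp}(w_{d'})$ for the smallest $d'\in\{0,\dots,d\}$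 such that for every $d''\in\{0,\dots,d\}\setminus\{d'\}$ and every $j\in\mathrm{supp}(w_{d''})\setminus\mathrm{supp}(w_{d'})$, with $S=\mathrm{supp}(w_{d'})\cup\mathrm{supp}(w_{d''})$, $$\widehat{\mathrm{Var}}_2(X_i\mid X_{S\setminus\{j\}})-\widehat{\mathrm{Var}}_2(X_i\mid X_S)\le\nu\,\widehat{\mathrm{Var}}_2(X_i\mid X_S);$$ if there is no such $d'$, nothing is returned. \textbf{Theorem.} (1) (Correctness.) There is a universal constant $C>0$ such that the following holds. Consider a $\kappa$-nondegenerate attractive GGM on $n$ nodes with maximum degree $\Delta$, let $\delta>0$, and let $d$ be $\Delta$, or any integer with $\Delta\le d\le 1/\kappa^2$. If $m=2k\ge \frac{C}{\kappa^2}\bigl(\log n+\log(2/\delta)\bigr)$, then from $m$ i.i.d. samples, with probability at least $1-\delta$, SearchAndValidate$(i,d,\kappa^2/2)$ returns the true neighborhood of every node $i$, whatever minimizers are chosen. (2) (Running time.) There is one program for a real RAM (unit-cost addition and truncated subtraction of natural numbers, unit-cost exact arithmetic on reals, comparisons, indirect addressing) which, given $n\ge1$, $k$, $d$, $\nu$ and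 any two sample sets of size $k$, halts with a result of SearchAndValidate$(i,d,\nu)$ for every node $i$ after at most $C_d\,(n^{d+1}+d\,k\,n^2)$ steps in total, where $C_d$ depends only on $d$. (So the time is $O(n^{d+1})$ for every fixed $d$ and number of samples; the second term accounts for reading the samples, and for $d\ge2$ it is dominated by the first as soon as $m=O(n^{d-1})$.) (3) (Optimality.) For every $\kappa_0<1$ there is $c>0$ such that for all $n\ge2$, $d\ge1$, $0<\kappa\le\kappa_0$ and $0<\delta\le1/4$: if an estimator of the neighborhoods of all nodes from $m$ i.i.d. samples is correct with probability at least $1-\delta$ for every $\kappa$-nondegenerate attractive GGM on $n$ nodes with maximum degree at most $d$, then $m\ge \frac{c}{\kappa^2}\bigl(\log n+\log(2/\delta)\bigr)$. -/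

import Mathlib

noncomputable section

namespace GGM

/-! ### Gaussian graphical models with precision matrix `Θ` -/

/-- The set of neighbors of node `i` in the graph of the precision matrix `Θ`. -/
def nbhd {n : ℕ} (Θ : Matrix (Fin n) (Fin n) ℝ) (i : Fin n) : Finset (Fin n) :=
  open Classical in Finset.univ.filter fun j => j ≠ i ∧ Θ i j ≠ 0

/-- The maximum degree of the graph of `Θ`. -/
def maxDegree {n : ℕ} (Θ : Matrix (Fin n) (Fin n) ℝ) : ℕ :=
  Finset.univ.sup fun i => (nbhd Θ i).card

/-- `Θ` is the precision matrix of an attractive model. -/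
def IsAttractive {n : ℕ} (Θ : Matrix (Fin n) (Fin n) ℝ) : Prop :=
  ∀ i j, i ≠ j → Θ i j ≤ 0

/-- `κ`-nondegeneracy: every edge of the graph of `Θ` has normalized strength at least `κ`. -/
def IsNondegenerate {n : ℕ} (κ : ℝ) (Θ : Matrix (Fin n) (Fin n) ℝ) : Prop :=
  ∀ i j, i ≠ j → Θ i j ≠ 0 → κ ≤ |Θ i j| / Real.sqrt (Θ i i * Θ j j)

/-- A list of `k` observations of a vector with `n` coordinates. -/
abbrev Sample (k n : ℕ) : Type := Fin k → EuclideanSpace ℝ (Fin n)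

/-- The law of `k` i.i.d. observations of the centered Gaussian vector with covariance
matrix `Θ⁻¹`. -/
def sampleLaw {n : ℕ} (Θ : Matrix (Fin n) (Fin n) ℝ) (k : ℕ) : MeasureTheory.Measure (Sample k n) :=
  MeasureTheory.Measure.pi fun _ => ProbabilityTheory.multivariateGaussian 0 Θ⁻¹

/-! ### The algorithm SearchAndValidate -/

/-- The empirical expectation of `(X_i - w · X)²`. -/
def sqLoss {k n : ℕ} (X : Sample k n) (i : Fin n) (w : Fin n → ℝ) : ℝ :=
  (1 / (k : ℝ)) * ∑ l : Fin k, (X l i - ∑ j : Fin n, w j * X l j) ^ 2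

/-- The support of a coefficient vector. -/
def supp {n : ℕ} (w : Fin n → ℝ) : Finset (Fin n) :=
  open Classical in Finset.univ.filter fun j => w j ≠ 0

/-- `w` is a solution of the least squares problem of predicting `X_i` by the other coordinates
with at most `r` nonzero coefficients. -/
def IsL0Minimizer {k n : ℕ} (X : Sample k n) (i : Fin n) (r : ℕ) (w : Fin n → ℝ) : Prop :=
  (w i = 0 ∧ (supp w).card ≤ r) ∧
    ∀ v : Fin n → ℝ, v i = 0 → (supp v).card ≤ r → sqLoss X i w ≤ sqLoss X i v

/-- The empirical conditional variance of `X_i` given `X_S`: the smallest empirical square loss of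
a linear predictor of `X_i` from the coordinates in `S`. -/
def empCondVar {k n : ℕ} (X : Sample k n) (i : Fin n) (S : Finset (Fin n)) : ℝ :=
  ⨅ w : {w : Fin n → ℝ // ∀ j, j ∉ S → w j = 0}, sqLoss X i w

/-- In the validation loop, the candidate `w r` is discarded (the outer loop continues with the
next `r`). -/
def IsRejected {k n : ℕ} (X : Sample k n) (d : ℕ) (ν : ℝ) (i : Fin n) (w : ℕ → Fin n → ℝ)
    (r : ℕ) : Prop :=
  ∃ q, q ≤ d ∧ q ≠ r ∧ ∃ j, j ∈ supp (w q) \ supp (w r) ∧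
    empCondVar X i ((supp (w r) ∪ supp (w q)).erase j)
        - empCondVar X i (supp (w r) ∪ supp (w q))
      > ν * empCondVar X i (supp (w r) ∪ supp (w q))

/-- The validation loop: it returns the support of the first candidate among `w 0, …, w d` that is
not discarded, and `none` if all of them are. -/
def validate {k n : ℕ} (X : Sample k n) (d : ℕ) (ν : ℝ) (i : Fin n) (w : ℕ → Fin n → ℝ) :
    Option (Finset (Fin n)) :=
  open Classical in
  ((List.range (d + 1)).find? fun r => decide (¬ IsRejected X d ν i w r)).map fun r => supp (w r)

/-- `out` is a possible result of SearchAndValidate`(i, d, ν)` on the sample sets `X₁` (search)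
and `X₂` (validation). The minimizers in the search step need not be unique, so that the algorithm
is specified as a relation, which allows every choice of them. -/
def IsSearchAndValidateOutput {k n : ℕ} (X₁ X₂ : Sample k n) (d : ℕ) (ν : ℝ) (i : Fin n)
    (out : Option (Finset (Fin n))) : Prop :=
  ∃ w : ℕ → Fin n → ℝ, (∀ r, r ≤ d → IsL0Minimizer X₁ i r (w r)) ∧ out = validate X₂ d ν i w

/-! ### A real RAM

Programs of a random access machine with natural number and real registers, and a natural number
and a real memory which are addressed indirectly, through natural number registers. A program is a
finite object which mentions finitely many registers. -/

/-- A state of the machine: natural number registers, real registers, natural number memory,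
real memory. -/
structure State where
  nreg : ℕ → ℕ
  rreg : ℕ → ℝ
  nmem : ℕ → ℕ
  rmem : ℕ → ℝ

/-- The elementary instructions. On natural numbers there are only constants, addition and
truncated subtraction; on reals the four arithmetic operations, with exact arithmetic. -/
inductive Instr where
  | nconst (x c : ℕ)
  | nadd (x y z : ℕ)
  | nsub (x y z : ℕ)
  | nload (x y : ℕ)
  | nstore (x y : ℕ)
  | rconst (x c : ℕ)
  | radd (x y z : ℕ)
  | rsub (x y z : ℕ)
  | rmul (x y z : ℕ)
  | rdiv (x y z : ℕ)
  | rload (x y : ℕ)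
  | rstore (x y : ℕ)

/-- The effect of an elementary instruction. -/
def Instr.exec : Instr → State → State
  | .nconst x c, s => { s with nreg := Function.update s.nreg x c }
  | .nadd x y z, s => { s with nreg := Function.update s.nreg x (s.nreg y + s.nreg z) }
  | .nsub x y z, s => { s with nreg := Function.update s.nreg x (s.nreg y - s.nreg z) }
  | .nload x y, s => { s with nreg := Function.update s.nreg x (s.nmem (s.nreg y)) }
  | .nstore x y, s => { s with nmem := Function.update s.nmem (s.nreg x) (s.nreg y) }
  | .rconst x c, s => { s with rreg := Function.update s.rreg x (c : ℝ) }
  | .radd x y z, s => { s with rreg := Function.update s.rreg x (s.rreg y + s.rreg z) }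
  | .rsub x y z, s => { s with rreg := Function.update s.rreg x (s.rreg y - s.rreg z) }
  | .rmul x y z, s => { s with rreg := Function.update s.rreg x (s.rreg y * s.rreg z) }
  | .rdiv x y z, s => { s with rreg := Function.update s.rreg x (s.rreg y / s.rreg z) }
  | .rload x y, s => { s with rreg := Function.update s.rreg x (s.rmem (s.nreg y)) }
  | .rstore x y, s => { s with rmem := Function.update s.rmem (s.nreg x) (s.rreg y) }

/-- The tests that control the flow of a program: comparisons of two registers. -/
inductive Test where
  | nlt (x y : ℕ)
  | rlt (x y : ℕ)

/-- The truth of a test in a state. -/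
def Test.holds : Test → State → Prop
  | .nlt x y, s => s.nreg x < s.nreg y
  | .rlt x y, s => s.rreg x < s.rreg y

/-- Programs. -/
inductive Prog where
  | instr (o : Instr)
  | seq (p q : Prog)
  | ite (t : Test) (p q : Prog)
  | loop (t : Test) (p : Prog)

/-- `Runs p s t s'`: started in state `s`, the program `p` halts after `t` steps in state `s'`.
Every elementary instruction and every evaluation of a test is one step. -/
inductive Runs : Prog → State → ℕ → State → Prop
  | instr (o : Instr) (s : State) : Runs (.instr o) s 1 (o.exec s)
  | seq {p q : Prog} {s s' s'' : State} {a b : ℕ} :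
      Runs p s a s' → Runs q s' b s'' → Runs (.seq p q) s (a + b) s''
  | ite_true {t : Test} {p q : Prog} {s s' : State} {a : ℕ} :
      t.holds s → Runs p s a s' → Runs (.ite t p q) s (a + 1) s'
  | ite_false {t : Test} {p q : Prog} {s s' : State} {a : ℕ} :
      ¬ t.holds s → Runs q s a s' → Runs (.ite t p q) s (a + 1) s'
  | loop_true {t : Test} {p : Prog} {s s' s'' : State} {a b : ℕ} :
      t.holds s → Runs p s a s' → Runs (.loop t p) s' b s'' → Runs (.loop t p) s (a + b + 1) s''
  | loop_false {t : Test} {p : Prog} {s : State} :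
      ¬ t.holds s → Runs (.loop t p) s 1 s

/-- The row-major enumeration of the entries of a sample, continued by zeros: the entry `X l j` has
the index `l * n + j`. -/
def flatten {k n : ℕ} (X : Sample k n) (a : ℕ) : ℝ :=
  if h : a / n < k ∧ a % n < n then X ⟨a / n, h.1⟩ ⟨a % n, h.2⟩ else 0

/-- The initial state: the natural number registers `0, 1, 2` hold `n, k, d`, the real register
`0` holds `ν`, the real memory holds the entries of `X₁` followed by those of `X₂`, and everything
else is zero. -/
def inputState {k n : ℕ} (X₁ X₂ : Sample k n) (d : ℕ) (ν : ℝ) : State where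
  nreg := fun x => if x = 0 then n else if x = 1 then k else if x = 2 then d else 0
  rreg := fun x => if x = 0 then ν else 0
  nmem := fun _ => 0
  rmem := fun a => if a < k * n then flatten X₁ a else flatten X₂ (a - k * n)

/-- The results `out i` for all nodes `i` can be read off the natural number memory: row `i` of an
`n × (n + 1)` table starts with a cell which tells whether `out i` is a set, followed by the
indicator vector of that set. -/
def HoldsOutput {n : ℕ} (out : Fin n → Option (Finset (Fin n))) (s : State) : Prop :=
  ∀ i : Fin n, s.nmem ((i : ℕ) * (n + 1)) = (if (out i).isSome then 1 else 0) ∧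
    ∀ j : Fin n, s.nmem ((i : ℕ) * (n + 1) + 1 + (j : ℕ)) = if j ∈ (out i).getD ∅ then 1 else 0

end GGM

end

/-! The three claims have independent proofs.

Correctness. Row `i` of `Θ` gives the regression √Θᵢᵢ Xᵢ = ∑ bⱼ Xⱼ + ε with bⱼ = -Θᵢⱼ/√Θᵢᵢ and unit
variance noise ε independent of the other coordinates. Read column by column, the `k` observations
are vectors in ℝᵏ, and every comparison in the algorithm is one of squared distances (`resid`,
`rss`) of column `i` from spans of other columns. The crux is how much this distance grows when a
set `A` of neighbors is missing from the span. For a vector `a`, the functional Θa is uncorrelated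
with every functional orthogonal to `a`; hence the share of ∑_{j ∈ A} bⱼ Xⱼ along it, of variance
(b_A · a)² / aᵀΘa, cannot be explained by coordinates outside the support of `a`. Attractiveness
makes `b` positive on neighbors and gives aᵀΘa ≤ ∑ aⱼ²Θⱼⱼ for a ≥ 0. With aⱼ = bⱼ/Θⱼⱼ on `A` the
variance is at least ∑_{j ∈ A} bⱼ²/Θⱼⱼ ≥ |A|κ², whatever the other predictors are; so up to
fluctuations the loss is |A|κ²k (`sampleLaw_gap_lt`). Positive definiteness bounds the same sum by
1, so degrees are at most 1/κ², and `k` is large compared with `d`.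

A set T no larger than the neighborhood N has at most |N \ T| superfluous elements, so overfitting
gains only a chi-square variable with |N \ T| degrees of freedom. T therefore beats N with
probability exponentially small in |N \ T| k κ² (`sampleLaw_search`), and a binomial sum over all T
settles the search at sparsity |N|. For validation, ties between sets have probability zero, so each
search result is a function of the first sample set (`sampleLaw_resid_eq_of_ne`). It is thus a fixed
set for the fresh second sample set, and no union bound over sets is needed. On N ∪ T, dropping a
neighbor costs at least 0.7 κ²k, dropping another node at most 0.4 κ²k, while the threshold κ²/2
times the residual lies between 0.4 κ²k and 0.65 κ²k. Consequently N is accepted and every smaller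
candidate is rejected.

Running time. The two Gram matrices are computed once. The squared distance of a column from the
span of at most 2d others is the last pivot of a Gaussian elimination of size 2d + 1, at a cost
depending on `d` only. For each node the search runs through at most n^r lists for each r ≤ d.
Replacing a candidate only upon strict improvement keeps it minimal under inclusion, hence it is the
exact support of some minimizer, as the specification demands.

Optimality. The empty graph is compared with the n - 1 models having a single edge {a, b} with `a`
fixed. The likelihood ratio of `m` samples has second moment (1 - κ²)^(-m). The success events of
the n - 1 models are disjoint and lie in the failure event of the empty graph, so they share mass at
most δ there, while Cauchy–Schwarz forces each to have mass at least (9/16)(1 - κ²)^m. -/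

namespace GGM

/-! ### Chi-square bounds and the likelihood ratio of a correlated Gaussian pair -/

section ChiSquare

open MeasureTheory ProbabilityTheory
open scoped ENNReal

variable {α β : Type*} [MeasurableSpace α] [MeasurableSpace β]

/-- `P` has a density with respect to `Q` whose square has integral at most `C`, in a form which
avoids the density. -/
def ChiSqBound (P Q : Measure α) (C : ℝ≥0∞) : Prop :=
  ∀ f : α → ℝ≥0∞, Measurable f → (∫⁻ x, f x ∂P) ^ 2 ≤ C * ∫⁻ x, f x ^ 2 ∂Q

theorem lintegral_mul_sq_le (μ : Measure α) {f g : α → ℝ≥0∞} (hf : Measurable f)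
    (hg : Measurable g) :
    (∫⁻ x, f x * g x ∂μ) ^ 2 ≤ (∫⁻ x, f x ^ 2 ∂μ) * ∫⁻ x, g x ^ 2 ∂μ := by
  have h := ENNReal.lintegral_mul_le_Lp_mul_Lq μ Real.HolderConjugate.two_two hf.aemeasurable
    hg.aemeasurable
  simp only [Pi.mul_apply, ENNReal.rpow_two] at h
  calc (∫⁻ x, f x * g x ∂μ) ^ 2
      ≤ ((∫⁻ x, f x ^ 2 ∂μ) ^ (1 / 2 : ℝ) * (∫⁻ x, g x ^ 2 ∂μ) ^ (1 / 2 : ℝ)) ^ 2 := by gcongr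
    _ = _ := by
      rw [mul_pow, ← ENNReal.rpow_natCast, ← ENNReal.rpow_natCast, ← ENNReal.rpow_mul,
        ← ENNReal.rpow_mul]
      norm_num

theorem ChiSqBound.refl (P : Measure α) [IsProbabilityMeasure P] : ChiSqBound P P 1 := by
  intro f hf
  simpa using lintegral_mul_sq_le P measurable_const (g := f) (f := 1) hf

theorem ChiSqBound.map {P Q : Measure α} {C : ℝ≥0∞} (h : ChiSqBound P Q C) {g : α → β}
    (hg : Measurable g) : ChiSqBound (P.map g) (Q.map g) C := by
  intro f hf
  rw [lintegral_map hf hg, lintegral_map (hf.pow_const 2) hg]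
  exact h _ (hf.comp hg)

/-- Fubini: the bound for `P` is applied to the inner integral and the bound for `P'` to each
section, so the constants multiply. -/
theorem ChiSqBound.prod {P Q : Measure α} {P' Q' : Measure β} [SFinite P] [SFinite Q] [SFinite P']
    [SFinite Q'] {C C' : ℝ≥0∞} (h : ChiSqBound P Q C) (h' : ChiSqBound P' Q' C') :
    ChiSqBound (P.prod P') (Q.prod Q') (C * C') := by
  intro f hf
  rw [lintegral_prod _ hf.aemeasurable, lintegral_prod _ (hf.pow_const 2).aemeasurable]
  calc (∫⁻ x, ∫⁻ y, f (x, y) ∂P' ∂P) ^ 2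
      ≤ C * ∫⁻ x, (∫⁻ y, f (x, y) ∂P') ^ 2 ∂Q := h _ hf.lintegral_prod_right'
    _ ≤ C * ∫⁻ x, C' * ∫⁻ y, f (x, y) ^ 2 ∂Q' ∂Q := by
        gcongr with x
        exact h' _ (hf.comp measurable_prodMk_left)
    _ = C * C' * ∫⁻ x, ∫⁻ y, f (x, y) ^ 2 ∂Q' ∂Q := by
        rw [lintegral_const_mul _ (hf.pow_const 2).lintegral_prod_right', mul_assoc]

theorem ChiSqBound.pi {P Q : Measure α} [IsProbabilityMeasure P] [IsProbabilityMeasure Q]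
    {C : ℝ≥0∞} (h : ChiSqBound P Q C) (m : ℕ) :
    ChiSqBound (Measure.pi fun _ : Fin m => P) (Measure.pi fun _ : Fin m => Q) (C ^ m) := by
  induction m with
  | zero =>
    have : (Measure.pi fun _ : Fin 0 => P) = Measure.pi fun _ : Fin 0 => Q := by
      rw [Measure.pi_of_empty, Measure.pi_of_empty]
    rw [this, pow_zero]
    exact ChiSqBound.refl _
  | succ m ih =>
    have hP := measurePreserving_piFinSuccAbove (fun _ : Fin (m + 1) => P) 0
    have hQ := measurePreserving_piFinSuccAbove (fun _ : Fin (m + 1) => Q) 0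
    have key := (h.prod ih).map (MeasurableEquiv.piFinSuccAbove (fun _ => α) 0).symm.measurable
    rw [← hP.map_eq, ← hQ.map_eq, MeasurableEquiv.map_symm_map, MeasurableEquiv.map_symm_map,
      ← pow_succ'] at key
    exact key

theorem measurable_update_prod {ι : Type*} [DecidableEq ι] (b : ι) :
    Measurable fun p : (ι → ℝ) × ℝ => Function.update p.1 b p.2 := by
  refine measurable_pi_lambda _ fun i => ?_
  by_cases h : i = b
  · subst h; simpa using measurable_snd
  · simp only [Function.update_of_ne h]; fun_prop

/-- Resampling one coordinate does not change a product law. -/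
theorem map_update_pi {ι : Type*} [Fintype ι] [DecidableEq ι] (μ : Measure ℝ)
    [IsProbabilityMeasure μ] (b : ι) :
    ((Measure.pi fun _ : ι => μ).prod μ).map (fun p => Function.update p.1 b p.2) =
      Measure.pi fun _ : ι => μ := by
  symm
  apply Measure.pi_eq
  intro s hs
  have hm := measurable_update_prod (ι := ι) b
  rw [Measure.map_apply hm (MeasurableSet.univ_pi hs)]
  have : (fun p : (ι → ℝ) × ℝ => Function.update p.1 b p.2) ⁻¹' Set.univ.pi s =
      (Set.univ.pi (Function.update s b Set.univ)) ×ˢ s b := by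
    ext p
    simp only [Set.mem_preimage, Set.mem_univ_pi, Set.mem_prod]
    constructor
    · intro h
      refine ⟨fun i => ?_, by simpa using h b⟩
      by_cases hi : i = b
      · subst hi; simp
      · simpa [hi] using h i
    · rintro ⟨h, hb⟩ i
      by_cases hi : i = b
      · subst hi; simpa using hb
      · simpa [hi] using h i
  rw [this, Measure.prod_prod, Measure.pi_pi, ← Finset.prod_erase_mul _ _ (Finset.mem_univ b),
    ← Finset.prod_erase_mul Finset.univ (fun i => μ (s i)) (Finset.mem_univ b)]
  simp only [Function.update_self, measure_univ, mul_one]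
  congr 1
  refine Finset.prod_congr rfl fun i hi => ?_
  rw [Function.update_of_ne (Finset.ne_of_mem_erase hi)]

/-- The likelihood ratio of the conditional law of one coordinate given the other, for a pair of
standard Gaussians of correlation `κ`. -/
noncomputable def corrDensity (κ x y : ℝ) : ℝ≥0∞ :=
  ENNReal.ofReal ((Real.sqrt (1 - κ ^ 2))⁻¹ *
    Real.exp (y ^ 2 / 2 - (y - κ * x) ^ 2 / (2 * (1 - κ ^ 2))))

theorem measurable_corrDensity (κ : ℝ) : Measurable fun p : ℝ × ℝ => corrDensity κ p.1 p.2 := by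
  unfold corrDensity; fun_prop

theorem measurable_corrDensity_right (κ x : ℝ) : Measurable (corrDensity κ x) := by
  unfold corrDensity; fun_prop

theorem gaussianReal_map_corr {κ : ℝ} (h0 : 0 < κ) (h1 : κ < 1) (x : ℝ) :
    (gaussianReal 0 1).map (fun y => κ * x + Real.sqrt (1 - κ ^ 2) * y) =
      (gaussianReal 0 1).withDensity (corrDensity κ x) := by
  have hs : 0 < 1 - κ ^ 2 := by nlinarith
  have e : (fun y : ℝ => κ * x + Real.sqrt (1 - κ ^ 2) * y) =
    (fun y => κ * x + y) ∘ (fun y => Real.sqrt (1 - κ ^ 2) * y) := rfl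
  rw [e, ← Measure.map_map (by fun_prop) (by fun_prop), gaussianReal_map_const_mul,
    gaussianReal_map_const_add]
  have hv : (NNReal.mk (Real.sqrt (1 - κ ^ 2) ^ 2) (sq_nonneg _) * 1 : NNReal) =
      NNReal.mk (1 - κ ^ 2) hs.le := by
    ext; simp [Real.sq_sqrt hs.le]
  rw [hv, gaussianReal_of_var_ne_zero _ (by rw [← NNReal.coe_ne_zero]; exact hs.ne'),
    gaussianReal_of_var_ne_zero _ one_ne_zero,
    ← withDensity_mul _ (measurable_gaussianPDF _ _) (measurable_corrDensity_right κ x)]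
  congr 1
  ext y
  rw [Pi.mul_apply, gaussianPDF, gaussianPDF, corrDensity,
    ← ENNReal.ofReal_mul (gaussianPDFReal_nonneg _ _ _), gaussianPDFReal_def, gaussianPDFReal_def]
  congr 1
  simp only [NNReal.coe_mk, NNReal.coe_one, mul_one, mul_zero, zero_add, sub_zero]
  rw [mul_mul_mul_comm, ← Real.exp_add, Real.sqrt_mul (by positivity) (1 - κ ^ 2), mul_inv]
  congr 2
  ring

/-- Completing the square turns the integrand, weighted by the standard Gaussian densities, into
1/(1 - κ²) times a Gaussian density in `x` times a Gaussian density in `y` whose mean depends on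
`x`; both integrate to one. -/
theorem lintegral_corrDensity_sq {κ : ℝ} (h0 : 0 < κ) (h1 : κ < 1) :
    ∫⁻ x, ∫⁻ y, corrDensity κ x y ^ 2 ∂(gaussianReal 0 1) ∂(gaussianReal 0 1) =
      ENNReal.ofReal (1 / (1 - κ ^ 2)) := by
  have hs : 0 < 1 - κ ^ 2 := by nlinarith
  have hq : 0 < 1 + κ ^ 2 := by positivity
  set v₁ : NNReal := NNReal.mk ((1 - κ ^ 2) / (1 + κ ^ 2)) (by positivity) with hv₁
  set v₂ : NNReal := NNReal.mk ((1 + κ ^ 2) / (1 - κ ^ 2)) (by positivity) with hv₂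
  have hv₁0 : v₁ ≠ 0 := by
    rw [← NNReal.coe_ne_zero]; simp [hv₁, hs.ne', hq.ne']
  have hv₂0 : v₂ ≠ 0 := by
    rw [← NNReal.coe_ne_zero]; simp [hv₂, hs.ne', hq.ne']
  have key : ∀ x y : ℝ, gaussianPDF 0 1 x * (gaussianPDF 0 1 y * corrDensity κ x y ^ 2) =
      ENNReal.ofReal (1 / (1 - κ ^ 2)) * gaussianPDF 0 v₂ x *
        gaussianPDF (2 * κ * x / (1 + κ ^ 2)) v₁ y := by
    intro x y
    simp only [gaussianPDF, corrDensity]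
    rw [← ENNReal.ofReal_pow (by positivity), ← ENNReal.ofReal_mul (gaussianPDFReal_nonneg _ _ _),
      ← ENNReal.ofReal_mul (gaussianPDFReal_nonneg _ _ _), ← ENNReal.ofReal_mul (by positivity),
      ← ENNReal.ofReal_mul (mul_nonneg (by positivity) (gaussianPDFReal_nonneg _ _ _))]
    congr 1
    simp only [gaussianPDFReal_def, hv₁, hv₂, NNReal.coe_mk, NNReal.coe_one]
    rw [mul_pow, ← Real.exp_nat_mul, inv_pow, Real.sq_sqrt hs.le]
    have e1 : Real.sqrt (2 * Real.pi * ((1 + κ ^ 2) / (1 - κ ^ 2))) *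
        Real.sqrt (2 * Real.pi * ((1 - κ ^ 2) / (1 + κ ^ 2))) = 2 * Real.pi := by
      rw [← Real.sqrt_mul (by positivity)]
      rw [show (2 * Real.pi * ((1 + κ ^ 2) / (1 - κ ^ 2)) *
        (2 * Real.pi * ((1 - κ ^ 2) / (1 + κ ^ 2)))) = (2 * Real.pi) ^ 2 by field_simp]
      exact Real.sqrt_sq (by positivity)
    have e2 : Real.sqrt (2 * Real.pi * 1) * Real.sqrt (2 * Real.pi * 1) = 2 * Real.pi := by
      rw [Real.mul_self_sqrt (by positivity), mul_one]
    have e3 : ∀ a b c d p q r : ℝ, a⁻¹ * p * (b⁻¹ * q * (c * r)) = (a * b)⁻¹ * c * (p * (q * r)) := by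
      intros; rw [mul_inv]; ring
    have e4 : ∀ a b c p q : ℝ, c * (a⁻¹ * p) * (b⁻¹ * q) = (a * b)⁻¹ * c * (p * q) := by
      intros; rw [mul_inv]; ring
    rw [e3 _ _ _ 0, e4, e1, e2, ← Real.exp_add, ← Real.exp_add, ← Real.exp_add, one_div]
    congr 2
    push_cast
    field_simp
    ring
  have hm : ∀ x, Measurable fun y => corrDensity κ x y ^ 2 := fun x =>
    (measurable_corrDensity_right κ x).pow_const 2
  have hm2 : Measurable fun x => ∫⁻ y, corrDensity κ x y ^ 2 ∂(gaussianReal 0 1) :=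
    ((measurable_corrDensity κ).pow_const 2).lintegral_prod_right'
  rw [gaussianReal_of_var_ne_zero _ one_ne_zero] at hm2 ⊢
  rw [lintegral_withDensity_eq_lintegral_mul _ (measurable_gaussianPDF _ _) hm2]
  simp only [Pi.mul_apply]
  calc ∫⁻ x, gaussianPDF 0 1 x *
        ∫⁻ y, corrDensity κ x y ^ 2 ∂(volume.withDensity (gaussianPDF 0 1))
      = ∫⁻ x, ENNReal.ofReal (1 / (1 - κ ^ 2)) * gaussianPDF 0 v₂ x := by
        refine lintegral_congr fun x => ?_
        rw [lintegral_withDensity_eq_lintegral_mul _ (measurable_gaussianPDF _ _) (hm x),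
          ← lintegral_const_mul _ ((measurable_gaussianPDF _ _).mul (hm x))]
        simp only [Pi.mul_apply, key]
        rw [lintegral_const_mul _ (measurable_gaussianPDF _ _),
          lintegral_gaussianPDF_eq_one _ hv₁0, mul_one]
    _ = _ := by
        rw [lintegral_const_mul _ (measurable_gaussianPDF _ _),
          lintegral_gaussianPDF_eq_one _ hv₂0, mul_one]

end ChiSquare

end GGM

namespace GGM

/-! ### Correlating two of many independent coordinates -/

section ChiSquare

open MeasureTheory ProbabilityTheory
open scoped ENNReal

/-- The linear map which correlates the coordinate `b` with the coordinate `a`. -/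
noncomputable def correlate {ι : Type*} [DecidableEq ι] (κ : ℝ) (a b : ι) (x : ι → ℝ) : ι → ℝ :=
  Function.update x b (κ * x a + Real.sqrt (1 - κ ^ 2) * x b)

theorem measurable_correlate {ι : Type*} [DecidableEq ι] (κ : ℝ) (a b : ι) :
    Measurable (correlate κ a b) := by
  refine measurable_pi_lambda _ fun i => ?_
  by_cases h : i = b
  · subst h; simp only [correlate, Function.update_self]; fun_prop
  · simpa [correlate, Function.update_of_ne h] using measurable_pi_apply i

theorem lintegral_pi_update {ι : Type*} [Fintype ι] [DecidableEq ι] (μ : Measure ℝ)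
    [IsProbabilityMeasure μ] (b : ι) {g : (ι → ℝ) → ℝ≥0∞} (hg : Measurable g) :
    ∫⁻ x, g x ∂(Measure.pi fun _ : ι => μ) =
      ∫⁻ x, ∫⁻ y, g (Function.update x b y) ∂μ ∂(Measure.pi fun _ : ι => μ) := by
  conv_lhs => rw [← map_update_pi μ b]
  have h : Measurable fun p : (ι → ℝ) × ℝ => g (Function.update p.1 b p.2) :=
    hg.comp (measurable_update_prod b)
  rw [lintegral_map hg (measurable_update_prod b), lintegral_prod _ h.aemeasurable]

theorem lintegral_correlate {ι : Type*} [Fintype ι] [DecidableEq ι] {κ : ℝ} (h0 : 0 < κ)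
    (h1 : κ < 1) {a b : ι} (hab : a ≠ b) {f : (ι → ℝ) → ℝ≥0∞} (hf : Measurable f) (x : ι → ℝ) :
    ∫⁻ y, f (correlate κ a b (Function.update x b y)) ∂(gaussianReal 0 1) =
      ∫⁻ y, f (Function.update x b y) * corrDensity κ (x a) y ∂(gaussianReal 0 1) := by
  have hfx : Measurable fun y => f (Function.update x b y) :=
    hf.comp ((measurable_update_prod b).comp measurable_prodMk_left)
  have e := congrArg (fun μ : Measure ℝ => ∫⁻ y, f (Function.update x b y) ∂μ)
    (gaussianReal_map_corr h0 h1 (x a))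
  rw [lintegral_map hfx (by fun_prop),
    lintegral_withDensity_eq_lintegral_mul _ (measurable_corrDensity_right κ _) hfx] at e
  simpa [correlate, Function.update_of_ne hab, mul_comm] using e

/-- With coordinate `b` resampled, the left side becomes the integral of `f` times the likelihood
ratio over the product with a fresh Gaussian, and the claim is Cauchy–Schwarz there. -/
theorem chiSqBound_correlate {ι : Type*} [Fintype ι] [DecidableEq ι] {κ : ℝ} (h0 : 0 < κ)
    (h1 : κ < 1) {a b : ι} (hab : a ≠ b) :
    ChiSqBound ((Measure.pi fun _ : ι => gaussianReal 0 1).map (correlate κ a b))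
      (Measure.pi fun _ : ι => gaussianReal 0 1) (ENNReal.ofReal (1 / (1 - κ ^ 2))) := by
  intro f hf
  have hu := measurable_update_prod (ι := ι) b
  have hρ : Measurable fun p : (ι → ℝ) × ℝ => corrDensity κ (p.1 a) p.2 := by
    unfold corrDensity; fun_prop
  have hfu : Measurable fun p : (ι → ℝ) × ℝ => f (Function.update p.1 b p.2) := hf.comp hu
  have hfρ : Measurable fun p : (ι → ℝ) × ℝ =>
      f (Function.update p.1 b p.2) * corrDensity κ (p.1 a) p.2 := hfu.mul hρ
  have hfc : Measurable fun x => f (correlate κ a b x) := hf.comp (measurable_correlate κ a b)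
  have e1 : ∫⁻ x, f x ∂((Measure.pi fun _ : ι => gaussianReal 0 1).map (correlate κ a b)) =
      ∫⁻ p, f (Function.update p.1 b p.2) * corrDensity κ (p.1 a) p.2
        ∂((Measure.pi fun _ : ι => gaussianReal 0 1).prod (gaussianReal 0 1)) := by
    rw [lintegral_map hf (measurable_correlate κ a b), lintegral_pi_update _ b hfc,
      lintegral_prod _ hfρ.aemeasurable]
    exact lintegral_congr fun x => lintegral_correlate h0 h1 hab hf x
  have e2 : ∫⁻ p, corrDensity κ (p.1 a) p.2 ^ 2
      ∂((Measure.pi fun _ : ι => gaussianReal 0 1).prod (gaussianReal 0 1)) =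
        ENNReal.ofReal (1 / (1 - κ ^ 2)) := by
    rw [lintegral_prod _ (hρ.pow_const 2).aemeasurable, ← lintegral_corrDensity_sq h0 h1]
    exact (measurePreserving_eval (fun _ : ι => gaussianReal 0 1) a).lintegral_comp
      ((measurable_corrDensity κ).pow_const 2).lintegral_prod_right'
  have e3 : ∫⁻ p, f (Function.update p.1 b p.2) ^ 2
      ∂((Measure.pi fun _ : ι => gaussianReal 0 1).prod (gaussianReal 0 1)) =
        ∫⁻ x, f x ^ 2 ∂(Measure.pi fun _ : ι => gaussianReal 0 1) := by
    rw [lintegral_pi_update _ b (hf.pow_const 2),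
      lintegral_prod _ (hfu.pow_const 2).aemeasurable]
  rw [e1, ← e2, ← e3, mul_comm]
  exact lintegral_mul_sq_le _ hfu hρ

end ChiSquare

end GGM

namespace GGM

/-! ### The models with a single edge -/

section SingleEdge

open MeasureTheory ProbabilityTheory
open scoped ENNReal

variable {n : ℕ}

/-- The covariance matrix of standard Gaussians of which only those at `a` and `b` are correlated. -/
noncomputable def edgeCov (κ : ℝ) (a b : Fin n) : Matrix (Fin n) (Fin n) ℝ :=
  1 + κ • (Matrix.single a b 1 + Matrix.single b a 1)

/-- The precision matrix of the model with the single edge `{a, b}`. -/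
noncomputable def edgePrecision (κ : ℝ) (a b : Fin n) : Matrix (Fin n) (Fin n) ℝ :=
  1 + (κ / (1 - κ ^ 2)) • (κ • (Matrix.single a a 1 + Matrix.single b b 1) -
    (Matrix.single a b 1 + Matrix.single b a 1))

theorem edgeCov_mul_edgePrecision {κ : ℝ} (h0 : 0 < κ) (h1 : κ < 1) {a b : Fin n} (hab : a ≠ b) :
    edgeCov κ a b * edgePrecision κ a b = 1 := by
  have hs : 1 - κ ^ 2 ≠ 0 := by nlinarith
  -- With `W` the swap of the two coordinates and `P` the projection onto their plane, W² = P and WP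
  -- = W, so the product lives in the span of 1, `W` and `P`.
  set W : Matrix (Fin n) (Fin n) ℝ := Matrix.single a b 1 + Matrix.single b a 1 with hW
  set P : Matrix (Fin n) (Fin n) ℝ := Matrix.single a a 1 + Matrix.single b b 1 with hP
  have hWW : W * W = P := by
    simp [hW, hP, add_mul, mul_add, hab, hab.symm, add_comm]
  have hWP : W * P = W := by
    simp [hW, hP, add_mul, mul_add, hab, hab.symm, add_comm]
  simp only [edgeCov, edgePrecision, ← hW, ← hP, add_mul, mul_add, mul_sub, one_mul, mul_one,
    smul_mul_assoc, mul_smul_comm, hWW, hWP, smul_sub, smul_smul]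
  have hc : κ = κ / (1 - κ ^ 2) - κ * (κ / (1 - κ ^ 2)) * κ := by field_simp
  have e : (1 : Matrix (Fin n) (Fin n) ℝ) +
      ((κ / (1 - κ ^ 2) * κ) • P - (κ / (1 - κ ^ 2)) • W) +
        (κ • W + ((κ / (1 - κ ^ 2) * (κ * κ)) • W - (κ / (1 - κ ^ 2) * κ) • P)) =
      1 + (κ - (κ / (1 - κ ^ 2) - κ * (κ / (1 - κ ^ 2)) * κ)) • W := by module
  rw [← hc, sub_self, zero_smul, add_zero] at e
  refine Eq.trans ?_ e
  module

theorem dotProduct_edgeCov_mulVec (κ : ℝ) (a b : Fin n) (x : Fin n → ℝ) :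
    x ⬝ᵥ (edgeCov κ a b).mulVec x = ∑ i, x i ^ 2 + 2 * κ * (x a * x b) := by
  simp only [edgeCov, Matrix.add_mulVec, Matrix.one_mulVec, Matrix.smul_mulVec,
    Matrix.single_mulVec, dotProduct_add, dotProduct_smul]
  simp [dotProduct, pow_two, Function.update_apply]
  ring

theorem edgeCov_posDef {κ : ℝ} (h0 : 0 < κ) (h1 : κ < 1) {a b : Fin n} (hab : a ≠ b) :
    (edgeCov κ a b).PosDef := by
  refine Matrix.PosDef.of_dotProduct_mulVec_pos ?_ fun x hx => ?_
  · simp [Matrix.IsHermitian, edgeCov, add_comm]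
  · rw [star_trivial, dotProduct_edgeCov_mulVec]
    have hpos : 0 < ∑ i, x i ^ 2 := by
      obtain ⟨i, hi⟩ := Function.ne_iff.1 hx
      exact Finset.sum_pos' (fun i _ => sq_nonneg _) ⟨i, Finset.mem_univ i, by
        have : x i ≠ 0 := hi
        positivity⟩
    have hle : x a ^ 2 + x b ^ 2 ≤ ∑ i, x i ^ 2 := by
      rw [← Finset.sum_pair hab (f := fun i => x i ^ 2)]
      exact Finset.sum_le_sum_of_subset_of_nonneg (Finset.subset_univ _)
        fun i _ _ => sq_nonneg _
    -- The form equals ∑ xᵢ² - κ(xₐ² + x_b²) + κ(xₐ + x_b)², which is at least (1 - κ) ∑ xᵢ².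
    nlinarith [mul_nonneg h0.le (sq_nonneg (x a + x b))]

theorem edgePrecision_inv {κ : ℝ} (h0 : 0 < κ) (h1 : κ < 1) {a b : Fin n} (hab : a ≠ b) :
    (edgePrecision κ a b)⁻¹ = edgeCov κ a b :=
  Matrix.inv_eq_left_inv (edgeCov_mul_edgePrecision h0 h1 hab)

theorem edgePrecision_posDef {κ : ℝ} (h0 : 0 < κ) (h1 : κ < 1) {a b : Fin n} (hab : a ≠ b) :
    (edgePrecision κ a b).PosDef := by
  rw [← Matrix.inv_eq_right_inv (edgeCov_mul_edgePrecision h0 h1 hab)]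
  exact (edgeCov_posDef h0 h1 hab).inv

theorem edgePrecision_apply_ne {κ : ℝ} {a b : Fin n} (hab : a ≠ b) {i j : Fin n} (hij : i ≠ j) :
    edgePrecision κ a b i j =
      if (i = a ∧ j = b) ∨ (i = b ∧ j = a) then -(κ / (1 - κ ^ 2)) else 0 := by
  simp only [edgePrecision, Matrix.add_apply, Matrix.smul_apply, Matrix.sub_apply,
    Matrix.single_apply, Matrix.one_apply_ne hij, smul_eq_mul]
  by_cases h1 : i = a <;> by_cases h2 : j = b <;> by_cases h3 : i = b <;> by_cases h4 : j = a <;>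
    grind

theorem edgePrecision_apply_left {κ : ℝ} (h0 : 0 < κ) (h1 : κ < 1) {a b : Fin n} (hab : a ≠ b) :
    edgePrecision κ a b a a = 1 / (1 - κ ^ 2) := by
  have hs : 1 - κ ^ 2 ≠ 0 := by nlinarith
  simp [edgePrecision, hab.symm]
  field_simp
  ring

theorem edgePrecision_comm (κ : ℝ) (a b : Fin n) : edgePrecision κ a b = edgePrecision κ b a := by
  simp [edgePrecision, add_comm]

theorem edgePrecision_isAttractive {κ : ℝ} (h0 : 0 < κ) (h1 : κ < 1) {a b : Fin n} (hab : a ≠ b) :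
    IsAttractive (edgePrecision κ a b) := by
  intro i j hij
  have hs : 0 < 1 - κ ^ 2 := by nlinarith
  rw [edgePrecision_apply_ne hab hij]
  split_ifs
  · exact neg_nonpos.2 (by positivity)
  · exact le_rfl

theorem edgePrecision_isNondegenerate {κ : ℝ} (h0 : 0 < κ) (h1 : κ < 1) {a b : Fin n}
    (hab : a ≠ b) : IsNondegenerate κ (edgePrecision κ a b) := by
  intro i j hij h
  have hs : 0 < 1 - κ ^ 2 := by nlinarith
  have hb : edgePrecision κ a b b b = 1 / (1 - κ ^ 2) := by
    rw [edgePrecision_comm, edgePrecision_apply_left h0 h1 hab.symm]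
  rw [edgePrecision_apply_ne hab hij] at h ⊢
  split_ifs at h ⊢ with hc
  · have : Real.sqrt (edgePrecision κ a b i i * edgePrecision κ a b j j) = 1 / (1 - κ ^ 2) := by
      rcases hc with ⟨rfl, rfl⟩ | ⟨rfl, rfl⟩ <;>
      · rw [hb, edgePrecision_apply_left h0 h1 hab]
        exact Real.sqrt_mul_self (by positivity)
    rw [this, abs_neg, abs_of_pos (by positivity)]
    field_simp
    exact le_rfl
  · exact absurd rfl h

theorem mem_nbhd {Θ : Matrix (Fin n) (Fin n) ℝ} {i j : Fin n} :
    j ∈ nbhd Θ i ↔ j ≠ i ∧ Θ i j ≠ 0 := by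
  simp [nbhd]

theorem mem_nbhd_edgePrecision {κ : ℝ} (h0 : 0 < κ) (h1 : κ < 1) {a b : Fin n} (hab : a ≠ b)
    {i j : Fin n} : j ∈ nbhd (edgePrecision κ a b) i ↔ (i = a ∧ j = b) ∨ (i = b ∧ j = a) := by
  have hs : 0 < 1 - κ ^ 2 := by nlinarith
  have hc : κ / (1 - κ ^ 2) ≠ 0 := by positivity
  rw [mem_nbhd]
  constructor
  · rintro ⟨hij, h⟩
    rw [edgePrecision_apply_ne hab hij.symm] at h
    by_contra hcon
    exact h (if_neg hcon)
  · intro h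
    have hij : i ≠ j := by rcases h with ⟨rfl, rfl⟩ | ⟨rfl, rfl⟩ <;> [exact hab; exact hab.symm]
    refine ⟨hij.symm, ?_⟩
    rw [edgePrecision_apply_ne hab hij, if_pos h]
    simpa using hc

theorem maxDegree_edgePrecision_le {κ : ℝ} (h0 : 0 < κ) (h1 : κ < 1) {a b : Fin n} (hab : a ≠ b) :
    maxDegree (edgePrecision κ a b) ≤ 1 := by
  refine Finset.sup_le fun i _ => ?_
  rw [Finset.card_le_one]
  intro x hx y hy
  rw [mem_nbhd_edgePrecision h0 h1 hab] at hx hy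
  grind

theorem nbhd_one (i : Fin n) : nbhd (1 : Matrix (Fin n) (Fin n) ℝ) i = ∅ := by
  ext j
  simp only [mem_nbhd, Finset.notMem_empty, iff_false, not_and, not_not]
  exact fun h => Matrix.one_apply_ne h.symm

/-- By characteristic functions: pairing the correlated vector with `t` amounts to pairing the
uncorrelated one with the adjoint image `t'` of `t`, and ‖t'‖² is the quadratic form of `edgeCov` at
`t`. -/
theorem map_correlate_eq_multivariateGaussian {κ : ℝ} (h0 : 0 < κ) (h1 : κ < 1) {a b : Fin n}
    (hab : a ≠ b) :
    ((Measure.pi fun _ : Fin n => gaussianReal 0 1).map (correlate κ a b)).map (WithLp.toLp 2) =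
      multivariateGaussian 0 (edgeCov κ a b) := by
  have hs : 0 < 1 - κ ^ 2 := by nlinarith
  have hm := measurable_correlate κ a b
  have hlp : Measurable (WithLp.toLp 2 : (Fin n → ℝ) → EuclideanSpace ℝ (Fin n)) := by fun_prop
  have hp : IsProbabilityMeasure (((Measure.pi fun _ : Fin n => gaussianReal 0 1).map
      (correlate κ a b)).map (WithLp.toLp 2 : (Fin n → ℝ) → EuclideanSpace ℝ (Fin n))) := by
    have := Measure.isProbabilityMeasure_map (μ := Measure.pi fun _ : Fin n => gaussianReal 0 1)
      hm.aemeasurable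
    exact Measure.isProbabilityMeasure_map hlp.aemeasurable
  apply Measure.ext_of_charFun
  ext t
  set t' : EuclideanSpace ℝ (Fin n) := t + (κ * t b) • EuclideanSpace.single a (1 : ℝ) +
    ((Real.sqrt (1 - κ ^ 2) - 1) * t b) • EuclideanSpace.single b (1 : ℝ) with ht'
  have hcomp : ∀ x : Fin n → ℝ,
      inner ℝ (WithLp.toLp 2 (correlate κ a b x)) t = inner ℝ (WithLp.toLp 2 x) t' := by
    intro x
    have e : WithLp.toLp 2 (correlate κ a b x) = WithLp.toLp 2 x +
        (κ * x a + (Real.sqrt (1 - κ ^ 2) - 1) * x b) • EuclideanSpace.single b (1 : ℝ) := by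
      ext i
      by_cases hi : i = b
      · subst hi; simp [correlate]; ring
      · simp [correlate, hi]
    rw [e, ht']
    simp only [inner_add_left, inner_add_right, inner_smul_left, inner_smul_right,
      EuclideanSpace.inner_single_left, EuclideanSpace.inner_single_right]
    simp
    ring
  have hnorm : ‖t'‖ ^ 2 = t.ofLp ⬝ᵥ (edgeCov κ a b).mulVec t.ofLp := by
    rw [dotProduct_edgeCov_mulVec, ← real_inner_self_eq_norm_sq, ht']
    simp only [inner_add_left, inner_add_right, inner_smul_left, inner_smul_right,
      EuclideanSpace.inner_single_left, EuclideanSpace.inner_single_right]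
    simp [hab, hab.symm, EuclideanSpace.real_norm_sq_eq]
    have := Real.sq_sqrt hs.le
    linear_combination (t.ofLp b) ^ 2 * this
  rw [charFun_multivariateGaussian (edgeCov_posDef h0 h1 hab).posSemidef, ← hnorm, charFun_apply,
    integral_map hlp.aemeasurable (by fun_prop), integral_map hm.aemeasurable (by fun_prop)]
  simp_rw [hcomp]
  rw [← integral_map (φ := (WithLp.toLp 2 : (Fin n → ℝ) → EuclideanSpace ℝ (Fin n)))
    (f := fun y => Complex.exp (inner ℝ y t' * Complex.I)) hlp.aemeasurable (by fun_prop),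
    map_pi_eq_stdGaussian, ← charFun_apply, charFun_stdGaussian]
  simp [neg_div]

theorem chiSqBound_sampleLaw {κ : ℝ} (h0 : 0 < κ) (h1 : κ < 1) {a b : Fin n}
    (hab : a ≠ b) (m : ℕ) :
    ChiSqBound (sampleLaw (edgePrecision κ a b) m) (sampleLaw 1 m)
      (ENNReal.ofReal (1 / (1 - κ ^ 2)) ^ m) := by
  have h := (chiSqBound_correlate h0 h1 hab).map
    (g := (WithLp.toLp 2 : (Fin n → ℝ) → EuclideanSpace ℝ (Fin n))) (by fun_prop)
  rw [map_correlate_eq_multivariateGaussian h0 h1 hab, map_pi_eq_stdGaussian,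
    ← multivariateGaussian_zero_one] at h
  rw [sampleLaw, sampleLaw, edgePrecision_inv h0 h1 hab, inv_one]
  exact h.pi m

end SingleEdge

end GGM

namespace GGM

/-! ### Lower bound on the number of samples -/

section LowerBound

open MeasureTheory ProbabilityTheory
open scoped ENNReal

theorem isProbabilityMeasure_sampleLaw {n : ℕ} (Θ : Matrix (Fin n) (Fin n) ℝ) (m : ℕ) :
    IsProbabilityMeasure (sampleLaw Θ m) := by
  unfold sampleLaw; infer_instance

/-- Since n - 1 ≥ n/2 and n/δ ≥ 8, the fourth power of the argument on the right is at least 2n/δ;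
this is the origin of the factor 1/4. -/
theorem one_div_four_mul_log_le {n : ℕ} {δ : ℝ} (hn : 2 ≤ n) (h0 : 0 < δ) (h1 : δ ≤ 1 / 4) :
    1 / 4 * (Real.log n + Real.log (2 / δ)) ≤ Real.log ((n - 1) * (9 / 16) / δ) := by
  have hn' : (2 : ℝ) ≤ n := by exact_mod_cast hn
  have hz : 8 ≤ n / δ := by
    rw [le_div_iff₀ h0]; nlinarith
  rw [← Real.log_mul (by positivity) (by positivity)]
  have hx : 0 < (n - 1) * (9 / 16) / δ := by
    apply div_pos _ h0; nlinarith
  have hge : 9 / 32 * (n / δ) ≤ (n - 1) * (9 / 16) / δ := by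
    rw [mul_div_assoc', div_le_div_iff_of_pos_right h0]; nlinarith
  have e : n * (2 / δ) = 2 * (n / δ) := by ring
  have key : 2 * (n / δ) ≤ ((n - 1) * (9 / 16) / δ) ^ 4 := by
    calc 2 * (n / δ) ≤ (9 / 32 * (n / δ)) ^ 4 := by
          have : (8 : ℝ) ^ 3 ≤ (n / δ) ^ 3 := by gcongr
          nlinarith
      _ ≤ _ := by gcongr
  rw [e]
  have := Real.log_le_log (by positivity) key
  rw [Real.log_pow] at this
  push_cast at this
  linarith

/-- All alternatives share the node `a`, where their neighborhoods {b} are distinct and nonempty.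
Hence their success events are disjoint and inside the failure event of the empty graph; the
chi-square bound, applied to indicators, transports their probabilities to the empty graph. -/
theorem sq_sum_le_of_estimator {n m : ℕ} {κ δ : ℝ} (est : Sample m n → Fin n → Finset (Fin n))
    (hn : 2 ≤ n) (h0 : 0 < κ) (h1 : κ < 1) (hδ0 : 0 < δ) (hδ1 : δ ≤ 1 / 4)
    (h : ∀ Θ : Matrix (Fin n) (Fin n) ℝ,
      Θ.PosDef → IsAttractive Θ → IsNondegenerate κ Θ → maxDegree Θ ≤ 1 →
        (sampleLaw Θ m) {X | ¬ ∀ i, est X i = nbhd Θ i} ≤ ENNReal.ofReal δ) :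
    ((n : ℝ) - 1) * (9 / 16) ≤ (1 / (1 - κ ^ 2)) ^ m * δ := by
  classical
  have hs : 0 < 1 - κ ^ 2 := by nlinarith
  have := fun Θ : Matrix (Fin n) (Fin n) ℝ => isProbabilityMeasure_sampleLaw Θ m
  obtain ⟨a⟩ : Nonempty (Fin n) := ⟨⟨0, by omega⟩⟩
  -- Measurable hulls of the failure events, because the estimator is arbitrary and need not be
  -- measurable.
  let bad : Matrix (Fin n) (Fin n) ℝ → Set (Sample m n) := fun Θ =>
    toMeasurable (sampleLaw Θ m) {X | ¬ ∀ i, est X i = nbhd Θ i}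
  have hbad : ∀ Θ X, X ∉ bad Θ → ∀ i, est X i = nbhd Θ i := by
    intro Θ X hX
    by_contra hcon
    exact hX (subset_toMeasurable _ _ hcon)
  have hmeas : ∀ Θ, MeasurableSet (bad Θ) := fun Θ => measurableSet_toMeasurable _ _
  have hbadle : ∀ b ∈ Finset.univ.erase a,
      sampleLaw (edgePrecision κ a b) m (bad (edgePrecision κ a b)) ≤ ENNReal.ofReal δ := by
    intro b hb
    have hab : a ≠ b := (Finset.ne_of_mem_erase hb).symm
    rw [measure_toMeasurable]
    exact h _ (edgePrecision_posDef h0 h1 hab) (edgePrecision_isAttractive h0 h1 hab)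
      (edgePrecision_isNondegenerate h0 h1 hab) (maxDegree_edgePrecision_le h0 h1 hab)
  have hbad1 : sampleLaw 1 m (bad 1) ≤ ENNReal.ofReal δ := by
    rw [measure_toMeasurable]
    refine h _ Matrix.PosDef.one ?_ ?_ ?_
    · intro i j hij; rw [Matrix.one_apply_ne hij]
    · intro i j hij hne; exact absurd (Matrix.one_apply_ne hij) hne
    · exact Finset.sup_le fun i _ => by simp [nbhd_one]
  have hsub : ∀ b ∈ Finset.univ.erase a, (bad (edgePrecision κ a b))ᶜ ⊆ bad 1 := by
    intro b hb X hX
    by_contra hcon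
    have hab : a ≠ b := (Finset.ne_of_mem_erase hb).symm
    have e1 := hbad _ X hX a
    rw [hbad 1 X hcon a, nbhd_one] at e1
    have : b ∈ nbhd (edgePrecision κ a b) a :=
      (mem_nbhd_edgePrecision h0 h1 hab).2 (Or.inl ⟨rfl, rfl⟩)
    simp [← e1] at this
  have hdisj : Set.PairwiseDisjoint (↑(Finset.univ.erase a))
      fun b => (bad (edgePrecision κ a b))ᶜ := by
    intro b hb b' hb' hne
    refine Set.disjoint_left.2 fun X hX hX' => hne ?_
    have hab : a ≠ b := (Finset.ne_of_mem_erase hb).symm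
    have hab' : a ≠ b' := (Finset.ne_of_mem_erase hb').symm
    have e1 := (hbad _ X hX a).symm.trans (hbad _ X hX' a)
    have hm : b ∈ nbhd (edgePrecision κ a b) a :=
      (mem_nbhd_edgePrecision h0 h1 hab).2 (Or.inl ⟨rfl, rfl⟩)
    rw [e1, mem_nbhd_edgePrecision h0 h1 hab'] at hm
    grind
  have hone : ∀ b ∈ Finset.univ.erase a, ENNReal.ofReal (9 / 16) ≤
      ENNReal.ofReal (1 / (1 - κ ^ 2)) ^ m * sampleLaw 1 m (bad (edgePrecision κ a b))ᶜ := by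
    intro b hb
    have hab : a ≠ b := (Finset.ne_of_mem_erase hb).symm
    have hchi := chiSqBound_sampleLaw h0 h1 hab m
      ((bad (edgePrecision κ a b))ᶜ.indicator 1) (measurable_one.indicator (hmeas _).compl)
    have hind : ∀ x, (bad (edgePrecision κ a b))ᶜ.indicator (1 : Sample m n → ℝ≥0∞) x ^ 2 =
        (bad (edgePrecision κ a b))ᶜ.indicator 1 x := by
      intro x
      by_cases hx : x ∈ (bad (edgePrecision κ a b))ᶜ
      · simp only [Set.indicator_of_mem hx, Pi.one_apply, one_pow]
      · simp only [Set.indicator_of_notMem hx]; simp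
    simp only [hind] at hchi
    rw [lintegral_indicator_one (hmeas _).compl, lintegral_indicator_one (hmeas _).compl] at hchi
    refine le_trans ?_ hchi
    -- As δ ≤ 1/4, each success probability is at least 3/4; its square is the constant 9/16.
    have h34 : ENNReal.ofReal (3 / 4) ≤
        sampleLaw (edgePrecision κ a b) m (bad (edgePrecision κ a b))ᶜ := by
      rw [prob_compl_eq_one_sub (hmeas _)]
      calc ENNReal.ofReal (3 / 4) ≤ ENNReal.ofReal (1 - δ) := ENNReal.ofReal_le_ofReal (by linarith)
        _ = 1 - ENNReal.ofReal δ := by rw [ENNReal.ofReal_sub _ hδ0.le, ENNReal.ofReal_one]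
        _ ≤ _ := tsub_le_tsub_left (hbadle b hb) _
    calc ENNReal.ofReal (9 / 16) = ENNReal.ofReal (3 / 4) ^ 2 := by
          rw [← ENNReal.ofReal_pow (by norm_num)]; norm_num
      _ ≤ _ := by gcongr
  have hsum := Finset.sum_le_sum hone
  rw [Finset.sum_const, ← Finset.mul_sum, ← measure_biUnion_finset hdisj
    fun b _ => (hmeas _).compl] at hsum
  have hfin : sampleLaw 1 m (⋃ b ∈ Finset.univ.erase a, (bad (edgePrecision κ a b))ᶜ) ≤
      ENNReal.ofReal δ :=
    (measure_mono (Set.iUnion₂_subset hsub)).trans hbad1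
  have hfinal := hsum.trans (mul_le_mul_right hfin _)
  rw [Finset.card_erase_of_mem (Finset.mem_univ _), Finset.card_univ, Fintype.card_fin,
    nsmul_eq_mul, ← ENNReal.ofReal_natCast, ← ENNReal.ofReal_mul (by positivity),
    ← ENNReal.ofReal_pow (by positivity), ← ENNReal.ofReal_mul (by positivity),
    ENNReal.ofReal_le_ofReal_iff (by positivity), Nat.cast_sub (by omega)] at hfinal
  simpa using hfinal

theorem sample_size_lower_bound (κ₀ : ℝ) (hκ₀ : κ₀ < 1) : ∃ c : ℝ, 0 < c ∧
    ∀ (n m d : ℕ) (κ δ : ℝ) (est : Sample m n → Fin n → Finset (Fin n)),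
      2 ≤ n → 1 ≤ d → 0 < κ → κ ≤ κ₀ → 0 < δ → δ ≤ 1 / 4 →
      (∀ Θ : Matrix (Fin n) (Fin n) ℝ,
        Θ.PosDef → IsAttractive Θ → IsNondegenerate κ Θ → maxDegree Θ ≤ d →
        (sampleLaw Θ m) {X | ¬ ∀ i, est X i = nbhd Θ i} ≤ ENNReal.ofReal δ) →
      c * ((1 / κ ^ 2) * (Real.log n + Real.log (2 / δ))) ≤ (m : ℝ) := by
  rcases le_or_gt κ₀ 0 with hneg | hpos
  · exact ⟨1, one_pos, fun n m d κ δ est _ _ h0 h1 => absurd (h0.trans_le h1) (not_lt.2 hneg)⟩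
  have hs₀ : 0 < 1 - κ₀ ^ 2 := by nlinarith
  refine ⟨(1 - κ₀ ^ 2) / 4, by positivity, ?_⟩
  intro n m d κ δ est hn hd h0 hκ hδ0 hδ1 h
  have h1 : κ < 1 := hκ.trans_lt hκ₀
  have hs : 0 < 1 - κ ^ 2 := by nlinarith
  have hsle : 1 - κ₀ ^ 2 ≤ 1 - κ ^ 2 := by nlinarith
  have hn' : (2 : ℝ) ≤ n := by exact_mod_cast hn
  have key := sq_sum_le_of_estimator est hn h0 h1 hδ0 hδ1
    fun Θ hΘ ha hnd hdeg => h Θ hΘ ha hnd (hdeg.trans hd)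
  rw [← div_le_iff₀ hδ0] at key
  have hx : 0 < (n - 1) * (9 / 16) / δ := by
    apply div_pos _ hδ0; nlinarith
  have hlog := Real.log_le_log hx key
  rw [Real.log_pow] at hlog
  -- One sample contributes log(1/(1 - κ²)), which is of order κ² only as long as κ stays away from
  -- 1; this is where κ₀ enters.
  have hl1 : Real.log (1 / (1 - κ ^ 2)) ≤ κ ^ 2 / (1 - κ₀ ^ 2) := by
    calc Real.log (1 / (1 - κ ^ 2)) ≤ 1 / (1 - κ ^ 2) - 1 :=
          Real.log_le_sub_one_of_pos (by positivity)
      _ = κ ^ 2 / (1 - κ ^ 2) := by field_simp; ring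
      _ ≤ _ := by gcongr
  have hall : 1 / 4 * (Real.log n + Real.log (2 / δ)) ≤ m * (κ ^ 2 / (1 - κ₀ ^ 2)) :=
    (one_div_four_mul_log_le hn hδ0 hδ1).trans (hlog.trans (by gcongr))
  rw [mul_div_assoc', le_div_iff₀ hs₀] at hall
  rw [show (1 - κ₀ ^ 2) / 4 * ((1 / κ ^ 2) * (Real.log n + Real.log (2 / δ))) =
    (1 / 4 * (Real.log n + Real.log (2 / δ)) * (1 - κ₀ ^ 2)) / κ ^ 2 by ring,
    div_le_iff₀ (by positivity)]
  exact hall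

end LowerBound

end GGM

namespace GGM

/-! ### Tails of squared lengths of Gaussian vectors -/

section GaussianTails

open MeasureTheory ProbabilityTheory Module

theorem integrable_exp_mul_sq_gaussianReal {t : ℝ} (ht : t < 1 / 2) :
    Integrable (fun x : ℝ => Real.exp (t * x ^ 2)) (gaussianReal 0 1) := by
  rw [gaussianReal_of_var_ne_zero _ one_ne_zero]
  have hm : Measurable fun x => (gaussianPDFReal 0 1 x).toNNReal :=
    (measurable_gaussianPDFReal 0 1).real_toNNReal
  have e : gaussianPDF 0 1 = fun x => ((gaussianPDFReal 0 1 x).toNNReal : ENNReal) := rfl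
  rw [e, integrable_withDensity_iff_integrable_smul hm]
  have h := (integrable_exp_neg_mul_sq (b := 1 / 2 - t) (by linarith)).const_mul
    (Real.sqrt (2 * Real.pi))⁻¹
  refine h.congr (Filter.Eventually.of_forall fun x => ?_)
  simp only [NNReal.smul_def, smul_eq_mul, Real.coe_toNNReal _ (gaussianPDFReal_nonneg 0 1 x)]
  simp only [gaussianPDFReal_def, NNReal.coe_one, mul_one, sub_zero]
  rw [mul_assoc, ← Real.exp_add]
  congr 2
  ring

theorem integral_exp_mul_sq_gaussianReal {t : ℝ} (ht : t < 1 / 2) :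
    ∫ x, Real.exp (t * x ^ 2) ∂(gaussianReal 0 1) = (Real.sqrt (1 - 2 * t))⁻¹ := by
  rw [integral_gaussianReal_eq_integral_smul one_ne_zero]
  have e : ∀ x : ℝ, gaussianPDFReal 0 1 x • Real.exp (t * x ^ 2) =
      (Real.sqrt (2 * Real.pi))⁻¹ * Real.exp (-(1 / 2 - t) * x ^ 2) := by
    intro x
    simp only [gaussianPDFReal_def, NNReal.coe_one, mul_one, sub_zero, smul_eq_mul]
    rw [mul_assoc, ← Real.exp_add]
    congr 2
    ring
  simp_rw [e]
  rw [integral_const_mul, integral_gaussian, ← Real.sqrt_inv, ← Real.sqrt_inv,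
    ← Real.sqrt_mul (by positivity)]
  congr 1
  have := Real.pi_ne_zero
  have h1 : 1 / 2 - t ≠ 0 := by linarith
  have h2 : 1 - 2 * t ≠ 0 := by linarith
  rw [show 1 / 2 - t = (1 - 2 * t) / 2 by ring]
  field_simp

theorem norm_sq_sum_smul_stdOrthonormalBasis {E : Type*} [NormedAddCommGroup E]
    [InnerProductSpace ℝ E] [FiniteDimensional ℝ E] (x : Fin (finrank ℝ E) → ℝ) :
    ‖∑ i, x i • stdOrthonormalBasis ℝ E i‖ ^ 2 = ∑ i, x i ^ 2 := by
  rw [← (stdOrthonormalBasis ℝ E).sum_sq_inner_left]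
  refine Finset.sum_congr rfl fun i _ => ?_
  rw [real_inner_comm, ← OrthonormalBasis.repr_apply_apply]
  simp [Pi.single_apply]

variable {E : Type*} [NormedAddCommGroup E] [InnerProductSpace ℝ E] [FiniteDimensional ℝ E]
  [MeasurableSpace E] [BorelSpace E]

theorem integrable_exp_mul_norm_sq_stdGaussian {t : ℝ} (ht : t < 1 / 2) :
    Integrable (fun x : E => Real.exp (t * ‖x‖ ^ 2)) (stdGaussian E) := by
  rw [stdGaussian, integrable_map_measure (by fun_prop)
    (Measurable.aemeasurable (by fun_prop))]
  have : (fun x : E => Real.exp (t * ‖x‖ ^ 2)) ∘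
      (fun x : Fin (finrank ℝ E) → ℝ => ∑ i, x i • stdOrthonormalBasis ℝ E i) =
      fun x => ∏ i, Real.exp (t * x i ^ 2) := by
    ext x
    simp only [Function.comp_apply]
    rw [norm_sq_sum_smul_stdOrthonormalBasis, Finset.mul_sum, Real.exp_sum]
  rw [this]
  exact Integrable.fintype_prod (f := fun _ x => Real.exp (t * x ^ 2))
    fun _ => integrable_exp_mul_sq_gaussianReal ht

theorem integral_exp_mul_norm_sq_stdGaussian {t : ℝ} (ht : t < 1 / 2) :
    ∫ x : E, Real.exp (t * ‖x‖ ^ 2) ∂(stdGaussian E) =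
      (Real.sqrt (1 - 2 * t))⁻¹ ^ finrank ℝ E := by
  rw [stdGaussian, integral_map (Measurable.aemeasurable (by fun_prop)) (by fun_prop)]
  simp_rw [norm_sq_sum_smul_stdOrthonormalBasis, Finset.mul_sum, Real.exp_sum]
  rw [integral_fintype_prod_eq_prod (f := fun _ x => Real.exp (t * x ^ 2))]
  simp [integral_exp_mul_sq_gaussianReal ht]

theorem map_orthogonalProjectionOnto_stdGaussian (W : Submodule ℝ E) :
    (stdGaussian E).map W.orthogonalProjectionOnto = stdGaussian W := by
  have hp : IsProbabilityMeasure ((stdGaussian E).map W.orthogonalProjectionOnto) :=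
    Measure.isProbabilityMeasure_map (by fun_prop)
  apply Measure.ext_of_charFun
  ext t
  rw [charFun_stdGaussian, charFun_apply, integral_map (by fun_prop) (by fun_prop)]
  have : ∀ x : E, inner ℝ (W.orthogonalProjectionOnto x) t = inner ℝ x (t : E) :=
    fun x => W.inner_orthogonalProjectionOnto_eq_of_mem_right t x
  simp_rw [this]
  rw [← charFun_apply, charFun_stdGaussian]
  simp

/-- Chernoff's bound for the squared length of a projection of a standard Gaussian vector. -/
theorem stdGaussian_chernoff (W : Submodule ℝ E) {t : ℝ} (ht : t < 1 / 2) (s : ℝ) :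
    stdGaussian E {g | t * s ≤ t * ‖W.starProjection g‖ ^ 2} ≤
      ENNReal.ofReal (Real.exp (-(t * s)) * (Real.sqrt (1 - 2 * t))⁻¹ ^ finrank ℝ W) := by
  have hset : {g : E | t * s ≤ t * ‖W.starProjection g‖ ^ 2} =
      W.orthogonalProjectionOnto ⁻¹' {y : W | Real.exp (t * s) ≤ Real.exp (t * ‖y‖ ^ 2)} := by
    ext g
    simp
  have hmeas : MeasurableSet {y : W | Real.exp (t * s) ≤ Real.exp (t * ‖y‖ ^ 2)} :=
    measurableSet_le measurable_const (by fun_prop)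
  rw [hset, ← Measure.map_apply (by fun_prop) hmeas, map_orthogonalProjectionOnto_stdGaussian]
  have h := mul_meas_ge_le_integral_of_nonneg (μ := stdGaussian W)
    (f := fun y : W => Real.exp (t * ‖y‖ ^ 2))
    (Filter.Eventually.of_forall fun y => (Real.exp_pos _).le)
    (integrable_exp_mul_norm_sq_stdGaussian ht) (Real.exp (t * s))
  rw [integral_exp_mul_norm_sq_stdGaussian ht] at h
  rw [← ofReal_measureReal]
  refine ENNReal.ofReal_le_ofReal ?_
  rw [Real.exp_neg, inv_mul_eq_div, le_div_iff₀ (Real.exp_pos _), mul_comm]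
  exact h

/-- The parameter t = 3/8 makes 1 - 2t = (1/2)², so every dimension contributes a factor 2. -/
theorem stdGaussian_norm_sq_starProjection_ge (W : Submodule ℝ E) {r : ℕ} (hr : finrank ℝ W ≤ r)
    (s : ℝ) : stdGaussian E {g | s ≤ ‖W.starProjection g‖ ^ 2} ≤
      ENNReal.ofReal (2 ^ r * Real.exp (-(3 / 8 * s))) := by
  have h := stdGaussian_chernoff W (t := 3 / 8) (by norm_num) s
  have e : Real.sqrt (1 - 2 * (3 / 8)) = 1 / 2 := by
    rw [show (1 - 2 * (3 / 8) : ℝ) = (1 / 2) ^ 2 by norm_num]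
    exact Real.sqrt_sq (by norm_num)
  rw [e] at h
  calc _ ≤ _ := measure_mono fun g hg => by
          simp only [Set.mem_ofPred_eq] at hg ⊢; linarith
    _ ≤ _ := h
    _ ≤ _ := by
      apply ENNReal.ofReal_le_ofReal
      rw [mul_comm, one_div, inv_inv]
      gcongr
      norm_num

theorem stdGaussian_norm_sq_ge {k : ℕ} (hk : finrank ℝ E = k) :
    stdGaussian E {g | 1.3 * (k : ℝ) ≤ ‖g‖ ^ 2} ≤ ENNReal.ofReal (Real.exp (-(k / 200))) := by
  have h := stdGaussian_chernoff (⊤ : Submodule ℝ E) (t := 1 / 9) (by norm_num) (1.3 * k)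
  rw [finrank_top, hk] at h
  calc _ ≤ _ := measure_mono fun g hg => by
          simp only [Set.mem_ofPred_eq, Submodule.starProjection_top] at hg ⊢
          simpa using hg
    _ ≤ _ := h
    _ ≤ _ := by
      apply ENNReal.ofReal_le_ofReal
      -- Here 13/90 = 1.3 · 1/9 is what the threshold provides per dimension and 1/200 is the rate
      -- that has to remain.
      have hq : (Real.sqrt (1 - 2 * (1 / 9)))⁻¹ ≤ Real.exp (13 / 90 - 1 / 200) := by
        rw [← Real.sqrt_inv]
        apply Real.sqrt_le_iff.2 ⟨(Real.exp_pos _).le, ?_⟩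
        rw [← Real.exp_nat_mul]
        have := Real.quadratic_le_exp_of_nonneg
          (x := ((2 : ℕ) : ℝ) * (13 / 90 - 1 / 200)) (by norm_num)
        refine le_trans ?_ this
        norm_num
      calc _ ≤ Real.exp (-(1 / 9 * (1.3 * k))) * Real.exp (13 / 90 - 1 / 200) ^ k := by gcongr
        _ = _ := by
          rw [← Real.exp_nat_mul, ← Real.exp_add]
          congr 1
          ring

theorem stdGaussian_norm_sq_starProjection_orthogonal_le {k : ℕ} (hk : finrank ℝ E = k)
    (W : Submodule ℝ E) (hW : 50 * finrank ℝ W ≤ k) :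
    stdGaussian E {g | ‖Wᗮ.starProjection g‖ ^ 2 ≤ 0.8 * (k : ℝ)} ≤
      ENNReal.ofReal (Real.exp (-(k / 200))) := by
  have h := stdGaussian_chernoff Wᗮ (t := -(1 / 8)) (by norm_num) (0.8 * k)
  calc _ ≤ _ := measure_mono fun g hg => by
          simp only [Set.mem_ofPred_eq] at hg ⊢; linarith
    _ ≤ _ := h
    _ ≤ _ := by
      apply ENNReal.ofReal_le_ofReal
      have hdim : finrank ℝ W + finrank ℝ Wᗮ = k := by
        rw [Submodule.finrank_add_finrank_orthogonal, hk]
      set q := finrank ℝ Wᗮ with hqdef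
      have hq : (49 / 50 : ℝ) * k ≤ q := by
        have h1 : (50 * finrank ℝ W : ℝ) ≤ k := by exact_mod_cast hW
        have h2 : (finrank ℝ W + q : ℝ) = k := by exact_mod_cast hdim
        linarith
      -- This is exp(3/14) ≤ 5/4, checked on 14th powers as e³ ≤ (5/4)^14.
      have hr : (Real.sqrt (1 - 2 * -(1 / 8)))⁻¹ ≤ Real.exp (-(3 / 28)) := by
        rw [Real.exp_neg]
        apply inv_anti₀ (Real.exp_pos _)
        apply Real.le_sqrt_of_sq_le
        rw [← Real.exp_nat_mul]
        have h1 : Real.exp (((2 : ℕ) : ℝ) * (3 / 28)) ^ 14 ≤ (5 / 4) ^ 14 := by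
          rw [← Real.exp_nat_mul]
          have : Real.exp (((14 : ℕ) : ℝ) * (((2 : ℕ) : ℝ) * (3 / 28))) = Real.exp 1 ^ 3 := by
            rw [← Real.exp_nat_mul]; norm_num
          rw [this]
          calc Real.exp 1 ^ 3 ≤ 2.7182818286 ^ 3 := by
                gcongr; exact Real.exp_one_lt_d9.le
            _ ≤ _ := by norm_num
        have := (pow_le_pow_iff_left₀ (Real.exp_pos _).le (by norm_num) (by norm_num)).1 h1
        linarith
      calc _ ≤ Real.exp (-(-(1 / 8) * (0.8 * k))) * Real.exp (-(3 / 28)) ^ q := by gcongr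
        _ = Real.exp (0.1 * k - 3 / 28 * q) := by
          rw [← Real.exp_nat_mul, ← Real.exp_add]
          congr 1
          ring
        -- With q ≥ 49k/50 the exponent is at most 0.1k - (3/28)(49/50)k, which is exactly -k/200.
        _ ≤ _ := by
          apply Real.exp_le_exp.2
          have : (0 : ℝ) ≤ k := by positivity
          linarith

end GaussianTails

end GGM

namespace GGM

/-! ### Squared distances from spans -/

section Residual

open MeasureTheory ProbabilityTheory Module

section Span

variable {E : Type*} [NormedAddCommGroup E] [InnerProductSpace ℝ E] {ι : Type*}

/-- The span of the vectors `x j` with `j ∈ T`. -/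
def colSpan (x : ι → E) (T : Finset ι) : Submodule ℝ E := Submodule.span ℝ (x '' T)

theorem mem_colSpan {x : ι → E} {T : Finset ι} {v : E} :
    v ∈ colSpan x T ↔ ∃ w : ι → ℝ, ∑ j ∈ T, w j • x j = v := by
  rw [colSpan]
  exact Submodule.mem_span_image_finset_iff_exists_fun' ℝ

theorem colSpan_mono {x : ι → E} {T T' : Finset ι} (h : T ⊆ T') : colSpan x T ≤ colSpan x T' :=
  Submodule.span_mono (Set.image_mono (by exact_mod_cast h))

theorem finrank_colSpan_le (x : ι → E) (T : Finset ι) : finrank ℝ (colSpan x T) ≤ T.card := by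
  classical
  have h := finrank_span_finset_le_card (R := ℝ) (T.image x)
  rw [Finset.coe_image] at h
  exact h.trans Finset.card_image_le

theorem finrank_colSpan_le_add [DecidableEq ι] (x : ι → E) {T₀ T : Finset ι} (h : T₀ ⊆ T) :
    finrank ℝ (colSpan x T) ≤ finrank ℝ (colSpan x T₀) + (T \ T₀).card := by
  have e : colSpan x T = colSpan x T₀ ⊔ colSpan x (T \ T₀) := by
    rw [colSpan, colSpan, colSpan, ← Submodule.span_union, ← Set.image_union, ← Finset.coe_union,
      Finset.union_sdiff_of_subset h]
  rw [e]
  have (S : Finset ι) : FiniteDimensional ℝ (colSpan x S) :=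
    FiniteDimensional.span_of_finite ℝ (S.finite_toSet.image x)
  exact (Submodule.finrank_add_le_finrank_add_finrank _ _).trans
    (Nat.add_le_add_left (finrank_colSpan_le _ _) _)

theorem colSpan_congr {x y : ι → E} {T : Finset ι} (h : ∀ j ∈ T, x j = y j) :
    colSpan x T = colSpan y T := by
  rw [colSpan, colSpan, Set.image_congr fun j hj => h j hj]

end Span

variable {E : Type*} [NormedAddCommGroup E] [InnerProductSpace ℝ E] [FiniteDimensional ℝ E] {ι : Type*}

/-- The squared distance of `v` from the subspace `W`. -/
noncomputable def resid (W : Submodule ℝ E) (v : E) : ℝ := ‖Wᗮ.starProjection v‖ ^ 2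

theorem resid_nonneg (W : Submodule ℝ E) (v : E) : 0 ≤ resid W v := sq_nonneg _

theorem resid_le_norm_sq (W : Submodule ℝ E) (v : E) : resid W v ≤ ‖v‖ ^ 2 := by
  unfold resid
  gcongr
  exact Submodule.norm_starProjection_apply_le _ _

theorem starProjection_orthogonal_of_mem {W : Submodule ℝ E} {w : E} (hw : w ∈ W) :
    Wᗮ.starProjection w = 0 := by
  rw [Submodule.starProjection_apply_eq_zero_iff, Submodule.orthogonal_orthogonal]
  exact hw

theorem resid_add_mem {W : Submodule ℝ E} {w : E} (hw : w ∈ W) (v : E) :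
    resid W (w + v) = resid W v := by
  rw [resid, map_add, starProjection_orthogonal_of_mem hw, zero_add, resid]

theorem resid_smul (W : Submodule ℝ E) (a : ℝ) (v : E) :
    resid W (a • v) = a ^ 2 * resid W v := by
  rw [resid, map_smul, norm_smul, mul_pow, Real.norm_eq_abs, sq_abs, resid]

theorem resid_le_norm_sub_sq {W : Submodule ℝ E} {w : E} (hw : w ∈ W) (v : E) :
    resid W v ≤ ‖v - w‖ ^ 2 := by
  have h := resid_le_norm_sq W (v - w)
  rwa [← resid_add_mem hw (v - w), add_sub_cancel] at h

theorem resid_eq_norm_sub_sq (W : Submodule ℝ E) (v : E) :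
    resid W v = ‖v - W.starProjection v‖ ^ 2 := by
  rw [resid, Submodule.starProjection_orthogonal_val]

theorem resid_top (v : E) : resid ⊤ v = 0 := by
  rw [resid_eq_norm_sub_sq, Submodule.starProjection_eq_self_iff.2 Submodule.mem_top, sub_self,
    norm_zero, zero_pow two_ne_zero]

theorem resid_anti {W W' : Submodule ℝ E} (h : W ≤ W') (v : E) : resid W' v ≤ resid W v := by
  rw [resid_eq_norm_sub_sq W]
  exact resid_le_norm_sub_sq (h (Submodule.starProjection_apply_mem W v)) v

theorem resid_add (W : Submodule ℝ E) (u g : E) :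
    resid W (u + g) = resid W u + 2 * inner ℝ (Wᗮ.starProjection u) g + resid W g := by
  have h : inner ℝ (Wᗮ.starProjection u) (Wᗮ.starProjection g) =
      inner ℝ (Wᗮ.starProjection u) g := by
    rw [← Submodule.inner_starProjection_left_eq_right,
      Submodule.starProjection_eq_self_iff.2 (Submodule.starProjection_apply_mem _ _)]
  rw [resid, map_add, norm_add_sq_real, h, resid, resid]

/-- Pythagoras: the component orthogonal to `W₀` is the sum of the component orthogonal to `W` and
the one inside `W` but orthogonal to `W₀`. For a Gaussian vector the difference is thus a chi-square
variable. -/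
theorem resid_sub_resid {W₀ W : Submodule ℝ E} (h : W₀ ≤ W) (v : E) :
    resid W₀ v - resid W v = ‖(W₀ᗮ ⊓ W).starProjection v‖ ^ 2 := by
  have hb : Wᗮ.starProjection v ∈ Wᗮ := Submodule.starProjection_apply_mem _ _
  have hb₀ : W₀.starProjection v ∈ W₀ := Submodule.starProjection_apply_mem _ _
  have e1 : W₀ᗮ.starProjection v = v - W₀.starProjection v :=
    Submodule.starProjection_orthogonal_val v
  have e2 : Wᗮ.starProjection v = v - W.starProjection v :=
    Submodule.starProjection_orthogonal_val v
  have ha : W₀ᗮ.starProjection v - Wᗮ.starProjection v ∈ W₀ᗮ ⊓ W := by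
    refine ⟨sub_mem (Submodule.starProjection_apply_mem _ _) (Submodule.orthogonal_le h hb), ?_⟩
    rw [e1, e2, sub_sub_sub_cancel_left]
    exact sub_mem (Submodule.starProjection_apply_mem _ _) (h hb₀)
  have e : (W₀ᗮ ⊓ W).starProjection v = W₀ᗮ.starProjection v - Wᗮ.starProjection v := by
    refine (Submodule.eq_starProjection_of_mem_orthogonal ha ?_)
    have : v - (W₀ᗮ.starProjection v - Wᗮ.starProjection v) =
        W₀.starProjection v + Wᗮ.starProjection v := by rw [e1]; abel
    rw [this]
    refine add_mem ?_ (Submodule.orthogonal_le inf_le_right hb)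
    have h1 : W₀ᗮᗮ ≤ (W₀ᗮ ⊓ W)ᗮ := Submodule.orthogonal_le inf_le_left
    rw [Submodule.orthogonal_orthogonal] at h1
    exact h1 hb₀
  have horth : inner ℝ (W₀ᗮ.starProjection v - Wᗮ.starProjection v) (Wᗮ.starProjection v) = 0 :=
    Submodule.inner_right_of_mem_orthogonal ha.2 hb
  rw [e, resid, resid]
  conv_lhs => rw [← sub_add_cancel (W₀ᗮ.starProjection v) (Wᗮ.starProjection v)]
  rw [norm_add_sq_real, horth]
  ring

theorem resid_colSpan_eq_iInf (x : ι → E) (T : Finset ι) (v : E) :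
    resid (colSpan x T) v = ⨅ w : ι → ℝ, ‖v - ∑ j ∈ T, w j • x j‖ ^ 2 := by
  have hbdd : BddBelow (Set.range fun w : ι → ℝ => ‖v - ∑ j ∈ T, w j • x j‖ ^ 2) :=
    ⟨0, by rintro _ ⟨w, rfl⟩; positivity⟩
  apply le_antisymm
  · exact le_ciInf fun w => resid_le_norm_sub_sq (mem_colSpan.2 ⟨w, rfl⟩) v
  · obtain ⟨w, hw⟩ := mem_colSpan.1 (Submodule.starProjection_apply_mem (colSpan x T) v)
    rw [resid_eq_norm_sub_sq, ← hw]
    exact ciInf_le hbdd w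

/-- The distance is not continuous in the spanning vectors, since the dimension of the span may
jump, but as an infimum of continuous functions it is upper semicontinuous. -/
theorem measurable_resid_colSpan [Finite ι] [MeasurableSpace E] [BorelSpace E] (T : Finset ι) :
    Measurable fun p : (ι → E) × E => resid (colSpan p.1 T) p.2 := by
  simp_rw [resid_colSpan_eq_iInf]
  apply UpperSemicontinuous.measurable
  apply upperSemicontinuous_ciInf
  · exact fun p => ⟨0, by rintro _ ⟨w, rfl⟩; positivity⟩
  · exact fun w => Continuous.upperSemicontinuous (by fun_prop)

theorem measurable_resid_colSpan_comp [Finite ι] [MeasurableSpace E] [BorelSpace E] {α : Type*}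
    [MeasurableSpace α] {f : α → ι → E} {g : α → E} (hf : Measurable f) (hg : Measurable g)
    (T : Finset ι) : Measurable fun a => resid (colSpan (f a) T) (g a) :=
  Measurable.comp (g := fun p : (ι → E) × E => resid (colSpan p.1 T) p.2)
    (f := fun a => (f a, g a)) (measurable_resid_colSpan T) (hf.prodMk hg)

section Events

variable [MeasurableSpace E] [BorelSpace E]

theorem stdGaussian_resid_sub_ge {W₀ W : Submodule ℝ E} (h : W₀ ≤ W) {r : ℕ}
    (hr : finrank ℝ W ≤ finrank ℝ W₀ + r) (s : ℝ) :
    stdGaussian E {g | s ≤ resid W₀ g - resid W g} ≤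
      ENNReal.ofReal (2 ^ r * Real.exp (-(3 / 8 * s))) := by
  simp_rw [resid_sub_resid h]
  apply stdGaussian_norm_sq_starProjection_ge
  have := Submodule.finrank_add_inf_finrank_orthogonal h
  omega

/-- Expanding the square cancels the residual of `g`, and only the cross term 2⟨p, g⟩ is random, `p`
being the part of `u` orthogonal to `W`. It involves just the projection of `g` onto the line
through `p`, whose length exceeds `s` with the stated probability. -/
theorem stdGaussian_resid_add_lt (W : Submodule ℝ E) (u : E) {s : ℝ} (hs : 0 ≤ s) :
    stdGaussian E {g | resid W (u + g) - resid W g <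
        resid W u - 2 * (s * Real.sqrt (resid W u))} ≤
      ENNReal.ofReal (2 * Real.exp (-(3 / 8 * s ^ 2))) := by
  set p := Wᗮ.starProjection u with hp
  have hnorm : Real.sqrt (resid W u) = ‖p‖ := by rw [resid, Real.sqrt_sq (norm_nonneg _)]
  have hdim : finrank ℝ (Submodule.span ℝ {p}) ≤ 1 := by
    simpa using finrank_span_le_card (R := ℝ) ({p} : Set E)
  refine (measure_mono fun g hg => ?_).trans
    ((stdGaussian_norm_sq_starProjection_ge (Submodule.span ℝ {p}) hdim (s ^ 2)).trans
      (by rw [pow_one]))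
  simp only [Set.mem_ofPred_eq] at hg ⊢
  rw [resid_add, hnorm, ← hp] at hg
  have hin : inner ℝ p g = inner ℝ p ((Submodule.span ℝ {p}).starProjection g) := by
    rw [← Submodule.inner_starProjection_left_eq_right,
      Submodule.starProjection_eq_self_iff.2 (Submodule.mem_span_singleton_self p)]
  have hcs : -(‖p‖ * ‖(Submodule.span ℝ {p}).starProjection g‖) ≤ inner ℝ p g := by
    rw [hin]
    exact (abs_le.1 (abs_real_inner_le_norm _ _)).1
  have hlt : s * ‖p‖ < ‖p‖ * ‖(Submodule.span ℝ {p}).starProjection g‖ := by linarith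
  have hp0 : 0 < ‖p‖ := by
    by_contra hcon
    have : ‖p‖ = 0 := le_antisymm (not_lt.1 hcon) (norm_nonneg _)
    simp [this] at hlt
  have : s < ‖(Submodule.span ℝ {p}).starProjection g‖ := by nlinarith
  gcongr

theorem prod_measure_le_of_section {α β : Type*} [MeasurableSpace α] [MeasurableSpace β]
    (ν : Measure α) (μ : Measure β) [IsProbabilityMeasure ν] [SFinite μ] {B : Set (α × β)}
    (hB : MeasurableSet B) {p : ENNReal} (h : ∀ a, μ {b | (a, b) ∈ B} ≤ p) :
    (ν.prod μ) B ≤ p := by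
  rw [Measure.prod_apply hB]
  calc _ ≤ ∫⁻ _, p ∂ν := lintegral_mono fun a => h a
    _ = p := by simp

end Events

end Residual

end GGM

namespace GGM

/-! ### Independence of the columns of a sample -/

section Columns

open MeasureTheory ProbabilityTheory Module

variable {n k : ℕ} {ι : Type*}

/-- The vector of the `k` observed values of the linear functional with coefficients `c`. -/
noncomputable def col (c : Fin n → ℝ) (X : Sample k n) : EuclideanSpace ℝ (Fin k) :=
  WithLp.toLp 2 fun l => c ⬝ᵥ (X l).ofLp

/-- The observed values of a family of linear functionals. -/
noncomputable def cols (b : ι → Fin n → ℝ) (X : Sample k n) : ι → EuclideanSpace ℝ (Fin k) :=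
  fun s => col (b s) X

theorem measurable_col (c : Fin n → ℝ) : Measurable (col (k := k) c) := by
  unfold col dotProduct; fun_prop

theorem measurable_cols (b : ι → Fin n → ℝ) : Measurable (cols (k := k) b) :=
  measurable_pi_lambda _ fun s => measurable_col (b s)

theorem dotProduct_eq_inner (c : Fin n → ℝ) (x : EuclideanSpace ℝ (Fin n)) :
    c ⬝ᵥ x.ofLp = inner ℝ (WithLp.toLp 2 c) x := by
  simp [PiLp.inner_apply, dotProduct, mul_comm]

/-- For one observation: jointly Gaussian functionals that are uncorrelated are independent. -/
theorem map_row_prod [Finite ι] {S : Matrix (Fin n) (Fin n) ℝ} (hS : S.PosSemidef)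
    {b : ι → Fin n → ℝ} {c : Fin n → ℝ} (hc : c ⬝ᵥ S.mulVec c = 1)
    (hb : ∀ s, b s ⬝ᵥ S.mulVec c = 0) :
    (multivariateGaussian 0 S).map (fun x => (fun s => b s ⬝ᵥ x.ofLp, c ⬝ᵥ x.ofLp)) =
      ((multivariateGaussian 0 S).map (fun x s => b s ⬝ᵥ x.ofLp)).prod (gaussianReal 0 1) := by
  have hmb : Measurable fun (x : EuclideanSpace ℝ (Fin n)) s => b s ⬝ᵥ x.ofLp := by
    unfold dotProduct; fun_prop
  have hmc : Measurable fun x : EuclideanSpace ℝ (Fin n) => c ⬝ᵥ x.ofLp := by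
    unfold dotProduct; fun_prop
  have hcov : ∀ u v : Fin n → ℝ, cov[fun x : EuclideanSpace ℝ (Fin n) => u ⬝ᵥ x.ofLp,
      fun x => v ⬝ᵥ x.ofLp; multivariateGaussian 0 S] = u ⬝ᵥ S.mulVec v := by
    intro u v
    simp_rw [dotProduct_eq_inner]
    rw [← covarianceBilin_apply_eq_cov IsGaussian.memLp_two_id,
      covarianceBilin_multivariateGaussian hS]
  have hlaw : HasGaussianLaw (fun x : EuclideanSpace ℝ (Fin n) => c ⬝ᵥ x.ofLp)
      (multivariateGaussian 0 S) := by
    have h : HasGaussianLaw (id : EuclideanSpace ℝ (Fin n) → _) (multivariateGaussian 0 S) :=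
      IsGaussian.hasGaussianLaw_id
    simp_rw [dotProduct_eq_inner]
    exact h.map (innerSL ℝ (WithLp.toLp 2 c))
  have hmapc : (multivariateGaussian 0 S).map
      (fun x : EuclideanSpace ℝ (Fin n) => c ⬝ᵥ x.ofLp) = gaussianReal 0 1 := by
    rw [hlaw.map_eq_gaussianReal, ← covariance_self hmc.aemeasurable, hcov, hc]
    have : ∫ x : EuclideanSpace ℝ (Fin n), c ⬝ᵥ x.ofLp ∂(multivariateGaussian 0 S) = 0 := by
      simp_rw [dotProduct_eq_inner]
      have := (innerSL ℝ (WithLp.toLp 2 c)).integral_comp_comm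
        (IsGaussian.integrable_fun_id (μ := multivariateGaussian 0 S))
      simpa using this
    rw [this]
    simp
  have hjoint : HasGaussianLaw (fun x : EuclideanSpace ℝ (Fin n) =>
      ((fun s => b s ⬝ᵥ x.ofLp), (fun _ : Unit => c ⬝ᵥ x.ofLp))) (multivariateGaussian 0 S) := by
    have h : HasGaussianLaw (id : EuclideanSpace ℝ (Fin n) → _) (multivariateGaussian 0 S) :=
      IsGaussian.hasGaussianLaw_id
    simp_rw [dotProduct_eq_inner]
    have := Fintype.ofFinite ι
    exact h.map ((ContinuousLinearMap.pi fun s => innerSL ℝ (WithLp.toLp 2 (b s))).prod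
      (ContinuousLinearMap.pi fun _ : Unit => innerSL ℝ (WithLp.toLp 2 c)))
  have hind := hjoint.indepFun_of_covariance_eval (X := fun s (x : EuclideanSpace ℝ (Fin n)) => b s ⬝ᵥ x.ofLp)
    (Y := fun _ (x : EuclideanSpace ℝ (Fin n)) => c ⬝ᵥ x.ofLp) fun s _ => by rw [hcov, hb]
  have hind' := hind.comp measurable_id (measurable_pi_apply ())
  have e := (indepFun_iff_map_prod_eq_prod_map_map hmb.aemeasurable hmc.aemeasurable).1 hind'
  rw [hmapc] at e
  exact e

/-- The `k` rows are independent copies of the pair in `map_row_prod`; transposing the array of rows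
into columns turns a product of pairs into a pair of products. -/
theorem map_cols_prod [Finite ι] {Θ : Matrix (Fin n) (Fin n) ℝ} (hS : Θ⁻¹.PosSemidef)
    {b : ι → Fin n → ℝ} {c : Fin n → ℝ} (hc : c ⬝ᵥ Θ⁻¹.mulVec c = 1)
    (hb : ∀ s, b s ⬝ᵥ Θ⁻¹.mulVec c = 0) :
    (sampleLaw Θ k).map (fun X => (cols b X, col c X)) =
      ((sampleLaw Θ k).map (cols b)).prod (stdGaussian (EuclideanSpace ℝ (Fin k))) := by
  have := Fintype.ofFinite ι
  set μ := multivariateGaussian 0 Θ⁻¹ with hμ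
  have hmb : Measurable fun (x : EuclideanSpace ℝ (Fin n)) s => b s ⬝ᵥ x.ofLp := by
    unfold dotProduct; fun_prop
  have hmc : Measurable fun x : EuclideanSpace ℝ (Fin n) => c ⬝ᵥ x.ofLp := by
    unfold dotProduct; fun_prop
  have hpb : IsProbabilityMeasure (μ.map (fun x s => b s ⬝ᵥ x.ofLp)) :=
    Measure.isProbabilityMeasure_map hmb.aemeasurable
  let τ : (Fin k → ι → ℝ) → ι → EuclideanSpace ℝ (Fin k) := fun y s => WithLp.toLp 2 fun l => y l s
  have hτ : Measurable τ := by fun_prop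
  have hrow : Measurable fun x : EuclideanSpace ℝ (Fin n) =>
    ((fun s => b s ⬝ᵥ x.ofLp), c ⬝ᵥ x.ofLp) := hmb.prodMk hmc
  have hprob : IsProbabilityMeasure (μ.map fun x => ((fun s => b s ⬝ᵥ x.ofLp), c ⬝ᵥ x.ofLp)) :=
    Measure.isProbabilityMeasure_map hrow.aemeasurable
  have h1 : (Measure.pi fun _ : Fin k => μ).map
      (fun X l => ((fun s => b s ⬝ᵥ (X l).ofLp), c ⬝ᵥ (X l).ofLp)) =
      Measure.pi fun _ : Fin k => (μ.map (fun x s => b s ⬝ᵥ x.ofLp)).prod (gaussianReal 0 1) := by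
    rw [← map_row_prod hS hc hb]
    exact Measure.pi_map_pi (f := fun _ (x : EuclideanSpace ℝ (Fin n)) =>
      ((fun s => b s ⬝ᵥ x.ofLp), c ⬝ᵥ x.ofLp)) fun _ => hrow.aemeasurable
  have h2 := (measurePreserving_arrowProdEquivProdArrow (ι → ℝ) ℝ (Fin k)
    (fun _ => μ.map (fun x s => b s ⬝ᵥ x.ofLp)) fun _ => gaussianReal 0 1).map_eq
  rw [← h1] at h2
  have h3 : (Measure.pi fun _ : Fin k => μ).map (fun X l s => b s ⬝ᵥ (X l).ofLp) =
      Measure.pi fun _ : Fin k => μ.map (fun x s => b s ⬝ᵥ x.ofLp) :=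
    Measure.pi_map_pi (f := fun _ (x : EuclideanSpace ℝ (Fin n)) s => b s ⬝ᵥ x.ofLp) fun _ => hmb.aemeasurable
  have hrows : Measurable fun (X : Sample k n) l => ((fun s => b s ⬝ᵥ (X l).ofLp), c ⬝ᵥ (X l).ofLp) :=
    measurable_pi_lambda _ fun l => hrow.comp (measurable_pi_apply l)
  have hrowsb : Measurable fun (X : Sample k n) l s => b s ⬝ᵥ (X l).ofLp :=
    measurable_pi_lambda _ fun l => hmb.comp (measurable_pi_apply l)
  have hlp : Measurable (WithLp.toLp 2 : (Fin k → ℝ) → EuclideanSpace ℝ (Fin k)) := by fun_prop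
  have e1 : cols b = τ ∘ fun (X : Sample k n) l s => b s ⬝ᵥ (X l).ofLp := rfl
  rw [sampleLaw, ← hμ, ← map_pi_eq_stdGaussian, e1, ← Measure.map_map hτ hrowsb, h3,
    Measure.map_prod_map _ _ hτ hlp, ← h2,
    Measure.map_map (MeasurableEquiv.measurable _) hrows,
    Measure.map_map (hτ.prodMap hlp) ((MeasurableEquiv.measurable _).comp hrows)]
  rfl

/-- Conditionally on the columns of the family `b`, the column of `c` is a standard Gaussian vector
in ℝᵏ. So an estimate that is uniform over fixed vectors `a` carries over to the sample. -/
theorem sampleLaw_le_of_section [Finite ι] {Θ : Matrix (Fin n) (Fin n) ℝ} (hS : Θ⁻¹.PosSemidef)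
    {b : ι → Fin n → ℝ} {c : Fin n → ℝ} (hc : c ⬝ᵥ Θ⁻¹.mulVec c = 1)
    (hb : ∀ s, b s ⬝ᵥ Θ⁻¹.mulVec c = 0)
    {B : Set ((ι → EuclideanSpace ℝ (Fin k)) × EuclideanSpace ℝ (Fin k))} (hB : MeasurableSet B)
    {p : ENNReal} (h : ∀ a, stdGaussian (EuclideanSpace ℝ (Fin k)) {g | (a, g) ∈ B} ≤ p) :
    sampleLaw Θ k {X | (cols b X, col c X) ∈ B} ≤ p := by
  have hprob := isProbabilityMeasure_sampleLaw Θ k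
  have hm : Measurable fun X : Sample k n => (cols b X, col c X) :=
    (measurable_cols b).prodMk (measurable_col c)
  have : IsProbabilityMeasure ((sampleLaw Θ k).map (cols b)) :=
    Measure.isProbabilityMeasure_map (measurable_cols b).aemeasurable
  change sampleLaw Θ k ((fun X => (cols b X, col c X)) ⁻¹' B) ≤ p
  rw [← Measure.map_apply hm hB, map_cols_prod hS hc hb]
  exact prod_measure_le_of_section _ _ hB h

end Columns

end GGM

namespace GGM

/-! ### Innovations and the tail events of the model -/

section ModelEvents

open MeasureTheory ProbabilityTheory Module

variable {n k : ℕ}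

/-- The observed values of the coordinates. -/
noncomputable def stdCols (X : Sample k n) : Fin n → EuclideanSpace ℝ (Fin k) :=
  cols (fun j => Pi.single j 1) X

theorem col_add (c c' : Fin n → ℝ) (X : Sample k n) : col (c + c') X = col c X + col c' X := by
  ext l; simp [col]

theorem col_smul (t : ℝ) (c : Fin n → ℝ) (X : Sample k n) : col (t • c) X = t • col c X := by
  ext l; simp [col]

theorem col_eq_sum (c : Fin n → ℝ) (X : Sample k n) : col c X = ∑ j, c j • stdCols X j := by
  ext l
  simp [col, stdCols, cols]
  rfl

/-- The coefficients, scaled to unit variance, of the combination with coefficients `a` of the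
coordinates of `Θ X`, which is independent of every functional orthogonal to `a`. -/
noncomputable def innov (Θ : Matrix (Fin n) (Fin n) ℝ) (a : Fin n → ℝ) : Fin n → ℝ :=
  (Real.sqrt (a ⬝ᵥ Θ.mulVec a))⁻¹ • Θ.mulVec a

theorem inv_mulVec_innov {Θ : Matrix (Fin n) (Fin n) ℝ} (hΘ : Θ.PosDef) (a : Fin n → ℝ) :
    Θ⁻¹.mulVec (innov Θ a) = (Real.sqrt (a ⬝ᵥ Θ.mulVec a))⁻¹ • a := by
  rw [innov, Matrix.mulVec_smul, Matrix.mulVec_mulVec,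
    Matrix.nonsing_inv_mul _ ((Matrix.isUnit_iff_isUnit_det _).1 hΘ.isUnit), Matrix.one_mulVec]

theorem dotProduct_mulVec_pos {Θ : Matrix (Fin n) (Fin n) ℝ} (hΘ : Θ.PosDef) {a : Fin n → ℝ}
    (ha : a ≠ 0) : 0 < a ⬝ᵥ Θ.mulVec a := by
  have := hΘ.dotProduct_mulVec_pos ha
  rwa [star_trivial] at this

/-- The covariance matrix maps the innovation to a multiple of `a`. Hence its covariance with a
functional `b` is proportional to b · a, and its variance is one by the choice of the scale. -/
theorem sampleLaw_le_of_section_innov {ι : Type*} [Finite ι] {Θ : Matrix (Fin n) (Fin n) ℝ}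
    (hΘ : Θ.PosDef) {b : ι → Fin n → ℝ} {a : Fin n → ℝ} (ha : a ≠ 0) (hb : ∀ s, b s ⬝ᵥ a = 0)
    {B : Set ((ι → EuclideanSpace ℝ (Fin k)) × EuclideanSpace ℝ (Fin k))} (hB : MeasurableSet B)
    {p : ENNReal} (h : ∀ x, stdGaussian (EuclideanSpace ℝ (Fin k)) {g | (x, g) ∈ B} ≤ p) :
    sampleLaw Θ k {X | (cols b X, col (innov Θ a) X) ∈ B} ≤ p := by
  have hpos := dotProduct_mulVec_pos hΘ ha
  refine sampleLaw_le_of_section hΘ.inv.posSemidef ?_ (fun s => ?_) hB h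
  · rw [inv_mulVec_innov hΘ, innov, smul_dotProduct, dotProduct_smul, dotProduct_comm _ a,
      smul_eq_mul, smul_eq_mul, ← mul_assoc, ← mul_inv, Real.mul_self_sqrt hpos.le,
      inv_mul_cancel₀ hpos.ne']
  · rw [inv_mulVec_innov hΘ, dotProduct_smul, hb, smul_zero]

/-- The coefficients with index in `A`. -/
noncomputable def restrictTo (A : Finset (Fin n)) (w : Fin n → ℝ) : Fin n → ℝ :=
  fun j => if j ∈ A then w j else 0

/-- Innovations keep a functional away from the span of columns with other indices. -/
theorem sampleLaw_resid_le {Θ : Matrix (Fin n) (Fin n) ℝ} (hΘ : Θ.PosDef) {a w : Fin n → ℝ}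
    (haw : 0 < w ⬝ᵥ a) {T : Finset (Fin n)} (hT : ∀ j ∈ T, a j = 0) (hk : 50 * (T.card + 1) ≤ k) :
    sampleLaw Θ k {X | resid (colSpan (stdCols X) T) (col w X) ≤
      (w ⬝ᵥ a) ^ 2 / (a ⬝ᵥ Θ.mulVec a) * (0.8 * (k : ℝ))} ≤
        ENNReal.ofReal (Real.exp (-(k / 200))) := by
  have ha : a ≠ 0 := by rintro rfl; simp at haw
  have hpos := dotProduct_mulVec_pos hΘ ha
  -- α is the covariance of `w` with the innovation. So w - α · innovation is orthogonal to `a`, and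
  -- the innovation is independent of it and of the coordinates where `a` vanishes.
  set α := (w ⬝ᵥ a) / Real.sqrt (a ⬝ᵥ Θ.mulVec a) with hα
  have hα2 : (w ⬝ᵥ a) ^ 2 / (a ⬝ᵥ Θ.mulVec a) = α ^ 2 := by
    rw [hα, div_pow, Real.sq_sqrt hpos.le]
  have hα0 : 0 < α := by positivity
  let b : Option (Fin n) → Fin n → ℝ := fun s => s.elim (w - α • innov Θ a)
    fun j => if a j = 0 then Pi.single j 1 else 0
  have hb : ∀ s, b s ⬝ᵥ a = 0 := by
    rintro (_ | j)
    · simp only [b, Option.elim_none, sub_dotProduct, smul_dotProduct, innov, smul_eq_mul]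
      rw [dotProduct_comm (Θ.mulVec a), hα, ← mul_assoc, div_mul_eq_mul_div, div_eq_mul_inv, mul_assoc,
        mul_assoc, ← mul_assoc (Real.sqrt _)⁻¹, ← mul_inv, Real.mul_self_sqrt hpos.le]
      field_simp
      ring
    · by_cases h : a j = 0 <;> simp [b, h]
  let T' : Finset (Option (Fin n)) := Finset.insertNone T
  have hB : MeasurableSet {p : (Option (Fin n) → EuclideanSpace ℝ (Fin k)) ×
      EuclideanSpace ℝ (Fin k) | resid (colSpan p.1 T') p.2 ≤ 0.8 * (k : ℝ)} :=
    measurableSet_le (measurable_resid_colSpan T') measurable_const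
  refine (measure_mono fun X hX => ?_).trans
    (sampleLaw_le_of_section_innov hΘ ha hb hB fun x =>
      stdGaussian_norm_sq_starProjection_orthogonal_le (by simp) (colSpan x T') ?_)
  · simp only [Set.mem_ofPred_eq] at hX ⊢
    -- Adjoining the column of w - α · innovation to the span only decreases the distance, and
    -- modulo the larger span the column of `w` is α times the innovation.
    have hle : colSpan (stdCols X) T ≤ colSpan (cols b X) T' := by
      rw [colSpan, Submodule.span_le]
      rintro _ ⟨j, hj, rfl⟩
      refine Submodule.subset_span ⟨some j, by simpa [T'] using hj, ?_⟩
      simp [cols, stdCols, b, hT j hj]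
    have hz : col (w - α • innov Θ a) X ∈ colSpan (cols b X) T' :=
      Submodule.subset_span ⟨none, by simp [T'], rfl⟩
    have e : col w X = col (w - α • innov Θ a) X + α • col (innov Θ a) X := by
      rw [← col_smul, ← col_add, sub_add_cancel]
    have h1 := resid_anti hle (col w X)
    rw [e, resid_add_mem hz, resid_smul, ← e] at h1
    rw [hα2] at hX
    have h2 : α ^ 2 * resid (colSpan (cols b X) T') (col (innov Θ a) X) ≤ α ^ 2 * (0.8 * k) :=
      h1.trans hX
    exact le_of_mul_le_mul_left h2 (by positivity)
  · have := finrank_colSpan_le x T'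
    rw [Finset.card_insertNone] at this
    omega

/-- The unit variance residual of the coordinate `i` given all others. -/
noncomputable def noise (Θ : Matrix (Fin n) (Fin n) ℝ) (i : Fin n) (X : Sample k n) :
    EuclideanSpace ℝ (Fin k) :=
  col (innov Θ (Pi.single i 1)) X

/-- The regression coefficients of the coordinate `i` given all others, in units of the standard
deviation of the residual. -/
noncomputable def regCoef (Θ : Matrix (Fin n) (Fin n) ℝ) (i : Fin n) : Fin n → ℝ :=
  fun j => if j = i then 0 else -Θ i j / Real.sqrt (Θ i i)

theorem diag_pos {Θ : Matrix (Fin n) (Fin n) ℝ} (hΘ : Θ.PosDef) (i : Fin n) : 0 < Θ i i :=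
  hΘ.diag_pos

theorem symm_apply {Θ : Matrix (Fin n) (Fin n) ℝ} (hΘ : Θ.PosDef) (i j : Fin n) :
    Θ i j = Θ j i := by
  have := hΘ.isHermitian.apply i j
  rw [star_trivial] at this
  exact this.symm

theorem innov_single {Θ : Matrix (Fin n) (Fin n) ℝ} (i : Fin n) :
    innov Θ (Pi.single i 1) = fun j => Θ j i / Real.sqrt (Θ i i) := by
  ext j
  simp [innov, Matrix.col_apply, div_eq_inv_mul]

/-- The regression equation of the coordinate `i`, solved for `Xᵢ` from row `i` of `Θ`. -/
theorem stdCols_eq_smul {Θ : Matrix (Fin n) (Fin n) ℝ} (hΘ : Θ.PosDef) (i : Fin n)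
    (X : Sample k n) :
    stdCols X i = (Real.sqrt (Θ i i))⁻¹ • (col (regCoef Θ i) X + noise Θ i X) := by
  have hs := Real.sqrt_pos.2 (diag_pos hΘ i)
  rw [noise, ← col_add, ← col_smul]
  change col (Pi.single i 1) X = _
  congr 1
  ext j
  rw [innov_single]
  by_cases h : j = i
  · subst h
    have := Real.mul_self_sqrt (diag_pos hΘ j).le
    simp only [Pi.smul_apply, Pi.add_apply, regCoef, if_true, Pi.single_eq_same, smul_eq_mul]
    field_simp
    nlinarith
  · simp only [Pi.smul_apply, Pi.add_apply, regCoef, h, if_false, Pi.single_eq_of_ne h, smul_eq_mul]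
    rw [symm_apply hΘ i j]
    ring

theorem single_ne_zero' (i : Fin n) : (Pi.single i 1 : Fin n → ℝ) ≠ 0 := by
  intro h
  have := congrFun h i
  simp at this

/-- All coordinates but `i`. -/
noncomputable def othersCoef (i : Fin n) : Fin n → Fin n → ℝ :=
  fun j => if j = i then 0 else Pi.single j 1

/-- The zero functional in place of the coordinate `i` keeps the index type while making the whole
family orthogonal to the `i`-th unit vector, hence independent of the noise. -/
theorem othersCoef_dotProduct (i j : Fin n) :
    othersCoef i j ⬝ᵥ (Pi.single i 1 : Fin n → ℝ) = 0 := by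
  by_cases h : j = i
  · simp [othersCoef, h]
  · simp [othersCoef, h]

theorem colSpan_othersCoef {i : Fin n} {T : Finset (Fin n)} (hi : i ∉ T) (X : Sample k n) :
    colSpan (cols (othersCoef i) X) T = colSpan (stdCols X) T := by
  apply colSpan_congr
  intro j hj
  have : j ≠ i := fun h => hi (h ▸ hj)
  simp [cols, stdCols, othersCoef, this]

theorem sum_smul_othersCoef {i : Fin n} {w : Fin n → ℝ} (hw : w i = 0) (X : Sample k n) :
    ∑ j, w j • cols (othersCoef i) X j = col w X := by
  rw [col_eq_sum]
  refine Finset.sum_congr rfl fun j _ => ?_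
  by_cases h : j = i
  · subst h; simp [hw]
  · simp [cols, stdCols, othersCoef, h]

/-- Overfitting: the noise is independent of the predictors, so the gain from at most `r` additional
ones is a chi-square variable with at most `r` degrees of freedom. -/
theorem sampleLaw_noise_sub_ge {Θ : Matrix (Fin n) (Fin n) ℝ} (hΘ : Θ.PosDef) {i : Fin n}
    {T₀ T : Finset (Fin n)} (hT : T₀ ⊆ T) (hi : i ∉ T) {r : ℕ} (hr : (T \ T₀).card ≤ r) (s : ℝ) :
    sampleLaw Θ k {X | s ≤ resid (colSpan (stdCols X) T₀) (noise Θ i X) -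
      resid (colSpan (stdCols X) T) (noise Θ i X)} ≤
        ENNReal.ofReal (2 ^ r * Real.exp (-(3 / 8 * s))) := by
  have hB : MeasurableSet {p : (Fin n → EuclideanSpace ℝ (Fin k)) × EuclideanSpace ℝ (Fin k) |
      s ≤ resid (colSpan p.1 T₀) p.2 - resid (colSpan p.1 T) p.2} :=
    measurableSet_le measurable_const
      ((measurable_resid_colSpan T₀).sub (measurable_resid_colSpan T))
  refine (measure_mono fun X hX => ?_).trans
    (sampleLaw_le_of_section_innov hΘ (single_ne_zero' i) (othersCoef_dotProduct i) hB fun x =>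
      stdGaussian_resid_sub_ge (colSpan_mono hT) (r := r) ?_ s)
  · simpa only [Set.mem_ofPred_eq, noise, colSpan_othersCoef hi,
      colSpan_othersCoef (fun h => hi (hT h))] using hX
  · exact (finrank_colSpan_le_add x hT).trans (by omega)

theorem sampleLaw_noise_resid_le {Θ : Matrix (Fin n) (Fin n) ℝ} (hΘ : Θ.PosDef) {i : Fin n}
    {T : Finset (Fin n)} (hi : i ∉ T) (hk : 50 * T.card ≤ k) :
    sampleLaw Θ k {X | resid (colSpan (stdCols X) T) (noise Θ i X) ≤ 0.8 * (k : ℝ)} ≤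
      ENNReal.ofReal (Real.exp (-(k / 200))) := by
  have hB : MeasurableSet {p : (Fin n → EuclideanSpace ℝ (Fin k)) × EuclideanSpace ℝ (Fin k) |
      resid (colSpan p.1 T) p.2 ≤ 0.8 * (k : ℝ)} :=
    measurableSet_le (measurable_resid_colSpan T) measurable_const
  refine (measure_mono fun X hX => ?_).trans
    (sampleLaw_le_of_section_innov hΘ (single_ne_zero' i) (othersCoef_dotProduct i) hB fun x =>
      stdGaussian_norm_sq_starProjection_orthogonal_le (by simp) (colSpan x T) ?_)
  · simpa only [Set.mem_ofPred_eq, noise, colSpan_othersCoef hi] using hX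
  · have := finrank_colSpan_le x T
    omega

theorem sampleLaw_noise_norm_ge {Θ : Matrix (Fin n) (Fin n) ℝ} (hΘ : Θ.PosDef) (i : Fin n) :
    sampleLaw Θ k {X | 1.3 * (k : ℝ) ≤ ‖noise Θ i X‖ ^ 2} ≤
      ENNReal.ofReal (Real.exp (-(k / 200))) := by
  have hB : MeasurableSet {p : (Fin n → EuclideanSpace ℝ (Fin k)) × EuclideanSpace ℝ (Fin k) |
      1.3 * (k : ℝ) ≤ ‖p.2‖ ^ 2} :=
    measurableSet_le measurable_const (by fun_prop)
  exact sampleLaw_le_of_section_innov hΘ (single_ne_zero' i) (othersCoef_dotProduct i) hB fun x =>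
    stdGaussian_norm_sq_ge (by simp)

/-- As w i = 0, the column of `w` is determined by the other columns, so given these it is the fixed
vector `u` of `stdGaussian_resid_add_lt`. -/
theorem sampleLaw_resid_add_lt {Θ : Matrix (Fin n) (Fin n) ℝ} (hΘ : Θ.PosDef) {i : Fin n}
    {w : Fin n → ℝ} (hw : w i = 0) {T : Finset (Fin n)} (hi : i ∉ T) {s : ℝ} (hs : 0 ≤ s) :
    sampleLaw Θ k {X | resid (colSpan (stdCols X) T) (col w X + noise Θ i X) -
        resid (colSpan (stdCols X) T) (noise Θ i X) <
          resid (colSpan (stdCols X) T) (col w X) -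
            2 * (s * Real.sqrt (resid (colSpan (stdCols X) T) (col w X)))} ≤
      ENNReal.ofReal (2 * Real.exp (-(3 / 8 * s ^ 2))) := by
  have hsum : Measurable fun p : (Fin n → EuclideanSpace ℝ (Fin k)) × EuclideanSpace ℝ (Fin k) =>
      ∑ j, w j • p.1 j := by fun_prop
  have hm1 := measurable_resid_colSpan_comp measurable_fst hsum T
  have hm2 := measurable_resid_colSpan_comp measurable_fst (hsum.add measurable_snd) T
  have hB : MeasurableSet {p : (Fin n → EuclideanSpace ℝ (Fin k)) × EuclideanSpace ℝ (Fin k) |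
      resid (colSpan p.1 T) (∑ j, w j • p.1 j + p.2) - resid (colSpan p.1 T) p.2 <
        resid (colSpan p.1 T) (∑ j, w j • p.1 j) -
          2 * (s * Real.sqrt (resid (colSpan p.1 T) (∑ j, w j • p.1 j)))} :=
    measurableSet_lt (hm2.sub (measurable_resid_colSpan T))
      (hm1.sub ((hm1.sqrt.const_mul s).const_mul 2))
  refine (measure_mono fun X hX => ?_).trans
    (sampleLaw_le_of_section_innov (p := ENNReal.ofReal (2 * Real.exp (-(3 / 8 * s ^ 2)))) hΘ
      (single_ne_zero' i) (othersCoef_dotProduct i) hB fun x => ?_)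
  · simpa only [Set.mem_ofPred_eq, noise, colSpan_othersCoef hi, sum_smul_othersCoef hw] using hX
  · simp only [Set.mem_ofPred_eq]
    exact stdGaussian_resid_add_lt (colSpan x T) (∑ j, w j • x j) hs

end ModelEvents

end GGM

namespace GGM

/-! ### Ties have probability zero -/

section Uniqueness

open MeasureTheory ProbabilityTheory Module

variable {E : Type*} [NormedAddCommGroup E] [InnerProductSpace ℝ E] [FiniteDimensional ℝ E]
  [MeasurableSpace E] [BorelSpace E]

/-- Resampling the component of a standard Gaussian vector in a fixed direction. -/
theorem map_resample_stdGaussian {e : E} (he : ‖e‖ = 1) :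
    ((stdGaussian E).prod (gaussianReal 0 1)).map
      (fun p => (Submodule.span ℝ {e})ᗮ.starProjection p.1 + p.2 • e) = stdGaussian E := by
  set P := (Submodule.span ℝ {e})ᗮ.starProjection with hP
  have hm : Measurable fun p : E × ℝ => P p.1 + p.2 • e := by fun_prop
  have hprob : IsProbabilityMeasure (((stdGaussian E).prod (gaussianReal 0 1)).map
      fun p => P p.1 + p.2 • e) := Measure.isProbabilityMeasure_map hm.aemeasurable
  apply Measure.ext_of_charFun
  ext s
  rw [charFun_apply, integral_map hm.aemeasurable (by fun_prop)]
  have hsplit : ∀ p : E × ℝ, Complex.exp (inner ℝ (P p.1 + p.2 • e) s * Complex.I) =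
      Complex.exp (inner ℝ p.1 (P s) * Complex.I) *
        Complex.exp (((inner ℝ e s : ℝ) : ℂ) * (p.2 : ℂ) * Complex.I) := by
    intro p
    rw [inner_add_left, inner_smul_left, hP, Submodule.inner_starProjection_left_eq_right,
      ← Complex.exp_add]
    congr 1
    simp
    ring
  simp_rw [hsplit]
  rw [integral_prod_mul (fun x : E => Complex.exp (inner ℝ x (P s) * Complex.I))
    (fun y : ℝ => Complex.exp (((inner ℝ e s : ℝ) : ℂ) * (y : ℂ) * Complex.I)), ← charFun_apply,
    ← charFun_apply_real, charFun_stdGaussian, charFun_gaussianReal, charFun_stdGaussian,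
    ← Complex.exp_add]
  have h1 := Submodule.norm_sq_eq_add_norm_sq_starProjection s (Submodule.span ℝ {e})
  rw [Submodule.starProjection_unit_singleton ℝ he, norm_smul, he, mul_one, Real.norm_eq_abs, sq_abs,
    ← hP] at h1
  have h2 : ((‖s‖ : ℝ) : ℂ) ^ 2 = ((inner ℝ e s : ℝ) : ℂ) ^ 2 + ((‖P s‖ : ℝ) : ℂ) ^ 2 := by
    exact_mod_cast congrArg (fun r : ℝ => (r : ℂ)) h1
  rw [h2]
  congr 1
  simp
  ring

theorem finite_quadratic_zeros {a b c : ℝ} (ha : a ≠ 0) :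
    Set.Finite {t : ℝ | a * t ^ 2 + b * t + c = 0} := by
  have hf : Polynomial.C a * Polynomial.X ^ 2 + Polynomial.C b * Polynomial.X +
      Polynomial.C c ≠ 0 := by
    intro h
    have h2 := congrArg (fun f => Polynomial.coeff f 2) h
    simp at h2
    exact ha h2
  refine (Polynomial.finite_setOfPred_isRoot hf).subset fun t ht => ?_
  simpa [Polynomial.IsRoot] using ht

/-- The squared distances from two subspaces agree with probability zero. -/
theorem stdGaussian_resid_eq_resid {W W' : Submodule ℝ E} {p : E} (hp : p ∈ W')
    (hpW : resid W p ≠ 0) (u : E) :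
    stdGaussian E {g | resid W (u + g) = resid W' (u + g)} = 0 := by
  set q := Wᗮ.starProjection p with hq
  have hq0 : 0 < ‖q‖ := by
    rw [resid] at hpW
    exact lt_of_le_of_ne (norm_nonneg _) fun h => hpW (by rw [← hq, ← h]; norm_num)
  -- Let `e` be the direction of the part of `p` orthogonal to `W`. Along `e`, the squared distance
  -- from `W` is a quadratic polynomial with leading coefficient 1, whereas for `W'` this
  -- coefficient is smaller, because `e` is not orthogonal to `p` ∈ W'. The two thus agree at
  -- finitely many points, and the component of the Gaussian vector along `e` avoids these almost
  -- surely.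
  set e := ‖q‖⁻¹ • q with he
  have he1 : ‖e‖ = 1 := by
    rw [he, norm_smul, norm_inv, norm_norm, inv_mul_cancel₀ hq0.ne']
  have heW : Wᗮ.starProjection e = e :=
    Submodule.starProjection_eq_self_iff.2
      (Submodule.smul_mem _ _ (Submodule.starProjection_apply_mem _ _))
  have hrW : resid W e = 1 := by rw [resid, heW, he1, one_pow]
  have hrW' : resid W' e < 1 := by
    have h1 := resid_add W' (‖q‖⁻¹ • q) 0
    have hpe : inner ℝ p e = ‖q‖ := by
      have : inner ℝ p q = ‖q‖ ^ 2 := by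
        rw [hq, ← Submodule.starProjection_eq_self_iff.2
          (Submodule.starProjection_apply_mem Wᗮ p),
          ← Submodule.inner_starProjection_left_eq_right,
          Submodule.starProjection_eq_self_iff.2 (Submodule.starProjection_apply_mem Wᗮ p),
          real_inner_self_eq_norm_sq]
      rw [he, inner_smul_right, this]
      field_simp
    have hne : W'.starProjection e ≠ 0 := by
      intro h0
      have : inner ℝ p e = 0 := by
        rw [← Submodule.starProjection_eq_self_iff.2 hp,
          Submodule.inner_starProjection_left_eq_right, h0, inner_zero_right]
      rw [hpe] at this
      exact hq0.ne' this
    have h2 := Submodule.norm_sq_eq_add_norm_sq_starProjection e W'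
    rw [he1] at h2
    have h3 : 0 < ‖W'.starProjection e‖ := norm_pos_iff.2 hne
    rw [resid]
    nlinarith
  clear_value e
  have hmeas : MeasurableSet {g : E | resid W (u + g) = resid W' (u + g)} := by
    unfold resid
    exact measurableSet_eq_fun (by fun_prop) (by fun_prop)
  have hm : Measurable fun p : E × ℝ =>
      (Submodule.span ℝ {e})ᗮ.starProjection p.1 + p.2 • e := by fun_prop
  refine le_antisymm ?_ bot_le
  rw [← map_resample_stdGaussian he1, Measure.map_apply hm hmeas]
  refine prod_measure_le_of_section _ _ (hm hmeas) fun y => ?_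
  set z := u + (Submodule.span ℝ {e})ᗮ.starProjection y with hz
  clear_value z
  have hquad : ∀ t : ℝ, resid W (z + t • e) - resid W' (z + t • e) =
      (1 - resid W' e) * t ^ 2 +
        2 * (inner ℝ (Wᗮ.starProjection z) e - inner ℝ (W'ᗮ.starProjection z) e) * t +
        (resid W z - resid W' z) := by
    intro t
    rw [resid_add W z, resid_add W' z, resid_smul, resid_smul, inner_smul_right,
      inner_smul_right, hrW]
    ring
  have hfin : Set.Finite {t : ℝ | (u + ((Submodule.span ℝ {e})ᗮ.starProjection y + t • e)) ∈
      {v | resid W v = resid W' v}} := by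
    refine (finite_quadratic_zeros (a := 1 - resid W' e)
      (b := 2 * (inner ℝ (Wᗮ.starProjection z) e - inner ℝ (W'ᗮ.starProjection z) e))
      (c := resid W z - resid W' z) (sub_ne_zero.2 hrW'.ne')).subset fun t ht => ?_
    simp only [Set.mem_ofPred_eq] at ht
    rw [← add_assoc, ← hz] at ht
    have := hquad t
    rw [ht, sub_self] at this
    exact this.symm
  have : NullSingletonClass (gaussianReal 0 1) := nullSingletonClass_gaussianReal one_ne_zero
  exact (hfin.measure_zero (gaussianReal 0 1)).le

variable {n k : ℕ}

theorem regCoef_self (Θ : Matrix (Fin n) (Fin n) ℝ) (i : Fin n) : regCoef Θ i i = 0 := by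
  simp [regCoef]

theorem resid_stdCols_eq {Θ : Matrix (Fin n) (Fin n) ℝ} (hΘ : Θ.PosDef) (i : Fin n)
    (X : Sample k n) (W : Submodule ℝ (EuclideanSpace ℝ (Fin k))) :
    resid W (stdCols X i) = (Θ i i)⁻¹ * resid W (col (regCoef Θ i) X + noise Θ i X) := by
  rw [stdCols_eq_smul hΘ, resid_smul, inv_pow, Real.sq_sqrt (diag_pos hΘ i).le]

/-- Given the other columns, the column of `j` serves as the vector of `T'` which is off the span of
`T`. The degenerate case in which it lies in that span is excluded here and treated separately. -/
theorem sampleLaw_resid_eq_resid {Θ : Matrix (Fin n) (Fin n) ℝ} (hΘ : Θ.PosDef) {i j : Fin n}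
    {T T' : Finset (Fin n)} (hi : i ∉ T) (hi' : i ∉ T') (hj' : j ∈ T') :
    sampleLaw Θ k {X | resid (colSpan (stdCols X) T) (stdCols X j) ≠ 0 ∧
      resid (colSpan (stdCols X) T) (stdCols X i) =
        resid (colSpan (stdCols X) T') (stdCols X i)} = 0 := by
  have hij : j ≠ i := fun h => hi' (h ▸ hj')
  have hsum : Measurable fun p : (Fin n → EuclideanSpace ℝ (Fin k)) × EuclideanSpace ℝ (Fin k) =>
      ∑ l, regCoef Θ i l • p.1 l + p.2 := by fun_prop
  have hj : Measurable fun p : (Fin n → EuclideanSpace ℝ (Fin k)) × EuclideanSpace ℝ (Fin k) =>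
      p.1 j := by fun_prop
  have hB : MeasurableSet {p : (Fin n → EuclideanSpace ℝ (Fin k)) × EuclideanSpace ℝ (Fin k) |
      resid (colSpan p.1 T) (p.1 j) ≠ 0 ∧
        resid (colSpan p.1 T) (∑ l, regCoef Θ i l • p.1 l + p.2) =
          resid (colSpan p.1 T') (∑ l, regCoef Θ i l • p.1 l + p.2)} :=
    ((measurableSet_eq_fun (measurable_resid_colSpan_comp measurable_fst hj T)
      measurable_const).compl).inter (measurableSet_eq_fun
        (measurable_resid_colSpan_comp measurable_fst hsum T)
        (measurable_resid_colSpan_comp measurable_fst hsum T'))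
  refine le_antisymm ((measure_mono fun X hX => ?_).trans
    (sampleLaw_le_of_section_innov hΘ (single_ne_zero' i) (othersCoef_dotProduct i) hB
      fun x => ?_)) bot_le
  · simp only [Set.mem_ofPred_eq] at hX ⊢
    have hjc : cols (othersCoef i) X j = stdCols X j := by simp [cols, stdCols, othersCoef, hij]
    rw [colSpan_othersCoef hi, colSpan_othersCoef hi', sum_smul_othersCoef (regCoef_self Θ i), hjc]
    refine ⟨hX.1, ?_⟩
    have h := hX.2
    rw [resid_stdCols_eq hΘ, resid_stdCols_eq hΘ] at h
    exact mul_left_cancel₀ (inv_ne_zero (diag_pos hΘ i).ne') h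
  · by_cases hx : resid (colSpan x T) (x j) = 0
    · simp [hx]
    · refine (measure_mono fun g hg => ?_).trans (stdGaussian_resid_eq_resid
        (W := colSpan x T) (W' := colSpan x T') (p := x j)
        (Submodule.subset_span ⟨j, hj', rfl⟩) hx (∑ l, regCoef Θ i l • x l)).le
      exact hg.2

/-- A vanishing distance is a tie with the whole space; since |T| < k, the span of `T` is a proper
subspace and the tie lemma applies. -/
theorem sampleLaw_resid_eq_zero {Θ : Matrix (Fin n) (Fin n) ℝ} (hΘ : Θ.PosDef) {j : Fin n}
    {T : Finset (Fin n)} (hj : j ∉ T) (hT : T.card < k) :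
    sampleLaw Θ k {X | resid (colSpan (stdCols X) T) (stdCols X j) = 0} = 0 := by
  have hsum : Measurable fun p : (Fin n → EuclideanSpace ℝ (Fin k)) × EuclideanSpace ℝ (Fin k) =>
      ∑ l, regCoef Θ j l • p.1 l + p.2 := by fun_prop
  have hB : MeasurableSet {p : (Fin n → EuclideanSpace ℝ (Fin k)) × EuclideanSpace ℝ (Fin k) |
      resid (colSpan p.1 T) (∑ l, regCoef Θ j l • p.1 l + p.2) = 0} :=
    measurableSet_eq_fun (measurable_resid_colSpan_comp measurable_fst hsum T) measurable_const
  refine le_antisymm ((measure_mono fun X hX => ?_).trans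
    (sampleLaw_le_of_section_innov hΘ (single_ne_zero' j) (othersCoef_dotProduct j) hB
      fun x => ?_)) bot_le
  · simp only [Set.mem_ofPred_eq] at hX ⊢
    rw [colSpan_othersCoef hj, sum_smul_othersCoef (regCoef_self Θ j)]
    rw [resid_stdCols_eq hΘ] at hX
    exact (mul_eq_zero.1 hX).resolve_left (inv_ne_zero (diag_pos hΘ j).ne')
  · have hne : colSpan x T ≠ ⊤ := by
      intro h
      have h1 := finrank_colSpan_le x T
      rw [h, finrank_top, finrank_euclideanSpace_fin] at h1
      omega
    obtain ⟨p, -, hp⟩ := SetLike.exists_of_lt hne.lt_top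
    have hpr : resid (colSpan x T) p ≠ 0 := by
      rw [resid, pow_ne_zero_iff two_ne_zero, norm_ne_zero_iff]
      intro h0
      rw [Submodule.starProjection_apply_eq_zero_iff, Submodule.orthogonal_orthogonal] at h0
      exact hp h0
    refine (measure_mono fun g hg => ?_).trans (stdGaussian_resid_eq_resid
      (W := colSpan x T) (W' := ⊤) (p := p) trivial hpr (∑ l, regCoef Θ j l • x l)).le
    simp only [Set.mem_ofPred_eq] at hg ⊢
    rw [hg, resid_top]

/-- Almost surely, no two sets of predictors fit a coordinate equally well. -/
theorem sampleLaw_resid_eq_of_ne {Θ : Matrix (Fin n) (Fin n) ℝ} (hΘ : Θ.PosDef) {i : Fin n}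
    {T T' : Finset (Fin n)} (hi : i ∉ T) (hi' : i ∉ T') (hT : T.card < k) (hT' : T'.card < k)
    (hne : T ≠ T') :
    sampleLaw Θ k {X | resid (colSpan (stdCols X) T) (stdCols X i) =
        resid (colSpan (stdCols X) T') (stdCols X i)} = 0 := by
  have key : ∀ {T T' : Finset (Fin n)} {j : Fin n}, i ∉ T → i ∉ T' → T.card < k → j ∈ T' → j ∉ T →
      sampleLaw Θ k {X | resid (colSpan (stdCols X) T) (stdCols X i) =
        resid (colSpan (stdCols X) T') (stdCols X i)} = 0 := by
    intro T T' j hi hi' hT hj' hj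
    refine measure_mono_null (fun X hX => ?_) (measure_union_null
      (sampleLaw_resid_eq_zero hΘ hj hT) (sampleLaw_resid_eq_resid (k := k) hΘ hi hi' hj'))
    by_cases h : resid (colSpan (stdCols X) T) (stdCols X j) = 0
    · exact Or.inl h
    · exact Or.inr ⟨h, hX⟩
  by_cases hsub : T' ⊆ T
  · have : ¬ T ⊆ T' := fun h => hne (Finset.Subset.antisymm h hsub)
    obtain ⟨j, hj, hj'⟩ := Finset.not_subset.1 this
    rw [← key hi' hi hT' hj hj']
    congr 1
    ext X
    exact eq_comm
  · obtain ⟨j, hj', hj⟩ := Finset.not_subset.1 hsub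
    exact key hi hi' hT hj' hj

end Uniqueness

end GGM

namespace GGM

/-! ### Attractive models: signal against noise -/

section ModelTails

open MeasureTheory ProbabilityTheory Module

variable {n k : ℕ} {Θ : Matrix (Fin n) (Fin n) ℝ} {κ : ℝ} {i : Fin n}

theorem notMem_nbhd_self (Θ : Matrix (Fin n) (Fin n) ℝ) (i : Fin n) : i ∉ nbhd Θ i := by
  simp [mem_nbhd]

theorem regCoef_pos (hΘ : Θ.PosDef) (hatt : IsAttractive Θ) {j : Fin n} (hj : j ∈ nbhd Θ i) :
    0 < regCoef Θ i j := by
  obtain ⟨hne, h0⟩ := mem_nbhd.1 hj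
  have h1 : Θ i j < 0 := lt_of_le_of_ne (hatt i j hne.symm) h0
  have := Real.sqrt_pos.2 (diag_pos hΘ i)
  simp only [regCoef, hne, if_false]
  exact div_pos (by linarith) this

theorem regCoef_eq_zero {j : Fin n} (hj : j ∉ nbhd Θ i) : regCoef Θ i j = 0 := by
  rw [mem_nbhd, not_and_or, not_not, not_not] at hj
  rcases hj with h | h <;> simp [regCoef, h]

theorem sq_le_regCoef_sq (hΘ : Θ.PosDef) (hnd : IsNondegenerate κ Θ) (hκ : 0 < κ) {j : Fin n}
    (hj : j ∈ nbhd Θ i) : κ ^ 2 ≤ regCoef Θ i j ^ 2 / Θ j j := by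
  obtain ⟨hne, h0⟩ := mem_nbhd.1 hj
  have hi' := diag_pos hΘ i
  have hj' := diag_pos hΘ j
  have h := hnd i j hne.symm h0
  have h2 : κ ^ 2 ≤ (|Θ i j| / Real.sqrt (Θ i i * Θ j j)) ^ 2 := by gcongr
  rw [div_pow, sq_abs, Real.sq_sqrt (by positivity)] at h2
  simp only [regCoef, hne, if_false]
  rw [div_pow, neg_sq, Real.sq_sqrt hi'.le, div_div]
  exact h2

/-- For nonnegative `a` every off-diagonal term of the quadratic form is nonpositive. -/
theorem dotProduct_mulVec_le_of_attractive (hatt : IsAttractive Θ) {a : Fin n → ℝ}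
    (ha : ∀ j, 0 ≤ a j) : a ⬝ᵥ Θ.mulVec a ≤ ∑ j, a j ^ 2 * Θ j j := by
  rw [dotProduct]
  refine Finset.sum_le_sum fun j _ => ?_
  rw [Matrix.mulVec, dotProduct, Finset.mul_sum, ← Finset.add_sum_erase _ _ (Finset.mem_univ j)]
  have : ∑ l ∈ Finset.univ.erase j, a j * (Θ j l * a l) ≤ 0 := by
    refine Finset.sum_nonpos fun l hl => ?_
    have h1 := hatt j l (Finset.ne_of_mem_erase hl).symm
    have := mul_nonpos_of_nonpos_of_nonneg h1 (ha l)
    exact mul_nonpos_of_nonneg_of_nonpos (ha j) this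
  linarith [this, (by ring : a j * (Θ j j * a j) = a j ^ 2 * Θ j j)]

/-- The direction of the innovations used to bound the part of the coordinate `i` which is explained
by its neighbors in `A`. -/
noncomputable def gapDir (Θ : Matrix (Fin n) (Fin n) ℝ) (i : Fin n) (A : Finset (Fin n)) :
    Fin n → ℝ :=
  fun j => restrictTo A (regCoef Θ i) j / Θ j j

/-- The strength of the edges between `i` and `A`. -/
noncomputable def edgeWeight (Θ : Matrix (Fin n) (Fin n) ℝ) (i : Fin n) (A : Finset (Fin n)) : ℝ :=
  ∑ j ∈ A, regCoef Θ i j ^ 2 / Θ j j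

theorem card_mul_le_edgeWeight (hΘ : Θ.PosDef) (hnd : IsNondegenerate κ Θ) (hκ : 0 < κ)
    {A : Finset (Fin n)} (hA : A ⊆ nbhd Θ i) : A.card * κ ^ 2 ≤ edgeWeight Θ i A := by
  rw [edgeWeight, ← nsmul_eq_mul]
  exact Finset.card_nsmul_le_sum _ _ _ fun j hj => sq_le_regCoef_sq hΘ hnd hκ (hA hj)

theorem restrictTo_dotProduct_gapDir (A : Finset (Fin n)) :
    restrictTo A (regCoef Θ i) ⬝ᵥ gapDir Θ i A = edgeWeight Θ i A := by
  rw [edgeWeight, dotProduct, ← Finset.sum_subset (Finset.subset_univ A)]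
  · refine Finset.sum_congr rfl fun j hj => ?_
    simp only [gapDir, restrictTo, hj, if_true]
    ring
  · intro j _ hj
    simp [gapDir, restrictTo, hj]

/-- The direction is nonnegative by attractiveness, and its diagonal terms aⱼ²Θⱼⱼ are the summands
bⱼ²/Θⱼⱼ of the edge weight. Together with b · a being the edge weight as well, this makes (b ·
a)²/aᵀΘa at least the edge weight. -/
theorem gapDir_quad_le (hΘ : Θ.PosDef) (hatt : IsAttractive Θ) {A : Finset (Fin n)}
    (hA : A ⊆ nbhd Θ i) : gapDir Θ i A ⬝ᵥ Θ.mulVec (gapDir Θ i A) ≤ edgeWeight Θ i A := by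
  refine (dotProduct_mulVec_le_of_attractive hatt fun j => ?_).trans (le_of_eq ?_)
  · simp only [gapDir, restrictTo]
    split_ifs with h
    · exact div_nonneg (regCoef_pos hΘ hatt (hA h)).le (diag_pos hΘ j).le
    · simp
  · rw [edgeWeight, ← Finset.sum_subset (Finset.subset_univ A)]
    · refine Finset.sum_congr rfl fun j hj => ?_
      have := (diag_pos hΘ j).ne'
      simp only [gapDir, restrictTo, hj, if_true]
      field_simp
    · intro j _ hj
      simp [gapDir, restrictTo, hj]

/-- The quadratic form is positive at the `i`-th unit vector plus √Θᵢᵢ times `gapDir`. With Q the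
edge weight its value is at most Θᵢᵢ(1 - 2Q + Q), the middle term coming from row `i` and the last
from `gapDir_quad_le`; so Q < 1. -/
theorem edgeWeight_nbhd_lt_one (hΘ : Θ.PosDef) (hatt : IsAttractive Θ) :
    edgeWeight Θ i (nbhd Θ i) < 1 := by
  have hi := diag_pos hΘ i
  set s := Real.sqrt (Θ i i) with hs
  have hss : s * s = Θ i i := Real.mul_self_sqrt hi.le
  have hs0 : 0 < s := Real.sqrt_pos.2 hi
  set a := gapDir Θ i (nbhd Θ i) with ha
  set v : Fin n → ℝ := Pi.single i 1 + s • a with hv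
  have hai : a i = 0 := by simp [ha, gapDir, restrictTo, notMem_nbhd_self]
  have hv0 : v ≠ 0 := by
    intro h
    have := congrFun h i
    simp [hv, hai] at this
  have hpos := dotProduct_mulVec_pos hΘ hv0
  have hrow : ∀ b : Fin n → ℝ, b ⬝ᵥ Θ.mulVec (Pi.single i 1) = ∑ j, b j * Θ j i := by
    intro b
    simp [dotProduct, Matrix.col_apply]
  have hcross : ∑ j, a j * Θ j i = -(s * edgeWeight Θ i (nbhd Θ i)) := by
    rw [← restrictTo_dotProduct_gapDir, ← ha, dotProduct, Finset.mul_sum, ← Finset.sum_neg_distrib]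
    refine Finset.sum_congr rfl fun j _ => ?_
    by_cases hj : j ∈ nbhd Θ i
    · have hne := (mem_nbhd.1 hj).1
      simp only [restrictTo, hj, if_true, regCoef, hne, if_false, ← hs]
      rw [symm_apply hΘ j i]
      field_simp
    · simp [ha, gapDir, restrictTo, hj]
  have hsymm : Pi.single i 1 ⬝ᵥ Θ.mulVec a = ∑ j, a j * Θ j i := by
    rw [single_one_dotProduct, Matrix.mulVec, dotProduct]
    refine Finset.sum_congr rfl fun j _ => ?_
    rw [symm_apply hΘ i j, mul_comm]
  rw [hv, Matrix.mulVec_add, add_dotProduct, dotProduct_add, dotProduct_add, Matrix.mulVec_smul,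
    dotProduct_smul, smul_dotProduct, smul_dotProduct, dotProduct_smul, hsymm, hrow, hrow,
    hcross] at hpos
  have hle : a ⬝ᵥ Θ.mulVec a ≤ edgeWeight Θ i (nbhd Θ i) := gapDir_quad_le hΘ hatt subset_rfl
  have hone : ∑ j, (Pi.single i 1 : Fin n → ℝ) j * Θ j i = Θ i i := by simp [Pi.single_apply]
  rw [hone] at hpos
  simp only [smul_eq_mul] at hpos
  have hexp : 0 < s * s * (1 - edgeWeight Θ i (nbhd Θ i)) := by
    have := mul_le_mul_of_nonneg_left hle (mul_pos hs0 hs0).le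
    nlinarith
  have := (mul_pos_iff_of_pos_left (mul_pos hs0 hs0)).1 hexp
  linarith

theorem card_nbhd_mul_sq_le_one (hΘ : Θ.PosDef) (hatt : IsAttractive Θ)
    (hnd : IsNondegenerate κ Θ) (hκ : 0 < κ) (i : Fin n) : (nbhd Θ i).card * κ ^ 2 ≤ 1 :=
  (card_mul_le_edgeWeight hΘ hnd hκ subset_rfl).trans (edgeWeight_nbhd_lt_one hΘ hatt).le

theorem restrictTo_self_eq_zero {A : Finset (Fin n)} : restrictTo A (regCoef Θ i) i = 0 := by
  simp [restrictTo, regCoef]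

/-- The central estimate: missing the neighbors `A` costs about k|A|κ², for every set `T` of
predictors disjoint from `A`. The innovation along `gapDir` keeps the signal of `A` away from the
span of `T`, and the cross term between signal and noise is of smaller order. -/
theorem sampleLaw_gap_lt (hΘ : Θ.PosDef) (hatt : IsAttractive Θ) (hnd : IsNondegenerate κ Θ)
    (hκ : 0 < κ) {A T : Finset (Fin n)} (hA : A ⊆ nbhd Θ i) (hne : A.Nonempty)
    (hAT : Disjoint A T) (hi : i ∉ T) (hk : 50 * (T.card + 1) ≤ k) :
    sampleLaw Θ k {X | resid (colSpan (stdCols X) T)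
        (col (restrictTo A (regCoef Θ i)) X + noise Θ i X) -
        resid (colSpan (stdCols X) T) (noise Θ i X) < 0.7 * (k * (A.card * κ ^ 2))} ≤
      ENNReal.ofReal (3 * Real.exp (-(k * (A.card * κ ^ 2) / 2000))) := by
  have hAκ : A.card * κ ^ 2 ≤ 1 := by
    refine le_trans ?_ (card_nbhd_mul_sq_le_one hΘ hatt hnd hκ i)
    gcongr
  have hk0 : (0 : ℝ) < k := by
    have : 0 < k := by omega
    exact_mod_cast this
  have hA0 : (0 : ℝ) < A.card := by exact_mod_cast hne.card_pos
  set M : ℝ := k * (A.card * κ ^ 2) with hM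
  have hM0 : 0 < M := by positivity
  have hMk : M ≤ k := by
    rw [hM]; nlinarith
  set w := restrictTo A (regCoef Θ i) with hw
  have hQ := card_mul_le_edgeWeight hΘ hnd hκ hA
  have hQ0 : 0 < edgeWeight Θ i A := lt_of_lt_of_le (by positivity) hQ
  have hdot : w ⬝ᵥ gapDir Θ i A = edgeWeight Θ i A := restrictTo_dotProduct_gapDir A
  have ha0 : gapDir Θ i A ≠ 0 := by
    intro h
    rw [h, dotProduct_zero] at hdot
    exact hQ0.ne hdot
  have hquad := dotProduct_mulVec_pos hΘ ha0
  have hratio : A.card * κ ^ 2 ≤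
      (w ⬝ᵥ gapDir Θ i A) ^ 2 / (gapDir Θ i A ⬝ᵥ Θ.mulVec (gapDir Θ i A)) := by
    rw [hdot, le_div_iff₀ hquad]
    have h1 := gapDir_quad_le hΘ hatt hA
    calc A.card * κ ^ 2 * (gapDir Θ i A ⬝ᵥ Θ.mulVec (gapDir Θ i A))
        ≤ edgeWeight Θ i A * edgeWeight Θ i A := by gcongr
      _ = _ := by ring
  have h1 := sampleLaw_resid_le (k := k) hΘ (w := w) (a := gapDir Θ i A) (T := T)
    (by rw [hdot]; exact hQ0) (fun j hj => by
      have : j ∉ A := fun h => Finset.disjoint_left.1 hAT h hj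
      simp [gapDir, restrictTo, this]) hk
  -- With s = √M/20 the cross term is at most √M √ρ / 10, and the exponent 3M/3200 still exceeds
  -- M/2000.
  have h2 := sampleLaw_resid_add_lt (k := k) hΘ (w := w) (restrictTo_self_eq_zero) hi
    (s := Real.sqrt M / 20) (by positivity)
  have hexp1 : Real.exp (-(k / 200 : ℝ)) ≤ Real.exp (-(M / 2000)) := by
    apply Real.exp_le_exp.2
    linarith
  have hexp2 : Real.exp (-(3 / 8 * (Real.sqrt M / 20) ^ 2)) ≤ Real.exp (-(M / 2000)) := by
    apply Real.exp_le_exp.2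
    rw [div_pow, Real.sq_sqrt hM0.le]
    linarith
  refine (measure_mono fun X hX => ?_).trans ((measure_union_le _ _).trans
    ((add_le_add h1 h2).trans ?_))
  · by_contra hcon
    simp only [Set.mem_union, Set.mem_ofPred_eq, not_or, not_le, not_lt] at hX hcon
    obtain ⟨hc1, hc2⟩ := hcon
    set ρ := resid (colSpan (stdCols X) T) (col w X) with hρ
    have hρ0 : 0 ≤ ρ := resid_nonneg _ _
    have hρM : 0.8 * M ≤ ρ := by
      refine le_trans ?_ hc1.le
      rw [hM]
      have : 0 ≤ 0.8 * (k : ℝ) := by positivity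
      nlinarith [mul_le_mul_of_nonneg_right hratio this]
    have hm := Real.mul_self_sqrt hM0.le
    have hr := Real.mul_self_sqrt hρ0
    have hm0 := Real.sqrt_nonneg M
    have hr0 := Real.sqrt_nonneg ρ
    -- From ρ ≥ 0.8 M and 0.8 · 1.12² > 1. Hence at least (1 - 0.112)ρ ≥ 0.71 M is left after the
    -- cross term.
    have hmr : Real.sqrt M ≤ 1.12 * Real.sqrt ρ := by
      apply abs_le_of_sq_le_sq' _ (by positivity) |>.2
      nlinarith
    nlinarith [mul_le_mul_of_nonneg_right hmr hr0]
  · rw [← ENNReal.ofReal_add (Real.exp_pos _).le (by positivity)]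
    apply ENNReal.ofReal_le_ofReal
    linarith

/-- The squared distance of a coordinate from the span of others, in terms of the residual. -/
theorem resid_stdCols (hΘ : Θ.PosDef) (X : Sample k n) {T A : Finset (Fin n)}
    (hTA : nbhd Θ i \ A ⊆ T) :
    resid (colSpan (stdCols X) T) (stdCols X i) =
      (Θ i i)⁻¹ * resid (colSpan (stdCols X) T)
        (col (restrictTo A (regCoef Θ i)) X + noise Θ i X) := by
  have hsplit : col (regCoef Θ i) X = col (regCoef Θ i - restrictTo A (regCoef Θ i)) X +
      col (restrictTo A (regCoef Θ i)) X := by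
    rw [← col_add, sub_add_cancel]
  have hmem : col (regCoef Θ i - restrictTo A (regCoef Θ i)) X ∈ colSpan (stdCols X) T := by
    rw [col_eq_sum]
    refine sum_mem fun j _ => ?_
    by_cases hj : j ∈ T
    · exact Submodule.smul_mem _ _ (Submodule.subset_span ⟨j, hj, rfl⟩)
    · have h0 : (regCoef Θ i - restrictTo A (regCoef Θ i)) j = 0 := by
        by_cases hjA : j ∈ A
        · simp [restrictTo, hjA]
        · have : j ∉ nbhd Θ i := fun h => hj (hTA (Finset.mem_sdiff.2 ⟨h, hjA⟩))
          simp [restrictTo, hjA, regCoef_eq_zero this]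
      rw [h0, zero_smul]
      exact Submodule.zero_mem _
  rw [resid_stdCols_eq hΘ, hsplit, add_assoc, resid_add_mem hmem]

theorem resid_stdCols_of_subset (hΘ : Θ.PosDef) (X : Sample k n) {T : Finset (Fin n)}
    (hT : nbhd Θ i ⊆ T) :
    resid (colSpan (stdCols X) T) (stdCols X i) =
      (Θ i i)⁻¹ * resid (colSpan (stdCols X) T) (noise Θ i X) := by
  have h := resid_stdCols hΘ X (i := i) (T := T) (A := ∅) (Finset.sdiff_subset.trans hT)
  have h0 : col (restrictTo ∅ (regCoef Θ i)) X = 0 := by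
    rw [col_eq_sum]; simp [restrictTo]
  rwa [h0, zero_add] at h

/-- Here 0.225 = 3/8 · 0.6 is the exponent of the overfitting bound; the factor 2 for each degree of
freedom is absorbed once x ≥ 4. -/
theorem two_mul_exp_le {x : ℝ} (hx : 4 ≤ x) : 2 * Real.exp (-(0.225 * x)) ≤ Real.exp (-(x / 2000)) := by
  have h1 : (2 : ℝ) ≤ Real.exp 0.8 := by
    have := Real.quadratic_le_exp_of_nonneg (x := 0.8) (by norm_num)
    refine le_trans ?_ this
    norm_num
  calc 2 * Real.exp (-(0.225 * x)) ≤ Real.exp 0.8 * Real.exp (-(0.225 * x)) := by gcongr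
    _ = Real.exp (0.8 - 0.225 * x) := by rw [← Real.exp_add]; congr 1
    _ ≤ _ := by
      apply Real.exp_le_exp.2
      linarith

/-- The true neighborhood beats every other set of at most the same size. -/
theorem sampleLaw_search (hΘ : Θ.PosDef) (hatt : IsAttractive Θ) (hnd : IsNondegenerate κ Θ)
    (hκ : 0 < κ) {T : Finset (Fin n)} (hi : i ∉ T) (hne : (nbhd Θ i \ T).Nonempty)
    (hcard : T.card ≤ (nbhd Θ i).card) (hk : 50 * (T.card + 1) ≤ k) (hkκ : 4 ≤ k * κ ^ 2) :
    sampleLaw Θ k {X | resid (colSpan (stdCols X) T) (stdCols X i) ≤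
        resid (colSpan (stdCols X) (nbhd Θ i)) (stdCols X i)} ≤
      ENNReal.ofReal (4 * Real.exp (-(k * κ ^ 2 / 2000)) ^ (nbhd Θ i \ T).card) := by
  set A := nbhd Θ i \ T with hA
  have hA0 : (0 : ℝ) < A.card := by exact_mod_cast hne.card_pos
  set M : ℝ := k * (A.card * κ ^ 2) with hM
  have hk0 : (0 : ℝ) < k := by
    have : 0 < k := by omega
    exact_mod_cast this
  have hM0 : 0 < M := by positivity
  have h1 := sampleLaw_gap_lt (k := k) hΘ hatt hnd hκ (i := i) (A := A) (T := T)
    Finset.sdiff_subset hne Finset.sdiff_disjoint hi hk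
  -- As `T` is no larger than the neighborhood, it has at most as many superfluous nodes as it
  -- misses neighbors.
  have hTN : (T \ (nbhd Θ i ∩ T)).card ≤ A.card := by
    rw [Finset.sdiff_inter_self_right]
    have e1 := Finset.card_sdiff_add_card_inter T (nbhd Θ i)
    have e2 := Finset.card_sdiff_add_card_inter (nbhd Θ i) T
    rw [Finset.inter_comm (nbhd Θ i) T] at e2
    rw [hA]
    omega
  -- The level 0.6 M of the overfitting stays below the gap 0.7 M.
  have h2 := sampleLaw_noise_sub_ge (k := k) hΘ (i := i) (T₀ := nbhd Θ i ∩ T) (T := T)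
    Finset.inter_subset_right hi hTN (0.6 * M)
  have hq : Real.exp (-(k * κ ^ 2 / 2000)) ^ A.card = Real.exp (-(M / 2000)) := by
    rw [← Real.exp_nat_mul]
    congr 1
    rw [hM]; ring
  have hexp : 2 ^ A.card * Real.exp (-(3 / 8 * (0.6 * M))) ≤
      Real.exp (-(k * κ ^ 2 / 2000)) ^ A.card := by
    have e : Real.exp (-(3 / 8 * (0.6 * M))) = Real.exp (-(0.225 * (k * κ ^ 2))) ^ A.card := by
      rw [← Real.exp_nat_mul]
      congr 1
      rw [hM]; ring
    rw [e, ← mul_pow]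
    gcongr
    exact two_mul_exp_le hkκ
  refine (measure_mono fun X hX => ?_).trans ((measure_union_le _ _).trans
    ((add_le_add h1 h2).trans ?_))
  · by_contra hcon
    simp only [Set.mem_union, Set.mem_ofPred_eq, not_or, not_le, not_lt] at hX hcon
    obtain ⟨hc1, hc2⟩ := hcon
    rw [resid_stdCols hΘ X (i := i) (T := T) (A := A)
      (fun l hl => by
        rw [hA, Finset.mem_sdiff, Finset.mem_sdiff] at hl
        tauto),
      resid_stdCols_of_subset hΘ X subset_rfl] at hX
    have hle := le_of_mul_le_mul_left hX (inv_pos.2 (diag_pos hΘ i))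
    have hanti := resid_anti (colSpan_mono (x := stdCols X)
      (Finset.inter_subset_left (s₁ := nbhd Θ i) (s₂ := T))) (noise Θ i X)
    linarith
  · rw [← ENNReal.ofReal_add (by positivity) (by positivity)]
    apply ENNReal.ofReal_le_ofReal
    rw [← hq]
    linarith

/-- A variable outside the neighborhood passes the validation. -/
theorem sampleLaw_validate_notMem (hΘ : Θ.PosDef) (hκ : 0 < κ) (hκ1 : κ ≤ 1)
    {S : Finset (Fin n)} {j : Fin n} (hi : i ∉ S) (hS : nbhd Θ i ⊆ S) (hj : j ∈ S)
    (hjN : j ∉ nbhd Θ i) (hk : 50 * S.card ≤ k) :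
    sampleLaw Θ k {X | κ ^ 2 / 2 * resid (colSpan (stdCols X) S) (stdCols X i) <
        resid (colSpan (stdCols X) (S.erase j)) (stdCols X i) -
          resid (colSpan (stdCols X) S) (stdCols X i)} ≤
      ENNReal.ofReal (4 * Real.exp (-(k * κ ^ 2 / 2000))) := by
  have hκ2 : κ ^ 2 ≤ 1 := by nlinarith
  have hk0 : (0 : ℝ) ≤ k := by positivity
  have hcard : (S \ S.erase j).card ≤ 1 := by
    rw [Finset.card_sdiff_of_subset (Finset.erase_subset _ _), Finset.card_erase_of_mem hj]
    omega
  have h1 := sampleLaw_noise_resid_le (k := k) hΘ hi hk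
  -- The level equals κ²/2 · 0.8 k, the threshold when the residual has its least typical value.
  have h2 := sampleLaw_noise_sub_ge (k := k) hΘ (Finset.erase_subset j S) hi hcard
    (0.4 * (k * κ ^ 2))
  refine (measure_mono fun X hX => ?_).trans ((measure_union_le _ _).trans
    ((add_le_add h1 h2).trans ?_))
  · by_contra hcon
    simp only [Set.mem_union, Set.mem_ofPred_eq, not_or, not_le] at hX hcon
    obtain ⟨hc1, hc2⟩ := hcon
    have hinv := inv_pos.2 (diag_pos hΘ i)
    rw [resid_stdCols_of_subset hΘ X hS, resid_stdCols_of_subset hΘ X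
      (fun l hl => Finset.mem_erase.2 ⟨by rintro rfl; exact hjN hl, hS hl⟩), ← mul_sub,
      mul_left_comm] at hX
    have hlt := lt_of_mul_lt_mul_left hX hinv.le
    have : κ ^ 2 / 2 * (0.8 * k) ≤
        κ ^ 2 / 2 * resid (colSpan (stdCols X) S) (noise Θ i X) := by gcongr
    nlinarith
  · rw [← ENNReal.ofReal_add (by positivity) (by positivity)]
    apply ENNReal.ofReal_le_ofReal
    have e1 : Real.exp (-(k / 200 : ℝ)) ≤ Real.exp (-(k * κ ^ 2 / 2000)) := by
      apply Real.exp_le_exp.2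
      nlinarith
    have e2 : Real.exp (-(3 / 8 * (0.4 * (k * κ ^ 2)))) ≤ Real.exp (-(k * κ ^ 2 / 2000)) := by
      apply Real.exp_le_exp.2
      have : 0 ≤ k * κ ^ 2 := by positivity
      linarith
    linarith [Real.exp_pos (-(k * κ ^ 2 / 2000))]

/-- A neighbor fails the validation. -/
theorem sampleLaw_validate_mem (hΘ : Θ.PosDef) (hatt : IsAttractive Θ)
    (hnd : IsNondegenerate κ Θ) (hκ : 0 < κ) (hκ1 : κ ≤ 1)
    {S : Finset (Fin n)} {j : Fin n} (hi : i ∉ S) (hS : nbhd Θ i ⊆ S)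
    (hjN : j ∈ nbhd Θ i) (hk : 50 * S.card ≤ k) :
    sampleLaw Θ k {X | resid (colSpan (stdCols X) (S.erase j)) (stdCols X i) -
        resid (colSpan (stdCols X) S) (stdCols X i) ≤
          κ ^ 2 / 2 * resid (colSpan (stdCols X) S) (stdCols X i)} ≤
      ENNReal.ofReal (4 * Real.exp (-(k * κ ^ 2 / 2000))) := by
  have hj := hS hjN
  have hκ2 : κ ^ 2 ≤ 1 := by nlinarith
  have hk1 : 50 * ((S.erase j).card + 1) ≤ k := by
    rwa [Finset.card_erase_add_one hj]
  have hk0 : (0 : ℝ) < k := by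
    have : 0 < k := by omega
    exact_mod_cast this
  have hi' : i ∉ S.erase j := fun h => hi (Finset.mem_of_mem_erase h)
  have h1 := sampleLaw_gap_lt (k := k) hΘ hatt hnd hκ (i := i) (A := {j}) (T := S.erase j)
    (Finset.singleton_subset_iff.2 hjN) (Finset.singleton_nonempty j)
    (Finset.disjoint_singleton_left.2 (Finset.notMem_erase j S)) hi' hk1
  have h2 := sampleLaw_noise_norm_ge (k := k) hΘ i
  rw [Finset.card_singleton, Nat.cast_one, one_mul] at h1
  refine (measure_mono fun X hX => ?_).trans ((measure_union_le _ _).trans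
    ((add_le_add h1 h2).trans ?_))
  · by_contra hcon
    simp only [Set.mem_union, Set.mem_ofPred_eq, not_or, not_le, not_lt] at hX hcon
    obtain ⟨hc1, hc2⟩ := hcon
    have hinv := inv_pos.2 (diag_pos hΘ i)
    rw [resid_stdCols_of_subset hΘ X hS, resid_stdCols hΘ X (T := S.erase j) (A := {j})
      (fun l hl => Finset.mem_erase.2 ⟨by simpa using (Finset.mem_sdiff.1 hl).2,
        hS (Finset.mem_sdiff.1 hl).1⟩), ← mul_sub, mul_left_comm] at hX
    have hle := le_of_mul_le_mul_left hX hinv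
    have ha1 := resid_anti (colSpan_mono (x := stdCols X) (Finset.erase_subset j S)) (noise Θ i X)
    -- The threshold is at most κ²/2 · 1.3 k = 0.65 kκ², below the gap 0.7 kκ².
    have ha2 : κ ^ 2 / 2 * resid (colSpan (stdCols X) S) (noise Θ i X) ≤ κ ^ 2 / 2 * (1.3 * k) := by
      gcongr
      exact (resid_le_norm_sq _ _).trans hc2.le
    have : 0 < k * κ ^ 2 := by positivity
    nlinarith
  · rw [← ENNReal.ofReal_add (by positivity) (by positivity)]
    apply ENNReal.ofReal_le_ofReal
    have e1 : Real.exp (-(k / 200 : ℝ)) ≤ Real.exp (-(k * κ ^ 2 / 2000)) := by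
      apply Real.exp_le_exp.2
      nlinarith
    linarith

end ModelTails

end GGM

namespace GGM

/-! ### The algorithm in terms of residual sums of squares -/

section LeastSquares

variable {n k : ℕ}

/-- The residual sum of squares of the regression of the coordinate `i` on the coordinates in
`T`. -/
noncomputable def rss (X : Sample k n) (i : Fin n) (T : Finset (Fin n)) : ℝ :=
  resid (colSpan (stdCols X) T) (stdCols X i)

theorem measurable_rss (i : Fin n) (T : Finset (Fin n)) :
    Measurable fun X : Sample k n => rss X i T :=
  measurable_resid_colSpan_comp (measurable_cols _)
    (show Measurable fun X : Sample k n => stdCols X i from measurable_col _) T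

theorem mem_supp {w : Fin n → ℝ} {j : Fin n} : j ∈ supp w ↔ w j ≠ 0 := by
  simp [supp]

theorem stdCols_apply (X : Sample k n) (j : Fin n) (l : Fin k) : stdCols X j l = X l j := by
  simp [stdCols, cols, col]

theorem sqLoss_eq (X : Sample k n) (i : Fin n) (w : Fin n → ℝ) :
    sqLoss X i w = (1 / (k : ℝ)) * ‖stdCols X i - ∑ j, w j • stdCols X j‖ ^ 2 := by
  rw [sqLoss, EuclideanSpace.norm_sq_eq]
  congr 1
  refine Finset.sum_congr rfl fun l _ => ?_
  simp [stdCols_apply]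

theorem sum_smul_stdCols_mem {w : Fin n → ℝ} {T : Finset (Fin n)} (hw : supp w ⊆ T)
    (X : Sample k n) : ∑ j, w j • stdCols X j ∈ colSpan (stdCols X) T := by
  refine mem_colSpan.2 ⟨w, Finset.sum_subset (Finset.subset_univ T) fun j _ hj => ?_⟩
  rw [not_not.1 (mt mem_supp.2 fun h => hj (hw h)), zero_smul]

theorem rss_le_norm_sq (X : Sample k n) (i : Fin n) {w : Fin n → ℝ} {T : Finset (Fin n)}
    (hw : supp w ⊆ T) : rss X i T ≤ ‖stdCols X i - ∑ j, w j • stdCols X j‖ ^ 2 :=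
  resid_le_norm_sub_sq (sum_smul_stdCols_mem hw X) _

theorem rss_le_sqLoss (X : Sample k n) (i : Fin n) {w : Fin n → ℝ} {T : Finset (Fin n)}
    (hw : supp w ⊆ T) : (1 / (k : ℝ)) * rss X i T ≤ sqLoss X i w := by
  rw [sqLoss_eq]
  gcongr
  exact rss_le_norm_sq X i hw

theorem exists_norm_sq_eq_rss (X : Sample k n) (i : Fin n) (T : Finset (Fin n)) :
    ∃ w : Fin n → ℝ, supp w ⊆ T ∧
      ‖stdCols X i - ∑ j, w j • stdCols X j‖ ^ 2 = rss X i T := by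
  obtain ⟨w, hw⟩ := mem_colSpan.1
    (Submodule.starProjection_apply_mem (colSpan (stdCols X) T) (stdCols X i))
  refine ⟨restrictTo T w, fun j hj => ?_, ?_⟩
  · by_contra h
    exact mem_supp.1 hj (if_neg h)
  · rw [rss, resid_eq_norm_sub_sq, ← hw]
    simp [restrictTo, ite_smul, Finset.sum_ite_mem]

theorem exists_sqLoss_eq_rss (X : Sample k n) (i : Fin n) (T : Finset (Fin n)) :
    ∃ w : Fin n → ℝ, supp w ⊆ T ∧ sqLoss X i w = (1 / (k : ℝ)) * rss X i T := by
  obtain ⟨w, hw, h⟩ := exists_norm_sq_eq_rss X i T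
  exact ⟨w, hw, by rw [sqLoss_eq, h]⟩

theorem empCondVar_eq (X : Sample k n) (i : Fin n) (S : Finset (Fin n)) :
    empCondVar X i S = (1 / (k : ℝ)) * rss X i S := by
  have hsub (w : Fin n → ℝ) : (∀ j, j ∉ S → w j = 0) ↔ supp w ⊆ S := by
    refine forall_congr' fun j => ?_
    rw [mem_supp]
    tauto
  have h0 : ∀ w : {w : Fin n → ℝ // ∀ j, j ∉ S → w j = 0},
      (1 / (k : ℝ)) * rss X i S ≤ sqLoss X i w := fun w => rss_le_sqLoss X i ((hsub _).1 w.2)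
  have : Nonempty {w : Fin n → ℝ // ∀ j, j ∉ S → w j = 0} := ⟨0, fun _ _ => rfl⟩
  apply le_antisymm
  · obtain ⟨w, hw, h⟩ := exists_sqLoss_eq_rss X i S
    rw [← h]
    exact ciInf_le ⟨_, by rintro _ ⟨w, rfl⟩; exact h0 w⟩ 
      (⟨w, (hsub w).2 hw⟩ : {v : Fin n → ℝ // ∀ j, j ∉ S → v j = 0})
  · exact le_ciInf h0

/-- Positivity of `k` matters: the loss carries the factor 1/k, which is 0 for k = 0, so that it
would not determine the residual sum of squares. -/
theorem IsL0Minimizer.rss_supp_le {X : Sample k n} {i : Fin n} {r : ℕ} {w : Fin n → ℝ}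
    (hw : IsL0Minimizer X i r w) (hk : 0 < k) {T : Finset (Fin n)} (hi : i ∉ T)
    (hT : T.card ≤ r) : rss X i (supp w) ≤ rss X i T := by
  obtain ⟨v, hv, h⟩ := exists_sqLoss_eq_rss X i T
  have h1 := hw.2 v (not_not.1 (mt mem_supp.2 fun h => hi (hv h))) ((Finset.card_le_card hv).trans hT)
  rw [h] at h1
  have h2 := (rss_le_sqLoss X i (subset_refl (supp w))).trans h1
  exact le_of_mul_le_mul_left h2 (by positivity)

/-- Among the sets of minimal residual sum of squares, those which are minimal under inclusion are
supports of minimizers. -/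
theorem exists_isL0Minimizer {X : Sample k n} {i : Fin n} {r : ℕ} {T : Finset (Fin n)}
    (hi : i ∉ T) (hT : T.card ≤ r)
    (hmin : ∀ T' : Finset (Fin n), i ∉ T' → T'.card ≤ r → rss X i T ≤ rss X i T')
    (hstrict : ∀ T' ⊂ T, rss X i T < rss X i T') :
    ∃ w, IsL0Minimizer X i r w ∧ supp w = T := by
  obtain ⟨w, hw, h⟩ := exists_norm_sq_eq_rss X i T
  -- An optimal coefficient vector on `T` with a smaller support would make a proper subset of `T`
  -- fit as well.
  have hs : supp w = T := by
    by_contra hne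
    have h1 := hstrict _ (hw.ssubset_of_ne hne)
    have h2 := rss_le_norm_sq X i (subset_refl (supp w))
    linarith
  refine ⟨w, ⟨⟨not_not.1 (mt mem_supp.2 (hs ▸ hi)), hs ▸ hT⟩, fun v hv hvr => ?_⟩, hs⟩
  have h3 := hmin (supp v) (fun h => mem_supp.1 h hv) hvr
  rw [sqLoss_eq, h]
  refine le_trans ?_ (rss_le_sqLoss X i (subset_refl (supp v)))
  gcongr

/-- Sparsities above `n` add nothing, so only n + 1 of them need a probability estimate, however
large `d` is. -/
theorem IsL0Minimizer.min {X : Sample k n} {i : Fin n} {r : ℕ} {w : Fin n → ℝ}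
    (hw : IsL0Minimizer X i r w) : IsL0Minimizer X i (min r n) w := by
  have hn (v : Fin n → ℝ) : (supp v).card ≤ n := by
    simpa using Finset.card_le_univ (supp v)
  exact ⟨⟨hw.1.1, le_min hw.1.2 (hn w)⟩, fun v hv hvr => hw.2 v hv (hvr.trans (min_le_left _ _))⟩

theorem rss_of_subsingleton (X : Sample 0 n) (i : Fin n) (T : Finset (Fin n)) : rss X i T = 0 := by
  rw [rss, Subsingleton.elim (stdCols X i) 0, resid, map_zero, norm_zero, zero_pow two_ne_zero]

/-- Rejection in terms of residual sums of squares. -/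
theorem isRejected_iff {X : Sample k n} {d : ℕ} {ν : ℝ} {i : Fin n}
    {w : ℕ → Fin n → ℝ} {r : ℕ} :
    IsRejected X d ν i w r ↔ ∃ q, q ≤ d ∧ q ≠ r ∧ ∃ j, j ∈ supp (w q) \ supp (w r) ∧
      ν * rss X i (supp (w r) ∪ supp (w q)) <
        rss X i ((supp (w r) ∪ supp (w q)).erase j) - rss X i (supp (w r) ∪ supp (w q)) := by
  -- Without samples both sides compare zeros, as 1/0 = 0.
  rcases Nat.eq_zero_or_pos k with rfl | hk
  · simp [IsRejected, empCondVar_eq, rss_of_subsingleton]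
  have hk' : (0 : ℝ) < 1 / (k : ℝ) := by positivity
  simp only [IsRejected, empCondVar_eq, gt_iff_lt, ← mul_sub, mul_left_comm ν,
    mul_lt_mul_iff_right₀ hk']

theorem not_isRejected_zero {X : Sample k n} {ν : ℝ} {i : Fin n} {w : ℕ → Fin n → ℝ} :
    ¬ IsRejected X 0 ν i w 0 := by
  rintro ⟨q, hq, hne, -⟩
  exact hne (Nat.le_zero.1 hq)

theorem validate_eq_some {X : Sample k n} {d : ℕ} {ν : ℝ} {i : Fin n} {w : ℕ → Fin n → ℝ} {r : ℕ}
    (hr : r ≤ d) (hrej : ¬ IsRejected X d ν i w r) (hlt : ∀ q < r, IsRejected X d ν i w q) :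
    validate X d ν i w = some (supp (w r)) := by
  classical
  rw [validate, Option.map_eq_some_iff]
  refine ⟨r, ?_, rfl⟩
  rw [List.find?_range_eq_some]
  refine ⟨by simpa using hrej, List.mem_range.2 (by omega), fun q hq => by simpa using hlt q hq⟩

theorem validate_eq_none {X : Sample k n} {d : ℕ} {ν : ℝ} {i : Fin n} {w : ℕ → Fin n → ℝ}
    (hlt : ∀ q ≤ d, IsRejected X d ν i w q) : validate X d ν i w = none := by
  classical
  rw [validate, Option.map_eq_none_iff, List.find?_eq_none]
  intro q hq
  simpa using hlt q (by have := List.mem_range.1 hq; omega)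

/-- On the sample set `X`, the comparison of `T` with the set `N` singles out the elements of `N`. -/
def Separates (X : Sample k n) (ν : ℝ) (i : Fin n) (N T : Finset (Fin n)) : Prop :=
  ∀ j ∈ N ∪ T, (ν * rss X i (N ∪ T) < rss X i ((N ∪ T).erase j) - rss X i (N ∪ T) ↔ j ∈ N)

/-- The deterministic part of the correctness. No candidate contributes a node outside `N` that
passes the threshold, so `N` is not discarded. A candidate of sparsity below |N| misses some
neighbor, and the comparison with `N` exposes it. Nothing is required of the order of the candidates
after `N`. -/
theorem validate_eq_some_of_separates {X : Sample k n} {d : ℕ} {ν : ℝ} {i : Fin n}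
    {w : ℕ → Fin n → ℝ} {N : Finset (Fin n)} (hN : supp (w N.card) = N) (hd : N.card ≤ d)
    (hw : ∀ r ≤ d, (supp (w r)).card ≤ r)
    (hsep : ∀ r ≤ d, Separates X ν i N (supp (w r))) :
    validate X d ν i w = some N := by
  rw [validate_eq_some hd, hN]
  · rw [isRejected_iff]
    rintro ⟨q, hq, -, j, hj, hlt⟩
    rw [hN] at hj hlt
    exact (Finset.mem_sdiff.1 hj).2
      ((hsep q hq j (Finset.mem_union_right _ (Finset.mem_sdiff.1 hj).1)).1 hlt)
  · intro q hq
    rw [isRejected_iff]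
    obtain ⟨j, hj, hj'⟩ : ∃ j ∈ N, j ∉ supp (w q) := by
      by_contra! hcon
      have := (Finset.card_le_card hcon).trans (hw q (by omega))
      omega
    refine ⟨N.card, hd, hq.ne', j, ?_, ?_⟩
    · rw [hN]
      exact Finset.mem_sdiff.2 ⟨hj, hj'⟩
    · rw [hN, Finset.union_comm]
      exact (hsep q (by omega) j (Finset.mem_union_left _ hj)).2 hj

end LeastSquares

end GGM

namespace GGM

/-! ### Failure probability at one node -/

section Correctness

open MeasureTheory ProbabilityTheory

variable {n k : ℕ} {Θ : Matrix (Fin n) (Fin n) ℝ} {κ : ℝ} {i : Fin n}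

/-- The map taking `T` to its symmetric difference with `N` permutes the sets, so this is the
binomial sum. It yields a union bound over all sets at once whose cost is about n p. -/
theorem sum_pow_card_symmDiff (p : ℝ) (N : Finset (Fin n)) :
    ∑ T : Finset (Fin n), p ^ (symmDiff T N).card = (1 + p) ^ n := by
  have h := Fintype.sum_pow_mul_eq_add_pow (Fin n) p (1 : ℝ)
  simp only [one_pow, mul_one, Fintype.card_fin] at h
  rw [add_comm 1 p, ← h]
  exact Fintype.sum_bijective (fun T => symmDiff T N) (symmDiff_left_involutive N).bijective _ _
    fun _ => rfl

theorem one_add_pow_sub_one_le {p : ℝ} (hp : 0 ≤ p) (hnp : n * p ≤ 1) :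
    (1 + p) ^ n - 1 ≤ 2 * (n * p) := by
  have h1 : (1 + p) ^ n ≤ Real.exp (n * p) := by
    rw [Real.exp_nat_mul]
    gcongr
    linarith [Real.add_one_le_exp p]
  have h2 := Real.abs_exp_sub_one_le (x := n * p) (by rw [abs_of_nonneg (by positivity)]; exact hnp)
  rw [abs_of_nonneg (a := (n : ℝ) * p) (by positivity)] at h2
  linarith [(abs_le.1 h2).2]

/-- The search at the right sparsity does not miss a neighbor. -/
theorem sampleLaw_search_fails (hΘ : Θ.PosDef) (hatt : IsAttractive Θ)
    (hnd : IsNondegenerate κ Θ) (hκ : 0 < κ) (hk : 50 * ((nbhd Θ i).card + 1) ≤ k)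
    (hkκ : 4 ≤ k * κ ^ 2) {p : ℝ} (hp : p = Real.exp (-(k * κ ^ 2 / 4000))) (hnp : n * p ≤ 1) :
    sampleLaw Θ k {X | ∃ T, i ∉ T ∧ (nbhd Θ i \ T).Nonempty ∧ T.card ≤ (nbhd Θ i).card ∧
      rss X i T ≤ rss X i (nbhd Θ i)} ≤ ENNReal.ofReal (8 * (n * p)) := by
  classical
  have hp0 : 0 < p := hp ▸ Real.exp_pos _
  have hp1 : p ≤ 1 := by
    rw [hp, Real.exp_le_one_iff, neg_nonpos]
    positivity
  set F : Finset (Finset (Fin n)) := Finset.univ.filter fun T =>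
    i ∉ T ∧ (nbhd Θ i \ T).Nonempty ∧ T.card ≤ (nbhd Θ i).card with hF
  have hsub : {X : Sample k n | ∃ T, i ∉ T ∧ (nbhd Θ i \ T).Nonempty ∧
      T.card ≤ (nbhd Θ i).card ∧ rss X i T ≤ rss X i (nbhd Θ i)} ⊆
      ⋃ T ∈ F, {X | rss X i T ≤ rss X i (nbhd Θ i)} := by
    rintro X ⟨T, h1, h2, h3, h4⟩
    simp only [Set.mem_iUnion]
    exact ⟨T, by simp [hF, h1, h2, h3], h4⟩
  have hterm : ∀ T ∈ F, sampleLaw Θ k {X | rss X i T ≤ rss X i (nbhd Θ i)} ≤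
      ENNReal.ofReal (4 * p ^ (symmDiff T (nbhd Θ i)).card) := by
    intro T hT
    simp only [hF, Finset.mem_filter, Finset.mem_univ, true_and] at hT
    refine (sampleLaw_search hΘ hatt hnd hκ hT.1 hT.2.1 hT.2.2
      (le_trans (by omega) hk) hkκ).trans (ENNReal.ofReal_le_ofReal ?_)
    have hq : Real.exp (-(k * κ ^ 2 / 2000)) = p ^ 2 := by
      rw [hp, ← Real.exp_nat_mul]
      congr 1
      push_cast
      ring
    rw [hq, ← pow_mul]
    -- Since |T| ≤ |N|, the symmetric difference has at most 2|N \ T| elements. This is why `p` is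
    -- the square root of the rate for one missing neighbor.
    have hcard : (symmDiff T (nbhd Θ i)).card ≤ 2 * (nbhd Θ i \ T).card := by
      have e1 := Finset.card_sdiff_add_card_inter T (nbhd Θ i)
      have e2 := Finset.card_sdiff_add_card_inter (nbhd Θ i) T
      rw [Finset.inter_comm (nbhd Θ i) T] at e2
      have e3 : (symmDiff T (nbhd Θ i)).card ≤ (T \ nbhd Θ i).card + (nbhd Θ i \ T).card :=
        Finset.card_union_le _ _
      omega
    have := pow_le_pow_of_le_one hp0.le hp1 hcard
    linarith
  refine (measure_mono hsub).trans ((measure_biUnion_finset_le _ _).trans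
    ((Finset.sum_le_sum hterm).trans ?_))
  rw [← ENNReal.ofReal_sum_of_nonneg fun _ _ => by positivity]
  apply ENNReal.ofReal_le_ofReal
  rw [← Finset.mul_sum]
  -- Every set considered misses a neighbor, so N itself does not occur and the term 1 of the
  -- binomial sum can be removed.
  have hN : nbhd Θ i ∉ F := by simp [hF]
  have hle : ∑ T ∈ F, p ^ (symmDiff T (nbhd Θ i)).card ≤ (1 + p) ^ n - 1 := by
    rw [← sum_pow_card_symmDiff p (nbhd Θ i), le_sub_iff_add_le, add_comm]
    have h1 : (1 : ℝ) = p ^ (symmDiff (nbhd Θ i) (nbhd Θ i)).card := by simp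
    conv_lhs => rw [h1]
    rw [← Finset.sum_insert (f := fun T => p ^ (symmDiff T (nbhd Θ i)).card) hN]
    exact Finset.sum_le_sum_of_subset_of_nonneg (Finset.subset_univ _) fun _ _ _ => by positivity
  linarith [one_add_pow_sub_one_le hp0.le hnp]

/-- The comparison of a fixed set with the neighborhood separates the neighbors. -/
theorem sampleLaw_not_separates (hΘ : Θ.PosDef) (hatt : IsAttractive Θ)
    (hnd : IsNondegenerate κ Θ) (hκ : 0 < κ) (hκ1 : κ ≤ 1) {T : Finset (Fin n)} (hi : i ∉ T)
    (hk : 50 * (nbhd Θ i ∪ T).card ≤ k) :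
    sampleLaw Θ k {X | ¬ Separates X (κ ^ 2 / 2) i (nbhd Θ i) T} ≤
      ENNReal.ofReal (n * (4 * Real.exp (-(k * κ ^ 2 / 2000)))) := by
  set q := Real.exp (-(k * κ ^ 2 / 2000)) with hq
  set S := nbhd Θ i ∪ T with hS
  have hiS : i ∉ S := by
    simp [hS, hi, notMem_nbhd_self]
  have hsub : {X : Sample k n | ¬ Separates X (κ ^ 2 / 2) i (nbhd Θ i) T} ⊆
      ⋃ j ∈ S, {X | ¬ (κ ^ 2 / 2 * rss X i S < rss X i (S.erase j) - rss X i S ↔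
        j ∈ nbhd Θ i)} := by
    intro X hX
    simp only [Separates, not_forall, Set.mem_ofPred_eq] at hX
    obtain ⟨j, hj, h⟩ := hX
    simp only [Set.mem_iUnion]
    exact ⟨j, hj, h⟩
  have hterm : ∀ j ∈ S, sampleLaw Θ k {X | ¬ (κ ^ 2 / 2 * rss X i S <
      rss X i (S.erase j) - rss X i S ↔ j ∈ nbhd Θ i)} ≤ ENNReal.ofReal (4 * q) := by
    intro j hj
    by_cases hjN : j ∈ nbhd Θ i
    · simp only [hjN, iff_true, not_lt]
      exact sampleLaw_validate_mem hΘ hatt hnd hκ hκ1 hiS Finset.subset_union_left hjN hk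
    · simp only [hjN, iff_false, not_not]
      exact sampleLaw_validate_notMem hΘ hκ hκ1 hiS Finset.subset_union_left hj hjN hk
  refine (measure_mono hsub).trans ((measure_biUnion_finset_le _ _).trans
    ((Finset.sum_le_sum hterm).trans ?_))
  rw [Finset.sum_const, nsmul_eq_mul, ← ENNReal.ofReal_natCast, ← ENNReal.ofReal_mul (by positivity)]
  apply ENNReal.ofReal_le_ofReal
  have : (S.card : ℝ) ≤ n := by
    exact_mod_cast (Finset.card_le_univ S).trans_eq (Fintype.card_fin n)
  gcongr

/-- The set `T` is the unique solution of the search with sparsity `r`. -/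
def IsStrictBest (X : Sample k n) (i : Fin n) (r : ℕ) (T : Finset (Fin n)) : Prop :=
  (i ∉ T ∧ T.card ≤ r) ∧ ∀ T' : Finset (Fin n), i ∉ T' → T'.card ≤ r → T' ≠ T →
    rss X i T < rss X i T'

theorem IsStrictBest.unique {X : Sample k n} {r : ℕ} {T T' : Finset (Fin n)}
    (h : IsStrictBest X i r T) (h' : IsStrictBest X i r T') : T = T' := by
  by_contra hne
  have h1 := h.2 T' h'.1.1 h'.1.2 (Ne.symm hne)
  have h2 := h'.2 T h.1.1 h.1.2 hne
  linarith

theorem measurableSet_isStrictBest (i : Fin n) (r : ℕ) (T : Finset (Fin n)) :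
    MeasurableSet {X : Sample k n | IsStrictBest X i r T} := by
  unfold IsStrictBest
  refine MeasurableSet.inter (s₂ := {X | ∀ T' : Finset (Fin n), i ∉ T' → T'.card ≤ r → T' ≠ T →
    rss X i T < rss X i T'}) (MeasurableSet.const _) ?_
  simp only [Set.ofPred_forall]
  exact MeasurableSet.iInter fun T' => MeasurableSet.iInter fun _ => MeasurableSet.iInter fun _ =>
    MeasurableSet.iInter fun _ => measurableSet_lt (measurable_rss i T) (measurable_rss i T')

theorem measurableSet_separates (ν : ℝ) (i : Fin n) (N T : Finset (Fin n)) :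
    MeasurableSet {X : Sample k n | Separates X ν i N T} := by
  unfold Separates
  simp only [Set.ofPred_forall]
  refine MeasurableSet.iInter fun j => MeasurableSet.iInter fun _ => ?_
  exact (measurableSet_lt ((measurable_rss i _).const_mul ν)
    ((measurable_rss i _).sub (measurable_rss i _))).iff (MeasurableSet.const _)

/-- The validation of the unique solution of the search is reliable, since it uses fresh samples. -/
theorem sampleLaw_prod_not_separates (hΘ : Θ.PosDef) (hatt : IsAttractive Θ)
    (hnd : IsNondegenerate κ Θ) (hκ : 0 < κ) (hκ1 : κ ≤ 1) {r : ℕ}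
    (hk : 50 * ((nbhd Θ i).card + r) ≤ k) :
    ((sampleLaw Θ k).prod (sampleLaw Θ k)) {X | ∃ T, IsStrictBest X.1 i r T ∧
        ¬ Separates X.2 (κ ^ 2 / 2) i (nbhd Θ i) T} ≤
      ENNReal.ofReal (n * (4 * Real.exp (-(k * κ ^ 2 / 2000)))) := by
  have := isProbabilityMeasure_sampleLaw Θ k
  apply prod_measure_le_of_section
  · simp only [Set.ofPred_exists]
    refine MeasurableSet.iUnion fun T => MeasurableSet.inter ?_ ?_
    · exact measurable_fst (measurableSet_isStrictBest i r T)
    · exact measurable_snd (measurableSet_separates _ i _ T).compl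
  -- The first sample is fixed. It admits at most one strict solution, so the event for the second
  -- sample concerns a single set.
  · intro X
    by_cases h : ∃ T, IsStrictBest X i r T
    · obtain ⟨T, hT⟩ := h
      refine (measure_mono ?_).trans (sampleLaw_not_separates hΘ hatt hnd hκ hκ1 hT.1.1
        (le_trans (Nat.mul_le_mul_left _ ((Finset.card_union_le _ _).trans
          (Nat.add_le_add_left hT.1.2 _))) hk))
      rintro Y ⟨T', hT', hY⟩
      rwa [hT'.unique hT] at hY
    · have : {Y : Sample k n | (X, Y) ∈ {X : Sample k n × Sample k n | ∃ T, IsStrictBest X.1 i r T ∧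
          ¬ Separates X.2 (κ ^ 2 / 2) i (nbhd Θ i) T}} = ∅ := by
        ext Y
        simp only [Set.mem_ofPred_eq, Set.mem_empty_iff_false, iff_false]
        rintro ⟨T, hT, -⟩
        exact h ⟨T, hT⟩
      rw [this, measure_empty]
      exact zero_le

/-- Ties between sets of fewer than `k` coordinates have probability zero. -/
theorem sampleLaw_tie (hΘ : Θ.PosDef) {d : ℕ} (hd : d < k) :
    sampleLaw Θ k {X | ∃ T T' : Finset (Fin n), i ∉ T ∧ i ∉ T' ∧ T.card ≤ d ∧ T'.card ≤ d ∧
      T ≠ T' ∧ rss X i T = rss X i T'} = 0 := by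
  simp only [Set.ofPred_exists]
  refine measure_iUnion_null fun T => measure_iUnion_null fun T' => ?_
  by_cases h : i ∉ T ∧ i ∉ T' ∧ T.card ≤ d ∧ T'.card ≤ d ∧ T ≠ T'
  · obtain ⟨h1, h2, h3, h4, h5⟩ := h
    refine measure_mono_null (fun X hX => ?_) (sampleLaw_resid_eq_of_ne hΘ h1 h2
      (h3.trans_lt hd) (h4.trans_lt hd) h5)
    exact hX.2.2.2.2.2
  · convert measure_empty (μ := sampleLaw Θ k)
    ext X
    simp only [Set.mem_ofPred_eq, Set.mem_empty_iff_false, iff_false]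
    tauto

/-- The failure probability of the algorithm at the node `i`. -/
theorem sampleLaw_prod_fails (hΘ : Θ.PosDef) (hatt : IsAttractive Θ)
    (hnd : IsNondegenerate κ Θ) (hκ : 0 < κ) (hκ1 : κ ≤ 1) {d : ℕ}
    (hd : (nbhd Θ i).card ≤ d) (hk : 100 * d ≤ k) (hk1 : 50 * (d + 1) ≤ k)
    (hkκ : 4 ≤ k * κ ^ 2) {p : ℝ} (hp : p = Real.exp (-(k * κ ^ 2 / 4000))) (hnp : n * p ≤ 1) :
    ((sampleLaw Θ k).prod (sampleLaw Θ k)) {X | ∃ out,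
        IsSearchAndValidateOutput X.1 X.2 d (κ ^ 2 / 2) i out ∧ out ≠ some (nbhd Θ i)} ≤
      ENNReal.ofReal (8 * (n * p) + (n + 1) * (n * (4 * p ^ 2))) := by
  have := isProbabilityMeasure_sampleLaw Θ k
  have hk0 : 0 < k := by omega
  set μ := sampleLaw Θ k with hμ
  have hq : Real.exp (-(k * κ ^ 2 / 2000)) = p ^ 2 := by
    rw [hp, ← Real.exp_nat_mul]
    congr 1
    push_cast
    ring
  set B₀ : Set (Sample k n) := {X | ∃ T T' : Finset (Fin n), i ∉ T ∧ i ∉ T' ∧ T.card ≤ d ∧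
    T'.card ≤ d ∧ T ≠ T' ∧ rss X i T = rss X i T'} with hB₀
  set B₁ : Set (Sample k n) := {X | ∃ T, i ∉ T ∧ (nbhd Θ i \ T).Nonempty ∧
    T.card ≤ (nbhd Θ i).card ∧ rss X i T ≤ rss X i (nbhd Θ i)} with hB₁
  set B₂ : ℕ → Set (Sample k n × Sample k n) := fun r => {X | r ≤ d ∧ ∃ T,
    IsStrictBest X.1 i r T ∧ ¬ Separates X.2 (κ ^ 2 / 2) i (nbhd Θ i) T} with hB₂
  have hsub : {X : Sample k n × Sample k n | ∃ out,
      IsSearchAndValidateOutput X.1 X.2 d (κ ^ 2 / 2) i out ∧ out ≠ some (nbhd Θ i)} ⊆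
      (B₀ ×ˢ Set.univ ∪ B₁ ×ˢ Set.univ) ∪ ⋃ r ∈ Finset.range (n + 1), B₂ r := by
    rintro ⟨X, Y⟩ ⟨out, ⟨w, hw, hout⟩, hne⟩
    by_contra hcon
    simp only [Set.mem_union, Set.mem_prod, Set.mem_univ, and_true, Set.mem_iUnion,
      Finset.mem_range, not_or, not_exists] at hcon
    obtain ⟨⟨h0, h1⟩, h2⟩ := hcon
    have hi (r : ℕ) (hr : r ≤ d) : i ∉ supp (w r) := fun h => mem_supp.1 h (hw r hr).1.1
    have hbest (r : ℕ) (hr : r ≤ d) : IsStrictBest X i r (supp (w r)) := by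
      refine ⟨⟨hi r hr, (hw r hr).1.2⟩, fun T' hT' hc hne' =>
        lt_of_le_of_ne ((hw r hr).rss_supp_le hk0 hT' hc) fun heq => h0 ?_⟩
      exact ⟨_, _, hi r hr, hT', (hw r hr).1.2.trans hr, hc.trans hr, hne'.symm, heq⟩
    apply hne
    rw [hout]
    refine validate_eq_some_of_separates ?_ hd (fun r hr => (hw r hr).1.2) fun r hr => ?_
    · have hmin := (hw _ hd).rss_supp_le hk0 (notMem_nbhd_self Θ i) le_rfl
      have hsubset : nbhd Θ i ⊆ supp (w (nbhd Θ i).card) := by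
        by_contra hns
        exact h1 ⟨_, hi _ hd, Finset.sdiff_nonempty.2 hns, (hw _ hd).1.2, hmin⟩
      exact (Finset.eq_of_subset_of_card_le hsubset (hw _ hd).1.2).symm
    -- Supports have at most `n` elements, so the sparsity can be capped at `n`, which bounds the
    -- number of events `B₂` by n + 1.
    · by_contra hsep
      refine h2 (min r n) (by omega) ⟨by omega, supp (w r), ⟨⟨hi r hr, (hw r hr).min.1.2⟩, ?_⟩, hsep⟩
      exact fun T' hT' hc => (hbest r hr).2 T' hT' (hc.trans (min_le_left _ _))
  have hterm : ∀ r ∈ Finset.range (n + 1), (μ.prod μ) (B₂ r) ≤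
      ENNReal.ofReal (n * (4 * p ^ 2)) := by
    intro r _
    by_cases hr : r ≤ d
    · simp only [hB₂, hr, true_and]
      rw [← hq]
      exact sampleLaw_prod_not_separates hΘ hatt hnd hκ hκ1 (by omega)
    · simp [hB₂, hr]
  have e0 : (μ.prod μ) (B₀ ×ˢ Set.univ) = 0 := by
    rw [Measure.prod_prod, sampleLaw_tie hΘ (by omega), zero_mul]
  have e1 : (μ.prod μ) (B₁ ×ˢ Set.univ) ≤ ENNReal.ofReal (8 * (n * p)) := by
    rw [Measure.prod_prod, measure_univ, mul_one]
    exact sampleLaw_search_fails hΘ hatt hnd hκ (by omega) hkκ hp hnp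
  have e2 : (μ.prod μ) (⋃ r ∈ Finset.range (n + 1), B₂ r) ≤
      ENNReal.ofReal ((n + 1) * (n * (4 * p ^ 2))) := by
    refine (measure_biUnion_finset_le _ _).trans ((Finset.sum_le_sum hterm).trans ?_)
    rw [Finset.sum_const, Finset.card_range, nsmul_eq_mul, ← ENNReal.ofReal_natCast,
      ← ENNReal.ofReal_mul (by positivity)]
    push_cast
    exact le_rfl
  have hp0 : 0 < p := hp ▸ Real.exp_pos _
  calc _ ≤ _ := measure_mono hsub
    _ ≤ _ := (measure_union_le _ _).trans (add_le_add (measure_union_le _ _) e2)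
    _ ≤ _ := by
      rw [e0, zero_add, ENNReal.ofReal_add (by positivity) (by positivity)]
      gcongr

end Correctness

end GGM

namespace GGM

/-! ### The number of samples -/

section SampleComplexity

open MeasureTheory ProbabilityTheory

variable {n k : ℕ} {Θ : Matrix (Fin n) (Fin n) ℝ} {κ : ℝ} {i : Fin n}

theorem measure_eq_zero_of_forall_notMem {α : Type*} [MeasurableSpace α] {μ : Measure α}
    {s : Set α} (h : ∀ x, x ∉ s) : μ s = 0 := by
  rw [Set.eq_empty_of_forall_notMem h, measure_empty]

theorem card_nbhd_le_maxDegree (Θ : Matrix (Fin n) (Fin n) ℝ) (i : Fin n) :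
    (nbhd Θ i).card ≤ maxDegree Θ :=
  Finset.le_sup (f := fun i => (nbhd Θ i).card) (Finset.mem_univ i)

theorem maxDegree_mul_sq_le_one (hΘ : Θ.PosDef) (hatt : IsAttractive Θ)
    (hnd : IsNondegenerate κ Θ) (hκ : 0 < κ) : maxDegree Θ * κ ^ 2 ≤ 1 := by
  rw [← le_div_iff₀ (by positivity)]
  have : maxDegree Θ ≤ ⌊1 / κ ^ 2⌋₊ := Finset.sup_le fun i _ => Nat.le_floor <| by
    rw [le_div_iff₀ (by positivity)]
    exact card_nbhd_mul_sq_le_one hΘ hatt hnd hκ i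
  exact (Nat.le_floor_iff (by positivity)).1 this

/-- With d = 0 the only candidate is the empty set and there is nothing to compare it with, so no
samples are needed. -/
theorem isSearchAndValidateOutput_zero {X₁ X₂ : Sample k n} {ν : ℝ}
    {out : Option (Finset (Fin n))} (h : IsSearchAndValidateOutput X₁ X₂ 0 ν i out) :
    out = some ∅ := by
  obtain ⟨w, hw, rfl⟩ := h
  rw [validate_eq_some le_rfl not_isRejected_zero fun q hq => absurd hq (Nat.not_lt_zero q)]
  rw [Finset.card_eq_zero.1 (Nat.le_zero.1 (hw 0 le_rfl).1.2)]

/-- The number of samples makes the failure probability small. -/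
theorem failure_le {n : ℕ} {δ p : ℝ} (hn : 0 < n) (hδ : 0 < δ) (hδ1 : δ ≤ 1) (hp0 : 0 < p)
    (hp : p ≤ (δ / (2 * n)) ^ 10) :
    n * p ≤ 1 ∧ n * (8 * (n * p) + (n + 1) * (n * (4 * p ^ 2))) ≤ δ := by
  have hn1 : (1 : ℝ) ≤ n := by exact_mod_cast hn
  set x : ℝ := δ / (2 * n) with hx
  have hx0 : 0 < x := by positivity
  have hnx : n * x = δ / 2 := by
    rw [hx]
    field_simp
  have hx1 : x ≤ 1 / 2 := by nlinarith
  have hpx : p ≤ x ^ 2 / 256 := by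
    have : x ^ 8 ≤ (1 / 2) ^ 8 := by gcongr
    calc p ≤ x ^ 2 * x ^ 8 := by rw [← pow_add]; exact hp
      _ ≤ x ^ 2 * (1 / 2) ^ 8 := by gcongr
      _ = x ^ 2 / 256 := by norm_num; ring
  have hnp : n * p ≤ δ * x / 512 := by
    calc n * p ≤ n * (x ^ 2 / 256) := by gcongr
      _ = n * x * x / 256 := by ring
      _ = δ * x / 512 := by rw [hnx]; ring
  have hδx : δ * x ≤ 1 := by nlinarith
  have hp1 : n * p ≤ 1 := by nlinarith
  refine ⟨hp1, ?_⟩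
  have h1 : n * (n * p) ≤ δ / 1024 := by
    calc n * (n * p) ≤ n * (δ * x / 512) := by gcongr
      _ = δ * (n * x) / 512 := by ring
      _ = δ * δ / 1024 := by rw [hnx]; ring
      _ ≤ δ / 1024 := by nlinarith
  have h2 : n * ((n + 1) * (n * p ^ 2)) ≤ 2 * (δ / 1024) := by
    have e : n * ((n + 1) * (n * p ^ 2)) = (n * (n * p)) * ((n + 1) * p) := by ring
    rw [e]
    have : (n + 1) * p ≤ 2 := by nlinarith
    have : 0 ≤ (n + 1) * p := by positivity
    have : 0 ≤ n * (n * p) := by positivity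
    nlinarith
  linarith [h1, h2, (by ring : n * (8 * (n * p) + (n + 1) * (n * (4 * p ^ 2))) =
    8 * (n * (n * p)) + 4 * (n * ((n + 1) * (n * p ^ 2))))]

/-- With L = log n + log(2/δ), the constant gives kκ² ≥ 40000 L, so p = exp(-kκ²/4000) is at most
(δ/(2n))^10. In both cases allowed for `d` one has dκ² ≤ 1, and L ≥ 1/2 then yields k ≥ 20000 d,
which covers all requirements on dimensions. -/
theorem searchAndValidate_correct :
    ∃ C : ℝ, 0 < C ∧
      ∀ (n k d : ℕ) (κ δ : ℝ) (Θ : Matrix (Fin n) (Fin n) ℝ),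
        0 < κ → 0 < δ → Θ.PosDef → IsAttractive Θ → IsNondegenerate κ Θ →
        maxDegree Θ ≤ d → (d : ℝ) ≤ max (maxDegree Θ : ℝ) (1 / κ ^ 2) →
        C * ((1 / κ ^ 2) * (Real.log n + Real.log (2 / δ))) ≤ ((2 * k : ℕ) : ℝ) →
        ((sampleLaw Θ k).prod (sampleLaw Θ k))
            {X | ¬ ∀ (i : Fin n) (out : Option (Finset (Fin n))),
              IsSearchAndValidateOutput X.1 X.2 d (κ ^ 2 / 2) i out →
                out = some (nbhd Θ i)}
          ≤ ENNReal.ofReal δ := by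
  refine ⟨80000, by norm_num, fun n k d κ δ Θ hκ hδ hΘ hatt hnd hΔ hd hm => ?_⟩
  have := isProbabilityMeasure_sampleLaw Θ k
  -- Treated apart, because dκ² ≤ 1 bounds κ by 1 only if d > 0.
  rcases Nat.eq_zero_or_pos d with rfl | hd0
  · refine le_of_eq_of_le (measure_eq_zero_of_forall_notMem fun X hX => hX fun i out h => ?_) zero_le
    rw [isSearchAndValidateOutput_zero h, eq_comm, Option.some_inj, ← Finset.card_eq_zero]
    exact Nat.le_zero.1 ((card_nbhd_le_maxDegree Θ i).trans hΔ)
  rcases le_or_gt 1 δ with hδ1 | hδ1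
  · exact prob_le_one.trans (by rw [← ENNReal.ofReal_one]; exact ENNReal.ofReal_le_ofReal hδ1)
  rcases Nat.eq_zero_or_pos n with rfl | hn
  · exact le_of_eq_of_le (measure_eq_zero_of_forall_notMem fun X hX => hX fun i => i.elim0) zero_le
  have hdκ : d * κ ^ 2 ≤ 1 := by
    rcases le_max_iff.1 hd with h | h
    · exact le_trans (by gcongr) (maxDegree_mul_sq_le_one hΘ hatt hnd hκ)
    · rwa [le_div_iff₀ (by positivity)] at h
  have hd1 : (1 : ℝ) ≤ d := by exact_mod_cast hd0
  have hκ2 : κ ^ 2 ≤ 1 := by nlinarith [sq_nonneg κ]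
  have hκ1 : κ ≤ 1 := by nlinarith
  have hn1 : (1 : ℝ) ≤ n := by exact_mod_cast hn
  set L := Real.log n + Real.log (2 / δ) with hL
  have hLeq : L = -Real.log (δ / (2 * n)) := by
    rw [hL, ← Real.log_mul (by positivity) (by positivity), ← Real.log_inv]
    congr 1
    field_simp
  have hL1 : 1 / 2 ≤ L := by
    have h1 : 0 ≤ Real.log n := Real.log_nonneg hn1
    have h2 : Real.log 2 ≤ Real.log (2 / δ) :=
      Real.log_le_log (by norm_num) ((le_div_iff₀ hδ).2 (by linarith))
    linarith [Real.log_two_gt_d9]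
  have hkκ : 40000 * L ≤ k * κ ^ 2 := by
    push_cast at hm
    have h1 : 80000 * (1 / κ ^ 2 * L) * κ ^ 2 ≤ 2 * k * κ ^ 2 := by gcongr
    have h2 : 80000 * (1 / κ ^ 2 * L) * κ ^ 2 = 80000 * L := by field_simp
    linarith
  have hkd : 20000 * (d : ℝ) ≤ k := by
    have h3 : 20000 * (d * κ ^ 2) ≤ k * κ ^ 2 := by nlinarith
    have : 20000 * d * κ ^ 2 ≤ k * κ ^ 2 := by linarith
    exact le_of_mul_le_mul_right this (by positivity)
  have hkd' : 20000 * d ≤ k := by exact_mod_cast hkd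
  set p := Real.exp (-(k * κ ^ 2 / 4000)) with hp
  have hpx : p ≤ (δ / (2 * n)) ^ 10 := by
    rw [← Real.exp_log (show 0 < (δ / (2 * n)) ^ 10 by positivity), Real.log_pow, hp]
    apply Real.exp_le_exp.2
    push_cast
    linarith
  obtain ⟨hnp, htot⟩ := failure_le hn hδ hδ1.le (Real.exp_pos _) hpx
  have hsub : {X : Sample k n × Sample k n | ¬ ∀ (i : Fin n) (out : Option (Finset (Fin n))),
      IsSearchAndValidateOutput X.1 X.2 d (κ ^ 2 / 2) i out → out = some (nbhd Θ i)} ⊆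
      ⋃ i ∈ (Finset.univ : Finset (Fin n)), {X | ∃ out,
        IsSearchAndValidateOutput X.1 X.2 d (κ ^ 2 / 2) i out ∧ out ≠ some (nbhd Θ i)} := by
    intro X hX
    simp only [Set.mem_ofPred_eq, not_forall] at hX
    obtain ⟨i, out, h, hne⟩ := hX
    simp only [Set.mem_iUnion]
    exact ⟨i, Finset.mem_univ i, out, h, hne⟩
  refine (measure_mono hsub).trans ((measure_biUnion_finset_le _ _).trans
    ((Finset.sum_le_sum fun i _ => sampleLaw_prod_fails hΘ hatt hnd hκ hκ1
      ((card_nbhd_le_maxDegree Θ i).trans hΔ) (by omega) (by omega) (by linarith) hp hnp).trans ?_))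
  rw [Finset.sum_const, Finset.card_univ, Fintype.card_fin, nsmul_eq_mul,
    ← ENNReal.ofReal_natCast, ← ENNReal.ofReal_mul (by positivity)]
  exact ENNReal.ofReal_le_ofReal htot

end SampleComplexity

end GGM

namespace GGM

/-! ### Reasoning about programs of the machine -/

section Machine

/-- The natural number register written by an instruction. -/
def Instr.nw : Instr → List ℕ
  | .nconst x _ | .nadd x _ _ | .nsub x _ _ | .nload x _ => [x]
  | _ => []

/-- The real register written by an instruction. -/
def Instr.rw : Instr → List ℕ
  | .rconst x _ | .radd x _ _ | .rsub x _ _ | .rmul x _ _ | .rdiv x _ _ | .rload x _ => [x]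
  | _ => []

/-- Does an instruction write to the natural number memory? -/
def Instr.nst : Instr → Bool
  | .nstore _ _ => true
  | _ => false

/-- Does an instruction write to the real memory? -/
def Instr.rst : Instr → Bool
  | .rstore _ _ => true
  | _ => false

/-- The natural number registers written by a program. -/
def Prog.nw : Prog → List ℕ
  | .instr o => o.nw
  | .seq p q | .ite _ p q => p.nw ++ q.nw
  | .loop _ p => p.nw

/-- The real registers written by a program. -/
def Prog.rw : Prog → List ℕ
  | .instr o => o.rw
  | .seq p q | .ite _ p q => p.rw ++ q.rw
  | .loop _ p => p.rw

/-- Does a program write to the natural number memory? -/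
def Prog.nst : Prog → Bool
  | .instr o => o.nst
  | .seq p q | .ite _ p q => p.nst || q.nst
  | .loop _ p => p.nst

/-- Does a program write to the real memory? -/
def Prog.rst : Prog → Bool
  | .instr o => o.rst
  | .seq p q | .ite _ p q => p.rst || q.rst
  | .loop _ p => p.rst

/-- The parts of the state which a program cannot change. -/
structure Frame (p : Prog) (s s' : State) : Prop where
  nreg : ∀ x, x ∉ p.nw → s'.nreg x = s.nreg x
  rreg : ∀ x, x ∉ p.rw → s'.rreg x = s.rreg x
  nmem : p.nst = false → s'.nmem = s.nmem
  rmem : p.rst = false → s'.rmem = s.rmem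

theorem Frame.refl (p : Prog) (s : State) : Frame p s s :=
  ⟨fun _ _ => rfl, fun _ _ => rfl, fun _ => rfl, fun _ => rfl⟩

theorem Frame.trans {p : Prog} {s s' s'' : State} (h : Frame p s s') (h' : Frame p s' s'') :
    Frame p s s'' :=
  ⟨fun x hx => (h'.nreg x hx).trans (h.nreg x hx), fun x hx => (h'.rreg x hx).trans (h.rreg x hx),
    fun hx => (h'.nmem hx).trans (h.nmem hx), fun hx => (h'.rmem hx).trans (h.rmem hx)⟩

theorem Frame.mono {p q : Prog} {s s' : State} (h : Frame p s s') (h1 : p.nw ⊆ q.nw)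
    (h2 : p.rw ⊆ q.rw) (h3 : p.nst ≤ q.nst) (h4 : p.rst ≤ q.rst) : Frame q s s' :=
  ⟨fun x hx => h.nreg x fun hp => hx (h1 hp), fun x hx => h.rreg x fun hp => hx (h2 hp),
    fun hq => h.nmem (by rw [hq] at h3; exact Bool.eq_false_of_le_false h3),
    fun hq => h.rmem (by rw [hq] at h4; exact Bool.eq_false_of_le_false h4)⟩

theorem Frame.instr (o : Instr) (s : State) : Frame (.instr o) s (o.exec s) := by
  constructor <;> cases o <;>
    simp +contextual [Prog.nw, Prog.rw, Prog.nst, Prog.rst, Instr.nw, Instr.rw, Instr.nst,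
      Instr.rst, Instr.exec]

theorem Frame.left {p q : Prog} {s s' : State} (h : Frame p s s') : Frame (p.seq q) s s' :=
  h.mono (List.subset_append_left _ _) (List.subset_append_left _ _) (Bool.left_le_or _ _)
    (Bool.left_le_or _ _)

theorem Frame.right {p q : Prog} {s s' : State} (h : Frame q s s') : Frame (p.seq q) s s' :=
  h.mono (List.subset_append_right _ _) (List.subset_append_right _ _) (Bool.right_le_or _ _)
    (Bool.right_le_or _ _)

theorem Frame.loop {p : Prog} {b : Test} {s s' : State} (h : Frame p s s') :
    Frame (.loop b p) s s' :=
  ⟨h.nreg, h.rreg, h.nmem, h.rmem⟩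

theorem Frame.of_runs {p : Prog} {s s' : State} {t : ℕ} (h : Runs p s t s') : Frame p s s' := by
  induction h with
  | instr o s => exact Frame.instr o s
  | seq _ _ ih1 ih2 => exact ih1.left.trans ih2.right
  | ite_true _ _ ih =>
    exact ih.mono (List.subset_append_left _ _) (List.subset_append_left _ _) (Bool.left_le_or _ _)
      (Bool.left_le_or _ _)
  | ite_false _ _ ih =>
    exact ih.mono (List.subset_append_right _ _) (List.subset_append_right _ _)
      (Bool.right_le_or _ _) (Bool.right_le_or _ _)
  | loop_true _ _ _ ih1 ih2 => exact ih1.loop.trans ih2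
  | loop_false _ => exact Frame.refl _ _

/-- Started in `s`, the program `p` halts after at most `T` steps in a state which satisfies `Q`. -/
def Reach (p : Prog) (s : State) (T : ℕ) (Q : State → Prop) : Prop :=
  ∃ t s', Runs p s t s' ∧ t ≤ T ∧ Q s'

/-- The new postcondition may use the frame of `p`. Specifications therefore mention only what a
program changes; everything else is recovered from the syntactic list of written registers. -/
theorem Reach.mono {p : Prog} {s : State} {T T' : ℕ} {Q Q' : State → Prop} (h : Reach p s T Q)
    (hT : T ≤ T') (hQ : ∀ s', Frame p s s' → Q s' → Q' s') : Reach p s T' Q' := by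
  obtain ⟨t, s', hr, ht, hq⟩ := h
  exact ⟨t, s', hr, ht.trans hT, hQ s' (Frame.of_runs hr) hq⟩

theorem Reach.seq {p q : Prog} {s : State} {T₁ T₂ : ℕ} {Q₁ Q : State → Prop}
    (h : Reach p s T₁ Q₁) (h' : ∀ s', Frame p s s' → Q₁ s' → Reach q s' T₂ Q) :
    Reach (p.seq q) s (T₁ + T₂) Q := by
  obtain ⟨t, s', hr, ht, hq⟩ := h
  obtain ⟨t', s'', hr', ht', hq'⟩ := h' s' (Frame.of_runs hr) hq
  exact ⟨t + t', s'', hr.seq hr', by omega, hq'⟩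

theorem Reach.ite {p q : Prog} {b : Test} {s : State} {T : ℕ} {Q : State → Prop}
    (h : b.holds s → Reach p s T Q) (h' : ¬ b.holds s → Reach q s T Q) :
    Reach (.ite b p q) s (T + 1) Q := by
  by_cases hb : b.holds s
  · obtain ⟨t, s', hr, ht, hq⟩ := h hb
    exact ⟨t + 1, s', hr.ite_true hb, by omega, hq⟩
  · obtain ⟨t, s', hr, ht, hq⟩ := h' hb
    exact ⟨t + 1, s', hr.ite_false hb, by omega, hq⟩

/-- A sequence of instructions. -/
def blk : Instr → List Instr → Prog
  | o, [] => .instr o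
  | o, o' :: l => .seq (.instr o) (blk o' l)

theorem Reach.blk (o : Instr) (l : List Instr) {s : State} {Q : State → Prop}
    (h : Q (l.foldl (fun s o => o.exec s) (o.exec s))) : Reach (blk o l) s (l.length + 1) Q := by
  induction l generalizing o s with
  | nil => exact ⟨1, _, Runs.instr o s, le_rfl, h⟩
  | cons o' l ih =>
    obtain ⟨t, s', hr, ht, hq⟩ := ih o' h
    exact ⟨1 + t, s', (Runs.instr o s).seq hr, by rw [List.length_cons]; omega, hq⟩

theorem Reach.blk_seq {o : Instr} {l : List Instr} {q : Prog} {s : State} {T₀ T : ℕ}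
    {Q : State → Prop} (Q₁ : State → Prop) (hT : T₀ = l.length + 1)
    (h : Q₁ (l.foldl (fun s o => o.exec s) (o.exec s)))
    (h' : ∀ s', Frame (GGM.blk o l) s s' → Q₁ s' → Reach q s' T Q) :
    Reach ((GGM.blk o l).seq q) s (T₀ + T) Q :=
  hT ▸ (Reach.blk o l h).seq h'

/-- The state `s` with the natural number register `x` set to `v`. -/
def State.setN (s : State) (x v : ℕ) : State := { s with nreg := Function.update s.nreg x v }

/-- A loop in which the register `c` runs through the numbers below the content of the
register `N`. The register `3` holds the number `1`. -/
def forP (c N : ℕ) (body : Prog) : Prog :=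
  .seq (.instr (.nconst c 0)) (.loop (.nlt c N) (.seq body (.instr (.nadd c c 3))))

/-- `I j` is the invariant before pass `j`. After a pass it is required of the state in which the
counter has already been increased. The overhead is a test and an increment for each pass, plus the
initialization and the last test. -/
theorem Reach.forP {c N : ℕ} {body : Prog} {s : State} {m T : ℕ} {Q : State → Prop}
    (I : ℕ → State → Prop)
    (hw : c ∉ body.nw ∧ N ∉ body.nw ∧ 3 ∉ body.nw ∧ c ≠ N ∧ c ≠ 3)
    (hN : s.nreg N = m) (h3 : s.nreg 3 = 1) (h0 : I 0 (s.setN c 0))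
    (hstep : ∀ j s', j < m → s'.nreg c = j → Frame (forP c N body) s s' → I j s' →
      Reach body s' T fun s'' => Frame body s' s'' → I (j + 1) (s''.setN c (j + 1)))
    (hQ : ∀ s', Frame (forP c N body) s s' → I m s' → Q s') :
    Reach (forP c N body) s (m * (T + 2) + 2) Q := by
  obtain ⟨hc, hN', h3', hcN, hc3⟩ := hw
  -- Induction on the number `l` of passes which are left.
  have key : ∀ l j s', l + j = m → s'.nreg c = j → Frame (GGM.forP c N body) s s' → I j s' →
      Reach (.loop (.nlt c N) (.seq body (.instr (.nadd c c 3)))) s' (l * (T + 2) + 1)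
        fun s'' => Frame (GGM.forP c N body) s s'' ∧ I m s'' := by
    intro l
    induction l with
    | zero =>
      intro j s' hj hcj hf hI
      rw [Nat.zero_add] at hj
      subst hj
      have hNs : s'.nreg N = j := (hf.nreg N (by
        simp [GGM.forP, Prog.nw, Instr.nw, hN', hcN.symm])).trans hN
      exact ⟨1, s', Runs.loop_false (by simp [Test.holds, hcj, hNs]), by omega, hf, hI⟩
    | succ l ih =>
      intro j s' hj hcj hf hI
      have hNs : s'.nreg N = m := (hf.nreg N (by
        simp [GGM.forP, Prog.nw, Instr.nw, hN', hcN.symm])).trans hN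
      have h3s : s'.nreg 3 = 1 := (hf.nreg 3 (by
        simp [GGM.forP, Prog.nw, Instr.nw, h3', hc3.symm])).trans h3
      obtain ⟨t, s'', hr, ht, hq⟩ := hstep j s' (by omega) hcj hf hI
      have hb := Frame.of_runs hr
      have hs : (Instr.nadd c c 3).exec s'' = s''.setN c (j + 1) := by
        simp [Instr.exec, State.setN, hb.nreg c hc, hb.nreg 3 h3', hcj, h3s]
      have hr2 := hr.seq (Runs.instr (.nadd c c 3) s'')
      rw [hs] at hr2
      have hf2 : Frame (GGM.forP c N body) s (s''.setN c (j + 1)) :=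
        hf.trans (Frame.right (Frame.of_runs hr2).loop)
      obtain ⟨t', s''', hr', ht', hq'⟩ := ih (j + 1) (s''.setN c (j + 1)) (by omega)
        (by simp [State.setN]) hf2 (hq hb)
      refine ⟨t + 1 + t' + 1, s''', Runs.loop_true (by simp [Test.holds, hcj, hNs]; omega) hr2 hr',
        ?_, hq'⟩
      rw [Nat.succ_mul]
      omega
  have hr0 := Runs.instr (.nconst c 0) s
  have hs0 : (Instr.nconst c 0).exec s = s.setN c 0 := rfl
  rw [hs0] at hr0
  obtain ⟨t, s', hr, ht, hf, hI⟩ := key m 0 (s.setN c 0) rfl (by simp [State.setN])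
    (Frame.left (Frame.of_runs hr0)) h0
  exact ⟨1 + t, s', hr0.seq hr, by omega, hQ s' hf hI⟩

end Machine

end GGM

namespace GGM

/-! ### Distances by elimination in the Gram matrix -/

section Elimination

variable {E : Type*} [NormedAddCommGroup E] [InnerProductSpace ℝ E] [FiniteDimensional ℝ E]

open Classical in
/-- The inverse of a pivot, or zero if the pivot is to be skipped. -/
noncomputable def pivotInv (sk : Prop) (v : ℝ) : ℝ := if sk then 0 else if 0 < v then 1 / v else 0

/-- Successive elimination of the rows of the matrix `M`, except for those in `sk`. -/
noncomputable def schur (M : ℕ → ℕ → ℝ) (sk : ℕ → Prop) : ℕ → ℕ → ℕ → ℝ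
  | 0, b, c => M b c
  | a + 1, b, c => schur M sk a b c -
      schur M sk a a b * pivotInv (sk a) (schur M sk a a a) * schur M sk a a c

/-- One step of Gram–Schmidt. If `v` already lies in `W`, the pivot is 0 and its inverse is 0 by
convention, so nothing is subtracted, as it should be. -/
theorem starProjection_orthogonal_sup_span (W : Submodule ℝ E) (v y : E) :
    (W ⊔ Submodule.span ℝ {v})ᗮ.starProjection y = Wᗮ.starProjection y -
      (inner ℝ (Wᗮ.starProjection v) (Wᗮ.starProjection y) *
        pivotInv False (inner ℝ (Wᗮ.starProjection v) (Wᗮ.starProjection v))) •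
          Wᗮ.starProjection v := by
  set P := Wᗮ.starProjection with hP
  have hmem (z : E) : P z ∈ Wᗮ := Submodule.starProjection_apply_mem _ _
  have hW (z : E) : z - P z ∈ W := by
    rw [hP, Submodule.starProjection_orthogonal_val, sub_sub_cancel]
    exact Submodule.starProjection_apply_mem _ _
  have hPv : P v ∈ W ⊔ Submodule.span ℝ {v} := by
    rw [← sub_sub_cancel v (P v)]
    exact sub_mem (Submodule.mem_sup_right (Submodule.mem_span_singleton_self v))
      (Submodule.mem_sup_left (hW v))
  have hortho (a z : E) (ha : a ∈ Wᗮ) : inner ℝ z a = inner ℝ (P z) a := by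
    have : inner ℝ (z - P z) a = 0 := Submodule.inner_right_of_mem_orthogonal (hW z) ha
    rw [inner_sub_left] at this
    linarith
  apply Submodule.eq_starProjection_of_mem_orthogonal
  · have hm : P y - (inner ℝ (P v) (P y) * pivotInv False (inner ℝ (P v) (P v))) • P v ∈ Wᗮ :=
      sub_mem (hmem y) (Submodule.smul_mem _ _ (hmem v))
    rw [← Submodule.inf_orthogonal]
    refine ⟨hm, Submodule.mem_orthogonal_singleton_iff_inner_right.2 ?_⟩
    rw [hortho _ _ hm, inner_sub_right, inner_smul_right, pivotInv, if_neg not_false]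
    by_cases h : P v = 0
    · simp [h]
    · have hpos : 0 < inner ℝ (P v) (P v) := real_inner_self_pos.2 h
      rw [if_pos hpos, mul_assoc, one_div, inv_mul_cancel₀ hpos.ne', mul_one, sub_self]
  · rw [Submodule.orthogonal_orthogonal, sub_sub_eq_add_sub, add_sub_right_comm]
    exact add_mem (Submodule.mem_sup_left (hW y)) (Submodule.smul_mem _ _ hPv)

/-- Eliminating row `a` replaces the projections orthogonal to the earlier vectors by those
orthogonal to `x a` as well; by the previous lemma this is the elimination formula for their inner
products. Linear dependence is harmless. -/
theorem schur_eq_inner (x : ℕ → E) (sk : ℕ → Prop) (a b c : ℕ) :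
    schur (fun b c => inner ℝ (x b) (x c)) sk a b c =
      inner ℝ ((Submodule.span ℝ (x '' {p | p < a ∧ ¬ sk p}))ᗮ.starProjection (x b))
        ((Submodule.span ℝ (x '' {p | p < a ∧ ¬ sk p}))ᗮ.starProjection (x c)) := by
  induction a generalizing b c with
  | zero => simp [schur, Submodule.starProjection_top]
  | succ a ih =>
    rw [schur, ih, ih, ih, ih]
    by_cases h : sk a
    · have : {p | p < a + 1 ∧ ¬ sk p} = {p | p < a ∧ ¬ sk p} := by
        ext p
        simp only [Set.mem_ofPred_eq]
        refine ⟨fun hp => ⟨lt_of_le_of_ne (Nat.lt_succ_iff.1 hp.1) ?_, hp.2⟩,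
          fun hp => ⟨hp.1.trans (Nat.lt_succ_self a), hp.2⟩⟩
        rintro rfl
        exact hp.2 h
      rw [this, pivotInv, if_pos h, mul_zero, zero_mul, sub_zero]
    · have : {p | p < a + 1 ∧ ¬ sk p} = {p | p < a ∧ ¬ sk p} ∪ {a} := by
        ext p
        simp only [Set.mem_ofPred_eq, Set.mem_union, Set.mem_singleton_iff]
        constructor
        · rintro ⟨hp, hs⟩
          rcases Nat.lt_succ_iff_lt_or_eq.1 hp with hp | hp
          · exact Or.inl ⟨hp, hs⟩
          · exact Or.inr hp
        · rintro (⟨hp, hs⟩ | rfl)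
          · exact ⟨hp.trans (Nat.lt_succ_self a), hs⟩
          · exact ⟨Nat.lt_succ_self p, h⟩
      rw [this, Set.image_union, Set.image_singleton, Submodule.span_union,
        starProjection_orthogonal_sup_span, starProjection_orthogonal_sup_span]
      set P := (Submodule.span ℝ (x '' {p | p < a ∧ ¬ sk p}))ᗮ.starProjection with hP
      rw [eq_false h, inner_sub_left, inner_sub_right, inner_sub_right, inner_smul_left,
        inner_smul_right, inner_smul_right, inner_smul_left, pivotInv, if_neg not_false, real_inner_comm (P (x a)) (P (x b))]
      by_cases hz : P (x a) = 0
      · simp [hz]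
      · have hpos : 0 < inner ℝ (P (x a)) (P (x a)) := real_inner_self_pos.2 hz
        rw [if_pos hpos]
        field_simp
        ring

/-- The set of the nodes on a list, except for `i` and `x`. -/
def listSet {n : ℕ} (i x : ℕ) (b : ℕ → ℕ) (L : ℕ) : Finset (Fin n) :=
  open Classical in Finset.univ.filter fun j => (j : ℕ) ≠ i ∧ (j : ℕ) ≠ x ∧ ∃ p < L, b p = j

theorem mem_listSet {n : ℕ} {i x : ℕ} {b : ℕ → ℕ} {L : ℕ} {j : Fin n} :
    j ∈ listSet i x b L ↔ (j : ℕ) ≠ i ∧ (j : ℕ) ≠ x ∧ ∃ p < L, b p = j := by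
  simp [listSet]

/-- The Gram matrix of the columns on a list. -/
noncomputable def listGram {n k : ℕ} (X : Sample k n) (b : ℕ → ℕ) (p q : ℕ) : ℝ :=
  if h : b p < n ∧ b q < n then inner ℝ (stdCols X ⟨b p, h.1⟩) (stdCols X ⟨b q, h.2⟩) else 0

/-- The list may repeat nodes and contain `i` or `x`: repetitions produce zero pivots, while `i` and
`x` are skipped. -/
theorem schur_listGram {n k : ℕ} (X : Sample k n) (i : Fin n) (x : ℕ) (b : ℕ → ℕ) (L : ℕ)
    (hb : ∀ p < L, b p < n) (hi : b L = i) :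
    schur (listGram X b) (fun p => b p = i ∨ b p = x) L L L = rss X i (listSet i x b L) := by
  set y : ℕ → EuclideanSpace ℝ (Fin k) := fun p =>
    if h : b p < n then stdCols X ⟨b p, h⟩ else 0 with hy
  have hM : listGram X b = fun p q => inner ℝ (y p) (y q) := by
    funext p q
    by_cases h1 : b p < n <;> by_cases h2 : b q < n <;> simp [listGram, hy, h1, h2]
  have hL : y L = stdCols X i := by
    simp [hy, hi]
  have himg : y '' {p | p < L ∧ ¬ (b p = i ∨ b p = x)} =
      stdCols X '' (listSet (n := n) i x b L : Finset (Fin n)) := by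
    ext v
    simp only [Set.mem_image, Set.mem_ofPred_eq, Finset.mem_coe, mem_listSet, not_or]
    constructor
    · rintro ⟨p, ⟨hp, h1, h2⟩, rfl⟩
      exact ⟨⟨b p, hb p hp⟩, ⟨h1, h2, p, hp, rfl⟩, by simp [hy, hb p hp]⟩
    · rintro ⟨j, ⟨h1, h2, p, hp, hj⟩, rfl⟩
      exact ⟨p, ⟨hp, by rw [hj]; exact h1, by rw [hj]; exact h2⟩, by simp [hy, hj]⟩
  rw [hM, schur_eq_inner, himg, hL, real_inner_self_eq_norm_sq]
  rfl

end Elimination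

end GGM

namespace GGM

/-! ### The program that computes a squared distance -/

section Distance

/-- A program which does nothing of interest. -/
def skipP : Prog := .instr (.nconst 63 0)

/-- Run `p` if the registers `x` and `y` differ. -/
def ifNe (x y : ℕ) (p : Prog) : Prog := .ite (.nlt x y) p (.ite (.nlt y x) p skipP)

theorem Reach.ifNe {x y : ℕ} {p : Prog} {s : State} {T : ℕ} {Q : State → Prop} (hT : 1 ≤ T)
    (h : s.nreg x ≠ s.nreg y → Reach p s T Q) (h' : s.nreg x = s.nreg y → Q (s.setN 63 0)) :
    Reach (ifNe x y p) s (T + 2) Q := by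
  refine (Reach.ite (T := T + 1) (fun hb => (h (ne_of_lt hb)).mono (by omega) fun _ _ h => h)
    fun hb => ?_)
  refine Reach.ite (fun hb' => h (ne_of_gt hb')) fun hb' => ?_
  exact ⟨1, _, Runs.instr _ s, hT, h' (le_antisymm (not_lt.1 hb') (not_lt.1 hb))⟩

/-- The content of the registers and of the part of the memory which is set up once. -/
structure Env {n k : ℕ} (X₁ X₂ : Sample k n) (d : ℕ) (ν : ℝ) (s : State) : Prop where
  reg0 : s.nreg 0 = n
  reg2 : s.nreg 2 = d
  reg3 : s.nreg 3 = 1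
  reg4 : s.nreg 4 = n * (n + 1)
  reg5 : s.nreg 5 = s.nreg 4 + n
  reg6 : s.nreg 6 = s.nreg 5 + (2 * d + 1)
  reg8 : s.nreg 8 = s.nreg 7 + n * n
  reg9 : s.nreg 9 = s.nreg 8 + n * n
  reg10 : s.nreg 10 = 2 * d + 1
  reg11 : s.nreg 11 = (2 * d + 1) * (2 * d + 1)
  reg13 : s.nreg 13 = n + 1
  reg14 : s.nreg 14 = 2 * d
  reg15 : s.nreg 15 = d + 1
  rreg0 : s.rreg 0 = ν
  rows : ∀ a < n, s.nmem (s.nreg 4 + a) = a * n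
  gram₁ : ∀ a b : Fin n, s.rmem (s.nreg 7 + (a * n + b)) = inner ℝ (stdCols X₁ a) (stdCols X₁ b)
  gram₂ : ∀ a b : Fin n, s.rmem (s.nreg 8 + (a * n + b)) = inner ℝ (stdCols X₂ a) (stdCols X₂ b)

theorem mul_add_lt_mul {a b m n : ℕ} (ha : a < m) (hb : b < n) : a * n + b < m * n :=
  calc a * n + b < a * n + n := by omega
    _ = (a + 1) * n := (Nat.succ_mul a n).symm
    _ ≤ m * n := Nat.mul_le_mul_right n ha

/-- Apart from registers, the environment consists of the multiples of `n` in the natural number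
memory, between the addresses in registers `4` and `5`, and of the Gram matrices below the address
in register `9` of the real memory. The output below register `4`, the buffer from register `5`, the
candidates from register `6` and the real scratch space from register `9` may change freely. -/
theorem Env.congr {n k : ℕ} {X₁ X₂ : Sample k n} {d : ℕ} {ν : ℝ} {s s' : State}
    (h : Env X₁ X₂ d ν s) (h1 : ∀ x < 16, s'.nreg x = s.nreg x) (h2 : s'.rreg 0 = s.rreg 0)
    (h3 : ∀ a, s.nreg 4 ≤ a → a < s.nreg 5 → s'.nmem a = s.nmem a)
    (h4 : ∀ a < s.nreg 9, s'.rmem a = s.rmem a) : Env X₁ X₂ d ν s' := by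
  have e (x : ℕ) (hx : x < 16 := by decide) := h1 x hx
  have hg (a b : Fin n) : (a : ℕ) * n + b < n * n := mul_add_lt_mul a.2 b.2
  have e9 := h.reg9
  have e8 := h.reg8
  have e5 := h.reg5
  constructor
  case rows =>
    intro a ha
    rw [e 4, h3 _ (by omega) (by omega)]
    exact h.rows a ha
  case gram₁ =>
    intro a b
    have := hg a b
    rw [e 7, h4 _ (by omega)]
    exact h.gram₁ a b
  case gram₂ =>
    intro a b
    have := hg a b
    rw [e 8, h4 _ (by omega)]
    exact h.gram₂ a b
  case rreg0 => rw [h2, h.rreg0]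
  all_goals simp only [e 0, e 2, e 3, e 4, e 5, e 6, e 7, e 8, e 9, e 10, e 11, e 13, e 14, e 15]
  exacts [h.reg0, h.reg2, h.reg3, h.reg4, h.reg5, h.reg6, h.reg8, h.reg9, h.reg10, h.reg11,
    h.reg13, h.reg14, h.reg15]

/-- The position of an entry in the sequence of matrices. -/
def idx (W a b c : ℕ) : ℕ := a * (W * W) + b * W + c

theorem idx_succ (W a b c : ℕ) : idx W a b (c + 1) = idx W a b c + 1 := rfl

theorem idx_row (W a b : ℕ) : idx W a b W = idx W a (b + 1) 0 := by
  simp only [idx]; ring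

theorem idx_layer (W a : ℕ) : idx W a W 0 = idx W (a + 1) 0 0 := by
  simp only [idx]; ring

/-- The layers of the elimination lie one behind the other, so what is read from an earlier layer
has been written already and is never overwritten. -/
theorem idx_lt (W : ℕ) {a b c a' : ℕ} (hb : b < W) (hc : c < W) (ha : a < a') (b' c' : ℕ) :
    idx W a b c < idx W a' b' c' := by
  have h1 := mul_add_lt_mul hb hc
  have h2 := mul_add_lt_mul ha h1
  simp only [idx]
  omega

/-- The sequence of all entries. -/
noncomputable def entries (R : ℕ → ℕ → ℕ → ℝ) (W q : ℕ) : ℝ :=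
  R (q / (W * W)) (q % (W * W) / W) (q % W)

theorem entries_idx (R : ℕ → ℕ → ℕ → ℝ) {W a b c : ℕ} (hb : b < W) (hc : c < W) :
    entries R W (idx W a b c) = R a b c := by
  have h1 := mul_add_lt_mul hb hc
  have e1 : idx W a b c / (W * W) = a := by
    rw [idx, add_assoc, mul_comm a, Nat.mul_add_div (by omega), Nat.div_eq_of_lt h1, add_zero]
  have e2 : idx W a b c % (W * W) = b * W + c := by
    rw [idx, add_assoc, mul_comm a, Nat.mul_add_mod, Nat.mod_eq_of_lt h1]
  have e3 : idx W a b c % W = c := by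
    rw [idx, ← mul_assoc, ← add_mul, mul_comm, Nat.mul_add_mod, Nat.mod_eq_of_lt hc]
  rw [entries, e1, e2, e3, mul_comm b, Nat.mul_add_div (by omega), Nat.div_eq_of_lt hc, add_zero]

/-- In the state `s`, the first `P` entries of the sequence `F` have been written. -/
structure Filled (s₀ : State) (F : ℕ → ℝ) (P : ℕ) (s : State) : Prop where
  nreg : ∀ x < 20, s.nreg x = s₀.nreg x
  nmem : s.nmem = s₀.nmem
  ptr : s.nreg 20 = s₀.nreg 9 + P
  done : ∀ q < P, s.rmem (s₀.nreg 9 + q) = F q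
  below : ∀ a < s₀.nreg 9, s.rmem a = s₀.rmem a

theorem Filled.congr {s₀ s s' : State} {F : ℕ → ℝ} {P : ℕ} (h : Filled s₀ F P s)
    (h1 : ∀ x ≤ 20, s'.nreg x = s.nreg x) (h2 : s'.nmem = s.nmem) (h3 : s'.rmem = s.rmem) :
    Filled s₀ F P s' :=
  ⟨fun x hx => (h1 x (by omega)).trans (h.nreg x hx), h2.trans h.nmem,
    (h1 20 (by omega)).trans h.ptr, by rw [h3]; exact h.done, by rw [h3]; exact h.below⟩

theorem Filled.write {s₀ s s' : State} {F : ℕ → ℝ} {P : ℕ} (h : Filled s₀ F P s)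
    (h1 : ∀ x < 20, s'.nreg x = s.nreg x) (h2 : s'.nmem = s.nmem)
    (h3 : s'.nreg 20 = s.nreg 20 + 1) (h4 : s'.rmem = Function.update s.rmem (s.nreg 20) (F P)) :
    Filled s₀ F (P + 1) s' := by
  refine ⟨fun x hx => (h1 x hx).trans (h.nreg x hx), h2.trans h.nmem, by rw [h3, h.ptr, add_assoc],
    fun q hq => ?_, fun a ha => ?_⟩
  · rw [h4, h.ptr, Function.update_apply]
    split_ifs with he
    · rw [show q = P by omega]
    · exact h.done q (by omega)
  · rw [h4, h.ptr, Function.update_of_ne (by omega)]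
    exact h.below a ha

/-- Copying one entry of the Gram matrix. -/
def fillEntry : Prog :=
  blk (.nadd 24 5 23) [.nload 24 24, .nadd 24 22 24, .rload 2 24, .rstore 20 2, .nadd 20 20 3]

/-- Copying one row of the Gram matrix. -/
def fillRow : Prog :=
  .seq (blk (.nadd 22 5 21) [.nload 22 22, .nadd 22 4 22, .nload 22 22, .nadd 22 16 22])
    (forP 23 10 fillEntry)

/-- Copying the Gram matrix of the nodes in the buffer. -/
def fillMatrix : Prog :=
  .seq (blk (.nconst 20 0) [.nadd 20 20 9]) (forP 21 10 fillRow)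

variable {n k : ℕ} {X₁ X₂ X : Sample k n} {d : ℕ} {ν : ℝ}

/-- The register `16` holds the address of the Gram matrix of the sample set `X`. -/
structure GramAt (X : Sample k n) (s : State) : Prop where
  le : s.nreg 16 + n * n ≤ s.nreg 9
  gram : ∀ a b : Fin n, s.rmem (s.nreg 16 + (a * n + b)) = inner ℝ (stdCols X a) (stdCols X b)

theorem reach_fillEntry {s₀ s : State} (hE : Env X₁ X₂ d ν s₀) (hG : GramAt X s₀)
    (hb : ∀ p < 2 * d + 1, s₀.nmem (s₀.nreg 5 + p) < n)
    {b c : ℕ} (hb' : b < 2 * d + 1) (hc' : c < 2 * d + 1) (hc : s.nreg 23 = c)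
    (h22 : s.nreg 22 = s₀.nreg 16 + s₀.nmem (s₀.nreg 5 + b) * n) {R : ℕ → ℕ → ℕ → ℝ}
    (hR : R 0 = listGram X fun p => s₀.nmem (s₀.nreg 5 + p))
    (hI : Filled s₀ (entries R (2 * d + 1)) (idx (2 * d + 1) 0 b c) s) :
    Reach fillEntry s 6 fun s' =>
      Filled s₀ (entries R (2 * d + 1)) (idx (2 * d + 1) 0 b (c + 1)) (s'.setN 23 (c + 1)) := by
  refine (Reach.blk _ _ ?_).mono (by simp) fun _ _ h => h
  have h1 := mul_add_lt_mul (hb b hb') (hb c hc')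
  have hle := hG.le
  have hg := hG.gram ⟨_, hb b hb'⟩ ⟨_, hb c hc'⟩
  rw [idx_succ]
  refine hI.write (fun x hx => ?_) ?_ ?_ ?_
  · have : x ≠ 20 ∧ x ≠ 23 ∧ x ≠ 24 := by omega
    simp [Instr.exec, State.setN, this]
  · simp [Instr.exec, State.setN]
  · simp [Instr.exec, State.setN, hI.nreg 3, hE.reg3]
  · rw [entries_idx R hb' hc', hR, listGram, dif_pos ⟨hb b hb', hb c hc'⟩, ← hg]
    simp only [Instr.exec, State.setN, Function.update_apply, List.foldl]
    -- The address uses the tabulated multiple of `n`, since the machine has no multiplication of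
    -- natural numbers.
    simp only [Nat.reduceEqDiff, if_false, if_true, hI.nreg 5 (by decide), hI.nmem, hc, h22]
    rw [add_assoc, hI.below _ (by omega)]

theorem reach_fillRow {s₀ s : State} (hE : Env X₁ X₂ d ν s₀) (hG : GramAt X s₀)
    (hb : ∀ p < 2 * d + 1, s₀.nmem (s₀.nreg 5 + p) < n)
    {b : ℕ} (hb' : b < 2 * d + 1) (h21 : s.nreg 21 = b) {R : ℕ → ℕ → ℕ → ℝ}
    (hR : R 0 = listGram X fun p => s₀.nmem (s₀.nreg 5 + p))
    (hI : Filled s₀ (entries R (2 * d + 1)) (idx (2 * d + 1) 0 b 0) s) :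
    Reach fillRow s (5 + ((2 * d + 1) * 8 + 2)) fun s' =>
      Filled s₀ (entries R (2 * d + 1)) (idx (2 * d + 1) 0 (b + 1) 0) (s'.setN 21 (b + 1)) := by
  refine Reach.blk_seq (fun s' => Filled s₀ (entries R (2 * d + 1)) (idx (2 * d + 1) 0 b 0) s' ∧
    s'.nreg 22 = s₀.nreg 16 + s₀.nmem (s₀.nreg 5 + b) * n)
    rfl ⟨?_, ?_⟩ ?_
  · refine hI.congr (fun x hx => ?_) ?_ ?_
    · have : x ≠ 22 := by omega
      simp [Instr.exec, this]
    · simp [Instr.exec]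
    · simp [Instr.exec]
  · simp [Instr.exec, hI.nreg 5, hI.nreg 4, hI.nreg 16, hI.nmem, h21, hE.rows _ (hb b hb')]
  · rintro s₁ - ⟨h1, h2⟩
    refine Reach.forP (m := 2 * d + 1) (T := 6) (fun c s' => Filled s₀ (entries R (2 * d + 1))
      (idx (2 * d + 1) 0 b c) s') (by decide) ((h1.nreg 10 (by decide)).trans hE.reg10)
      ((h1.nreg 3 (by decide)).trans hE.reg3) ?_ ?_ ?_
    · refine h1.congr (fun x hx => ?_) rfl rfl
      have : x ≠ 23 := by omega
      simp [State.setN, this]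
    · intro c s₂ hc h23 hf h3
      exact (reach_fillEntry hE hG hb hb' hc h23 ((hf.nreg 22 (by decide)).trans h2) hR h3).mono
        le_rfl fun _ _ h _ => h
    · intro s₂ hf h3
      rw [← idx_row]
      refine h3.congr (fun x hx => ?_) rfl rfl
      have : x ≠ 21 := by omega
      simp [State.setN, this]

theorem reach_fillMatrix {s₀ : State} (hE : Env X₁ X₂ d ν s₀) (hG : GramAt X s₀)
    (hb : ∀ p < 2 * d + 1, s₀.nmem (s₀.nreg 5 + p) < n) {R : ℕ → ℕ → ℕ → ℝ}
    (hR : R 0 = listGram X fun p => s₀.nmem (s₀.nreg 5 + p)) :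
    Reach fillMatrix s₀ (2 + ((2 * d + 1) * (5 + ((2 * d + 1) * 8 + 2) + 2) + 2)) fun s' =>
      Filled s₀ (entries R (2 * d + 1)) (idx (2 * d + 1) 1 0 0) s' := by
  refine Reach.blk_seq (fun s' => Filled s₀ (entries R (2 * d + 1)) 0 s')
    rfl ⟨fun x hx => ?_, ?_, ?_, ?_, ?_⟩ ?_
  · have : x ≠ 20 := by omega
    simp [Instr.exec, this]
  · simp [Instr.exec]
  · simp [Instr.exec]
  · simp
  · simp [Instr.exec]
  · rintro s₁ - h1
    refine Reach.forP (m := 2 * d + 1) (fun b s' => Filled s₀ (entries R (2 * d + 1))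
      (idx (2 * d + 1) 0 b 0) s') (by decide) ((h1.nreg 10 (by decide)).trans hE.reg10)
      ((h1.nreg 3 (by decide)).trans hE.reg3) ?_ ?_ ?_
    · have e : idx (2 * d + 1) 0 0 0 = 0 := by simp [idx]
      rw [e]
      refine h1.congr (fun x hx => ?_) rfl rfl
      have : x ≠ 21 := by omega
      simp [State.setN, this]
    · intro b s₂ hb' h21 hf h3
      exact (reach_fillRow hE hG hb hb' h21 hR h3).mono le_rfl fun _ _ h _ => h
    · intro s₂ hf h3
      rwa [← idx_layer]

/-- Elimination in one entry. -/
def elimEntry : Prog :=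
  blk (.nadd 24 26 31) [.rload 6 24, .rmul 6 5 6, .rload 7 25, .rsub 7 7 6, .rstore 20 7,
    .nadd 20 20 3, .nadd 25 25 3]

/-- Elimination in one row. -/
def elimRow : Prog :=
  .seq (blk (.nadd 24 26 30) [.rload 5 24, .rmul 5 5 4]) (forP 31 10 elimEntry)

/-- The inverse of the pivot. -/
def elimPivot : Prog :=
  .seq (blk (.nadd 28 5 27) [.nload 28 28, .nadd 29 26 27, .rload 3 29, .rconst 4 0])
    (ifNe 28 17 (ifNe 28 18 (.ite (.rlt 4 3) (blk (.rconst 8 1) [.rdiv 4 8 3]) skipP)))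

/-- Elimination of one row. -/
def elimLayer : Prog :=
  .seq elimPivot (.seq (forP 30 10 elimRow) (blk (.nadd 26 26 11) [.nadd 26 26 10]))

/-- The squared distance of the last column in the buffer from the span of the others. -/
def distP : Prog :=
  .seq fillMatrix (.seq (blk (.nconst 25 0) [.nadd 25 25 9, .nconst 26 0, .nadd 26 26 9])
    (.seq (forP 27 14 elimLayer) (blk (.nadd 24 26 14) [.rload 1 24])))

/-- In the state `s`, the elimination is about to write the entry `b`, `c` of the layer `a + 1`. -/
structure Eliminating (s₀ : State) (R : ℕ → ℕ → ℕ → ℝ) (d a b c : ℕ) (s : State) : Prop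
    extends Filled s₀ (entries R (2 * d + 1)) (idx (2 * d + 1) (a + 1) b c) s where
  src : s.nreg 25 = s₀.nreg 9 + idx (2 * d + 1) a b c
  row : s.nreg 26 = s₀.nreg 9 + idx (2 * d + 1) a a 0

theorem Eliminating.congr {s₀ s s' : State} {R : ℕ → ℕ → ℕ → ℝ} {a b c : ℕ}
    (h : Eliminating s₀ R d a b c s) (h1 : ∀ x ≤ 20, s'.nreg x = s.nreg x)
    (h25 : s'.nreg 25 = s.nreg 25) (h26 : s'.nreg 26 = s.nreg 26)
    (h2 : s'.nmem = s.nmem) (h3 : s'.rmem = s.rmem) : Eliminating s₀ R d a b c s' :=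
  ⟨h.toFilled.congr h1 h2 h3, h25.trans h.src, h26.trans h.row⟩

/-- Register `25` runs through layer `a` in step with the writing pointer `20` in layer a + 1, while
register `26` stays at the pivot row; by symmetry of the formula the column entry of the pivot is
also read from that row. -/
theorem reach_elimEntry {s₀ s : State} (hE : Env X₁ X₂ d ν s₀) {R : ℕ → ℕ → ℕ → ℝ} {v : ℝ}
    {a b c : ℕ} (ha : a < 2 * d) (hb : b < 2 * d + 1) (hc : c < 2 * d + 1)
    (hR : R (a + 1) b c = R a b c - R a a b * v * R a a c) (h31 : s.nreg 31 = c)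
    (h5 : s.rreg 5 = R a a b * v) (hI : Eliminating s₀ R d a b c s) :
    Reach elimEntry s 8 fun s' => Eliminating s₀ R d a b (c + 1) (s'.setN 31 (c + 1)) := by
  refine (Reach.blk _ _ ⟨?_, ?_, ?_⟩).mono (by simp) fun _ _ h => h
  · rw [idx_succ]
    refine hI.toFilled.write (fun x hx => ?_) ?_ ?_ ?_
    · have : x ≠ 20 ∧ x ≠ 24 ∧ x ≠ 25 ∧ x ≠ 31 := by omega
      simp [Instr.exec, State.setN, this]
    · simp [Instr.exec, State.setN]
    · simp [Instr.exec, State.setN, hI.nreg 3, hE.reg3]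
    · have e1 := hI.done _ (idx_lt (2 * d + 1) (by omega : a < 2 * d + 1) hc (Nat.lt_succ_self a) b c)
      have e2 := hI.done _ (idx_lt (2 * d + 1) hb hc (Nat.lt_succ_self a) b c)
      rw [entries_idx R (by omega) hc] at e1
      rw [entries_idx R hb hc] at e2
      have e3 : idx (2 * d + 1) a a 0 + c = idx (2 * d + 1) a a c := by simp [idx]
      rw [entries_idx R hb hc, hR]
      simp [Instr.exec, State.setN, hI.row, hI.src, h31, h5, add_assoc, e1, e2, e3]
  · simp [Instr.exec, State.setN, hI.nreg 3, hE.reg3, hI.src, idx_succ, add_assoc]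
  · simp [Instr.exec, State.setN, hI.row]

theorem reach_elimRow {s₀ s : State} (hE : Env X₁ X₂ d ν s₀) {R : ℕ → ℕ → ℕ → ℝ} {v : ℝ}
    {a b : ℕ} (ha : a < 2 * d) (hb : b < 2 * d + 1)
    (hR : ∀ b c, R (a + 1) b c = R a b c - R a a b * v * R a a c) (h30 : s.nreg 30 = b)
    (h4 : s.rreg 4 = v) (hI : Eliminating s₀ R d a b 0 s) :
    Reach elimRow s (3 + ((2 * d + 1) * 10 + 2)) fun s' =>
      Eliminating s₀ R d a (b + 1) 0 (s'.setN 30 (b + 1)) := by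
  refine Reach.blk_seq (fun s' => Eliminating s₀ R d a b 0 s' ∧ s'.rreg 5 = R a a b * v)
    rfl ⟨?_, ?_⟩ ?_
  · refine hI.congr (fun x hx => ?_) ?_ ?_ ?_ ?_
    · have : x ≠ 24 := by omega
      simp [Instr.exec, this]
    all_goals simp [Instr.exec]
  · have e1 := hI.done _ (idx_lt (2 * d + 1) (by omega : a < 2 * d + 1) hb (Nat.lt_succ_self a) b 0)
    rw [entries_idx R (by omega) hb] at e1
    have e3 : idx (2 * d + 1) a a 0 + b = idx (2 * d + 1) a a b := by simp [idx]
    simp [Instr.exec, hI.row, h30, h4, add_assoc, e3, e1]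
  · rintro s₁ - ⟨h1, h5⟩
    refine Reach.forP (m := 2 * d + 1) (T := 8) (fun c s' => Eliminating s₀ R d a b c s')
      (by decide) ((h1.nreg 10 (by decide)).trans hE.reg10)
      ((h1.nreg 3 (by decide)).trans hE.reg3) ?_ ?_ ?_
    · refine h1.congr (fun x hx => ?_) (by simp [State.setN]) (by simp [State.setN]) rfl rfl
      have : x ≠ 31 := by omega
      simp [State.setN, this]
    · intro c s₂ hc h31 hf h3
      exact (reach_elimEntry hE ha hb hc (hR b c) h31 ((hf.rreg 5 (by decide)).trans h5) h3).mono
        le_rfl fun _ _ h _ => h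
    · intro s₂ hf h3
      refine ⟨?_, ?_, ?_⟩
      · rw [← idx_row]
        refine h3.toFilled.congr (fun x hx => ?_) rfl rfl
        have : x ≠ 30 := by omega
        simp [State.setN, this]
      · rw [← idx_row]
        simp [State.setN, h3.src]
      · simp [State.setN, h3.row]

theorem reach_elimPivot {s₀ s : State} {R : ℕ → ℕ → ℕ → ℝ} {a : ℕ} (ha : a < 2 * d)
    (h27 : s.nreg 27 = a) (hI : Eliminating s₀ R d a 0 0 s) :
    Reach elimPivot s (5 + 7) fun s' => Eliminating s₀ R d a 0 0 s' ∧
      s'.rreg 4 = pivotInv (s₀.nmem (s₀.nreg 5 + a) = s₀.nreg 17 ∨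
        s₀.nmem (s₀.nreg 5 + a) = s₀.nreg 18) (R a a a) := by
  refine Reach.blk_seq (fun s' => Eliminating s₀ R d a 0 0 s' ∧
    s'.nreg 28 = s₀.nmem (s₀.nreg 5 + a) ∧ s'.rreg 3 = R a a a ∧ s'.rreg 4 = 0)
    rfl ⟨?_, ?_, ?_, ?_⟩ ?_
  · refine hI.congr (fun x hx => ?_) ?_ ?_ ?_ ?_
    · have : x ≠ 28 ∧ x ≠ 29 := by omega
      simp [Instr.exec, this]
    all_goals simp [Instr.exec]
  · simp [Instr.exec, hI.nreg 5, hI.nmem, h27]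
  · have e1 := hI.done _ (idx_lt (2 * d + 1) (by omega : a < 2 * d + 1)
      (by omega : a < 2 * d + 1) (Nat.lt_succ_self a) 0 0)
    rw [entries_idx R (by omega) (by omega)] at e1
    have e3 : idx (2 * d + 1) a a 0 + a = idx (2 * d + 1) a a a := by simp [idx]
    simp [Instr.exec, hI.row, h27, add_assoc, e3, e1]
  · simp [Instr.exec]
  · rintro s₁ - ⟨h1, h28, h3, h4⟩
    have hskip : Eliminating s₀ R d a 0 0 (s₁.setN 63 0) :=
      h1.congr (fun x hx => by simp [State.setN, show x ≠ 63 by omega]) (by simp [State.setN])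
        (by simp [State.setN]) rfl rfl
    have h17 := h1.nreg 17 (by decide)
    have h18 := h1.nreg 18 (by decide)
    refine Reach.ifNe (T := 5) (by decide) (fun hne => ?_) fun heq => ?_
    · refine Reach.ifNe (T := 3) (by decide) (fun hne' => ?_) fun heq => ?_
      · rw [h28, h17] at hne
        rw [h28, h18] at hne'
        have hor : ¬ (s₀.nmem (s₀.nreg 5 + a) = s₀.nreg 17 ∨
          s₀.nmem (s₀.nreg 5 + a) = s₀.nreg 18) := not_or.2 ⟨hne, hne'⟩
        refine Reach.ite (T := 2) (fun hpos => ?_) fun hpos => ?_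
        · simp only [Test.holds, h3, h4] at hpos
          refine (Reach.blk _ _ ⟨?_, ?_⟩).mono (by simp) fun _ _ h => h
          · exact h1.congr (fun x hx => by simp [Instr.exec]) rfl rfl rfl rfl
          · simp [Instr.exec, pivotInv, hor, hpos, h3]
        · simp only [Test.holds, h3, h4] at hpos
          refine ⟨1, _, Runs.instr _ s₁, by decide, hskip, ?_⟩
          simp [Instr.exec, pivotInv, hpos, h4]
      · rw [h28, h18] at heq
        exact ⟨hskip, by simp [State.setN, pivotInv, heq, h4]⟩
    · rw [h28, h17] at heq
      exact ⟨hskip, by simp [State.setN, pivotInv, heq, h4]⟩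

theorem reach_elimLayer {s₀ s : State} (hE : Env X₁ X₂ d ν s₀) {R : ℕ → ℕ → ℕ → ℝ} {a : ℕ}
    (ha : a < 2 * d) (hR : ∀ b c, R (a + 1) b c = R a b c -
      R a a b * pivotInv (s₀.nmem (s₀.nreg 5 + a) = s₀.nreg 17 ∨
        s₀.nmem (s₀.nreg 5 + a) = s₀.nreg 18) (R a a a) * R a a c)
    (h27 : s.nreg 27 = a) (hI : Eliminating s₀ R d a 0 0 s) :
    Reach elimLayer s
      (5 + 7 + (((2 * d + 1) * (3 + ((2 * d + 1) * 10 + 2) + 2) + 2) + 2)) fun s' =>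
      Eliminating s₀ R d (a + 1) 0 0 (s'.setN 27 (a + 1)) := by
  refine (reach_elimPivot ha h27 hI).seq ?_
  rintro s₁ hf₁ ⟨h1, h4⟩
  refine Reach.seq (Q₁ := fun s' => Eliminating s₀ R d a (2 * d + 1) 0 s')
    (Reach.forP (m := 2 * d + 1) (fun b s' => Eliminating s₀ R d a b 0 s') (by decide)
      ((h1.nreg 10 (by decide)).trans hE.reg10)
      ((h1.nreg 3 (by decide)).trans hE.reg3) ?_ ?_ ?_) ?_
  · refine h1.congr (fun x hx => ?_) (by simp [State.setN]) (by simp [State.setN]) rfl rfl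
    have : x ≠ 30 := by omega
    simp [State.setN, this]
  · intro b s₂ hb h30 hf h3
    exact (reach_elimRow hE ha hb hR h30 ((hf.rreg 4 (by decide)).trans h4) h3).mono
      le_rfl fun _ _ h _ => h
  · exact fun _ _ h => h
  · rintro s₂ - h2
    -- Adding W² + W with W = 2d + 1 leads from row `a` of layer `a` to row a + 1 of layer a + 1.
    refine (Reach.blk _ _ ⟨?_, ?_, ?_⟩).mono (by simp) fun _ _ h => h
    · rw [← idx_layer]
      refine h2.toFilled.congr (fun x hx => ?_) ?_ ?_
      · have : x ≠ 26 ∧ x ≠ 27 := by omega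
        simp [Instr.exec, State.setN, this]
      · simp [Instr.exec, State.setN]
      · simp [Instr.exec, State.setN]
    · rw [← idx_layer]
      simp [Instr.exec, State.setN, h2.src]
    · simp [Instr.exec, State.setN, h2.row, h2.nreg 11, h2.nreg 10, hE.reg11, hE.reg10, idx]
      ring

/-- The number of steps of the computation of a distance. -/
def distTime (d : ℕ) : ℕ :=
  (2 + ((2 * d + 1) * (5 + ((2 * d + 1) * 8 + 2) + 2) + 2)) + (4 +
    ((2 * d * (5 + 7 + (((2 * d + 1) * (3 + ((2 * d + 1) * 10 + 2) + 2) + 2) + 2) + 2) + 2) + 2))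

/-- The target `i` occupies the last place 2d of the buffer, behind the predictors. Register `18`
names a node to be left out; the value `n` means none. -/
theorem reach_distP {s : State} (hE : Env X₁ X₂ d ν s) (hG : GramAt X s)
    (hb : ∀ p < 2 * d + 1, s.nmem (s.nreg 5 + p) < n) {i : Fin n} (hi : s.nreg 17 = i)
    (hi' : s.nmem (s.nreg 5 + 2 * d) = i) :
    Reach distP s (distTime d) fun s' => (∀ a < s.nreg 9, s'.rmem a = s.rmem a) ∧
      s'.rreg 1 = rss X i (listSet i (s.nreg 18) (fun p => s.nmem (s.nreg 5 + p)) (2 * d)) := by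
  set R := schur (listGram X fun p => s.nmem (s.nreg 5 + p)) (fun p =>
    s.nmem (s.nreg 5 + p) = s.nreg 17 ∨ s.nmem (s.nreg 5 + p) = s.nreg 18) with hR
  have hres : R (2 * d) (2 * d) (2 * d) =
      rss X i (listSet i (s.nreg 18) (fun p => s.nmem (s.nreg 5 + p)) (2 * d)) := by
    rw [← schur_listGram X i _ _ _ (fun p hp => hb p (by omega)) hi', hR, hi]
  rw [← hres]
  refine (reach_fillMatrix hE hG hb (R := R) rfl).seq fun s₁ _ h1 => ?_
  refine Reach.blk_seq (fun s' => Eliminating s R d 0 0 0 s')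
    rfl ⟨?_, ?_, ?_⟩ ?_
  · refine h1.congr (fun x hx => ?_) ?_ ?_
    · have : x ≠ 25 ∧ x ≠ 26 := by omega
      simp [Instr.exec, this]
    · simp [Instr.exec]
    · simp [Instr.exec]
  · simp [Instr.exec, h1.nreg 9, idx]
  · simp [Instr.exec, h1.nreg 9, idx]
  intro s₂ _ h2
  refine Reach.seq (Q₁ := fun s' => Eliminating s R d (2 * d) 0 0 s')
    (Reach.forP (m := 2 * d) (fun a s' => Eliminating s R d a 0 0 s') (by decide)
      ((h2.nreg 14 (by decide)).trans hE.reg14)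
      ((h2.nreg 3 (by decide)).trans hE.reg3) ?_ ?_ ?_) ?_
  · refine h2.congr (fun x hx => ?_) (by simp [State.setN]) (by simp [State.setN]) rfl rfl
    have : x ≠ 27 := by omega
    simp [State.setN, this]
  · intro a s₃ ha h27 _ h3
    exact (reach_elimLayer hE ha (fun b c => rfl) h27 h3).mono le_rfl fun _ _ h _ => h
  · exact fun _ _ h => h
  · rintro s₃ - h3
    refine (Reach.blk _ _ ⟨fun a ha => ?_, ?_⟩).mono (by simp) fun _ _ h => h
    · simpa [Instr.exec] using h3.below a ha
    · have hlt : 2 * d < 2 * d + 1 := Nat.lt_succ_self _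
      have e1 := h3.done _ (idx_lt (2 * d + 1) hlt hlt (Nat.lt_succ_self (2 * d)) 0 0)
      rw [entries_idx R hlt hlt] at e1
      have e3 : idx (2 * d + 1) (2 * d) (2 * d) 0 + 2 * d =
        idx (2 * d + 1) (2 * d) (2 * d) (2 * d) := by simp [idx]
      simp [Instr.exec, h3.row, h3.nreg 14, hE.reg14, add_assoc, e3, e1]

end Distance

end GGM

namespace GGM

/-! ### Candidates and the enumeration of lists -/

section Search

variable {n k : ℕ}

/-- The set `T` is an optimal solution of the search with sparsity `r`, and none of its proper
subsets is. -/
structure IsCand (X : Sample k n) (i : Fin n) (r : ℕ) (T : Finset (Fin n)) : Prop where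
  notMem : i ∉ T
  card : T.card ≤ r
  le : ∀ T' : Finset (Fin n), i ∉ T' → T'.card ≤ r → rss X i T ≤ rss X i T'
  lt : ∀ T' ⊂ T, rss X i T < rss X i T'

/-- Minimality under inclusion survives the passage to the next sparsity: a retained candidate has
it already, and the proper subsets of a strictly better one have at most `r` elements, so they fit
no better than the old candidate. -/
theorem IsCand.of_le {X : Sample k n} {i : Fin n} {r : ℕ} {T T₀ : Finset (Fin n)}
    (h₀ : IsCand X i r T₀) (hi : i ∉ T) (hT : T.card ≤ r + 1) (hnew : T = T₀ ∨ rss X i T < rss X i T₀)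
    (hle : ∀ T' : Finset (Fin n), i ∉ T' → T'.card ≤ r + 1 → rss X i T ≤ rss X i T') :
    IsCand X i (r + 1) T := by
  refine ⟨hi, hT, hle, fun T' hT' => ?_⟩
  rcases hnew with rfl | hnew
  · exact h₀.lt T' hT'
  · have := Finset.card_lt_card hT'
    exact hnew.trans_le (h₀.le T' (fun h => hi (hT'.subset h)) (by omega))

theorem isCand_empty (X : Sample k n) (i : Fin n) : IsCand X i 0 ∅ := by
  refine ⟨by simp, by simp, fun T' _ h => ?_, fun T' h => absurd h (Finset.not_ssubset_empty T')⟩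
  rw [Finset.card_eq_zero.1 (Nat.le_zero.1 h)]

theorem notMem_listSet (i : Fin n) (x : ℕ) (b : ℕ → ℕ) (L : ℕ) : i ∉ listSet (n := n) i x b L := by
  simp [mem_listSet]

theorem listSet_congr {i x : ℕ} {b b' : ℕ → ℕ} {L : ℕ} (h : ∀ p < L, b p = b' p) :
    listSet (n := n) i x b L = listSet i x b' L := by
  ext j
  simp only [mem_listSet]
  refine and_congr_right fun _ => and_congr_right fun _ => ?_
  exact exists_congr fun p => and_congr_right fun hp => by rw [h p hp]

/-- Since `i` is dropped from the set of a list, it serves as padding; all lists can then have the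
same length in the buffer. -/
theorem listSet_pad {i x : ℕ} {b b' : ℕ → ℕ} {m L : ℕ} (hm : m ≤ L) (h : ∀ p < m, b p = b' p)
    (h' : ∀ p < L, m ≤ p → b p = i) : listSet (n := n) i x b L = listSet i x b' m := by
  ext j
  simp only [mem_listSet]
  refine and_congr_right fun hj => and_congr_right fun _ => ⟨?_, ?_⟩
  · rintro ⟨p, hp, hpj⟩
    by_cases hpm : p < m
    · exact ⟨p, hpm, (h p hpm).symm.trans hpj⟩
    · exact absurd ((h' p hp (by omega)).symm.trans hpj) (Ne.symm hj)
  · rintro ⟨p, hp, hpj⟩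
    exact ⟨p, by omega, (h p hp).trans hpj⟩

theorem card_listSet_le (i x : ℕ) (b : ℕ → ℕ) (L : ℕ) : (listSet (n := n) i x b L).card ≤ L := by
  classical
  have hsub : (listSet (n := n) i x b L).map Fin.valEmbedding ⊆ (Finset.range L).image b := by
    intro v hv
    obtain ⟨j, hj, rfl⟩ := Finset.mem_map.1 hv
    obtain ⟨p, hp, hpj⟩ := (mem_listSet.1 hj).2.2
    exact Finset.mem_image.2 ⟨p, Finset.mem_range.2 hp, hpj⟩
  have := Finset.card_le_card hsub
  rw [Finset.card_map] at this
  exact this.trans (Finset.card_image_le.trans_eq (Finset.card_range L))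

/-- The digits of `t` in base `n`. -/
def dig (n t p : ℕ) : ℕ := t / n ^ p % n

theorem dig_lt (hn : 0 < n) (t p : ℕ) : dig n t p < n := Nat.mod_lt _ hn

theorem dig_pow (hn : 0 < n) {r p : ℕ} (hp : p < r) : dig n (n ^ r) p = 0 := by
  rw [dig, Nat.pow_div hp.le hn]
  exact Nat.mod_eq_zero_of_dvd (dvd_pow_self n (by omega))

theorem dig_zero (n p : ℕ) : dig n 0 p = 0 := by simp [dig]

theorem dig_succ_of_not_dvd {t p : ℕ} (h : ¬ n ^ p ∣ t + 1) : dig n (t + 1) p = dig n t p := by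
  rw [dig, Nat.succ_div, if_neg h, add_zero, dig]

/-- When 1 is added to `t`, the carry reaches the place `p` exactly if n^p divides t + 1. -/
theorem dig_succ_of_dvd (hn : 0 < n) {t p : ℕ} (h : n ^ p ∣ t + 1) :
    dig n (t + 1) p = (if dig n t p + 1 < n then dig n t p + 1 else 0) ∧
      (n ^ (p + 1) ∣ t + 1 ↔ ¬ dig n t p + 1 < n) := by
  have e : (t + 1) / n ^ p = t / n ^ p + 1 := by rw [Nat.succ_div, if_pos h]
  have hdvd : n ^ (p + 1) ∣ t + 1 ↔ dig n (t + 1) p = 0 := by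
    rw [dig, pow_succ, ← Nat.dvd_iff_mod_eq_zero]
    obtain ⟨q, hq⟩ := h
    have hpos : 0 < n ^ p := by positivity
    rw [hq, Nat.mul_div_cancel_left _ hpos, Nat.mul_dvd_mul_iff_left hpos]
  have hlt := dig_lt hn t p
  have e2 : dig n (t + 1) p = if dig n t p + 1 < n then dig n t p + 1 else 0 := by
    have e3 : dig n (t + 1) p = (dig n t p + 1) % n := by
      rw [dig, e, ← Nat.mod_add_mod, dig]
    rw [e3]
    split_ifs with hc
    · exact Nat.mod_eq_of_lt hc
    · rw [show dig n t p + 1 = n by omega, Nat.mod_self]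
  refine ⟨e2, ?_⟩
  rw [hdvd, e2]
  split_ifs with hc <;> simp [hc]

theorem exists_dig_eq {m : ℕ} {f : ℕ → ℕ} (hf : ∀ p < m, f p < n) :
    ∃ t < n ^ m, ∀ p < m, dig n t p = f p := by
  refine ⟨finFunctionFinEquiv (fun p : Fin m => (⟨f p, hf p p.2⟩ : Fin n)), Fin.is_lt _,
    fun p hp => ?_⟩
  have h := finFunctionFinEquiv_symm_apply_val (n := m) (m := n)
    (finFunctionFinEquiv (fun p : Fin m => (⟨f p, hf p p.2⟩ : Fin n))) ⟨p, hp⟩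
  rw [Equiv.symm_apply_apply] at h
  exact h.symm

/-- Every set of at most `m` nodes occurs in the enumeration of the lists of length `m`. -/
theorem exists_listSet_dig_eq {i : Fin n} {m : ℕ} {T : Finset (Fin n)} (hi : i ∉ T)
    (hT : T.card ≤ m) : ∃ t < n ^ m, listSet i n (dig n t) m = T := by
  set e := T.equivFin.symm with he
  -- The places beyond the cardinality of `T` are filled with `i`.
  set f : ℕ → ℕ := fun p => if h : p < T.card then ((e ⟨p, h⟩ : T) : Fin n) else i with hf
  obtain ⟨t, ht, h⟩ := exists_dig_eq (n := n) (m := m) (f := f) fun p _ => by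
    simp only [hf]
    split_ifs
    · exact Fin.is_lt _
    · exact i.2
  refine ⟨t, ht, ?_⟩
  rw [listSet_congr h]
  ext j
  rw [mem_listSet]
  constructor
  · rintro ⟨h1, -, p, hp, hpj⟩
    simp only [hf] at hpj
    split_ifs at hpj with hc
    · rw [← Fin.ext hpj]
      exact (e ⟨p, hc⟩).2
    · exact absurd hpj.symm h1
  · intro hj
    refine ⟨fun h => hi (Fin.ext h ▸ hj), j.2.ne, T.equivFin ⟨j, hj⟩,
      lt_of_lt_of_le (Fin.is_lt _) hT, ?_⟩
    simp [hf, he]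

end Search

end GGM

namespace GGM

/-! ### Trying one list -/

section SearchProgram

/-- Copying `d` cells of the natural number memory, from the address in the register `src` to the
address in the register `dst`. -/
def copyP (src dst : ℕ) : Prog :=
  forP 35 2 (blk (.nadd 41 src 35) [.nload 42 41, .nadd 41 dst 35, .nstore 41 42])

theorem reach_copyP {src dst : ℕ} {s : State} {d : ℕ} (h2 : s.nreg 2 = d) (h3 : s.nreg 3 = 1)
    (hsrc : src ≠ 35 ∧ src ≠ 41 ∧ src ≠ 42) (hdst : dst ≠ 35 ∧ dst ≠ 41 ∧ dst ≠ 42)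
    (hdisj : s.nreg src + d ≤ s.nreg dst ∨ s.nreg dst + d ≤ s.nreg src) :
    Reach (copyP src dst) s (d * 6 + 2) fun s' =>
      (∀ p < d, s'.nmem (s.nreg dst + p) = s.nmem (s.nreg src + p)) ∧
      ∀ a, (a < s.nreg dst ∨ s.nreg dst + d ≤ a) → s'.nmem a = s.nmem a := by
  obtain ⟨hs1, hs2, hs3⟩ := hsrc
  obtain ⟨hd1, hd2, hd3⟩ := hdst
  refine Reach.forP (m := d) (T := 4) (fun j s' =>
    (∀ p < j, s'.nmem (s.nreg dst + p) = s.nmem (s.nreg src + p)) ∧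
      ∀ a, (a < s.nreg dst ∨ s.nreg dst + j ≤ a) → s'.nmem a = s.nmem a)
    (by simp [blk, Prog.nw, Instr.nw]) h2 h3 ⟨by simp, by simp [State.setN]⟩ ?_
    fun _ _ h => h
  intro j s' hj h35 hf ⟨h1, h4⟩
  have e1 : s'.nreg src = s.nreg src := hf.nreg src (by
    simp [forP, blk, Prog.nw, Instr.nw, hs1, hs2, hs3])
  have e2 : s'.nreg dst = s.nreg dst := hf.nreg dst (by
    simp [forP, blk, Prog.nw, Instr.nw, hd1, hd2, hd3])
  have hmem : ∀ s'' : State, s''.nmem = Function.update s'.nmem (s.nreg dst + j)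
      (s.nmem (s.nreg src + j)) →
      (∀ p < j + 1, s''.nmem (s.nreg dst + p) = s.nmem (s.nreg src + p)) ∧
      ∀ a, (a < s.nreg dst ∨ s.nreg dst + (j + 1) ≤ a) → s''.nmem a = s.nmem a := by
    intro s'' hs
    constructor
    · intro p hp
      rw [hs, Function.update_apply]
      split_ifs with he
      · rw [show p = j by omega]
      · exact h1 p (by omega)
    · intro a ha
      rw [hs, Function.update_of_ne (by omega)]
      exact h4 a (by omega)
  refine (Reach.blk _ _ (hmem _ ?_)).mono (by simp) fun _ _ h _ => h
  have e3 : s'.nmem (s.nreg src + j) = s.nmem (s.nreg src + j) := h4 _ (by omega)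
  simp [Instr.exec, State.setN, h35, e1, e2, e3, hd2, hd3]

/-- One step of the addition of `1` to the number whose digits are in the buffer. -/
def nextDigit : Prog :=
  .ite (.nlt 40 3) (.seq (blk (.nadd 41 5 35) [.nload 42 41, .nadd 42 42 3])
    (.ite (.nlt 42 0) (blk (.nstore 41 42) [.nconst 40 1]) (blk (.nconst 42 0) [.nstore 41 42])))
    skipP

/-- Addition of `1` to the number whose digits are in the buffer. -/
def nextP : Prog := .seq (blk (.nconst 40 0) []) (forP 35 38 nextDigit)

/-- Register `40` contains 0 as long as a carry is pending and 1 afterwards. -/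
theorem reach_nextDigit {s : State} {n t j : ℕ} (hn : 0 < n) (h0 : s.nreg 0 = n)
    (h3 : s.nreg 3 = 1) (h35 : s.nreg 35 = j) (h40 : s.nreg 40 = if n ^ j ∣ t + 1 then 0 else 1)
    (hdig : s.nmem (s.nreg 5 + j) = dig n t j) :
    Reach nextDigit s (3 + 3 + 1) fun s' =>
      (s'.nreg 40 = if n ^ (j + 1) ∣ t + 1 then 0 else 1) ∧
      s'.nmem = Function.update s.nmem (s.nreg 5 + j) (dig n (t + 1) j) := by
  by_cases hd : n ^ j ∣ t + 1
  · obtain ⟨e1, e2⟩ := dig_succ_of_dvd hn hd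
    rw [if_pos hd] at h40
    refine Reach.ite (T := 3 + 3) (fun _ => ?_) fun hc => absurd (by simp [Test.holds, h3, h40]) hc
    refine Reach.blk_seq (fun s' => s'.nreg 0 = n ∧ s'.nreg 40 = 0 ∧ s'.nreg 41 = s.nreg 5 + j ∧
      s'.nreg 42 = dig n t j + 1 ∧ s'.nmem = s.nmem) rfl ?_ ?_
    · simp [Instr.exec, h0, h3, h35, h40, hdig]
    · rintro s₁ - ⟨g0, g40, g41, g42, gm⟩
      refine Reach.ite (T := 2) (fun hlt => ?_) fun hlt => ?_
      · simp only [Test.holds, g42, g0] at hlt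
        refine (Reach.blk _ _ ⟨?_, ?_⟩).mono (by simp) fun _ _ h => h
        · simp [Instr.exec, e2, hlt]
        · simp [Instr.exec, g41, g42, gm, e1, hlt]
      · simp only [Test.holds, g42, g0] at hlt
        refine (Reach.blk _ _ ⟨?_, ?_⟩).mono (by simp) fun _ _ h => h
        · rw [if_pos (e2.2 hlt)]
          simp [Instr.exec, g40]
        · simp [Instr.exec, g41, gm, e1, hlt]
  · rw [if_neg hd] at h40
    refine Reach.ite (T := 3 + 3) (fun hc => absurd hc (by simp [Test.holds, h3, h40])) fun _ => ?_
    refine ⟨1, _, Runs.instr _ s, by decide, ?_, ?_⟩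
    · have : ¬ n ^ (j + 1) ∣ t + 1 := fun h => hd ((pow_dvd_pow n (Nat.le_succ j)).trans h)
      simp [Instr.exec, this, h40]
    · rw [dig_succ_of_not_dvd hd, ← hdig, Function.update_eq_self]
      rfl

theorem reach_nextP {s : State} {n t m d : ℕ} (hn : 0 < n) (h0 : s.nreg 0 = n)
    (h3 : s.nreg 3 = 1) (h38 : s.nreg 38 = m) (hm : m ≤ d)
    (hdig : ∀ p < m, s.nmem (s.nreg 5 + p) = dig n t p) :
    Reach nextP s (1 + (d * 9 + 2)) fun s' =>
      (∀ p < m, s'.nmem (s.nreg 5 + p) = dig n (t + 1) p) ∧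
      ∀ a, (a < s.nreg 5 ∨ s.nreg 5 + m ≤ a) → s'.nmem a = s.nmem a := by
  refine (Reach.blk_seq (T₀ := 1) (T := m * 9 + 2) (fun s' => s' = s.setN 40 0) rfl rfl ?_).mono
    (by gcongr) fun _ _ h => h
  rintro s₁ - rfl
  refine Reach.forP (m := m) (T := 7) (fun j s' =>
    (s'.nreg 40 = if n ^ j ∣ t + 1 then 0 else 1) ∧
    (∀ p < j, s'.nmem (s.nreg 5 + p) = dig n (t + 1) p) ∧
      ∀ a, (a < s.nreg 5 ∨ s.nreg 5 + j ≤ a) → s'.nmem a = s.nmem a)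
    (by decide) (by simp [State.setN, h38]) (by simp [State.setN, h3])
    ⟨by simp [State.setN], by simp, by simp [State.setN]⟩ ?_ fun _ _ h => h.2
  rintro j s' hj h35 hf ⟨h40, h1, h4⟩
  have e0 : s'.nreg 0 = n := (hf.nreg 0 (by decide)).trans (by simp [State.setN, h0])
  have e3 : s'.nreg 3 = 1 := (hf.nreg 3 (by decide)).trans (by simp [State.setN, h3])
  have e5 : s'.nreg 5 = s.nreg 5 := (hf.nreg 5 (by decide)).trans (by simp [State.setN])
  refine (reach_nextDigit (t := t) hn e0 e3 h35 h40 (by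
    rw [e5, h4 _ (by omega), hdig j hj])).mono (by decide) ?_
  rintro s'' - ⟨g40, gm⟩ -
  rw [e5] at gm
  refine ⟨by simpa [State.setN] using g40, fun p hp => ?_, fun a ha => ?_⟩
  · simp only [State.setN, gm, Function.update_apply]
    split_ifs with he
    · rw [show p = j by omega]
    · exact h1 p (by omega)
  · simp only [State.setN, gm]
    rw [Function.update_of_ne (by omega)]
    exact h4 a (by omega)

/-- The states `s₀` and `s` agree on what is set up once. -/
structure Same (s₀ s : State) : Prop where
  nreg : ∀ x < 16, s.nreg x = s₀.nreg x
  rreg : s.rreg 0 = s₀.rreg 0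
  nmem : ∀ a < s₀.nreg 5, s.nmem a = s₀.nmem a
  rmem : ∀ a < s₀.nreg 9, s.rmem a = s₀.rmem a

variable {n k : ℕ} {X₁ X₂ : Sample k n} {d : ℕ} {ν : ℝ} {i : Fin n}

theorem Same.env {s₀ s : State} (h : Same s₀ s) (hE : Env X₁ X₂ d ν s₀) : Env X₁ X₂ d ν s :=
  hE.congr h.nreg h.rreg (fun a _ ha => h.nmem a ha) h.rmem

theorem Same.step {s₀ s s' : State} {p : Prog} (h : Same s₀ s) (hf : Frame p s s')
    (hp : (∀ x < 16, x ∉ p.nw) ∧ 0 ∉ p.rw) (h1 : ∀ a < s₀.nreg 5, s'.nmem a = s.nmem a)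
    (h2 : ∀ a < s₀.nreg 9, s'.rmem a = s.rmem a) : Same s₀ s' :=
  ⟨fun x hx => (hf.nreg x (hp.1 x hx)).trans (h.nreg x hx), (hf.rreg 0 hp.2).trans h.rreg,
    fun a ha => (h1 a ha).trans (h.nmem a ha), fun a ha => (h2 a ha).trans (h.rmem a ha)⟩

theorem Env.gramAt₁ {s : State} (hE : Env X₁ X₂ d ν s) (h : s.nreg 16 = s.nreg 7) :
    GramAt X₁ s :=
  ⟨by have := hE.reg8; have := hE.reg9; omega, by rw [h]; exact hE.gram₁⟩

theorem Env.gramAt₂ {s : State} (hE : Env X₁ X₂ d ν s) (h : s.nreg 16 = s.nreg 8) :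
    GramAt X₂ s :=
  ⟨by have := hE.reg9; omega, by rw [h]; exact hE.gram₂⟩

/-- The row `r` of the table of candidates holds a solution of the search with sparsity `r`. -/
structure CandRow (X : Sample k n) (i : Fin n) (d C r : ℕ) (mem : ℕ → ℕ) : Prop where
  lt : ∀ p < d, mem (C + (r * d + p)) < n
  cand : IsCand X i r (listSet i n (fun p => mem (C + (r * d + p))) d)

theorem CandRow.congr {X : Sample k n} {C r : ℕ} {mem mem' : ℕ → ℕ} (h : CandRow X i d C r mem)
    (he : ∀ p < d, mem' (C + (r * d + p)) = mem (C + (r * d + p))) : CandRow X i d C r mem' := by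
  refine ⟨fun p hp => by rw [he p hp]; exact h.lt p hp, ?_⟩
  rw [listSet_congr he]
  exact h.cand

/-- The state during the enumeration of the lists of length `r + 1`, before the list number `t`. -/
structure TryInv (X₁ : Sample k n) (d : ℕ) (i : Fin n) (s₀ : State) (r t : ℕ) (s : State) :
    Prop where
  same : Same s₀ s
  reg16 : s.nreg 16 = s₀.nreg 7
  reg17 : s.nreg 17 = i
  reg18 : s.nreg 18 = n
  reg32 : s.nreg 32 = s₀.nreg 6 + (r + 1) * d
  buf : ∀ p < r + 1, s.nmem (s₀.nreg 5 + p) = dig n t p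
  pad : ∀ p ≤ 2 * d, r + 1 ≤ p → s.nmem (s₀.nreg 5 + p) = i
  old : ∀ q ≤ r, CandRow X₁ i d (s₀.nreg 6) q s.nmem
  lt : ∀ p < d, s.nmem (s₀.nreg 6 + ((r + 1) * d + p)) < n
  card : (listSet (n := n) i n (fun p => s.nmem (s₀.nreg 6 + ((r + 1) * d + p))) d).card ≤ r + 1
  best : s.rreg 10 =
    rss X₁ i (listSet i n (fun p => s.nmem (s₀.nreg 6 + ((r + 1) * d + p))) d)
  new : listSet (n := n) i n (fun p => s.nmem (s₀.nreg 6 + ((r + 1) * d + p))) d =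
      listSet i n (fun p => s.nmem (s₀.nreg 6 + (r * d + p))) d ∨
    s.rreg 10 < rss X₁ i (listSet i n (fun p => s.nmem (s₀.nreg 6 + (r * d + p))) d)
  le : ∀ u < t, s.rreg 10 ≤ rss X₁ i (listSet i n (dig n u) (r + 1))

theorem TryInv.congr {s₀ s s' : State} {r t : ℕ} (h : TryInv X₁ d i s₀ r t s)
    (h1 : ∀ x < 19, s'.nreg x = s.nreg x) (h32 : s'.nreg 32 = s.nreg 32)
    (h0 : s'.rreg 0 = s.rreg 0) (h10 : s'.rreg 10 = s.rreg 10) (hm : s'.nmem = s.nmem)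
    (hr : ∀ a < s₀.nreg 9, s'.rmem a = s.rmem a) : TryInv X₁ d i s₀ r t s' := by
  refine ⟨⟨fun x hx => (h1 x (by omega)).trans (h.same.nreg x hx), h0.trans h.same.rreg,
    by rw [hm]; exact h.same.nmem, fun a ha => (hr a ha).trans (h.same.rmem a ha)⟩,
    (h1 16 (by decide)).trans h.reg16, (h1 17 (by decide)).trans h.reg17,
    (h1 18 (by decide)).trans h.reg18, h32.trans h.reg32, ?_, ?_, ?_, ?_, ?_, ?_, ?_, ?_⟩
  all_goals simp only [hm, h10]
  exacts [h.buf, h.pad, h.old, h.lt, h.card, h.best, h.new, h.le]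

/-- Replacing the candidate if the list in the buffer is better. -/
def improveP : Prog :=
  .ite (.rlt 1 10) (.seq (blk (.rconst 10 0) [.radd 10 10 1]) (copyP 5 32)) skipP

/-- Trying one list. -/
def tryP : Prog := .seq distP (.seq improveP nextP)

/-- The state after the distance has been computed. -/
structure TriedInv (X₁ : Sample k n) (d : ℕ) (i : Fin n) (s₀ : State) (r t : ℕ) (s : State) : Prop
    extends TryInv X₁ d i s₀ r t s where
  dist : s.rreg 1 = rss X₁ i (listSet i n (dig n t) (r + 1))

theorem reach_dist_try {s₀ s : State} (hE : Env X₁ X₂ d ν s₀) {r t : ℕ} (hr : r < d)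
    (h : TryInv X₁ d i s₀ r t s) : Reach distP s (distTime d) (TriedInv X₁ d i s₀ r t) := by
  have hn : 0 < n := i.pos
  have hEs := h.same.env hE
  have e5 := h.same.nreg 5 (by decide)
  have hset : listSet (n := n) i (s.nreg 18) (fun p => s.nmem (s.nreg 5 + p)) (2 * d) =
      listSet i n (dig n t) (r + 1) := by
    rw [h.reg18, e5]
    exact listSet_pad (by omega) h.buf fun p hp hp' => h.pad p hp.le hp'
  refine (reach_distP hEs (hEs.gramAt₁ (h.reg16.trans (h.same.nreg 7 (by decide)).symm))
    (fun p hp => ?_) h.reg17 (by rw [e5]; exact h.pad _ le_rfl (by omega))).mono le_rfl ?_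
  · rw [e5]
    by_cases hpr : p < r + 1
    · rw [h.buf p hpr]
      exact dig_lt hn _ _
    · rw [h.pad p (by omega) (by omega)]
      exact i.2
  · rintro s' hf ⟨h1, h2⟩
    rw [hset] at h2
    exact ⟨h.congr (fun x hx => hf.nreg x (by revert x; decide)) (hf.nreg 32 (by decide))
      (hf.rreg 0 (by decide)) (hf.rreg 10 (by decide)) (hf.nmem rfl)
      fun a ha => h1 a (by rwa [h.same.nreg 9 (by decide)]), h2⟩

/-- The replacement happens only upon strict improvement. This maintains the alternative recorded in
`new`, equal to the candidate of the previous sparsity or strictly better, which `IsCand.of_le`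
requires. -/
theorem reach_improveP {s₀ s : State} (hE : Env X₁ X₂ d ν s₀) {r t : ℕ} (hr : r < d)
    (h : TriedInv X₁ d i s₀ r t s) : Reach improveP s (2 + (d * 6 + 2) + 1) fun s' =>
      TryInv X₁ d i s₀ r t s' ∧
        s'.rreg 10 ≤ rss X₁ i (listSet i n (dig n t) (r + 1)) := by
  have hn : 0 < n := i.pos
  have hEs := h.same.env hE
  have e5 := h.same.nreg 5 (by decide)
  have h6 := hE.reg6
  have hCr : d ≤ (r + 1) * d := Nat.le_mul_of_pos_left d (Nat.succ_pos r)
  refine Reach.ite (fun hb => ?_) fun hb => ?_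
  · simp only [Test.holds] at hb
    refine Reach.blk_seq (fun s' => s'.nreg = s.nreg ∧ s'.nmem = s.nmem ∧ s'.rmem = s.rmem ∧
      s'.rreg 10 = s.rreg 1 ∧ s'.rreg 0 = s.rreg 0) rfl (by simp [Instr.exec]) ?_
    rintro s₁ - ⟨g1, g2, g3, g4, g5⟩
    refine (reach_copyP (d := d) (by rw [g1]; exact hEs.reg2) (by rw [g1]; exact hEs.reg3)
      (by decide) (by decide) (Or.inl ?_)).mono le_rfl ?_
    · rw [g1, h.reg32, e5]
      omega
    · rintro s' hf ⟨h1, h2⟩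
      rw [g1, h.reg32, e5, g2] at h1
      rw [g1, h.reg32, g2] at h2
      have e10 : s'.rreg 10 = s.rreg 1 := (hf.rreg 10 (by decide)).trans g4
      have hnew : ∀ p < d, s'.nmem (s₀.nreg 6 + ((r + 1) * d + p)) = s.nmem (s₀.nreg 5 + p) := by
        intro p hp
        rw [← add_assoc]
        exact h1 p hp
      have hold : ∀ q ≤ r, ∀ p < d, s'.nmem (s₀.nreg 6 + (q * d + p)) =
          s.nmem (s₀.nreg 6 + (q * d + p)) := by
        intro q hq p hp
        have := mul_add_lt_mul (show q < r + 1 by omega) hp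
        exact h2 _ (by omega)
      have hbuf : ∀ p ≤ 2 * d, s'.nmem (s₀.nreg 5 + p) = s.nmem (s₀.nreg 5 + p) :=
        fun p hp => h2 _ (by omega)
      have hset : listSet (n := n) i n (fun p => s'.nmem (s₀.nreg 6 + ((r + 1) * d + p))) d =
          listSet i n (dig n t) (r + 1) := by
        rw [listSet_congr hnew]
        exact listSet_pad (by omega) h.buf fun p hp hp' => h.pad p (by omega) hp'
      refine ⟨⟨?_, ?_, ?_, ?_, ?_, ?_, ?_, ?_, ?_, ?_, ?_, ?_, ?_⟩, by rw [e10, h.dist]⟩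
      · exact ⟨fun x hx => by rw [hf.nreg x (by revert x; decide), g1, h.same.nreg x hx],
          by rw [hf.rreg 0 (by decide), g5, h.same.rreg],
          fun a ha => by rw [h2 a (by omega), h.same.nmem a ha],
          fun a ha => by rw [hf.rmem rfl, g3, h.same.rmem a ha]⟩
      · rw [hf.nreg 16 (by decide), g1, h.reg16]
      · rw [hf.nreg 17 (by decide), g1, h.reg17]
      · rw [hf.nreg 18 (by decide), g1, h.reg18]
      · rw [hf.nreg 32 (by decide), g1, h.reg32]
      · exact fun p hp => (hbuf p (by omega)).trans (h.buf p hp)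
      · exact fun p hp hp' => (hbuf p hp).trans (h.pad p hp hp')
      · exact fun q hq => (h.old q hq).congr (hold q hq)
      · intro p hp
        rw [hnew p hp]
        by_cases hpr : p < r + 1
        · rw [h.buf p hpr]
          exact dig_lt hn _ _
        · rw [h.pad p (by omega) (by omega)]
          exact i.2
      · rw [hset]
        exact card_listSet_le _ _ _ _
      · rw [hset, e10, h.dist]
      · right
        rw [listSet_congr (hold r le_rfl), e10]
        rcases h.new with he | hlt
        · rw [← he, ← h.best]
          exact hb
        · exact hb.trans hlt
      · intro u hu
        rw [e10]
        exact hb.le.trans (h.le u hu)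
  · simp only [Test.holds, not_lt, h.dist] at hb
    refine ⟨1, _, Runs.instr _ s, by omega, ?_, hb⟩
    exact h.toTryInv.congr (fun x hx => by simp [Instr.exec, show x ≠ 63 by omega])
      (by simp [Instr.exec]) rfl rfl rfl fun _ _ => rfl

theorem reach_tryP {s₀ s : State} (hE : Env X₁ X₂ d ν s₀) {r t : ℕ} (hr : r < d)
    (h38 : s.nreg 38 = r + 1) (h : TryInv X₁ d i s₀ r t s) :
    Reach tryP s (distTime d + ((2 + (d * 6 + 2) + 1) + (1 + (d * 9 + 2))))
      (TryInv X₁ d i s₀ r (t + 1)) := by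
  have hn : 0 < n := i.pos
  have h6 := hE.reg6
  refine (reach_dist_try hE hr h).seq fun s₁ hf₁ h₁ => ?_
  refine (reach_improveP hE hr h₁).seq ?_
  rintro s₂ hf₂ ⟨h₂, hle⟩
  have hEs := h₂.same.env hE
  have e5 := h₂.same.nreg 5 (by decide)
  have e38 : s₂.nreg 38 = r + 1 := by rw [hf₂.nreg 38 (by decide), hf₁.nreg 38 (by decide), h38]
  refine (reach_nextP hn hEs.reg0 hEs.reg3 e38 hr (t := t) (by rw [e5]; exact h₂.buf)).mono le_rfl ?_
  rintro s₃ hf ⟨g1, g2⟩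
  rw [e5] at g1 g2
  have e10 := hf.rreg 10 (by decide)
  have hrow (q p : ℕ) : s₃.nmem (s₀.nreg 6 + (q * d + p)) = s₂.nmem (s₀.nreg 6 + (q * d + p)) :=
    g2 _ (by omega)
  refine ⟨?_, ?_, ?_, ?_, ?_, g1, ?_, ?_, ?_, ?_, ?_, ?_, ?_⟩
  · exact h₂.same.step hf (by decide) (fun a ha => g2 a (by omega)) fun a _ => by rw [hf.rmem rfl]
  · rw [hf.nreg 16 (by decide), h₂.reg16]
  · rw [hf.nreg 17 (by decide), h₂.reg17]
  · rw [hf.nreg 18 (by decide), h₂.reg18]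
  · rw [hf.nreg 32 (by decide), h₂.reg32]
  · exact fun p hp hp' => (g2 _ (by omega)).trans (h₂.pad p hp hp')
  · exact fun q hq => (h₂.old q hq).congr fun p _ => hrow q p
  all_goals simp only [hrow, e10]
  · exact h₂.lt
  · exact h₂.card
  · exact h₂.best
  · exact h₂.new
  · intro u hu
    rcases Nat.lt_succ_iff_lt_or_eq.1 hu with hu | rfl
    · exact h₂.le u hu
    · exact hle

end SearchProgram

end GGM

namespace GGM

/-! ### The search for one node -/

section SearchLoop

variable {n k : ℕ} {X₁ X₂ : Sample k n} {d : ℕ} {ν : ℝ} {i : Fin n}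

/-- The state of the search before the lists of length `r + 1` are considered. -/
structure SearchInv (X₁ : Sample k n) (d : ℕ) (i : Fin n) (s₀ : State) (r : ℕ) (s : State) :
    Prop where
  same : Same s₀ s
  reg16 : s.nreg 16 = s₀.nreg 7
  reg17 : s.nreg 17 = i
  reg18 : s.nreg 18 = n
  reg32 : s.nreg 32 = s₀.nreg 6 + r * d
  reg33 : s.nreg 33 = n ^ r
  buf : ∀ p < r, s.nmem (s₀.nreg 5 + p) = 0
  pad : ∀ p ≤ 2 * d, r ≤ p → s.nmem (s₀.nreg 5 + p) = i
  rows : ∀ q ≤ r, CandRow X₁ i d (s₀.nreg 6) q s.nmem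
  best : s.rreg 10 = rss X₁ i (listSet i n (fun p => s.nmem (s₀.nreg 6 + (r * d + p))) d)

/-- Preparation of the enumeration of the lists of length `r + 1`. -/
def prepareP : Prog :=
  .seq (blk (.nadd 43 32 2) []) (.seq (copyP 32 43)
    (.seq (blk (.nconst 32 0) [.nadd 32 32 43, .nconst 36 0])
      (.seq (forP 37 0 (blk (.nadd 36 36 33) []))
        (blk (.nconst 33 0) [.nadd 33 33 36, .nadd 38 34 3, .nadd 41 5 34, .nconst 42 0,
          .nstore 41 42]))))

/-- The new row starts as a copy of the previous candidate, so that `new` holds by equality. The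
number of lists n^(r+1) is obtained by `n` additions. The digits below `r` are zero already, and
place `r` is turned from padding into a digit. -/
theorem reach_prepareP {s₀ s : State} (hE : Env X₁ X₂ d ν s₀) {r : ℕ} (hr : r < d)
    (h34 : s.nreg 34 = r) (h : SearchInv X₁ d i s₀ r s) :
    Reach prepareP s (1 + ((d * 6 + 2) + (3 + ((n * 3 + 2) + 6)))) fun s' =>
      TryInv X₁ d i s₀ r 0 s' ∧ s'.nreg 33 = n ^ (r + 1) ∧ s'.nreg 38 = r + 1 := by
  have hEs := h.same.env hE
  have h6 := hE.reg6
  have hmul : (r + 1) * d = r * d + d := Nat.succ_mul r d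
  refine Reach.blk_seq (fun s' => s' = s.setN 43 (s₀.nreg 6 + (r + 1) * d)) rfl ?_ ?_
  · simp [Instr.exec, State.setN, h.reg32, hEs.reg2, hmul, add_assoc]
  rintro s₁ - rfl
  refine Reach.seq (reach_copyP (d := d) (by simp [State.setN, hEs.reg2])
    (by simp [State.setN, hEs.reg3]) (by decide) (by decide)
    (Or.inl (by simp [State.setN, h.reg32, hmul, add_assoc]))) ?_
  rintro s₂ hf₂ ⟨g1, g2⟩
  simp only [State.setN, Function.update_self, Function.update_of_ne (show 32 ≠ 43 by decide),
    h.reg32] at g1 g2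
  refine Reach.blk_seq (fun s' => (∀ x < 32, s'.nreg x = s.nreg x) ∧ s'.nreg 33 = n ^ r ∧
    s'.nreg 34 = r ∧ s'.nreg 32 = s₀.nreg 6 + (r + 1) * d ∧ s'.nreg 36 = 0 ∧
    s'.nmem = s₂.nmem ∧ s'.rmem = s.rmem ∧ s'.rreg = s.rreg) rfl ?_ ?_
  · have e (x : ℕ) (hx : x ∉ (copyP 32 43).nw) (hx' : x ≠ 43) : s₂.nreg x = s.nreg x :=
      (hf₂.nreg x hx).trans (by simp [State.setN, hx'])
    have e43 : s₂.nreg 43 = s₀.nreg 6 + (r + 1) * d :=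
      (hf₂.nreg 43 (by decide)).trans (by simp [State.setN])
    refine ⟨fun x hx => ?_, ?_, ?_, ?_, ?_, ?_, ?_, ?_⟩
    · rw [← e x (by revert x; decide) (by omega)]
      simp [Instr.exec, show x ≠ 32 ∧ x ≠ 36 by omega]
    · simp [Instr.exec, e 33 (by decide) (by decide), h.reg33]
    · simp [Instr.exec, e 34 (by decide) (by decide), h34]
    · simp [Instr.exec, e43]
    · simp [Instr.exec]
    · simp [Instr.exec]
    · simpa [Instr.exec, State.setN] using hf₂.rmem rfl
    · funext x
      simpa [Instr.exec, State.setN] using hf₂.rreg x (by simp [copyP, forP, blk, Prog.rw, Instr.rw])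
  rintro s₃ - ⟨k1, k2, k3, k4, k5, k6, k7, k8⟩
  refine Reach.seq (Q₁ := fun s' => s'.nreg 36 = n * n ^ r ∧ s'.rreg = s₃.rreg)
    (Reach.forP (m := n) (T := 1) (fun j s' => s'.nreg 36 = j * n ^ r ∧ s'.rreg = s₃.rreg)
      (by decide) ((k1 0 (by decide)).trans hEs.reg0) ((k1 3 (by decide)).trans hEs.reg3)
      (by simp [State.setN, k5]) ?_ fun _ _ h => h) ?_
  · rintro j s' hj - hf ⟨h1, h2⟩
    refine (Reach.blk _ _ ⟨?_, ?_⟩).mono (by simp) fun _ _ h _ => h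
    · simp [Instr.exec, State.setN, h1, (hf.nreg 33 (by decide)).trans k2, Nat.succ_mul]
    · simpa [Instr.exec, State.setN] using h2
  rintro s₄ hf₄ ⟨l1, l2⟩
  have e32 (x : ℕ) (hx : x < 32) : s₄.nreg x = s.nreg x :=
    (hf₄.nreg x (by revert x; decide)).trans (k1 x hx)
  have em : s₄.nmem = s₂.nmem := (hf₄.nmem rfl).trans k6
  have hbuf (a : ℕ) (ha : a < s₀.nreg 6 + (r + 1) * d) (ha' : a ≠ s₀.nreg 5 + r) :
      Function.update s₄.nmem (s₀.nreg 5 + r) 0 a = s.nmem a := by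
    rw [Function.update_of_ne ha', em]
    exact g2 a (Or.inl ha)
  have hold (q : ℕ) (hq : q ≤ r) (p : ℕ) (hp : p < d) :
      Function.update s₄.nmem (s₀.nreg 5 + r) 0 (s₀.nreg 6 + (q * d + p)) =
        s.nmem (s₀.nreg 6 + (q * d + p)) := by
    have := mul_add_lt_mul (show q < r + 1 by omega) hp
    exact hbuf _ (by omega) (by omega)
  have hnew (p : ℕ) (hp : p < d) :
      Function.update s₄.nmem (s₀.nreg 5 + r) 0 (s₀.nreg 6 + ((r + 1) * d + p)) =
        s.nmem (s₀.nreg 6 + (r * d + p)) := by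
    rw [Function.update_of_ne (by omega), em, ← add_assoc, g1 p hp, add_assoc]
  have h5 : s.nreg 5 = s₀.nreg 5 := h.same.nreg 5 (by decide)
  have key (s' : State) (n1 : ∀ x < 32, s'.nreg x = s.nreg x)
      (n2 : s'.nreg 32 = s₀.nreg 6 + (r + 1) * d)
      (m1 : s'.nmem = Function.update s₄.nmem (s₀.nreg 5 + r) 0) (m2 : s'.rmem = s.rmem)
      (m3 : s'.rreg = s.rreg) : TryInv X₁ d i s₀ r 0 s' := by
    refine ⟨⟨fun x hx => (n1 x (by omega)).trans (h.same.nreg x hx), by rw [m3, h.same.rreg],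
      fun a ha => ?_, by rw [m2]; exact h.same.rmem⟩,
      (n1 16 (by decide)).trans h.reg16, (n1 17 (by decide)).trans h.reg17,
      (n1 18 (by decide)).trans h.reg18, n2, fun p hp => ?_, fun p hp hp' => ?_,
      fun q hq => ?_, fun p hp => ?_, ?_, ?_, ?_, ?_⟩
    · rw [m1, hbuf a (by omega) (by omega), h.same.nmem a ha]
    · rw [m1, dig_zero]
      by_cases hpr : p = r
      · rw [hpr, Function.update_self]
      · rw [hbuf _ (by omega) (by omega), h.buf p (by omega)]
    · rw [m1, hbuf _ (by omega) (by omega), h.pad p hp (by omega)]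
    · rw [m1]
      exact (h.rows q hq).congr (hold q hq)
    · rw [m1, hnew p hp]
      exact (h.rows r le_rfl).lt p hp
    · rw [m1, listSet_congr hnew]
      exact (h.rows r le_rfl).cand.card.trans (Nat.le_succ r)
    · rw [m1, m3, listSet_congr hnew]
      exact h.best
    · left
      rw [m1, listSet_congr hnew, listSet_congr (hold r le_rfl)]
    · exact fun u hu => absurd hu (Nat.not_lt_zero u)
  have e33 : s₄.nreg 32 = s₀.nreg 6 + (r + 1) * d := (hf₄.nreg 32 (by decide)).trans k4
  have e34 : s₄.nreg 34 = r := (hf₄.nreg 34 (by decide)).trans k3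
  refine (Reach.blk _ _ ⟨key _ (fun x hx => ?_) ?_ ?_ ?_ ?_, ?_, ?_⟩).mono (by simp) fun _ _ h => h
  · rw [← e32 x hx]
    simp [Instr.exec, show x ≠ 33 ∧ x ≠ 38 ∧ x ≠ 41 ∧ x ≠ 42 by omega]
  · simp [Instr.exec, e33]
  · simp [Instr.exec, e34, e32 5 (by decide), h5]
  · simpa [Instr.exec] using (hf₄.rmem rfl).trans k7
  · simpa [Instr.exec] using l2.trans k8
  · simp [Instr.exec, l1, pow_succ, mul_comm]
  · simp [Instr.exec, e34, e32 3 (by decide), hEs.reg3]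

/-- After n^(r+1) steps the counter has overflowed to zero, and every set of at most r + 1 nodes has
occurred, so the candidate is optimal. -/
theorem TryInv.searchInv {s₀ s : State} {r : ℕ}
    (h : TryInv X₁ d i s₀ r (n ^ (r + 1)) s) (h33 : s.nreg 33 = n ^ (r + 1)) :
    SearchInv X₁ d i s₀ (r + 1) s := by
  have hn : 0 < n := i.pos
  refine ⟨h.same, h.reg16, h.reg17, h.reg18, h.reg32, h33, fun p hp => ?_, h.pad, fun q hq => ?_,
    h.best⟩
  · rw [h.buf p hp, dig_pow hn hp]
  · rcases Nat.le_succ_iff.1 hq with hq | rfl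
    · exact h.old q hq
    · refine ⟨h.lt, (h.old r le_rfl).cand.of_le (notMem_listSet _ _ _ _) h.card ?_ ?_⟩
      · rw [← h.best]
        exact h.new
      · intro T' hT' hc
        obtain ⟨t, ht, rfl⟩ := exists_listSet_dig_eq hT' hc
        rw [← h.best]
        exact h.le t ht

/-- The enumeration of the lists of length `r + 1`. -/
def stageP : Prog := .seq prepareP (forP 39 33 tryP)

/-- The number of steps for one list. -/
def tryTime (d : ℕ) : ℕ := distTime d + ((2 + (d * 6 + 2) + 1) + (1 + (d * 9 + 2)))

/-- The number of steps for the lists of a fixed length. -/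
def stageTime (n d : ℕ) : ℕ :=
  (1 + ((d * 6 + 2) + (3 + ((n * 3 + 2) + 6)))) + (n ^ d * (tryTime d + 2) + 2)

theorem reach_stageP {s₀ s : State} (hE : Env X₁ X₂ d ν s₀) {r : ℕ} (hr : r < d)
    (h34 : s.nreg 34 = r) (h : SearchInv X₁ d i s₀ r s) :
    Reach stageP s (stageTime n d) (SearchInv X₁ d i s₀ (r + 1)) := by
  have hn : 0 < n := i.pos
  refine Reach.mono (T := (1 + ((d * 6 + 2) + (3 + ((n * 3 + 2) + 6)))) +
    (n ^ (r + 1) * (tryTime d + 2) + 2)) (Q := SearchInv X₁ d i s₀ (r + 1)) ?_ ?_ fun _ _ h => h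
  · refine (reach_prepareP hE hr h34 h).seq ?_
    rintro s₁ - ⟨h1, h33, h38⟩
    refine Reach.forP (m := n ^ (r + 1)) (fun t s' => TryInv X₁ d i s₀ r t s') (by decide) h33
      ((h1.same.env hE).reg3) ?_ ?_ ?_
    · exact h1.congr (fun x hx => by simp [State.setN, show x ≠ 39 by omega])
        (by simp [State.setN]) rfl rfl rfl fun _ _ => rfl
    · intro t s₂ _ _ hf h2
      refine (reach_tryP hE hr ((hf.nreg 38 (by decide)).trans h38) h2).mono le_rfl ?_
      intro s₃ _ h3 _
      exact h3.congr (fun x hx => by simp [State.setN, show x ≠ 39 by omega])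
        (by simp [State.setN]) rfl rfl rfl fun _ _ => rfl
    · intro s₂ hf h2
      exact h2.searchInv ((hf.nreg 33 (by decide)).trans h33)
  · have : n ^ (r + 1) ≤ n ^ d := Nat.pow_le_pow_right hn hr
    unfold stageTime
    gcongr

theorem SearchInv.congr {s₀ s s' : State} {r : ℕ} (h : SearchInv X₁ d i s₀ r s)
    (h1 : ∀ x < 34, s'.nreg x = s.nreg x) (h0 : s'.rreg = s.rreg) (hm : s'.nmem = s.nmem)
    (hr : s'.rmem = s.rmem) : SearchInv X₁ d i s₀ r s' := by
  refine ⟨⟨fun x hx => (h1 x (by omega)).trans (h.same.nreg x hx), by rw [h0, h.same.rreg],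
    by rw [hm]; exact h.same.nmem, by rw [hr]; exact h.same.rmem⟩,
    (h1 16 (by decide)).trans h.reg16, (h1 17 (by decide)).trans h.reg17,
    (h1 18 (by decide)).trans h.reg18, (h1 32 (by decide)).trans h.reg32,
    (h1 33 (by decide)).trans h.reg33, ?_, ?_, ?_, ?_⟩
  all_goals simp only [hm, h0]
  exacts [h.buf, h.pad, h.rows, h.best]

/-- The first candidate. -/
def searchInit : Prog :=
  .seq (forP 35 10 (blk (.nadd 41 5 35) [.nstore 41 17])) (.seq (copyP 5 6)
    (.seq (blk (.nconst 16 0) [.nadd 16 16 7, .nconst 18 0, .nadd 18 18 0])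
      (.seq distP (blk (.rconst 10 0) [.radd 10 10 1, .nconst 32 0, .nadd 32 32 6, .nconst 33 1]))))

theorem reach_searchInit {s : State} (hE : Env X₁ X₂ d ν s) (h17 : s.nreg 17 = i) :
    Reach searchInit s (((2 * d + 1) * 4 + 2) + ((d * 6 + 2) + (4 + (distTime d + 5))))
      (SearchInv X₁ d i s 0) := by
  have h6 := hE.reg6
  have hn : 0 < n := i.pos
  refine Reach.seq (Q₁ := fun s' => (∀ p < 2 * d + 1, s'.nmem (s.nreg 5 + p) = i) ∧
    ∀ a < s.nreg 5, s'.nmem a = s.nmem a)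
    (Reach.forP (m := 2 * d + 1) (T := 2) (fun j s' => (∀ p < j, s'.nmem (s.nreg 5 + p) = i) ∧
      ∀ a < s.nreg 5, s'.nmem a = s.nmem a) (by decide) hE.reg10 hE.reg3
      (by simp [State.setN]) ?_ fun _ _ h => h) ?_
  · rintro j s' hj h35 hf ⟨h1, h2⟩
    have e5 := hf.nreg 5 (by decide)
    have e17 := (hf.nreg 17 (by decide)).trans h17
    have hmem : ∀ s'' : State, s''.nmem = Function.update s'.nmem (s.nreg 5 + j) i →
        (∀ p < j + 1, s''.nmem (s.nreg 5 + p) = i) ∧ ∀ a < s.nreg 5, s''.nmem a = s.nmem a := by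
      intro s'' hs
      constructor
      · intro p hp
        rw [hs, Function.update_apply]
        split_ifs with he
        · rfl
        · exact h1 p (by omega)
      · intro a ha
        rw [hs, Function.update_of_ne (by omega)]
        exact h2 a ha
    refine (Reach.blk _ _ (hmem _ ?_)).mono (by simp) fun _ _ h _ => h
    simp [Instr.exec, State.setN, h35, e5, e17]
  rintro s₁ hf₁ ⟨b1, b2⟩
  have e (x : ℕ) (hx : x < 34) : s₁.nreg x = s.nreg x := hf₁.nreg x (by revert x; decide)
  refine Reach.seq (reach_copyP (d := d) ((e 2 (by decide)).trans hE.reg2)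
    ((e 3 (by decide)).trans hE.reg3) (by decide) (by decide) (Or.inl ?_)) ?_
  · rw [e 5 (by decide), e 6 (by decide)]
    omega
  rintro s₂ hf₂ ⟨c1, c2⟩
  rw [e 5 (by decide), e 6 (by decide)] at c1
  rw [e 6 (by decide)] at c2
  have e' (x : ℕ) (hx : x < 34) : s₂.nreg x = s.nreg x :=
    (hf₂.nreg x (by revert x; decide)).trans (e x hx)
  refine Reach.blk_seq (fun s' => Same s s' ∧ s'.nreg 16 = s.nreg 7 ∧ s'.nreg 17 = i ∧
    s'.nreg 18 = n ∧ s'.nmem = s₂.nmem) rfl ?_ ?_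
  · refine ⟨⟨fun x hx => ?_, ?_, fun a ha => ?_, fun a _ => ?_⟩, ?_, ?_, ?_, ?_⟩
    · rw [← e' x (by omega)]
      simp [Instr.exec, show x ≠ 16 ∧ x ≠ 18 by omega]
    · simpa [Instr.exec] using (hf₂.rreg 0 (by decide)).trans (hf₁.rreg 0 (by decide))
    · simpa [Instr.exec] using (c2 a (by omega)).trans (b2 a ha)
    · simpa [Instr.exec] using congrFun ((hf₂.rmem rfl).trans (hf₁.rmem rfl)) a
    · simp [Instr.exec, e' 7 (by decide)]
    · simp [Instr.exec, e' 17 (by decide), h17]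
    · simp [Instr.exec, e' 0 (by decide), hE.reg0]
    · simp [Instr.exec]
  rintro s₃ - ⟨hS, r16, r17, r18, rm⟩
  have hEs := hS.env hE
  have e5 := hS.nreg 5 (by decide)
  have hbuf (p : ℕ) (hp : p < 2 * d + 1) : s₃.nmem (s.nreg 5 + p) = i := by
    rw [rm, c2 _ (by omega)]
    exact b1 p hp
  -- A buffer filled with `i` represents the empty set, the only candidate of sparsity 0.
  have hset : ∀ b : ℕ → ℕ, ∀ L, (∀ p < L, b p = i) → listSet (n := n) i n b L = ∅ := by
    intro b L hb
    rw [listSet_pad (m := 0) (b' := b) (Nat.zero_le L) (by simp) fun p hp _ => hb p hp]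
    ext j
    simp [mem_listSet]
  refine Reach.seq (reach_distP hEs (hEs.gramAt₁ (r16.trans (hS.nreg 7 (by decide)).symm))
    (fun p hp => by rw [e5, hbuf p hp]; exact i.2) r17
    (by rw [e5]; exact hbuf _ (Nat.lt_succ_self _))) ?_
  rintro s₄ hf₄ ⟨d1, d2⟩
  have em := (hf₄.nmem rfl).trans rm
  rw [r18, hset _ _ fun p hp => by rw [e5]; exact hbuf p (by omega)] at d2
  have hrow (p : ℕ) (hp : p < d) : s₂.nmem (s.nreg 6 + (0 * d + p)) = i := by
    rw [zero_mul, zero_add, c1 p hp, b1 p (by omega)]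
  have key (s' : State) (n1 : ∀ x < 19, s'.nreg x = s₃.nreg x) (n2 : s'.nreg 32 = s.nreg 6)
      (n3 : s'.nreg 33 = 1) (m1 : s'.nmem = s₄.nmem) (m2 : s'.rmem = s₄.rmem)
      (m3 : s'.rreg 10 = s₄.rreg 1) (m4 : s'.rreg 0 = s₃.rreg 0) : SearchInv X₁ d i s 0 s' := by
    rw [em] at m1
    refine ⟨⟨fun x hx => (n1 x (by omega)).trans (hS.nreg x hx), m4.trans hS.rreg, fun a ha => ?_,
      fun a ha => ?_⟩, (n1 16 (by decide)).trans r16, (n1 17 (by decide)).trans r17,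
      (n1 18 (by decide)).trans r18, by rw [n2, zero_mul, add_zero], by rw [n3, pow_zero],
      fun p hp => absurd hp (Nat.not_lt_zero p), fun p hp _ => ?_, fun q hq => ?_, ?_⟩
    · rw [m1, ← rm, hS.nmem a ha]
    · rw [m2, d1 a (by rwa [hS.nreg 9 (by decide)]), hS.rmem a ha]
    · rw [m1, ← rm, hbuf p (by omega)]
    · rw [Nat.le_zero.1 hq, m1]
      refine ⟨fun p hp => by rw [hrow p hp]; exact i.2, ?_⟩
      rw [hset _ _ hrow]
      exact isCand_empty X₁ i
    · rw [m1, m3, d2, hset _ _ hrow]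
  have e32 (x : ℕ) (hx : x < 19) : s₄.nreg x = s₃.nreg x := hf₄.nreg x (by revert x; decide)
  refine (Reach.blk _ _ (key _ (fun x hx => ?_) ?_ ?_ ?_ ?_ ?_ ?_)).mono (by simp) fun _ _ h => h
  · rw [← e32 x hx]
    simp [Instr.exec, show x ≠ 32 ∧ x ≠ 33 by omega]
  · simp [Instr.exec, e32 6 (by decide), hS.nreg 6]
  · simp [Instr.exec]
  · simp [Instr.exec]
  · simp [Instr.exec]
  · simp [Instr.exec]
  · simpa [Instr.exec] using hf₄.rreg 0 (by decide)

/-- The search step. -/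
def searchP : Prog := .seq searchInit (forP 34 2 stageP)

/-- The number of steps of the search. -/
def searchTime (n d : ℕ) : ℕ :=
  (((2 * d + 1) * 4 + 2) + ((d * 6 + 2) + (4 + (distTime d + 5)))) + (d * (stageTime n d + 2) + 2)

theorem reach_searchP {s : State} (hE : Env X₁ X₂ d ν s) (h17 : s.nreg 17 = i) :
    Reach searchP s (searchTime n d) (SearchInv X₁ d i s d) := by
  refine (reach_searchInit hE h17).seq fun s₁ _ h1 => ?_
  refine Reach.forP (m := d) (fun r s' => SearchInv X₁ d i s r s') (by decide)
    ((h1.same.env hE).reg2) ((h1.same.env hE).reg3) ?_ ?_ fun _ _ h => h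
  · exact h1.congr (fun x hx => by simp [State.setN, show x ≠ 34 by omega]) rfl rfl rfl
  · intro r s₂ hr h34 hf h2
    refine (reach_stageP hE hr h34 h2).mono le_rfl fun s₃ _ h3 _ => ?_
    exact h3.congr (fun x hx => by simp [State.setN, show x ≠ 34 by omega]) rfl rfl rfl

end SearchLoop

end GGM

namespace GGM

/-! ### Comparing two candidates -/

section ValidateProgram

variable {n k : ℕ} {X₁ X₂ : Sample k n} {d : ℕ} {ν : ℝ} {i : Fin n}

/-- Run `p` if the registers `x` and `y` agree. -/
def ifEq (x y : ℕ) (p : Prog) : Prog := .ite (.nlt x y) skipP (.ite (.nlt y x) skipP p)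

theorem Reach.ifEq {x y : ℕ} {p : Prog} {s : State} {T : ℕ} {Q : State → Prop} (hT : 1 ≤ T)
    (h : s.nreg x = s.nreg y → Reach p s T Q) (h' : s.nreg x ≠ s.nreg y → Q (s.setN 63 0)) :
    Reach (ifEq x y p) s (T + 2) Q := by
  have hskip (hne : s.nreg x ≠ s.nreg y) : Reach skipP s T Q := ⟨1, _, Runs.instr _ s, hT, h' hne⟩
  refine (Reach.ite (T := T + 1) (fun hb => (hskip (ne_of_lt hb)).mono (by omega) fun _ _ h => h)
    fun hb => ?_)
  refine Reach.ite (fun hb' => hskip (ne_of_gt hb')) fun hb' => ?_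
  exact h (le_antisymm (not_lt.1 hb') (not_lt.1 hb))

/-- The entry `d + p` of the list `b` speaks against the first half of this list. -/
def RejAt (X₂ : Sample k n) (d : ℕ) (ν : ℝ) (i : Fin n) (b : ℕ → ℕ) (p : ℕ) : Prop :=
  b (d + p) ≠ i ∧ (∀ l < d, b l ≠ b (d + p)) ∧
    ν * rss X₂ i (listSet i n b (2 * d)) <
      rss X₂ i (listSet i (b (d + p)) b (2 * d)) - rss X₂ i (listSet i n b (2 * d))

/-- Is the node in the register `50` equal to `i` or to one of the first `d` entries of the
buffer? -/
def memberP : Prog :=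
  .seq (blk (.nconst 51 0) [])
    (.seq (forP 52 2 (.seq (blk (.nadd 54 5 52) [.nload 54 54])
      (ifEq 54 50 (blk (.nconst 51 1) []))))
      (ifEq 50 17 (blk (.nconst 51 1) [])))

theorem reach_memberP {s : State} (hE : Env X₁ X₂ d ν s) :
    Reach memberP s (1 + ((d * 7 + 2) + 3)) fun s' =>
      (0 < s'.nreg 51 ↔ s.nreg 50 = s.nreg 17 ∨ ∃ l < d, s.nmem (s.nreg 5 + l) = s.nreg 50) := by
  refine Reach.blk_seq (fun s' => s' = s.setN 51 0) rfl rfl ?_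
  rintro s₁ - rfl
  refine Reach.seq (Q₁ := fun s' => s'.nreg 50 = s.nreg 50 ∧ s'.nreg 17 = s.nreg 17 ∧
    (0 < s'.nreg 51 ↔ ∃ l < d, s.nmem (s.nreg 5 + l) = s.nreg 50))
    (Reach.forP (m := d) (T := 5) (fun j s' => 0 < s'.nreg 51 ↔
      ∃ l < j, s.nmem (s.nreg 5 + l) = s.nreg 50) (by decide)
      (by simp [State.setN, hE.reg2]) (by simp [State.setN, hE.reg3]) (by simp [State.setN]) ?_
      fun s' hf h => ⟨(hf.nreg 50 (by decide)).trans (by simp [State.setN]),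
        (hf.nreg 17 (by decide)).trans (by simp [State.setN]), h⟩) ?_
  · intro j s' hj h52 hf hI
    have e5 : s'.nreg 5 = s.nreg 5 := (hf.nreg 5 (by decide)).trans (by simp [State.setN])
    have e50 : s'.nreg 50 = s.nreg 50 := (hf.nreg 50 (by decide)).trans (by simp [State.setN])
    have em : s'.nmem = s.nmem := hf.nmem rfl
    refine Reach.blk_seq (T₀ := 2) (T := 3) (fun s'' => s''.nreg 54 = s.nmem (s.nreg 5 + j) ∧
      s''.nreg 50 = s.nreg 50 ∧ s''.nreg 51 = s'.nreg 51) rfl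
      (by simp [Instr.exec, h52, e5, em, e50]) ?_
    rintro s'' - ⟨h1, h2, h3⟩
    refine Reach.ifEq (T := 1) le_rfl (fun heq => ?_) fun hne _ => ?_
    · rw [h1, h2] at heq
      refine (Reach.blk _ _ ?_).mono (by simp) fun _ _ h => h
      intro _
      simp only [Nat.exists_lt_succ_right]
      simp [Instr.exec, State.setN, heq]
    · rw [h1, h2] at hne
      simp only [Nat.exists_lt_succ_right]
      simp [State.setN, hne, h3, hI]
  · rintro s₂ - ⟨h1, h2, h3⟩
    refine Reach.ifEq (T := 1) le_rfl (fun heq => ?_) fun hne => ?_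
    · rw [h1, h2] at heq
      refine (Reach.blk _ _ ?_).mono (by simp) fun _ _ h => h
      simp [Instr.exec, heq]
    · rw [h1, h2] at hne
      simp [State.setN, hne, h3]

/-- The test of one entry of the second list. -/
def checkP : Prog :=
  .seq (blk (.nadd 50 47 49) [.nload 50 50]) (.seq memberP
    (.ite (.nlt 51 3)
      (.seq (blk (.nconst 18 0) [.nadd 18 18 50]) (.seq distP
        (.seq (blk (.rsub 13 1 11) []) (.ite (.rlt 12 13) (blk (.nconst 46 1) []) skipP))))
      skipP))

/-- The buffer contains the list `b`, and the distance for this list is known. -/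
structure CheckCtx (X₁ X₂ : Sample k n) (d : ℕ) (ν : ℝ) (i : Fin n) (b : ℕ → ℕ) (s : State) :
    Prop where
  env : Env X₁ X₂ d ν s
  reg16 : s.nreg 16 = s.nreg 8
  reg17 : s.nreg 17 = i
  buf : ∀ p < 2 * d, s.nmem (s.nreg 5 + p) = b p
  node : s.nmem (s.nreg 5 + 2 * d) = i
  lt : ∀ p < 2 * d, b p < n
  row : ∀ p < d, s.nmem (s.nreg 47 + p) = b (d + p)
  rreg11 : s.rreg 11 = rss X₂ i (listSet i n b (2 * d))
  rreg12 : s.rreg 12 = ν * rss X₂ i (listSet i n b (2 * d))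

theorem CheckCtx.congr {b : ℕ → ℕ} {s s' : State} (h : CheckCtx X₁ X₂ d ν i b s)
    (h1 : ∀ x < 18, s'.nreg x = s.nreg x) (h47 : s'.nreg 47 = s.nreg 47)
    (h0 : s'.rreg 0 = s.rreg 0) (h11 : s'.rreg 11 = s.rreg 11) (h12 : s'.rreg 12 = s.rreg 12)
    (hm : s'.nmem = s.nmem) (hr : ∀ a < s.nreg 9, s'.rmem a = s.rmem a) :
    CheckCtx X₁ X₂ d ν i b s' := by
  refine ⟨h.env.congr (fun x hx => h1 x (by omega)) h0 (fun a _ _ => by rw [hm]) hr, ?_,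
    (h1 17 (by decide)).trans h.reg17, ?_, ?_, h.lt, ?_, h11.trans h.rreg11, h12.trans h.rreg12⟩
  · rw [h1 16 (by decide), h1 8 (by decide), h.reg16]
  · rw [hm, h1 5 (by decide)]; exact h.buf
  · rw [hm, h1 5 (by decide)]; exact h.node
  · rw [hm, h47]; exact h.row

/-- The number of steps for one entry. -/
def checkTime (d : ℕ) : ℕ :=
  2 + ((1 + ((d * 7 + 2) + 3)) + (2 + (distTime d + (1 + 2)) + 1))

/-- Nodes of the first list, and `i` as padding, are passed over since the difference of the two
supports excludes them. The distance without the node is obtained by naming it in register `18`,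
with the buffer unchanged. -/
theorem reach_checkP {b : ℕ → ℕ} {s : State} (h : CheckCtx X₁ X₂ d ν i b s) {p : ℕ} (hp : p < d)
    (h49 : s.nreg 49 = p) :
    Reach checkP s (checkTime d) fun s' => (∀ a < s.nreg 9, s'.rmem a = s.rmem a) ∧
      (0 < s'.nreg 46 ↔ 0 < s.nreg 46 ∨ RejAt X₂ d ν i b p) := by
  refine Reach.blk_seq (fun s' => CheckCtx X₁ X₂ d ν i b s' ∧ s'.nreg 50 = b (d + p) ∧
    s'.nreg 46 = s.nreg 46 ∧ s'.rmem = s.rmem) rfl ⟨?_, ?_, ?_, ?_⟩ ?_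
  · exact h.congr (fun x hx => by simp [Instr.exec, show x ≠ 50 by omega]) (by simp [Instr.exec])
      rfl rfl rfl rfl fun _ _ => rfl
  · simp [Instr.exec, h49, h.row p hp]
  · simp [Instr.exec]
  · simp [Instr.exec]
  rintro s₁ hf₁ ⟨h1, h50, h46, hrm⟩
  refine (reach_memberP h1.env).seq fun s₂ hf₂ h51 => ?_
  have h2 : CheckCtx X₁ X₂ d ν i b s₂ := h1.congr (fun x hx => hf₂.nreg x (by revert x; decide))
    (hf₂.nreg 47 (by decide)) (hf₂.rreg 0 (by decide)) (hf₂.rreg 11 (by decide))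
    (hf₂.rreg 12 (by decide)) (hf₂.nmem rfl) fun a _ => by rw [hf₂.rmem rfl]
  have e46 : s₂.nreg 46 = s.nreg 46 := (hf₂.nreg 46 (by decide)).trans h46
  have e50 : s₂.nreg 50 = b (d + p) := (hf₂.nreg 50 (by decide)).trans h50
  have erm : s₂.rmem = s.rmem := (hf₂.rmem rfl).trans hrm
  have e9 : s₂.nreg 9 = s.nreg 9 := (hf₂.nreg 9 (by decide)).trans (hf₁.nreg 9 (by decide))
  have hmem : (0 < s₂.nreg 51 ↔ ¬ (b (d + p) ≠ i ∧ ∀ l < d, b l ≠ b (d + p))) := by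
    rw [h51, h50, h1.reg17, not_and_or, not_not]
    push Not
    exact or_congr_right (exists_congr fun l => and_congr_right fun hl => by
      rw [h1.buf l (by omega)])
  refine Reach.ite (fun hb => ?_) fun hb => ?_
  · simp only [Test.holds, h2.env.reg3] at hb
    have hgood : b (d + p) ≠ i ∧ ∀ l < d, b l ≠ b (d + p) :=
      not_not.1 fun hc => absurd (hmem.2 hc) (by omega)
    refine Reach.blk_seq (fun s' => CheckCtx X₁ X₂ d ν i b s' ∧ s'.nreg 18 = b (d + p) ∧
      s'.nreg 46 = s.nreg 46 ∧ s'.rmem = s.rmem) rfl ⟨?_, ?_, ?_, ?_⟩ ?_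
    · exact h2.congr (fun x hx => by simp [Instr.exec, show x ≠ 18 by omega])
        (by simp [Instr.exec]) rfl rfl rfl rfl fun _ _ => rfl
    · simp [Instr.exec, e50]
    · simp [Instr.exec, e46]
    · simp [Instr.exec, erm]
    rintro s₃ hf₃ ⟨h3, h18, f46, frm⟩
    refine (reach_distP h3.env (h3.env.gramAt₂ h3.reg16) (fun l hl => ?_) h3.reg17 h3.node).seq ?_
    · rcases Nat.lt_succ_iff_lt_or_eq.1 hl with hl | rfl
      · rw [h3.buf l hl]
        exact h3.lt l hl
      · rw [h3.node]
        exact i.2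
    rintro s₄ hf₄ ⟨d1, d2⟩
    rw [h18, listSet_congr h3.buf] at d2
    refine Reach.blk_seq (fun s' => s'.rreg 13 = s₄.rreg 1 - rss X₂ i (listSet i n b (2 * d)) ∧
      s'.rreg 12 = ν * rss X₂ i (listSet i n b (2 * d)) ∧ s'.nreg = s₄.nreg ∧
      s'.rmem = s₄.rmem) rfl ⟨?_, ?_, rfl, rfl⟩ ?_
    · simp [Instr.exec, (hf₄.rreg 11 (by decide)).trans h3.rreg11]
    · simp [Instr.exec, (hf₄.rreg 12 (by decide)).trans h3.rreg12]
    rintro s₅ hf₅ ⟨g13, g12, gn, gm⟩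
    have g46 : s₅.nreg 46 = s.nreg 46 := by rw [gn, hf₄.nreg 46 (by decide), f46]
    have grm : ∀ a < s.nreg 9, s₅.rmem a = s.rmem a := fun a ha => by
      rw [gm, d1 a (by rwa [hf₃.nreg 9 (by decide), e9]), frm]
    have hrej : RejAt X₂ d ν i b p ↔ s₅.rreg 12 < s₅.rreg 13 := by
      rw [g12, g13, d2, RejAt]
      tauto
    refine Reach.ite (T := 1) (fun hb => ?_) fun hb => ?_
    · simp only [Test.holds] at hb
      refine (Reach.blk _ _ ⟨grm, ?_⟩).mono (by simp) fun _ _ h => h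
      simp [Instr.exec, hrej, hb]
    · simp only [Test.holds] at hb
      refine ⟨1, _, Runs.instr _ s₅, le_rfl, grm, ?_⟩
      simp [Instr.exec, hrej, hb, g46]
  · simp only [Test.holds, h2.env.reg3] at hb
    have hbad := hmem.1 (by omega)
    refine ⟨1, _, Runs.instr _ s₂, by omega, fun a _ => by simp [Instr.exec, erm], ?_⟩
    have : ¬ RejAt X₂ d ν i b p := fun hc => hbad ⟨hc.1, hc.2.1⟩
    simp [Instr.exec, e46, this]

/-- The list which consists of the first `d` entries of two lists. -/
def cat (d : ℕ) (b c : ℕ → ℕ) (p : ℕ) : ℕ := if p < d then b p else c (p - d)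

/-- The comparison of two candidates. -/
def compareP : Prog :=
  .seq (copyP 47 55) (.seq (blk (.nconst 18 0) [.nadd 18 18 0]) (.seq distP
    (.seq (blk (.rconst 11 0) [.radd 11 11 1, .rmul 12 0 11])
      (.seq (forP 49 2 checkP) (blk (.nadd 47 47 2) [])))))

/-- The number of steps for two candidates. -/
def compareTime (d : ℕ) : ℕ :=
  (d * 6 + 2) + (2 + (distTime d + (3 + ((d * (checkTime d + 2) + 2) + 1))))

/-- The two candidates occupy the two halves of the buffer, so the set of the combined list is their
union. Its residual and the threshold are computed once and serve for all entries of the second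
half. -/
theorem reach_compareP {s : State} (hE : Env X₁ X₂ d ν s) (h16 : s.nreg 16 = s.nreg 8)
    (h17 : s.nreg 17 = i) (h55 : s.nreg 55 = s.nreg 5 + d) (h47 : s.nreg 6 ≤ s.nreg 47)
    (hnode : s.nmem (s.nreg 5 + 2 * d) = i)
    (hlt : ∀ p < d, s.nmem (s.nreg 5 + p) < n) (hlt' : ∀ p < d, s.nmem (s.nreg 47 + p) < n) :
    Reach compareP s (compareTime d) fun s' =>
      s'.nreg 47 = s.nreg 47 + d ∧ (∀ a < s.nreg 9, s'.rmem a = s.rmem a) ∧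
      (∀ a, a < s.nreg 5 + d ∨ s.nreg 5 + 2 * d ≤ a → s'.nmem a = s.nmem a) ∧
      (0 < s'.nreg 46 ↔ 0 < s.nreg 46 ∨ ∃ p < d, RejAt X₂ d ν i
        (cat d (fun p => s.nmem (s.nreg 5 + p)) (fun p => s.nmem (s.nreg 47 + p))) p) := by
  have h6 := hE.reg6
  set b := cat d (fun p => s.nmem (s.nreg 5 + p)) (fun p => s.nmem (s.nreg 47 + p)) with hb
  have hb1 (p : ℕ) (hp : p < d) : b p = s.nmem (s.nreg 5 + p) := by simp [hb, cat, hp]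
  have hb2 (p : ℕ) : b (d + p) = s.nmem (s.nreg 47 + p) := by simp [hb, cat]
  have hblt (p : ℕ) (hp : p < 2 * d) : b p < n := by
    by_cases hpd : p < d
    · rw [hb1 p hpd]
      exact hlt p hpd
    · rw [show p = d + (p - d) by omega, hb2]
      exact hlt' _ (by omega)
  refine Reach.seq (reach_copyP (d := d) hE.reg2 hE.reg3 (by decide) (by decide)
    (Or.inr (by omega))) ?_
  rintro s₁ hf₁ ⟨c1, c2⟩
  rw [h55] at c1 c2
  have hbuf (p : ℕ) (hp : p < 2 * d) : s₁.nmem (s.nreg 5 + p) = b p := by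
    by_cases hpd : p < d
    · rw [hb1 p hpd, c2 _ (by omega)]
    · rw [show p = d + (p - d) by omega, hb2, ← add_assoc, c1 _ (by omega)]
  have e (x : ℕ) (hx : x ∉ (copyP 47 55).nw := by decide) := hf₁.nreg x hx
  refine Reach.blk_seq (fun s' => (∀ x < 18, s'.nreg x = s.nreg x) ∧ s'.nreg 18 = n ∧
    s'.nreg 46 = s.nreg 46 ∧ s'.nreg 47 = s.nreg 47 ∧ s'.nmem = s₁.nmem ∧ s'.rmem = s.rmem ∧
    s'.rreg 0 = s.rreg 0) rfl ⟨fun x hx => ?_, ?_, ?_, ?_, ?_, ?_, ?_⟩ ?_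
  · rw [← e x (by revert x; decide)]
    simp [Instr.exec, show x ≠ 18 by omega]
  · simp [Instr.exec, e 0, hE.reg0]
  · simp [Instr.exec, e 46]
  · simp [Instr.exec, e 47]
  · simp [Instr.exec]
  · simpa [Instr.exec] using hf₁.rmem rfl
  · simpa [Instr.exec] using hf₁.rreg 0 (by decide)
  rintro s₂ - ⟨g1, g18, g46, g47, gm, grm, g0⟩
  have hE₂ : Env X₁ X₂ d ν s₂ := hE.congr (fun x hx => g1 x (by omega)) g0
    (fun a _ ha => by rw [gm, c2 a (by omega)]) fun a _ => by rw [grm]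
  have e5 : s₂.nreg 5 = s.nreg 5 := g1 5 (by decide)
  have hnode₂ : s₂.nmem (s₂.nreg 5 + 2 * d) = i := by
    rw [e5, gm, c2 _ (by omega), hnode]
  have hbuf₂ : ∀ p < 2 * d, s₂.nmem (s₂.nreg 5 + p) = b p := by
    rw [e5, gm]
    exact hbuf
  have h16₂ : s₂.nreg 16 = s₂.nreg 8 := by rw [g1 16 (by decide), g1 8 (by decide), h16]
  refine (reach_distP hE₂ (hE₂.gramAt₂ h16₂) (fun l hl => ?_) ((g1 17 (by decide)).trans h17)
    hnode₂).seq ?_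
  · rcases Nat.lt_succ_iff_lt_or_eq.1 hl with hl | rfl
    · rw [hbuf₂ l hl]
      exact hblt l hl
    · rw [hnode₂]
      exact i.2
  rintro s₃ hf₃ ⟨d1, d2⟩
  rw [g18, listSet_congr hbuf₂] at d2
  have e3 (x : ℕ) (hx : x < 18) : s₃.nreg x = s.nreg x :=
    (hf₃.nreg x (by revert x; decide)).trans (g1 x hx)
  have em : s₃.nmem = s₁.nmem := (hf₃.nmem rfl).trans gm
  have erm : ∀ a < s.nreg 9, s₃.rmem a = s.rmem a := fun a ha => by
    rw [d1 a (by rwa [g1 9 (by decide)]), grm]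
  have e0 : s₃.rreg 0 = s.rreg 0 := (hf₃.rreg 0 (by decide)).trans g0
  refine Reach.blk_seq (fun s' => CheckCtx X₁ X₂ d ν i b s' ∧ s'.nreg = s₃.nreg ∧
    s'.nmem = s₃.nmem ∧ s'.rmem = s₃.rmem) rfl ⟨⟨?_, ?_, ?_, ?_, ?_, hblt, ?_, ?_, ?_⟩, ?_, ?_, ?_⟩ ?_
  · refine hE.congr (fun x hx => ?_) ?_ (fun a _ ha => ?_) fun a ha => ?_
    · simp [Instr.exec, e3 x (by omega)]
    · simp [Instr.exec, e0]
    · simp [Instr.exec, em, c2 a (by omega)]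
    · simp [Instr.exec, erm a ha]
  · simp [Instr.exec, e3 16, e3 8, h16]
  · simp [Instr.exec, e3 17, h17]
  · simpa [Instr.exec, e3 5, em] using hbuf
  · simp [Instr.exec, e3 5, em, c2 (s.nreg 5 + 2 * d) (by omega), hnode]
  · intro p hp
    have : s₃.nreg 47 = s.nreg 47 := (hf₃.nreg 47 (by decide)).trans g47
    simp [Instr.exec, this, em, hb2, c2 (s.nreg 47 + p) (by omega)]
  · simp [Instr.exec, d2]
  · simp [Instr.exec, d2, e0, hE.rreg0]
  · simp [Instr.exec]
  · simp [Instr.exec]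
  · simp [Instr.exec]
  rintro s₄ - ⟨h4, k1, k2, k3⟩
  refine Reach.seq (Q₁ := fun s' => (∀ a < s₄.nreg 9, s'.rmem a = s₄.rmem a) ∧
    (0 < s'.nreg 46 ↔ 0 < s.nreg 46 ∨ ∃ p < d, RejAt X₂ d ν i b p))
    (Reach.forP (m := d) (T := checkTime d) (fun p s' => (∀ a < s₄.nreg 9, s'.rmem a = s₄.rmem a) ∧
      (0 < s'.nreg 46 ↔ 0 < s.nreg 46 ∨ ∃ l < p, RejAt X₂ d ν i b l)) (by decide)
      h4.env.reg2 h4.env.reg3 ⟨fun _ _ => rfl, ?_⟩ ?_ fun _ _ h => h) ?_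
  · have : s₄.nreg 46 = s.nreg 46 := by rw [k1, hf₃.nreg 46 (by decide), g46]
    simp [State.setN, this]
  · rintro p s' hp h49 hf ⟨l1, l2⟩
    have hc : CheckCtx X₁ X₂ d ν i b s' := h4.congr
      (fun x hx => hf.nreg x (by revert x; decide)) (hf.nreg 47 (by decide))
      (hf.rreg 0 (by decide)) (hf.rreg 11 (by decide)) (hf.rreg 12 (by decide)) (hf.nmem rfl) l1
    refine (reach_checkP hc hp h49).mono le_rfl ?_
    rintro s'' hf' ⟨m1, m2⟩ -
    refine ⟨fun a ha => ?_, ?_⟩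
    · exact (m1 a (by rwa [hf.nreg 9 (by decide)])).trans (l1 a ha)
    · simp only [State.setN, Function.update_of_ne (show 46 ≠ 49 by decide), m2, l2, or_assoc]
      rw [Nat.exists_lt_succ_right]
  rintro s₅ hf₅ ⟨m1, m2⟩
  have e47 : s₅.nreg 47 = s.nreg 47 := by
    rw [hf₅.nreg 47 (by decide), k1, hf₃.nreg 47 (by decide), g47]
  have e2 : s₅.nreg 2 = d := (hf₅.nreg 2 (by decide)).trans h4.env.reg2
  refine (Reach.blk _ _ ⟨?_, fun a ha => ?_, fun a ha => ?_, ?_⟩).mono (by simp) fun _ _ h => h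
  · simp [Instr.exec, e47, e2]
  · have := m1 a (by rwa [k1, e3 9 (by decide)])
    simp [Instr.exec, this, k3, erm a ha]
  · have := hf₅.nmem rfl
    simp [Instr.exec, this, k2, em, c2 a (by omega)]
  · simpa [Instr.exec] using m2

end ValidateProgram

end GGM

namespace GGM

/-! ### Validation of all candidates for one node -/

section JudgeProgram

variable {n k : ℕ} {X₁ X₂ : Sample k n} {d : ℕ} {ν : ℝ} {i : Fin n}

/-- Writing the set of the first `d` entries of the buffer to the output. -/
def writeP : Prog :=
  .seq (blk (.nconst 43 1) [.nstore 53 43]) (forP 56 2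
    (.seq (blk (.nadd 57 5 56) [.nload 57 57])
      (ifNe 57 17 (blk (.nadd 57 57 53) [.nadd 57 57 3, .nstore 57 3]))))

/-- The output row lies below the buffer by the last hypothesis, so writing does not disturb the
list that is being read. Entries equal to `i` are padding and are not marked. -/
theorem reach_writeP {s : State} (h2 : s.nreg 2 = d) (h3 : s.nreg 3 = 1) (h17 : s.nreg 17 = i)
    (hlt : ∀ p < d, s.nmem (s.nreg 5 + p) < n) (h53 : s.nreg 53 + n < s.nreg 5) :
    Reach writeP s (2 + (d * 9 + 2)) fun s' => s'.nreg 43 = 1 ∧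
      ∀ a, s'.nmem a = if a = s.nreg 53 ∨ (∃ p < d, s.nmem (s.nreg 5 + p) ≠ i ∧
        a = s.nreg 53 + 1 + s.nmem (s.nreg 5 + p)) then 1 else s.nmem a := by
  classical
  refine Reach.blk_seq (fun s' => (∀ x, x ≠ 43 → s'.nreg x = s.nreg x) ∧ s'.nreg 43 = 1 ∧
    s'.nmem = Function.update s.nmem (s.nreg 53) 1) rfl ⟨fun x hx => ?_, ?_, ?_⟩ ?_
  · simp [Instr.exec, hx]
  · simp [Instr.exec]
  · simp [Instr.exec]
  rintro s₁ - ⟨g1, g43, gm⟩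
  refine Reach.forP (m := d) (T := 7) (fun j s' => ∀ a, s'.nmem a =
    if a = s.nreg 53 ∨ (∃ p < j, s.nmem (s.nreg 5 + p) ≠ i ∧
        a = s.nreg 53 + 1 + s.nmem (s.nreg 5 + p)) then 1 else s.nmem a) (by decide)
    ((g1 2 (by decide)).trans h2) ((g1 3 (by decide)).trans h3) ?_ ?_ ?_
  · intro a
    simp [State.setN, gm, Function.update_apply]
  · intro j s' hj h56 hf hI
    have e5 : s'.nreg 5 = s.nreg 5 := (hf.nreg 5 (by decide)).trans (g1 5 (by decide))
    have e3 : s'.nreg 3 = 1 := (hf.nreg 3 (by decide)).trans ((g1 3 (by decide)).trans h3)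
    have e17 : s'.nreg 17 = i := (hf.nreg 17 (by decide)).trans ((g1 17 (by decide)).trans h17)
    have e53 : s'.nreg 53 = s.nreg 53 := (hf.nreg 53 (by decide)).trans (g1 53 (by decide))
    have ej : s'.nmem (s.nreg 5 + j) = s.nmem (s.nreg 5 + j) := by
      rw [hI, if_neg]
      rintro (h | ⟨p, hp, -, h⟩)
      · omega
      · have := hlt p (by omega)
        omega
    refine Reach.blk_seq (T₀ := 2) (T := 5) (fun s'' => s''.nreg 57 = s.nmem (s.nreg 5 + j) ∧
      s''.nreg 17 = i ∧ s''.nreg 53 = s.nreg 53 ∧ s''.nreg 3 = 1 ∧ s''.nmem = s'.nmem) rfl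
      (by simp [Instr.exec, h56, e5, ej, e17, e53, e3]) ?_
    rintro s'' - ⟨l1, l2, l3, l4, l5⟩
    refine Reach.ifNe (T := 3) (by decide) (fun hne => ?_) fun heq _ => ?_
    · rw [l1, l2] at hne
      refine (Reach.blk _ _ ?_).mono (by simp) fun _ _ h => h
      intro _ a
      simp only [Nat.exists_lt_succ_right]
      have hm : s.nmem (s.nreg 5 + j) + s.nreg 53 + 1 = s.nreg 53 + 1 + s.nmem (s.nreg 5 + j) := by
        omega
      simp only [List.foldl, Instr.exec, State.setN, Function.update_self, Function.update_of_ne,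
        ne_eq, Nat.reduceEqDiff, not_false_eq_true, l1, l3, l4, l5, hm, Function.update_apply, hI]
      by_cases ha : a = s.nreg 53 + 1 + s.nmem (s.nreg 5 + j)
      · simp [ha, hne]
      · simp [ha]
    · rw [l1, l2] at heq
      intro a
      simp only [Nat.exists_lt_succ_right]
      simp [State.setN, l5, hI, heq]
  · exact fun s' hf h => ⟨(hf.nreg 43 (by decide)).trans g43, h⟩

/-- The candidate `r` of the table `row` is discarded. -/
def Rej (X₂ : Sample k n) (d : ℕ) (ν : ℝ) (i : Fin n) (row : ℕ → ℕ → ℕ) (r : ℕ) : Prop :=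
  ∃ q < d + 1, ∃ p < d, RejAt X₂ d ν i (cat d (row r) (row q)) p

/-- The table of candidates. -/
def State.row (s : State) (d q p : ℕ) : ℕ := s.nmem (s.nreg 6 + (q * d + p))

theorem cat_congr {b b' c c' : ℕ → ℕ} (h : ∀ p < d, b p = b' p) (h' : ∀ p < d, c p = c' p)
    {p : ℕ} (hp : p < 2 * d) : cat d b c p = cat d b' c' p := by
  unfold cat
  split_ifs with hc
  · exact h p hc
  · exact h' _ (by omega)

theorem RejAt.congr {b b' : ℕ → ℕ} (h : ∀ p < 2 * d, b p = b' p) {p : ℕ} (hp : p < d)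
    (hr : RejAt X₂ d ν i b p) : RejAt X₂ d ν i b' p := by
  obtain ⟨h1, h2, h3⟩ := hr
  have e := h (d + p) (by omega)
  refine ⟨e ▸ h1, fun l hl => ?_, ?_⟩
  · rw [← h l (by omega), ← e]
    exact h2 l hl
  · rw [← e, ← listSet_congr h, ← listSet_congr h]
    exact h3

theorem rejAt_congr {b b' : ℕ → ℕ} (h : ∀ p < 2 * d, b p = b' p) {p : ℕ} (hp : p < d) :
    RejAt X₂ d ν i b p ↔ RejAt X₂ d ν i b' p :=
  ⟨RejAt.congr h hp, RejAt.congr (fun p hp => (h p hp).symm) hp⟩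

/-- The comparisons of one candidate with all candidates. -/
def judgeP : Prog :=
  .seq (copyP 44 5) (.seq (blk (.nconst 46 0) [.nconst 47 0, .nadd 47 47 6, .nadd 55 5 2])
    (forP 48 15 compareP))

/-- The number of steps for one candidate. -/
def judgeTime (d : ℕ) : ℕ := (d * 6 + 2) + (4 + ((d + 1) * (compareTime d + 2) + 2))

theorem reach_judgeP {s : State} (hE : Env X₁ X₂ d ν s) (h16 : s.nreg 16 = s.nreg 8)
    (h17 : s.nreg 17 = i) {r : ℕ} (hr : r < d + 1) (h44 : s.nreg 44 = s.nreg 6 + r * d)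
    (hnode : s.nmem (s.nreg 5 + 2 * d) = i) (hlt : ∀ q < d + 1, ∀ p < d, s.row d q p < n) :
    Reach judgeP s (judgeTime d) fun s' => (∀ a < s.nreg 9, s'.rmem a = s.rmem a) ∧
      (∀ p < d, s'.nmem (s.nreg 5 + p) = s.row d r p) ∧
      (∀ a, a < s.nreg 5 ∨ s.nreg 5 + 2 * d ≤ a → s'.nmem a = s.nmem a) ∧
      (0 < s'.nreg 46 ↔ Rej X₂ d ν i (s.row d) r) := by
  have h6 := hE.reg6
  refine Reach.seq (reach_copyP (d := d) hE.reg2 hE.reg3 (by decide) (by decide)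
    (Or.inr (by omega))) ?_
  rintro s₁ hf₁ ⟨c1, c2⟩
  rw [h44] at c1
  have e (x : ℕ) (hx : x ∉ (copyP 44 5).nw := by decide) := hf₁.nreg x hx
  refine Reach.blk_seq (fun s' => (∀ x < 18, s'.nreg x = s.nreg x) ∧ s'.nreg 46 = 0 ∧
    s'.nreg 47 = s.nreg 6 ∧ s'.nreg 55 = s.nreg 5 + d ∧ s'.nmem = s₁.nmem ∧ s'.rmem = s.rmem ∧
    s'.rreg 0 = s.rreg 0) rfl ⟨fun x hx => ?_, ?_, ?_, ?_, ?_, ?_, ?_⟩ ?_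
  · rw [← e x (by revert x; decide)]
    simp [Instr.exec, show x ≠ 46 ∧ x ≠ 47 ∧ x ≠ 55 by omega]
  · simp [Instr.exec]
  · simp [Instr.exec, e 6]
  · simp [Instr.exec, e 5, e 2, hE.reg2]
  · simp [Instr.exec]
  · simpa [Instr.exec] using hf₁.rmem rfl
  · simpa [Instr.exec] using hf₁.rreg 0 (by decide)
  rintro s₂ - ⟨g1, g46, g47, g55, gm, grm, g0⟩
  have hbuf (p : ℕ) (hp : p < d) : s₁.nmem (s.nreg 5 + p) = s.row d r p := by
    rw [c1 p hp, State.row, add_assoc]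
  refine Reach.forP (m := d + 1) (T := compareTime d) (fun q s' =>
    (∀ a < s.nreg 9, s'.rmem a = s.rmem a) ∧ s'.nreg 47 = s.nreg 6 + q * d ∧
    (∀ a, a < s.nreg 5 + d ∨ s.nreg 5 + 2 * d ≤ a → s'.nmem a = s₁.nmem a) ∧
    (0 < s'.nreg 46 ↔ ∃ q' < q, ∃ p < d, RejAt X₂ d ν i (cat d (s.row d r) (s.row d q')) p))
    (by decide) ((g1 15 (by decide)).trans hE.reg15) ((g1 3 (by decide)).trans hE.reg3)
    ⟨fun a _ => by rw [State.setN, grm], by simp [State.setN, g47], fun a _ => by rw [State.setN, gm],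
      by simp [State.setN, g46]⟩ ?_ ?_
  · rintro q s' hq h48 hf ⟨i1, i2, i3, i4⟩
    have e' (x : ℕ) (hx : x < 18) : s'.nreg x = s.nreg x :=
      (hf.nreg x (by revert x; decide)).trans (g1 x hx)
    have hE' : Env X₁ X₂ d ν s' := hE.congr (fun x hx => e' x (by omega))
      ((hf.rreg 0 (by decide)).trans g0)
      (fun a _ ha => by rw [i3 a (by omega), c2 a (by omega)]) i1
    have hbuf' (p : ℕ) (hp : p < d) : s'.nmem (s'.nreg 5 + p) = s.row d r p := by
      rw [e' 5 (by decide), i3 _ (by omega), hbuf p hp]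
    have hrow' (p : ℕ) (hp : p < d) : s'.nmem (s'.nreg 47 + p) = s.row d q p := by
      rw [i2, i3 _ (by omega), c2 _ (by omega), State.row, add_assoc]
    refine (reach_compareP hE' (by rw [e' 16 (by decide), e' 8 (by decide), h16])
      ((e' 17 (by decide)).trans h17)
      (by rw [hf.nreg 55 (by decide), g55, e' 5 (by decide)])
      (by rw [i2, e' 6 (by decide)]; omega) ?_ (fun p hp => ?_) fun p hp => ?_).mono le_rfl ?_
    · rw [e' 5 (by decide), i3 _ (by omega), c2 _ (by omega), hnode]
    · rw [hbuf' p hp]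
      exact hlt r hr p hp
    · rw [hrow' p hp]
      exact hlt q hq p hp
    · rintro s'' - ⟨j1, j2, j3, j4⟩ -
      refine ⟨fun a ha => (j2 a (by rwa [e' 9 (by decide)])).trans (i1 a ha), ?_, fun a ha => ?_, ?_⟩
      · simp only [State.setN, Function.update_of_ne (show 47 ≠ 48 by decide), j1, i2]
        ring
      · exact (j3 a (by rwa [e' 5 (by decide)])).trans (i3 a ha)
      · simp only [State.setN, Function.update_of_ne (show 46 ≠ 48 by decide), j4, i4,
          Nat.exists_lt_succ_right]
        refine or_congr_right (exists_congr fun p => and_congr_right fun hp => ?_)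
        exact rejAt_congr (fun p hp => cat_congr hbuf' hrow' hp) hp
  · rintro s' hf ⟨i1, i2, i3, i4⟩
    refine ⟨i1, fun p hp => ?_, fun a ha => ?_, i4⟩
    · rw [i3 _ (by omega), hbuf p hp]
    · rw [i3 a (by omega), c2 a (by omega)]

/-- The validation of all candidates. -/
def validateP : Prog :=
  .seq (blk (.nconst 43 0) [.nconst 44 0, .nadd 44 44 6, .nconst 16 0, .nadd 16 16 8])
    (forP 45 15 (.seq judgeP (.seq (.ite (.nlt 46 3) (.ite (.nlt 43 3) writeP skipP) skipP)
      (blk (.nadd 44 44 2) []))))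

/-- The number of steps of the validation. -/
def validateTime (d : ℕ) : ℕ :=
  5 + ((d + 1) * (judgeTime d + (((2 + (d * 9 + 2)) + 1 + 1) + 1) + 2) + 2)

/-- The memory `m'` arises from `m` by writing the candidate `r` to the output. -/
def Written (d i ptr : ℕ) (row : ℕ → ℕ) (m m' : ℕ → ℕ) (a : ℕ) : Prop :=
  open Classical in
  m' a = if a = ptr ∨ (∃ p < d, row p ≠ i ∧ a = ptr + 1 + row p) then 1 else m a

/-- Register `43` records whether a candidate has been accepted. The loop does not stop then, but
the writing is suppressed, so the output shows the first accepted candidate. -/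
theorem reach_validateP {s : State} (hE : Env X₁ X₂ d ν s) (h17 : s.nreg 17 = i)
    (hnode : s.nmem (s.nreg 5 + 2 * d) = i) (hlt : ∀ q < d + 1, ∀ p < d, s.row d q p < n)
    (h53 : s.nreg 53 + n < s.nreg 4) :
    Reach validateP s (validateTime d) fun s' => (∀ a < s.nreg 9, s'.rmem a = s.rmem a) ∧
      (((∀ r < d + 1, Rej X₂ d ν i (s.row d) r) ∧ ∀ a < s.nreg 5, s'.nmem a = s.nmem a) ∨
      ∃ r < d + 1, ¬ Rej X₂ d ν i (s.row d) r ∧ (∀ q < r, Rej X₂ d ν i (s.row d) q) ∧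
        ∀ a < s.nreg 5, Written d i (s.nreg 53) (s.row d r) s.nmem s'.nmem a) := by
  have h6 := hE.reg6
  have h5 := hE.reg5
  refine Reach.blk_seq (fun s' => (∀ x < 16, s'.nreg x = s.nreg x) ∧ s'.nreg 16 = s.nreg 8 ∧
    s'.nreg 17 = i ∧ s'.nreg 53 = s.nreg 53 ∧ s'.nreg 43 = 0 ∧ s'.nreg 44 = s.nreg 6 ∧
    s'.nmem = s.nmem ∧ s'.rmem = s.rmem ∧
    s'.rreg 0 = s.rreg 0) rfl ⟨fun x hx => ?_, ?_, ?_, ?_, ?_, ?_, ?_, ?_, ?_⟩ ?_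
  · simp [Instr.exec, show x ≠ 43 ∧ x ≠ 44 ∧ x ≠ 16 by omega]
  · simp [Instr.exec]
  · simp [Instr.exec, h17]
  · simp [Instr.exec]
  · simp [Instr.exec]
  · simp [Instr.exec]
  · simp [Instr.exec]
  · simp [Instr.exec]
  · simp [Instr.exec]
  rintro s₁ - ⟨g1, g16, g17, g53, g43, g44, gm, grm, g0⟩
  refine Reach.forP (m := d + 1) (fun r s' => (∀ a < s.nreg 9, s'.rmem a = s.rmem a) ∧
    s'.nreg 44 = s.nreg 6 + r * d ∧ (∀ a, s.nreg 5 + 2 * d ≤ a → s'.nmem a = s.nmem a) ∧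
    ((s'.nreg 43 = 0 ∧ (∀ q < r, Rej X₂ d ν i (s.row d) q) ∧ ∀ a < s.nreg 5, s'.nmem a = s.nmem a) ∨
      (s'.nreg 43 = 1 ∧ ∃ q < r, ¬ Rej X₂ d ν i (s.row d) q ∧
        (∀ q' < q, Rej X₂ d ν i (s.row d) q') ∧
        ∀ a < s.nreg 5, Written d i (s.nreg 53) (s.row d q) s.nmem s'.nmem a)))
    (by decide) ((g1 15 (by decide)).trans hE.reg15) ((g1 3 (by decide)).trans hE.reg3)
    ⟨fun a _ => by rw [State.setN, grm], by simp [State.setN, g44], fun a _ => by rw [State.setN, gm],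
      by simp [State.setN, g43, gm]⟩ ?_ ?_
  · rintro r s₂ hr h45 hf ⟨i1, i2, i3, i4⟩
    have e (x : ℕ) (hx : x < 16) : s₂.nreg x = s.nreg x :=
      (hf.nreg x (by revert x; decide)).trans (g1 x hx)
    have e16 : s₂.nreg 16 = s.nreg 8 := (hf.nreg 16 (by decide)).trans g16
    have e17 : s₂.nreg 17 = i := (hf.nreg 17 (by decide)).trans g17
    have e53 : s₂.nreg 53 = s.nreg 53 := (hf.nreg 53 (by decide)).trans g53
    -- An output row ends before the table of multiples of `n`, which therefore stays intact.
    have hmid : ∀ a, s.nreg 4 ≤ a → a < s.nreg 5 → s₂.nmem a = s.nmem a := by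
      intro a ha ha'
      rcases i4 with ⟨-, -, h⟩ | ⟨-, q, hq, -, -, h⟩
      · exact h a ha'
      · have hw := h a ha'
        rw [Written, if_neg] at hw
        · exact hw
        · rintro (h | ⟨p, hp, -, h⟩)
          · omega
          · have := hlt q (by omega) p hp
            omega
    have hE₂ : Env X₁ X₂ d ν s₂ := hE.congr e ((hf.rreg 0 (by decide)).trans g0)
      hmid i1
    have hrow (q p : ℕ) : s₂.row d q p = s.row d q p := by
      rw [State.row, State.row, e 6 (by decide), i3 _ (by omega)]
    have hrow' : s₂.row d = s.row d := by
      funext q p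
      exact hrow q p
    refine Reach.seq (reach_judgeP hE₂ (by rw [e16, e 8 (by decide)]) e17 hr
      (by rw [i2, e 6 (by decide)]) (by rw [e 5 (by decide), i3 _ le_rfl, hnode])
      (by rw [hrow']; exact hlt)) ?_
    rintro s₃ hf₃ ⟨j1, j2, j3, j4⟩
    rw [e 5 (by decide)] at j2 j3
    rw [e 9 (by decide)] at j1
    rw [hrow'] at j2 j4
    have e' (x : ℕ) (hx : x < 16) : s₃.nreg x = s.nreg x :=
      (hf₃.nreg x (by revert x; decide)).trans (e x hx)
    have e53' : s₃.nreg 53 = s.nreg 53 := (hf₃.nreg 53 (by decide)).trans e53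
    have e43 : s₃.nreg 43 = s₂.nreg 43 := hf₃.nreg 43 (by decide)
    have e3 : s₃.nreg 3 = 1 := (e' 3 (by decide)).trans hE.reg3
    have hlow : ∀ a < s.nreg 5, s₃.nmem a = s₂.nmem a := fun a ha => j3 a (Or.inl ha)
    have hhigh : ∀ a, s.nreg 5 + 2 * d ≤ a → s₃.nmem a = s.nmem a := fun a ha =>
      (j3 a (Or.inr ha)).trans (i3 a ha)
    have hrm : ∀ a < s.nreg 9, s₃.rmem a = s.rmem a := fun a ha => (j1 a ha).trans (i1 a ha)
    refine Reach.seq (Q₁ := fun s' => (∀ a < s.nreg 9, s'.rmem a = s.rmem a) ∧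
      (∀ a, s.nreg 5 + 2 * d ≤ a → s'.nmem a = s.nmem a) ∧
      ((s'.nreg 43 = 0 ∧ (∀ q < r + 1, Rej X₂ d ν i (s.row d) q) ∧
        ∀ a < s.nreg 5, s'.nmem a = s.nmem a) ∨
      (s'.nreg 43 = 1 ∧ ∃ q < r + 1, ¬ Rej X₂ d ν i (s.row d) q ∧
        (∀ q' < q, Rej X₂ d ν i (s.row d) q') ∧
        ∀ a < s.nreg 5, Written d i (s.nreg 53) (s.row d q) s.nmem s'.nmem a))) ?_ ?_
    · have hfound : s₃.nreg 43 = 1 → ∃ q < r + 1, ¬ Rej X₂ d ν i (s.row d) q ∧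
          (∀ q' < q, Rej X₂ d ν i (s.row d) q') ∧
          ∀ a < s.nreg 5, Written d i (s.nreg 53) (s.row d q) s.nmem s₃.nmem a := by
        intro h43
        rcases i4 with ⟨h, -, -⟩ | ⟨-, q, hq, h1, h2, h3⟩
        · omega
        · refine ⟨q, by omega, h1, h2, fun a ha => ?_⟩
          rw [Written, hlow a ha]
          exact h3 a ha
      have hnone : s₃.nreg 43 ≠ 1 → s₃.nreg 43 = 0 ∧ (∀ q < r, Rej X₂ d ν i (s.row d) q) ∧
          ∀ a < s.nreg 5, s₃.nmem a = s.nmem a := by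
        intro h43
        rcases i4 with ⟨h1, h2, h3⟩ | ⟨h, -⟩
        · exact ⟨e43.trans h1, h2, fun a ha => (hlow a ha).trans (h3 a ha)⟩
        · omega
      have hskip : ∀ s' : State, s'.nreg 43 = s₃.nreg 43 → s'.nmem = s₃.nmem → s'.rmem = s₃.rmem →
          (s₃.nreg 43 = 1 ∨ Rej X₂ d ν i (s.row d) r) → (∀ a < s.nreg 9, s'.rmem a = s.rmem a) ∧
          (∀ a, s.nreg 5 + 2 * d ≤ a → s'.nmem a = s.nmem a) ∧
          ((s'.nreg 43 = 0 ∧ (∀ q < r + 1, Rej X₂ d ν i (s.row d) q) ∧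
            ∀ a < s.nreg 5, s'.nmem a = s.nmem a) ∨
          (s'.nreg 43 = 1 ∧ ∃ q < r + 1, ¬ Rej X₂ d ν i (s.row d) q ∧
            (∀ q' < q, Rej X₂ d ν i (s.row d) q') ∧
            ∀ a < s.nreg 5, Written d i (s.nreg 53) (s.row d q) s.nmem s'.nmem a)) := by
        intro s' k1 k2 k3 hor
        rw [k1, k2, k3]
        refine ⟨hrm, hhigh, ?_⟩
        by_cases h43 : s₃.nreg 43 = 1
        · exact Or.inr ⟨h43, hfound h43⟩
        · obtain ⟨h1, h2, h3⟩ := hnone h43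
          refine Or.inl ⟨h1, fun q hq => ?_, h3⟩
          rcases Nat.lt_succ_iff_lt_or_eq.1 hq with hq | rfl
          · exact h2 q hq
          · exact hor.resolve_left h43
      refine Reach.ite (fun hb => Reach.ite (fun hb' => ?_) fun hb' => ?_) fun hb => ?_
      · simp only [Test.holds, e3] at hb hb'
        obtain ⟨h1, h2, h3⟩ := hnone (by omega)
        have hrej : ¬ Rej X₂ d ν i (s.row d) r := fun h => by
          have := j4.2 h
          omega
        refine (reach_writeP (d := d) (n := n) (i := i) ((e' 2 (by decide)).trans hE.reg2) e3
          ((hf₃.nreg 17 (by decide)).trans e17) (fun p hp => ?_) ?_).mono le_rfl ?_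
        · rw [e' 5 (by decide), j2 p hp]
          exact hlt r hr p hp
        · rw [e53', e' 5 (by decide)]
          omega
        · rintro s' hf' ⟨w1, w2⟩
          have w3 (a : ℕ) : Written d i (s.nreg 53) (s.row d r) s₃.nmem s'.nmem a := by
            classical
            rw [Written, w2 a, e53', e' 5 (by decide)]
            refine if_congr (or_congr_right (exists_congr fun p => and_congr_right fun hp => ?_))
              rfl rfl
            rw [j2 p hp]
          refine ⟨fun a ha => by rw [hf'.rmem rfl, hrm a ha], fun a ha => ?_, Or.inr ⟨w1, r,
            Nat.lt_succ_self r, hrej, h2, fun a ha => ?_⟩⟩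
          · rw [← hhigh a ha, w3 a, if_neg]
            rintro (h | ⟨p, hp, -, h⟩)
            · omega
            · have := hlt r hr p hp
              omega
          · rw [Written, ← h3 a ha]
            exact w3 a
      · simp only [Test.holds, e3] at hb'
        refine ⟨1, _, Runs.instr _ s₃, by omega, hskip _ (by simp [Instr.exec]) rfl rfl (Or.inl ?_)⟩
        by_contra hc
        have := (hnone hc).1
        omega
      · simp only [Test.holds, e3] at hb
        exact ⟨1, _, Runs.instr _ s₃, by omega, hskip _ (by simp [Instr.exec]) rfl rfl
          (Or.inr (j4.1 (by omega)))⟩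
    · rintro s₄ hf₄ ⟨l1, l2, l3⟩
      have e44 : s₄.nreg 44 = s.nreg 6 + r * d := by
        rw [hf₄.nreg 44 (by decide), hf₃.nreg 44 (by decide), i2]
      have e2 : s₄.nreg 2 = d := by
        rw [hf₄.nreg 2 (by decide), e' 2 (by decide), hE.reg2]
      refine (Reach.blk _ _ fun _ => ⟨?_, ?_, ?_, ?_⟩).mono (by simp) fun _ _ h => h
      · simpa [Instr.exec, State.setN] using l1
      · simp [Instr.exec, State.setN, e44, e2]
        ring
      · simpa [Instr.exec, State.setN] using l2
      · simpa [Instr.exec, State.setN] using l3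
  · rintro s' - ⟨i1, -, -, i4⟩
    refine ⟨i1, ?_⟩
    rcases i4 with ⟨-, h1, h2⟩ | ⟨-, h⟩
    · exact Or.inl ⟨h1, h2⟩
    · exact Or.inr h

end JudgeProgram

end GGM

namespace GGM

/-! ### All steps for a node, and all nodes -/

section NodeProgram

variable {n k : ℕ} {X₁ X₂ : Sample k n} {d : ℕ} {ν : ℝ} {i : Fin n}

theorem listSet_cat (i : ℕ) (b c : ℕ → ℕ) :
    listSet (n := n) i n (cat d b c) (2 * d) = listSet i n b d ∪ listSet i n c d := by
  ext j
  simp only [Finset.mem_union, mem_listSet, cat]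
  constructor
  · rintro ⟨h1, h2, p, hp, h⟩
    split_ifs at h with hc
    · exact Or.inl ⟨h1, h2, p, hc, h⟩
    · exact Or.inr ⟨h1, h2, p - d, by omega, h⟩
  · rintro (⟨h1, h2, p, hp, h⟩ | ⟨h1, h2, p, hp, h⟩)
    · exact ⟨h1, h2, p, by omega, by simp [hp, h]⟩
    · exact ⟨h1, h2, d + p, by omega, by simp [h]⟩

theorem listSet_erase (i : ℕ) (b : ℕ → ℕ) (L : ℕ) (j : Fin n) :
    listSet (n := n) i j b L = (listSet i n b L).erase j := by
  ext l
  simp only [Finset.mem_erase, mem_listSet, ne_eq, Fin.val_inj]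
  have := l.2.ne
  tauto

/-- The program also compares a candidate with itself; no entry then lies outside the first list, so
the condition q ≠ r of the specification holds automatically. -/
theorem rej_iff {row : ℕ → ℕ → ℕ} (hlt : ∀ q < d + 1, ∀ p < d, row q p < n)
    {w : ℕ → Fin n → ℝ} (hw : ∀ q < d + 1, supp (w q) = listSet i n (row q) d) {r : ℕ}
    (hr : r < d + 1) : Rej X₂ d ν i row r ↔ IsRejected X₂ d ν i w r := by
  rw [isRejected_iff, Rej]
  constructor
  · rintro ⟨q, hq, p, hp, h1, h2, h3⟩
    have hcat : cat d (row r) (row q) (d + p) = row q p := by simp [cat]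
    have hcat' (l : ℕ) (hl : l < d) : cat d (row r) (row q) l = row r l := by simp [cat, hl]
    rw [hcat] at h1 h2 h3
    refine ⟨q, by omega, ?_, ⟨row q p, hlt q hq p hp⟩, ?_, ?_⟩
    · rintro rfl
      exact h2 p hp (hcat' p hp)
    · rw [hw q hq, hw r hr, Finset.mem_sdiff, mem_listSet, mem_listSet]
      refine ⟨⟨h1, (hlt q hq p hp).ne, p, hp, rfl⟩, ?_⟩
      rintro ⟨-, -, l, hl, h⟩
      exact h2 l hl ((hcat' l hl).trans h)
    · have := listSet_erase (n := n) i (cat d (row r) (row q)) (2 * d) ⟨row q p, hlt q hq p hp⟩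
      rw [hw q hq, hw r hr, ← listSet_cat, ← this]
      exact h3
  · rintro ⟨q, hq, hne, j, hj, h⟩
    rw [hw q (by omega), hw r hr] at hj h
    rw [Finset.mem_sdiff, mem_listSet, mem_listSet] at hj
    obtain ⟨⟨h1, h2, p, hp, hpj⟩, hj'⟩ := hj
    have hcat : cat d (row r) (row q) (d + p) = j := by simp [cat, hpj]
    refine ⟨q, by omega, p, hp, ?_, ?_, ?_⟩
    · rw [hcat]
      exact h1
    · intro l hl hc
      rw [hcat, cat, if_pos hl] at hc
      exact hj' ⟨h1, h2, l, hl, hc⟩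
    · rw [hcat, listSet_erase, listSet_cat]
      exact h

/-- The row `i` of the output table shows the result `o`. -/
def HoldsRow (n i : ℕ) (o : Option (Finset (Fin n))) (mem : ℕ → ℕ) : Prop :=
  mem (i * (n + 1)) = (if o.isSome then 1 else 0) ∧
    ∀ j : Fin n, mem (i * (n + 1) + 1 + j) = if j ∈ o.getD ∅ then 1 else 0

/-- All steps for one node. -/
def nodeP : Prog := .seq searchP (.seq validateP (blk (.nadd 53 53 13) []))

/-- The number of steps for one node. -/
def nodeTime (n d : ℕ) : ℕ := searchTime n d + (validateTime d + 1)

theorem reach_nodeP {s : State} (hE : Env X₁ X₂ d ν s) (h17 : s.nreg 17 = i)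
    (h53 : s.nreg 53 = i * (n + 1)) (hzero : ∀ a, i * (n + 1) ≤ a → a < n * (n + 1) → s.nmem a = 0) :
    Reach nodeP s (nodeTime n d) fun s' => Env X₁ X₂ d ν s' ∧ s'.nreg 53 = (i + 1) * (n + 1) ∧
      (∃ o, IsSearchAndValidateOutput X₁ X₂ d ν i o ∧ HoldsRow n i o s'.nmem) ∧
      (∀ a < i * (n + 1), s'.nmem a = s.nmem a) ∧
      ∀ a, (i + 1) * (n + 1) ≤ a → a < n * (n + 1) → s'.nmem a = 0 := by
  have hn : 0 < n := i.pos
  have h4 := hE.reg4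
  have h5 := hE.reg5
  have hmul : (i + 1) * (n + 1) = i * (n + 1) + (n + 1) := Nat.succ_mul _ _
  have hle : (i + 1) * (n + 1) ≤ n * (n + 1) := Nat.mul_le_mul_right _ i.2
  refine (reach_searchP hE h17).seq fun s₁ hf₁ h₁ => ?_
  have hE₁ := h₁.same.env hE
  have e4 : s₁.nreg 4 = s.nreg 4 := h₁.same.nreg 4 (by decide)
  have e5 : s₁.nreg 5 = s.nreg 5 := h₁.same.nreg 5 (by decide)
  have e6 : s₁.nreg 6 = s.nreg 6 := h₁.same.nreg 6 (by decide)
  have e53 : s₁.nreg 53 = i * (n + 1) := (hf₁.nreg 53 (by decide)).trans h53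
  have hrow (q : ℕ) (hq : q < d + 1) : CandRow X₁ i d (s₁.nreg 6) q s₁.nmem := by
    rw [e6]
    exact h₁.rows q (by omega)
  have hlt : ∀ q < d + 1, ∀ p < d, s₁.row d q p < n := fun q hq p hp => (hrow q hq).lt p hp
  have hcand (q : ℕ) (hq : q < d + 1) : IsCand X₁ i q (listSet i n (s₁.row d q) d) :=
    (hrow q hq).cand
  -- The program never computes coefficients. It suffices that each set found is the support of some
  -- minimizer, and the output of the specification is the one for this choice of minimizers.
  have hmin : ∀ q, ∃ w : Fin n → ℝ, q < d + 1 →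
      IsL0Minimizer X₁ i q w ∧ supp w = listSet i n (s₁.row d q) d := by
    intro q
    by_cases hq : q < d + 1
    · obtain ⟨w, hw⟩ := exists_isL0Minimizer (hcand q hq).notMem (hcand q hq).card
        (hcand q hq).le (hcand q hq).lt
      exact ⟨w, fun _ => hw⟩
    · exact ⟨0, fun h => absurd h hq⟩
  choose w hw using hmin
  have hrej (r : ℕ) (hr : r < d + 1) := rej_iff (X₂ := X₂) (ν := ν) hlt (fun q hq => (hw q hq).2) hr
  refine (reach_validateP hE₁ h₁.reg17 (by rw [e5]; exact h₁.pad _ le_rfl (by omega)) hlt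
    (by rw [e53, e4]; omega)).seq ?_
  rintro s₂ hf₂ ⟨hrm, hcase⟩
  rw [e53, e5] at hcase
  have e53' : s₂.nreg 53 = i * (n + 1) := (hf₂.nreg 53 (by decide)).trans e53
  have e13 : s₂.nreg 13 = n + 1 := (hf₂.nreg 13 (by decide)).trans hE₁.reg13
  have hlow : ∀ a < s.nreg 5, s₁.nmem a = s.nmem a := h₁.same.nmem
  have hout : IsSearchAndValidateOutput X₁ X₂ d ν i (validate X₂ d ν i w) :=
    ⟨w, fun q hq => (hw q (by omega)).1, rfl⟩
  have main : ∃ o, IsSearchAndValidateOutput X₁ X₂ d ν i o ∧ HoldsRow n i o s₂.nmem ∧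
      ∀ a < s.nreg 5, (a < i * (n + 1) ∨ (i + 1) * (n + 1) ≤ a) → s₂.nmem a = s.nmem a := by
    rcases hcase with ⟨hall, hmem⟩ | ⟨r, hr, hnot, hbefore, hmem⟩
    · refine ⟨none, ?_, ⟨?_, fun j => ?_⟩, fun a ha _ => (hmem a ha).trans (hlow a ha)⟩
      · rw [← validate_eq_none (X := X₂) (d := d) (ν := ν) (i := i) (w := w) fun q hq =>
          (hrej q (by omega)).1 (hall q (by omega))]
        exact hout
      · rw [hmem _ (by omega), hlow _ (by omega), hzero _ le_rfl (by omega)]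
        simp
      · have := j.2
        rw [hmem _ (by omega), hlow _ (by omega), hzero _ (by omega) (by omega)]
        simp
    · refine ⟨some (supp (w r)), ?_, ⟨?_, fun j => ?_⟩, fun a ha hor => ?_⟩
      · rw [← validate_eq_some (X := X₂) (d := d) (ν := ν) (i := i) (w := w) (by omega)
          (fun h => hnot ((hrej r hr).2 h)) fun q hq =>
          (hrej q (by omega)).1 (hbefore q hq)]
        exact hout
      · have h := hmem (i * (n + 1)) (by omega)
        rw [Written, if_pos (Or.inl rfl)] at h
        rw [h]
        simp
      · have h := hmem (i * (n + 1) + 1 + j) (by have := j.2; omega)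
        rw [h, hlow _ (by have := j.2; omega), hzero _ (by omega) (by have := j.2; omega)]
        rw [Option.getD_some, (hw r hr).2]
        refine if_congr ?_ rfl rfl
        rw [mem_listSet]
        constructor
        · rintro (h | ⟨p, hp, h1, h2⟩)
          · omega
          · have hj : s₁.row d r p = j := by omega
            exact ⟨by rwa [hj] at h1, j.2.ne, p, hp, hj⟩
        · rintro ⟨h1, -, p, hp, h2⟩
          exact Or.inr ⟨p, hp, by rwa [h2], by rw [h2]⟩
      · have h := hmem a ha
        rw [Written, if_neg] at h
        · rw [h, hlow a ha]
        · rintro (h | ⟨p, hp, -, h⟩)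
          · omega
          · have := hlt r hr p hp
            omega
  obtain ⟨o, ho1, ho2, ho3⟩ := main
  have hE₂ : Env X₁ X₂ d ν s₂ := hE.congr
    (fun x hx => (hf₂.nreg x (by revert x; decide)).trans (h₁.same.nreg x hx))
    ((hf₂.rreg 0 (by decide)).trans h₁.same.rreg)
    (fun a ha ha' => ho3 a ha' (Or.inr (by omega)))
    fun a ha => (hrm a (by rwa [h₁.same.nreg 9 (by decide)])).trans (h₁.same.rmem a ha)
  refine (Reach.blk _ _ ⟨?_, ?_, ⟨o, ho1, ?_⟩, fun a ha => ?_, fun a ha ha' => ?_⟩).mono (by simp)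
    fun _ _ h => h
  · refine hE₂.congr (fun x hx => ?_) rfl (fun _ _ _ => rfl) fun _ _ => rfl
    simp [Instr.exec, show x ≠ 53 by omega]
  · simp [Instr.exec, e53', e13, hmul]
  · simpa [Instr.exec] using ho2
  · simpa [Instr.exec] using ho3 a (by omega) (Or.inl ha)
  · simpa [Instr.exec] using (ho3 a (by omega) (Or.inr ha)).trans (hzero a (by omega) ha')

/-- The steps for all nodes. -/
def nodesP : Prog := .seq (blk (.nconst 53 0) []) (forP 17 0 nodeP)

theorem holdsRow_congr {i : Fin n} {o : Option (Finset (Fin n))} {mem mem' : ℕ → ℕ}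
    (h : HoldsRow n i o mem)
    (he : ∀ a < (i + 1) * (n + 1), mem' a = mem a) : HoldsRow n i o mem' := by
  have hmul : (i + 1) * (n + 1) = i * (n + 1) + (n + 1) := Nat.succ_mul _ _
  refine ⟨by rw [he _ (by omega)]; exact h.1, fun j => ?_⟩
  rw [he _ (by have := j.2; omega)]
  exact h.2 j

theorem reach_nodesP {s : State} (hE : Env X₁ X₂ d ν s) (hzero : ∀ a < n * (n + 1), s.nmem a = 0) :
    Reach nodesP s (1 + (n * (nodeTime n d + 2) + 2)) fun s' => ∀ i : Fin n,
      ∃ o, IsSearchAndValidateOutput X₁ X₂ d ν i o ∧ HoldsRow n i o s'.nmem := by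
  refine Reach.blk_seq (fun s' => Env X₁ X₂ d ν s' ∧ s'.nreg 53 = 0 ∧ s'.nmem = s.nmem) rfl
    ⟨hE.congr (fun x hx => ?_) rfl (fun _ _ _ => rfl) fun _ _ => rfl, ?_, ?_⟩ ?_
  · simp [Instr.exec, show x ≠ 53 by omega]
  · simp [Instr.exec]
  · simp [Instr.exec]
  rintro s₁ - ⟨hE₁, h53, hm⟩
  refine Reach.forP (m := n) (fun j s' => Env X₁ X₂ d ν s' ∧ s'.nreg 53 = j * (n + 1) ∧
    (∀ a, j * (n + 1) ≤ a → a < n * (n + 1) → s'.nmem a = 0) ∧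
    ∀ i : Fin n, (i : ℕ) < j →
      ∃ o, IsSearchAndValidateOutput X₁ X₂ d ν i o ∧ HoldsRow n i o s'.nmem) (by decide)
    hE₁.reg0 hE₁.reg3 ⟨?_, ?_, ?_, fun i hi => absurd hi (Nat.not_lt_zero _)⟩ ?_ ?_
  · exact hE₁.congr (fun x hx => by simp [State.setN, show x ≠ 17 by omega]) rfl
      (fun _ _ _ => rfl) fun _ _ => rfl
  · simp [State.setN, h53]
  · intro a _ ha
    rw [State.setN, hm, hzero a ha]
  · rintro j s₂ hj h17 hf ⟨i1, i2, i3, i4⟩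
    refine (reach_nodeP (i := ⟨j, hj⟩) i1 h17 i2 i3).mono le_rfl ?_
    rintro s₃ - ⟨k1, k2, k3, k4, k5⟩ -
    refine ⟨?_, ?_, k5, fun i hi => ?_⟩
    · exact k1.congr (fun x hx => by simp [State.setN, show x ≠ 17 by omega]) rfl
        (fun _ _ _ => rfl) fun _ _ => rfl
    · simpa [State.setN] using k2
    · rcases Nat.lt_succ_iff_lt_or_eq.1 hi with hi | hi
      · obtain ⟨o, ho1, ho2⟩ := i4 i hi
        have hle : (i + 1) * (n + 1) ≤ j * (n + 1) := Nat.mul_le_mul_right _ hi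
        exact ⟨o, ho1, holdsRow_congr ho2 fun a ha => k4 a (lt_of_lt_of_le ha hle)⟩
      · have : i = ⟨j, hj⟩ := Fin.ext hi
        subst this
        exact k3
  · rintro s' - ⟨-, -, -, h⟩ i
    exact h i i.2

end NodeProgram

end GGM

namespace GGM

/-! ### Gram matrices, multiples of `n` and products -/

section Setup

variable {n k : ℕ} {X₁ X₂ : Sample k n} {d : ℕ} {ν : ℝ}

/-- The inner product of two columns of a sample; the natural number registers `27` and `28`
point at the columns, the result is in the real register `2`. -/
def dotP : Prog := forP 29 1
  (blk (.rload 3 27) [.rload 4 28, .rmul 3 3 4, .radd 2 2 3, .nadd 27 27 0, .nadd 28 28 0])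

theorem reach_dotP {s : State} (h0 : s.nreg 0 = n) (h1 : s.nreg 1 = k) (h3 : s.nreg 3 = 1)
    (hr : s.rreg 2 = 0) : Reach dotP s (k * (6 + 2) + 2) fun s' => s'.rreg 2 =
      ∑ l ∈ Finset.range k, s.rmem (s.nreg 27 + l * n) * s.rmem (s.nreg 28 + l * n) := by
  refine Reach.forP (m := k) (fun j s' => s'.nreg 27 = s.nreg 27 + j * n ∧
    s'.nreg 28 = s.nreg 28 + j * n ∧ s'.rreg 2 =
      ∑ l ∈ Finset.range j, s.rmem (s.nreg 27 + l * n) * s.rmem (s.nreg 28 + l * n)) (by decide)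
    h1 h3 (by simp [State.setN, hr]) ?_ fun _ _ h => h.2.2
  rintro j s₁ - - hf ⟨i1, i2, i3⟩
  have e0 : s₁.nreg 0 = n := (hf.nreg 0 (by decide)).trans h0
  have em : s₁.rmem = s.rmem := hf.rmem (by decide)
  refine Reach.blk _ _ ?_
  rintro -
  simp [Instr.exec, State.setN, e0, em, i1, i2, i3, Finset.sum_range_succ, Nat.succ_mul,
    Nat.add_assoc]

/-- The Gram matrix of the columns of a sample. The sample starts at the address in register `24`,
the matrix at the address in register `23`, which is moved to its end. -/
def gramP : Prog := forP 25 0 (forP 26 0 (.seq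
  (blk (.nadd 27 24 25) [.nadd 28 24 26, .rconst 2 0]) (.seq dotP
  (blk (.rstore 23 2) [.nadd 23 23 3]))))

theorem mul_add_inj {a b c e n : ℕ} (hb : b < n) (he : e < n) (h : a * n + b = c * n + e) :
    a = c ∧ b = e := by
  have hn : 0 < n := by omega
  have h1 := congrArg (· / n) h
  have h2 := congrArg (· % n) h
  simp only [Nat.mul_comm _ n, Nat.mul_add_div hn, Nat.div_eq_of_lt hb, Nat.div_eq_of_lt he,
    Nat.mul_add_mod, Nat.mod_eq_of_lt hb, Nat.mod_eq_of_lt he] at h1 h2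
  exact ⟨h1, h2⟩

/-- The first `P` entries of a Gram matrix are stored from the address `D` on. -/
def GramTo (X : Sample k n) (D P : ℕ) (s : State) : Prop :=
  ∀ a b : Fin n, (a : ℕ) * n + b < P →
    s.rmem (D + (a * n + b)) = inner ℝ (stdCols X a) (stdCols X b)

theorem inner_stdCols (X : Sample k n) (a b : Fin n) (mem : ℕ → ℝ) (src : ℕ)
    (hsrc : ∀ (l : Fin k) (j : Fin n), mem (src + (l * n + j)) = X l j) :
    ∑ l ∈ Finset.range k, mem (src + a + l * n) * mem (src + b + l * n) =
      inner ℝ (stdCols X a) (stdCols X b) := by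
  rw [PiLp.inner_apply, Finset.sum_range]
  refine Finset.sum_congr rfl fun l _ => ?_
  rw [stdCols_apply, stdCols_apply, ← hsrc l a, ← hsrc l b]
  simp only [RCLike.inner_apply, conj_trivial]
  rw [mul_comm]
  congr 2 <;> ring

/-- The entries are written in row-major order, each after a pass of length `k` through two columns
of the sample. This is the source of the term k n² in the running time. -/
theorem reach_gramP {X : Sample k n} {s : State} (h0 : s.nreg 0 = n) (h1 : s.nreg 1 = k)
    (h3 : s.nreg 3 = 1)
    (hsrc : ∀ (l : Fin k) (j : Fin n), s.rmem (s.nreg 24 + (l * n + j)) = X l j)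
    (hle : s.nreg 24 + k * n ≤ s.nreg 23) :
    Reach gramP s (n * (n * (3 + (k * (6 + 2) + 2 + 2) + 2) + 2 + 2) + 2) fun s' =>
      s'.nreg 23 = s.nreg 23 + n * n ∧ (∀ a < s.nreg 23, s'.rmem a = s.rmem a) ∧
        GramTo X (s.nreg 23) (n * n) s' := by
  set D := s.nreg 23 with hD
  set src := s.nreg 24 with hS
  refine Reach.forP (m := n) (fun i s' => s'.nreg 23 = D + i * n ∧
    (∀ a < D, s'.rmem a = s.rmem a) ∧ GramTo X D (i * n) s') (by decide) h0 h3
    ⟨by simp [State.setN, hD], fun _ _ => rfl, fun a b h => by simp at h⟩ ?_ fun _ _ h => h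
  rintro i s₁ hi h25 hf₁ ⟨i1, i2, i3⟩
  have a0 : s₁.nreg 0 = n := (hf₁.nreg 0 (by decide)).trans h0
  have a1 : s₁.nreg 1 = k := (hf₁.nreg 1 (by decide)).trans h1
  have a3 : s₁.nreg 3 = 1 := (hf₁.nreg 3 (by decide)).trans h3
  have a24 : s₁.nreg 24 = src := hf₁.nreg 24 (by decide)
  refine Reach.forP (m := n) (fun j s' => s'.nreg 23 = D + (i * n + j) ∧
    (∀ a < D, s'.rmem a = s.rmem a) ∧ GramTo X D (i * n + j) s') (by decide) a0 a3
    ⟨by simp [State.setN, i1], i2, i3⟩ ?_ ?_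
  · rintro j s₂ hj h26 hf₂ ⟨j1, j2, j3⟩
    have b0 : s₂.nreg 0 = n := (hf₂.nreg 0 (by decide)).trans a0
    have b1 : s₂.nreg 1 = k := (hf₂.nreg 1 (by decide)).trans a1
    have b3 : s₂.nreg 3 = 1 := (hf₂.nreg 3 (by decide)).trans a3
    have b24 : s₂.nreg 24 = src := (hf₂.nreg 24 (by decide)).trans a24
    have b25 : s₂.nreg 25 = i := (hf₂.nreg 25 (by decide)).trans h25
    refine Reach.blk_seq (fun s' => s'.nreg 27 = src + i ∧ s'.nreg 28 = src + j ∧ s'.rreg 2 = 0)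
      rfl (by simp [Instr.exec, b24, b25, h26]) ?_
    rintro s₃ hf₃ ⟨c27, c28, c2⟩
    have c0 : s₃.nreg 0 = n := (hf₃.nreg 0 (by decide)).trans b0
    have c1 : s₃.nreg 1 = k := (hf₃.nreg 1 (by decide)).trans b1
    have c3 : s₃.nreg 3 = 1 := (hf₃.nreg 3 (by decide)).trans b3
    have cm : s₃.rmem = s₂.rmem := hf₃.rmem (by decide)
    refine (reach_dotP c0 c1 c3 c2).seq fun s₄ hf₄ h2 => Reach.blk _ _ ?_
    have d3 : s₄.nreg 3 = 1 := (hf₄.nreg 3 (by decide)).trans c3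
    have d23 : s₄.nreg 23 = D + (i * n + j) :=
      (hf₄.nreg 23 (by decide)).trans ((hf₃.nreg 23 (by decide)).trans j1)
    have dm : s₄.rmem = s₂.rmem := (hf₄.rmem (by decide)).trans cm
    rw [c27, c28, cm] at h2
    have hval := inner_stdCols X ⟨i, hi⟩ ⟨j, hj⟩ s₂.rmem src fun l q => by
      rw [j2 _ (by have := mul_add_lt_mul l.2 q.2; omega)]
      exact hsrc l q
    rw [hval] at h2
    rintro -
    refine ⟨?_, fun a ha => ?_, fun a b hab => ?_⟩
    · simp [Instr.exec, State.setN, d23, d3, Nat.add_assoc]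
    · simp only [List.foldl_cons, List.foldl_nil, Instr.exec, State.setN, d23, dm]
      rw [Function.update_of_ne (by omega)]
      exact j2 a ha
    · simp only [List.foldl_cons, List.foldl_nil, Instr.exec, State.setN, d23, dm]
      rcases (Nat.lt_succ_iff_lt_or_eq (n := i * n + j)).1 hab with h | h
      · rw [Function.update_of_ne (by omega)]
        exact j3 a b h
      · obtain ⟨ha, hb⟩ := mul_add_inj b.2 hj h
        have ha' : a = ⟨i, hi⟩ := Fin.ext ha
        have hb' : b = ⟨j, hj⟩ := Fin.ext hb
        subst ha' hb'
        rw [Function.update_self]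
        exact h2
  · rintro s' hf' ⟨k1, k2, k3⟩ -
    rw [← Nat.succ_mul] at k1 k3
    exact ⟨k1, k2, k3⟩

/-- The table of the numbers `a * n` for `a < n`, from the address in register `4` on. -/
def tableP : Prog := .seq (blk (.nconst 22 0) []) (forP 19 0
  (blk (.nadd 21 4 19) [.nstore 21 22, .nadd 22 22 0]))

theorem reach_tableP {s : State} (h0 : s.nreg 0 = n) (h3 : s.nreg 3 = 1) :
    Reach tableP s (1 + (n * (3 + 2) + 2)) fun s' =>
      (∀ a < s.nreg 4, s'.nmem a = s.nmem a) ∧ ∀ a < n, s'.nmem (s.nreg 4 + a) = a * n := by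
  refine Reach.blk_seq (fun s' => s'.nreg 22 = 0) rfl (by simp [Instr.exec]) ?_
  rintro s₁ hf₁ h22
  have a0 : s₁.nreg 0 = n := (hf₁.nreg 0 (by decide)).trans h0
  have a3 : s₁.nreg 3 = 1 := (hf₁.nreg 3 (by decide)).trans h3
  have a4 : s₁.nreg 4 = s.nreg 4 := hf₁.nreg 4 (by decide)
  have am : s₁.nmem = s.nmem := hf₁.nmem (by decide)
  refine Reach.forP (m := n) (fun j s' => s'.nreg 22 = j * n ∧
    (∀ a < s.nreg 4, s'.nmem a = s.nmem a) ∧ ∀ a < j, s'.nmem (s.nreg 4 + a) = a * n) (by decide)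
    a0 a3 ⟨by simp [State.setN, h22], fun a _ => by rw [State.setN, am], fun a ha => by omega⟩ ?_
    fun _ _ h => h.2
  rintro j s₂ hj h19 hf₂ ⟨i1, i2, i3⟩
  have b0 : s₂.nreg 0 = n := (hf₂.nreg 0 (by decide)).trans a0
  have b4 : s₂.nreg 4 = s.nreg 4 := (hf₂.nreg 4 (by decide)).trans a4
  refine Reach.blk _ _ ?_
  rintro -
  refine ⟨by simp [Instr.exec, State.setN, i1, b0, Nat.succ_mul], fun a ha => ?_, fun a ha => ?_⟩
  · simp [Instr.exec, State.setN, b4, h19, Function.update_of_ne (show a ≠ s.nreg 4 + j by omega),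
      i2 a ha]
  · rcases Nat.lt_succ_iff_lt_or_eq.1 ha with h | rfl
    · simp [Instr.exec, State.setN, b4, h19, h.ne, i3 a h]
    · simp [Instr.exec, State.setN, b4, h19, i1]

/-- The register `x` is increased by the product of the registers `y` and `N`. -/
def mulP (x y N : ℕ) : Prog := forP 19 N (blk (.nadd x x y) [])

/-- A product by repeated addition, whose time is linear in the content of `N`. -/
theorem reach_mulP {x y N : ℕ} {s : State} (h3 : s.nreg 3 = 1)
    (hw : 19 ≠ x ∧ N ≠ x ∧ 3 ≠ x ∧ 19 ≠ N ∧ y ≠ x ∧ y ≠ 19) :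
    Reach (mulP x y N) s (s.nreg N * (1 + 2) + 2) fun s' =>
      s'.nreg x = s.nreg x + s.nreg N * s.nreg y := by
  obtain ⟨w1, w2, w3, w4, w5, w6⟩ := hw
  refine Reach.forP (m := s.nreg N) (fun j s' => s'.nreg x = s.nreg x + j * s.nreg y)
    (by simp [blk, Prog.nw, Instr.nw, w1, w2, w3, w4]) rfl h3
    (by simp [State.setN, w1.symm]) ?_ fun _ _ h => h
  rintro j s₁ hj - hf h
  have hy : s₁.nreg y = s.nreg y :=
    hf.nreg y (by simp [forP, blk, Prog.nw, Instr.nw, w5, w6])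
  refine Reach.blk _ _ ?_
  rintro -
  simp [Instr.exec, State.setN, w1.symm, h, hy, Nat.succ_mul, Nat.add_assoc]

end Setup

end GGM

namespace GGM

/-! ### The initial state and the preparations -/

section Setup

variable {n k : ℕ} {X₁ X₂ : Sample k n} {d : ℕ} {ν : ℝ}

/-- All preparations: constants, the table of multiples of `n` and the two Gram matrices. -/
def setupP : Prog :=
  .seq (blk (.nconst 3 1) [.nadd 13 0 3, .nadd 14 2 2, .nadd 15 2 3, .nadd 10 14 3]) <|
  .seq (mulP 12 0 1) <| .seq (mulP 20 0 0) <| .seq (mulP 11 10 10) <|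
  .seq (blk (.nadd 4 20 0) [.nadd 5 4 0, .nadd 6 5 10, .nadd 7 12 12, .nadd 8 7 20, .nadd 9 8 20,
    .nadd 23 7 24]) <|
  .seq tableP <| .seq gramP <| .seq (blk (.nadd 24 24 12) []) gramP

/-- The number of steps for a Gram matrix. -/
def gramTime (n k : ℕ) : ℕ := n * (n * (3 + (k * (6 + 2) + 2 + 2) + 2) + 2 + 2) + 2

/-- The number of steps of the preparations. -/
def setupTime (n k d : ℕ) : ℕ :=
  5 + ((k * 3 + 2) + ((n * 3 + 2) + (((2 * d + 1) * 3 + 2) + (7 + ((1 + (n * 5 + 2)) +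
    (gramTime n k + (1 + gramTime n k)))))))

theorem flatten_apply (X : Sample k n) (l : Fin k) (j : Fin n) : flatten X (l * n + j) = X l j := by
  have hn : 0 < n := j.pos
  have h1 : ((l : ℕ) * n + j) / n = l := by
    rw [Nat.mul_comm, Nat.mul_add_div hn, Nat.div_eq_of_lt j.2, Nat.add_zero]
  have h2 : ((l : ℕ) * n + j) % n = j := by
    rw [Nat.mul_comm, Nat.mul_add_mod, Nat.mod_eq_of_lt j.2]
  have h : ((l : ℕ) * n + j) / n < k ∧ ((l : ℕ) * n + j) % n < n := by
    rw [h1, h2]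
    exact ⟨l.2, j.2⟩
  have e1 : (⟨_, h.1⟩ : Fin k) = l := Fin.ext h1
  have e2 : (⟨_, h.2⟩ : Fin n) = j := Fin.ext h2
  rw [flatten, dif_pos h, e1, e2]

theorem inputState_rmem₁ (l : Fin k) (j : Fin n) :
    (inputState X₁ X₂ d ν).rmem (l * n + j) = X₁ l j := by
  simp only [inputState]
  rw [if_pos (mul_add_lt_mul l.2 j.2), flatten_apply]

theorem inputState_rmem₂ (l : Fin k) (j : Fin n) :
    (inputState X₁ X₂ d ν).rmem (k * n + (l * n + j)) = X₂ l j := by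
  simp only [inputState]
  rw [if_neg (by omega), Nat.add_sub_cancel_left, flatten_apply]

theorem reach_setupP : Reach setupP (inputState X₁ X₂ d ν) (setupTime n k d) fun s' =>
    Env X₁ X₂ d ν s' ∧ ∀ a < n * (n + 1), s'.nmem a = 0 := by
  set s := inputState X₁ X₂ d ν with hs
  have z0 : s.nreg 0 = n := rfl
  have z1 : s.nreg 1 = k := rfl
  have z2 : s.nreg 2 = d := rfl
  have z (x : ℕ) (hx : 3 ≤ x) : s.nreg x = 0 := by
    simp [hs, inputState, show x ≠ 0 by omega, show x ≠ 1 by omega, show x ≠ 2 by omega]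
  refine Reach.blk_seq (fun s' => s'.nreg 3 = 1 ∧ s'.nreg 13 = n + 1 ∧ s'.nreg 14 = 2 * d ∧
    s'.nreg 15 = d + 1 ∧ s'.nreg 10 = 2 * d + 1) rfl
    (by simp [Instr.exec, z0, z2, two_mul]) ?_
  rintro s₁ f₁ ⟨a3, a13, a14, a15, a10⟩
  have a0 : s₁.nreg 0 = n := f₁.nreg 0 (by decide)
  have a1 : s₁.nreg 1 = k := f₁.nreg 1 (by decide)
  have a12 : s₁.nreg 12 = 0 := (f₁.nreg 12 (by decide)).trans (z _ (by decide))
  refine ((reach_mulP (x := 12) (y := 0) (N := 1) a3 (by decide)).mono (by rw [a1])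
    fun _ _ h => h).seq fun s₂ f₂ b12 => ?_
  rw [a0, a1, a12, Nat.zero_add] at b12
  have b0 : s₂.nreg 0 = n := (f₂.nreg 0 (by decide)).trans a0
  have b3 : s₂.nreg 3 = 1 := (f₂.nreg 3 (by decide)).trans a3
  have b20 : s₂.nreg 20 = 0 := (f₂.nreg 20 (by decide)).trans
    ((f₁.nreg 20 (by decide)).trans (z _ (by decide)))
  refine ((reach_mulP (x := 20) (y := 0) (N := 0) b3 (by decide)).mono (by rw [b0])
    fun _ _ h => h).seq fun s₃ f₃ c20 => ?_
  rw [b0, b20, Nat.zero_add] at c20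
  have c3 : s₃.nreg 3 = 1 := (f₃.nreg 3 (by decide)).trans b3
  have c10 : s₃.nreg 10 = 2 * d + 1 := (f₃.nreg 10 (by decide)).trans
    ((f₂.nreg 10 (by decide)).trans a10)
  have c11 : s₃.nreg 11 = 0 := (f₃.nreg 11 (by decide)).trans ((f₂.nreg 11 (by decide)).trans
    ((f₁.nreg 11 (by decide)).trans (z _ (by decide))))
  refine ((reach_mulP (x := 11) (y := 10) (N := 10) c3 (by decide)).mono (by rw [c10])
    fun _ _ h => h).seq fun s₄ f₄ d11 => ?_
  rw [c10, c11, Nat.zero_add] at d11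
  have d0 : s₄.nreg 0 = n := (f₄.nreg 0 (by decide)).trans ((f₃.nreg 0 (by decide)).trans b0)
  have d12 : s₄.nreg 12 = k * n :=
    (f₄.nreg 12 (by decide)).trans ((f₃.nreg 12 (by decide)).trans b12)
  have d20 : s₄.nreg 20 = n * n := (f₄.nreg 20 (by decide)).trans c20
  have d10 : s₄.nreg 10 = 2 * d + 1 := (f₄.nreg 10 (by decide)).trans c10
  have d24 : s₄.nreg 24 = 0 := (f₄.nreg 24 (by decide)).trans ((f₃.nreg 24 (by decide)).trans
    ((f₂.nreg 24 (by decide)).trans ((f₁.nreg 24 (by decide)).trans (z _ (by decide)))))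
  -- The real memory starts with the two samples, of k n cells each, followed by the two Gram
  -- matrices; the natural number memory starts with the output table of n(n + 1) cells.
  refine Reach.blk_seq (fun s' => s'.nreg 4 = n * (n + 1) ∧ s'.nreg 5 = n * (n + 1) + n ∧
    s'.nreg 6 = n * (n + 1) + n + (2 * d + 1) ∧ s'.nreg 7 = k * n + k * n ∧
    s'.nreg 8 = k * n + k * n + n * n ∧ s'.nreg 9 = k * n + k * n + n * n + n * n ∧
    s'.nreg 23 = k * n + k * n) rfl
    (by simp [Instr.exec, d0, d10, d12, d20, d24, Nat.mul_succ]) ?_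
  rintro s₅ f₅ ⟨e4, e5, e6, e7, e8, e9, e23⟩
  have e0 : s₅.nreg 0 = n := (f₅.nreg 0 (by decide)).trans d0
  have e3 : s₅.nreg 3 = 1 := (f₅.nreg 3 (by decide)).trans ((f₄.nreg 3 (by decide)).trans c3)
  have e24 : s₅.nreg 24 = 0 := (f₅.nreg 24 (by decide)).trans d24
  have e12 : s₅.nreg 12 = k * n := (f₅.nreg 12 (by decide)).trans d12
  have e1 : s₅.nreg 1 = k := (f₅.nreg 1 (by decide)).trans ((f₄.nreg 1 (by decide)).trans
    ((f₃.nreg 1 (by decide)).trans ((f₂.nreg 1 (by decide)).trans a1)))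
  have e2 : s₅.nreg 2 = d := (f₅.nreg 2 (by decide)).trans ((f₄.nreg 2 (by decide)).trans
    ((f₃.nreg 2 (by decide)).trans ((f₂.nreg 2 (by decide)).trans (f₁.nreg 2 (by decide)))))
  have e11 : s₅.nreg 11 = (2 * d + 1) * (2 * d + 1) := (f₅.nreg 11 (by decide)).trans d11
  have e10 : s₅.nreg 10 = 2 * d + 1 := (f₅.nreg 10 (by decide)).trans d10
  have e13 : s₅.nreg 13 = n + 1 := (f₅.nreg 13 (by decide)).trans ((f₄.nreg 13 (by decide)).trans
    ((f₃.nreg 13 (by decide)).trans ((f₂.nreg 13 (by decide)).trans a13)))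
  have e14 : s₅.nreg 14 = 2 * d := (f₅.nreg 14 (by decide)).trans ((f₄.nreg 14 (by decide)).trans
    ((f₃.nreg 14 (by decide)).trans ((f₂.nreg 14 (by decide)).trans a14)))
  have e15 : s₅.nreg 15 = d + 1 := (f₅.nreg 15 (by decide)).trans ((f₄.nreg 15 (by decide)).trans
    ((f₃.nreg 15 (by decide)).trans ((f₂.nreg 15 (by decide)).trans a15)))
  have er : s₅.rreg 0 = ν := (f₅.rreg 0 (by decide)).trans ((f₄.rreg 0 (by decide)).trans
    ((f₃.rreg 0 (by decide)).trans ((f₂.rreg 0 (by decide)).trans (f₁.rreg 0 (by decide)))))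
  have en : s₅.nmem = fun _ => 0 := (f₅.nmem (by decide)).trans ((f₄.nmem (by decide)).trans
    ((f₃.nmem (by decide)).trans ((f₂.nmem (by decide)).trans (f₁.nmem (by decide)))))
  have em : s₅.rmem = s.rmem := (f₅.rmem (by decide)).trans ((f₄.rmem (by decide)).trans
    ((f₃.rmem (by decide)).trans ((f₂.rmem (by decide)).trans (f₁.rmem (by decide)))))
  refine (reach_tableP e0 e3).seq ?_
  rintro s₆ f₆ ⟨t1, t2⟩
  rw [e4] at t1 t2
  have g23 : s₆.nreg 23 = k * n + k * n := (f₆.nreg 23 (by decide)).trans e23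
  have g24 : s₆.nreg 24 = 0 := (f₆.nreg 24 (by decide)).trans e24
  have gm : s₆.rmem = s.rmem := (f₆.rmem (by decide)).trans em
  refine (reach_gramP (X := X₁) ((f₆.nreg 0 (by decide)).trans e0)
    ((f₆.nreg 1 (by decide)).trans e1) ((f₆.nreg 3 (by decide)).trans e3)
    (fun l j => ?_) (by omega)).seq ?_
  · rw [g24, Nat.zero_add, gm]
    exact inputState_rmem₁ l j
  rintro s₇ f₇ ⟨h23, hlow, hgram⟩
  rw [g23] at h23 hlow hgram
  have h0 : s₇.nreg 0 = n := (f₇.nreg 0 (by decide)).trans ((f₆.nreg 0 (by decide)).trans e0)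
  have h1 : s₇.nreg 1 = k := (f₇.nreg 1 (by decide)).trans ((f₆.nreg 1 (by decide)).trans e1)
  have h3 : s₇.nreg 3 = 1 := (f₇.nreg 3 (by decide)).trans ((f₆.nreg 3 (by decide)).trans e3)
  have h12 : s₇.nreg 12 = k * n :=
    (f₇.nreg 12 (by decide)).trans ((f₆.nreg 12 (by decide)).trans e12)
  have h24 : s₇.nreg 24 = 0 := (f₇.nreg 24 (by decide)).trans g24
  refine Reach.blk_seq (fun s' => s'.nreg 24 = k * n) rfl (by simp [Instr.exec, h24, h12]) ?_
  rintro s₈ f₈ i24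
  have i23 : s₈.nreg 23 = k * n + k * n + n * n := (f₈.nreg 23 (by decide)).trans h23
  have im : s₈.rmem = s₇.rmem := f₈.rmem (by decide)
  refine (reach_gramP (X := X₂) ((f₈.nreg 0 (by decide)).trans h0)
    ((f₈.nreg 1 (by decide)).trans h1) ((f₈.nreg 3 (by decide)).trans h3)
    (fun l j => ?_) (by omega)).mono le_rfl ?_
  · have := mul_add_lt_mul l.2 j.2
    rw [i24, im, hlow _ (by omega), gm]
    exact inputState_rmem₂ l j
  rintro s₉ f₉ ⟨-, hlow', hgram'⟩
  rw [i23] at hlow' hgram'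
  have hreg (x : ℕ) (hx : x ∈ [0, 2, 3, 4, 5, 6, 7, 8, 9, 10, 11, 13, 14, 15]) :
      s₉.nreg x = s₅.nreg x :=
    (f₉.nreg x (by revert x; decide)).trans ((f₈.nreg x (by revert x; decide)).trans
      ((f₇.nreg x (by revert x; decide)).trans (f₆.nreg x (by revert x; decide))))
  have hmem : s₉.nmem = s₆.nmem := (f₉.nmem (by decide)).trans ((f₈.nmem (by decide)).trans
    (f₇.nmem (by decide)))
  refine ⟨⟨?_, ?_, ?_, ?_, ?_, ?_, ?_, ?_, ?_, ?_, ?_, ?_, ?_, ?_, ?_, ?_, ?_⟩, ?_⟩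
  · rw [hreg 0 (by decide), e0]
  · rw [hreg 2 (by decide), e2]
  · rw [hreg 3 (by decide), e3]
  · rw [hreg 4 (by decide), e4]
  · rw [hreg 5 (by decide), hreg 4 (by decide), e4, e5]
  · rw [hreg 6 (by decide), hreg 5 (by decide), e5, e6]
  · rw [hreg 8 (by decide), hreg 7 (by decide), e7, e8]
  · rw [hreg 9 (by decide), hreg 8 (by decide), e8, e9]
  · rw [hreg 10 (by decide), e10]
  · rw [hreg 11 (by decide), e11]
  · rw [hreg 13 (by decide), e13]
  · rw [hreg 14 (by decide), e14]
  · rw [hreg 15 (by decide), e15]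
  · exact (f₉.rreg 0 (by decide)).trans ((f₈.rreg 0 (by decide)).trans
      ((f₇.rreg 0 (by decide)).trans ((f₆.rreg 0 (by decide)).trans er)))
  · rw [hreg 4 (by decide), e4, hmem]
    exact t2
  · intro a b
    have hab := mul_add_lt_mul a.2 b.2
    rw [hreg 7 (by decide), e7, hlow' _ (by omega), im]
    exact hgram a b hab
  · intro a b
    rw [hreg 8 (by decide), e8]
    exact hgram' a b (mul_add_lt_mul a.2 b.2)
  · intro a ha
    rw [hmem, t1 a ha, en]

/-- The program for `d = 0`: every result is the empty set. -/
def smallP : Prog := .seq (blk (.nconst 3 1) [.nadd 13 0 3, .nconst 53 0])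
  (forP 17 0 (blk (.nstore 53 3) [.nadd 53 53 13]))

/-- For d = 0 the time bound is linear in `n` and does not even allow reading the samples, so this
case has its own program. -/
theorem reach_smallP : Reach smallP (inputState X₁ X₂ d ν) (3 + (n * (2 + 2) + 2)) fun s' =>
    ∀ i : Fin n, HoldsRow n i (some ∅) s'.nmem := by
  refine Reach.blk_seq (fun s' => s'.nreg 3 = 1 ∧ s'.nreg 13 = n + 1 ∧ s'.nreg 53 = 0) rfl
    (by simp [Instr.exec, inputState]) ?_
  rintro s₁ f₁ ⟨a3, a13, a53⟩
  have a0 : s₁.nreg 0 = n := f₁.nreg 0 (by decide)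
  have am : s₁.nmem = fun _ => 0 := f₁.nmem (by decide)
  refine Reach.forP (m := n) (fun j s' => s'.nreg 53 = j * (n + 1) ∧
    (∀ a, j * (n + 1) ≤ a → s'.nmem a = 0) ∧ ∀ i : Fin n, (i : ℕ) < j →
      HoldsRow n i (some ∅) s'.nmem) (by decide) a0 a3
    ⟨by simp [State.setN, a53], fun a _ => by rw [State.setN, am], fun i hi => by omega⟩ ?_
    fun _ _ h i => h.2.2 i i.2
  rintro j s₂ hj - f₂ ⟨i1, i2, i3⟩
  have b3 : s₂.nreg 3 = 1 := (f₂.nreg 3 (by decide)).trans a3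
  have b13 : s₂.nreg 13 = n + 1 := (f₂.nreg 13 (by decide)).trans a13
  have hmul : (j + 1) * (n + 1) = j * (n + 1) + (n + 1) := Nat.succ_mul _ _
  refine Reach.blk _ _ ?_
  rintro -
  simp only [List.foldl_cons, List.foldl_nil, Instr.exec, State.setN, i1, b3, b13]
  refine ⟨by simp [hmul], fun a ha => ?_, fun i hi => ?_⟩
  · rw [Function.update_of_ne (by omega)]
    exact i2 a (by omega)
  · rcases Nat.lt_succ_iff_lt_or_eq.1 hi with h | h
    · have hle : ((i : ℕ) + 1) * (n + 1) ≤ j * (n + 1) := Nat.mul_le_mul_right _ h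
      exact holdsRow_congr (i3 i h) fun a ha => Function.update_of_ne (by omega) _ _
    · subst h
      refine ⟨by simp, fun l => ?_⟩
      rw [Function.update_of_ne (by omega), i2 _ (by omega)]
      simp

end Setup

end GGM

namespace GGM

/-! ### The complete program and its running time -/

section MainProgram

variable {n k : ℕ} {d : ℕ} {ν : ℝ}

/-- SearchAndValidate for all nodes. -/
def mainP : Prog := .ite (.nlt 19 2) (.seq setupP nodesP) smallP

theorem isSearchAndValidateOutput_empty (X₁ X₂ : Sample k n) (i : Fin n) :
    IsSearchAndValidateOutput X₁ X₂ 0 ν i (some ∅) := by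
  have h0 : supp (0 : Fin n → ℝ) = ∅ := by ext j; simp [mem_supp]
  refine ⟨fun _ => 0, fun r hr => ⟨⟨rfl, by simp [h0]⟩, fun v _ hv => ?_⟩, ?_⟩
  · obtain rfl := Nat.le_zero.1 hr
    have hv0 : v = 0 := by
      funext j
      by_contra hj
      exact Finset.notMem_empty j (Finset.card_eq_zero.1 (Nat.le_zero.1 hv) ▸ mem_supp.2 hj)
    rw [hv0]
  · rw [validate_eq_some le_rfl not_isRejected_zero fun q hq => absurd hq (Nat.not_lt_zero q), h0]

/-- For n, d ≥ 1 both the constants and `n` are at most n^d times their values at n = 1, so the cost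
at n = 1 can serve as the constant depending on `d`. -/
theorem stageTime_le (hn : 0 < n) (hd : 0 < d) : stageTime n d ≤ n ^ d * stageTime 1 d := by
  have h1 : 1 ≤ n ^ d := Nat.one_le_pow _ _ hn
  have h2 : n ≤ n ^ d := Nat.le_self_pow hd.ne' n
  simp only [stageTime, one_pow]
  generalize n ^ d = N at *
  generalize tryTime d = T
  nlinarith [Nat.mul_le_mul_right d h1]

theorem nodeTime_le (hn : 0 < n) (hd : 0 < d) : nodeTime n d ≤ n ^ d * nodeTime 1 d := by
  have h1 : 1 ≤ n ^ d := Nat.one_le_pow _ _ hn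
  have h2 := Nat.mul_le_mul_left d (stageTime_le hn hd)
  have h3 : d ≤ n ^ d * d := Nat.le_mul_of_pos_left d h1
  have h4 : distTime d ≤ n ^ d * distTime d := Nat.le_mul_of_pos_left _ h1
  have h5 : validateTime d ≤ n ^ d * validateTime d := Nat.le_mul_of_pos_left _ h1
  simp only [nodeTime, searchTime]
  generalize n ^ d = N at *
  generalize distTime d = T at *
  generalize validateTime d = V at *
  generalize stageTime 1 d = S at *
  generalize stageTime n d = S' at *
  nlinarith

theorem gramTime_le (hn : 0 < n) (hd : 0 < d) :
    gramTime n k ≤ 15 * (n ^ (d + 1) + d * k * n ^ 2) := by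
  have h2 : n * n ≤ n ^ (d + 1) := by
    rw [← sq]
    exact Nat.pow_le_pow_right hn (by omega)
  have h3 : n ≤ n * n := Nat.le_mul_of_pos_left n hn
  have h4 : k * (n * n) ≤ d * k * n ^ 2 := by
    rw [sq, Nat.mul_assoc]
    exact Nat.le_mul_of_pos_left _ hd
  have h5 : gramTime n k = 8 * (k * (n * n)) + 9 * (n * n) + 4 * n + 2 := by
    rw [gramTime]
    ring
  rw [h5]
  omega

theorem setupTime_le (hn : 0 < n) (hd : 0 < d) :
    setupTime n k d ≤ (70 + 6 * d) * (n ^ (d + 1) + d * k * n ^ 2) := by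
  have h1 : 1 ≤ n ^ (d + 1) := Nat.one_le_pow _ _ hn
  have h2 : n ≤ n ^ (d + 1) := Nat.le_self_pow (by omega) n
  have h4 : k ≤ d * k * n ^ 2 :=
    (Nat.le_mul_of_pos_left k hd).trans (Nat.le_mul_of_pos_right _ (by positivity))
  have h5 := gramTime_le (k := k) hn hd
  have h6 : d ≤ d * (n ^ (d + 1) + d * k * n ^ 2) := Nat.le_mul_of_pos_right _ (by omega)
  rw [setupTime, Nat.add_mul 70, Nat.mul_assoc 6]
  omega

theorem searchAndValidate_program : ∃ (p : Prog) (C : ℕ → ℕ),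
    ∀ (n k d : ℕ) (ν : ℝ) (X₁ X₂ : Sample k n), 0 < n →
      ∃ (t : ℕ) (s : State) (out : Fin n → Option (Finset (Fin n))),
        Runs p (inputState X₁ X₂ d ν) t s ∧
        t ≤ C d * (n ^ (d + 1) + d * k * n ^ 2) ∧
        HoldsOutput out s ∧
        ∀ i, IsSearchAndValidateOutput X₁ X₂ d ν i (out i) := by
  -- The first summand of the constant bounds the work at the nodes, 70 + 6d the preparations, and
  -- the rest the overhead of the loop over the nodes.
  refine ⟨mainP, fun d => nodeTime 1 d + (80 + 6 * d), fun n k d ν X₁ X₂ hn => ?_⟩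
  -- Register `19` is zero initially, so the first test of the program asks whether d > 0.
  have h19 : (inputState X₁ X₂ d ν).nreg 19 = 0 := rfl
  have h2 : (inputState X₁ X₂ d ν).nreg 2 = d := rfl
  rcases Nat.eq_zero_or_pos d with rfl | hd
  · obtain ⟨t, s, hr, ht, hs⟩ := reach_smallP (X₁ := X₁) (X₂ := X₂) (d := 0) (ν := ν)
    refine ⟨t + 1, s, fun _ => some ∅, hr.ite_false (by simp [Test.holds, h19, h2]), ?_, hs,
      isSearchAndValidateOutput_empty X₁ X₂⟩
    rw [Nat.zero_add, pow_one, Nat.zero_mul, Nat.zero_mul, Nat.add_zero, Nat.add_mul]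
    omega
  · obtain ⟨t, s, hr, ht, hs⟩ := (reach_setupP (X₁ := X₁) (X₂ := X₂) (d := d) (ν := ν)).seq
      fun s' _ h => reach_nodesP h.1 h.2
    choose out ho hrow using hs
    refine ⟨t + 1, s, out, hr.ite_true (by simp [Test.holds, h19, h2, hd]), ?_, hrow, ho⟩
    have b1 : 1 ≤ n ^ (d + 1) := Nat.one_le_pow _ _ hn
    have b2 : n ≤ n ^ (d + 1) := Nat.le_self_pow (by omega) n
    have b3 := setupTime_le (k := k) hn hd
    have b4 : n * nodeTime n d ≤ nodeTime 1 d * (n ^ (d + 1) + d * k * n ^ 2) :=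
      calc n * nodeTime n d ≤ n * (n ^ d * nodeTime 1 d) :=
            Nat.mul_le_mul_left n (nodeTime_le hn hd)
        _ = nodeTime 1 d * n ^ (d + 1) := by ring
        _ ≤ _ := Nat.mul_le_mul_left _ (Nat.le_add_right _ _)
    rw [Nat.mul_add] at ht
    rw [Nat.add_mul] at b3 ⊢
    rw [Nat.add_mul 80]
    omega

end MainProgram

end GGM

theorem mainTheorem2 :
    -- correctness of SearchAndValidate with `ν = κ² / 2` from `m = 2 * k` samples
    (∃ C : ℝ, 0 < C ∧
      ∀ (n k d : ℕ) (κ δ : ℝ) (Θ : Matrix (Fin n) (Fin n) ℝ),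
        0 < κ → 0 < δ → Θ.PosDef → GGM.IsAttractive Θ → GGM.IsNondegenerate κ Θ →
        GGM.maxDegree Θ ≤ d → (d : ℝ) ≤ max (GGM.maxDegree Θ : ℝ) (1 / κ ^ 2) →
        C * ((1 / κ ^ 2) * (Real.log n + Real.log (2 / δ))) ≤ ((2 * k : ℕ) : ℝ) →
        ((GGM.sampleLaw Θ k).prod (GGM.sampleLaw Θ k))
            {X | ¬ ∀ (i : Fin n) (out : Option (Finset (Fin n))),
              GGM.IsSearchAndValidateOutput X.1 X.2 d (κ ^ 2 / 2) i out →
                out = some (GGM.nbhd Θ i)}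
          ≤ ENNReal.ofReal δ) ∧
    -- running time, for all nodes together
    (∃ (p : GGM.Prog) (C : ℕ → ℕ),
      ∀ (n k d : ℕ) (ν : ℝ) (X₁ X₂ : GGM.Sample k n), 0 < n →
        ∃ (t : ℕ) (s : GGM.State) (out : Fin n → Option (Finset (Fin n))),
          GGM.Runs p (GGM.inputState X₁ X₂ d ν) t s ∧
          t ≤ C d * (n ^ (d + 1) + d * k * n ^ 2) ∧
          GGM.HoldsOutput out s ∧
          ∀ i, GGM.IsSearchAndValidateOutput X₁ X₂ d ν i (out i)) ∧
    -- optimality of the sample complexity among all estimators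
    (∀ κ₀ : ℝ, κ₀ < 1 → ∃ c : ℝ, 0 < c ∧
      ∀ (n m d : ℕ) (κ δ : ℝ) (est : GGM.Sample m n → Fin n → Finset (Fin n)),
        2 ≤ n → 1 ≤ d → 0 < κ → κ ≤ κ₀ → 0 < δ → δ ≤ 1 / 4 →
        (∀ Θ : Matrix (Fin n) (Fin n) ℝ,
          Θ.PosDef → GGM.IsAttractive Θ → GGM.IsNondegenerate κ Θ → GGM.maxDegree Θ ≤ d →
          (GGM.sampleLaw Θ m) {X | ¬ ∀ i, est X i = GGM.nbhd Θ i} ≤ ENNReal.ofReal δ) →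
        c * ((1 / κ ^ 2) * (Real.log n + Real.log (2 / δ))) ≤ (m : ℝ)) := 
  ⟨GGM.searchAndValidate_correct, GGM.searchAndValidate_program, GGM.sample_size_lower_bound⟩
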